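/- Let $\nu\ge 1$, $\mathbb T=\mathbb R/2\pi\mathbb Z$, and let $V:\mathbb T^\nu\times[0,\pi]\to\mathbb R$ satisfy, for some $\rho>0$: (V1) the even $2\pi$-periodic extension of $V(\theta,x)$ in $x$ (still denoted $V$) is smooth in $(\theta,x)$ and extends analytically in $\theta$ to the strip $\{\theta\in\mathbb C^\nu:|\mathrm{Im}\,\theta|\le\rho\}$, the extension is smooth in $x$, and for every $\ell\ge 0$ there is $C_{\ell}>0$ with $|\partial_x^\ell V(\theta,x)|\le C_{\ell}$ for all $x$ and all $|\mathrm{Im}\,\theta|\le\rho$; (V2) $\int_{\mathbb T^\nu}V(\theta,x)\,d\theta=0$ for all $x\in[0,\pi]$. For real $r$ let $\mathcal H^r$ be the space of sine series $\varphi=\sum_{m\ge1}\varphi_m\sin(mx)$ on $[0,\pi]$ with $\|\varphi\|_{\mathcal H^r}^2=\sum_{m\ge1}(1+m^2)^r|\varphi_m|^2<\infty$. For $\mathsf m\ge0$ let $B=\sqrt{-\partial_{xx}+\mathsf m^2}$ with Dirichlet boundary conditions on $[0,\pi]$, with eigenvalues $\lambda_j=\sqrt{j^2+\mathsf m^2}$,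 $j\ge1$. For $\omega\in\mathbb R^\nu$ consider the Klein–Gordon system $$ i\,\partial_t\varphi=\mathbf H(t)\varphi,\qquad \mathbf H(t)=\begin{pmatrix}B&0\\0&-B\end{pmatrix}+\tfrac12B^{-1/2}V(\omega t,\cdot)B^{-1/2}\begin{pmatrix}1&1\\-1&-1\end{pmatrix}\qquad(\mathrm{KG}) $$ in the phase space $\mathcal H^r\times\mathcal H^r$. A solution of such an equation is a function of $t\in\mathbb R$ that is continuous with values in $\mathcal H^r\times\mathcal H^r$, is differentiable with values in $\mathcal H^{r-1}\times\mathcal H^{r-1}$, and satisfies the equation there. For $M>0$ let $R_M=\{\omega\in\mathbb R^\nu: M\le|\omega|\le 2M\}$ ($|\cdot|$ is the Euclidean norm). **Theorem.** Fix $r,\mathsf m\ge0$ and $\alpha\in(0,1)$. There are $\gamma_0>0$ and $C>0$ such that for every $\gamma_*\in(0,\gamma_0)$ there are $M_*>1$, $C_r>0$ and $C'>0$ such that for every $M\ge M_*$ there is a measurable set $\Omega_\infty^\alpha=\Omega^\alpha_\infty(M,\gamma_*)\subseteq R_M$ with $$\frac{\mathrm{meas}(R_M\setminus\Omega_\infty^\alpha)}{\mathrm{meas}(R_M)}\le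 C\gamma_*,$$ and real functions $\lambda_j^\infty(\omega)$, $j\ge1$, on $\Omega_\infty^\alpha$, Lipschitz in $\omega$ with a Lipschitz constant uniform in $j$, such that for every $\omega\in\Omega_\infty^\alpha$: 1. $|\lambda_j^\infty(\omega)-\lambda_j|\le \dfrac{C'}{M\,j^\alpha}$ for all $j\ge1$; 2. there is a family of bounded operators $\mathcal T(\theta;\omega)\in\mathcal L(\mathcal H^r\times\mathcal H^r)$, $\theta\in\mathbb T^\nu$, which extends analytically in $\theta$ to the strip $|\mathrm{Im}\,\theta|\le\rho/8$; every $\mathcal T(\theta;\omega)$, $\theta\in\mathbb T^\nu$, is boundedly invertible, maps pairs of the form $(\varphi,\bar\varphi)$ to pairs of this form, and satisfies $$\|\mathcal T(\theta;\omega)-\mathbf 1\|_{\mathcal L(\mathcal H^r\times\mathcal H^r)}\le \frac{C_r}{M^{(1-\alpha)/2}};$$ 3. the quasi-periodic change of coordinates $\varphi(t)=\mathcal T(\omega t;\omega)\psi(t)$ conjugates (KG) to the diagonal time-independent system $$ i\,\dot\psi=\begin{pmatrix}D&0\\0&-D\end{pmatrix}\psi,\qquad D=\mathrm{diag}\{\lambda_j^\infty(\omega):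 j\ge1\}, $$ that is, for every $\psi:\mathbb R\to\mathcal H^r\times\mathcal H^r$, $\psi$ is a solution of the diagonal system if and only if $t\mapsto\mathcal T(\omega t;\omega)\psi(t)$ is a solution of (KG). -/

import Mathlib

open Real MeasureTheory Set
open scoped NNReal

noncomputable section

/-! ### Sine-Sobolev spaces -/

/-- Sequences `(φ_m)_{m ≥ 1}` of sine coefficients; `φ` stands for the (possibly formal)
sine series `∑_{m ≥ 1} φ_m sin (m x)` on `[0, π]`. -/
abbrev SineCoeff : Type := ℕ+ → ℂ

/-- The Japanese bracket `⟨m⟩ = (1 + m²)^{1/2}` of a positive integer. -/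
def japanese (m : ℕ+) : ℝ := √(1 + (m : ℝ) ^ 2)

theorem japanese_pos (m : ℕ+) : 0 < japanese m := Real.sqrt_pos.2 (by positivity)

theorem one_le_japanese (m : ℕ+) : 1 ≤ japanese m :=
  Real.one_le_sqrt.2 (by nlinarith [sq_nonneg (m : ℝ)])

theorem norm_weight_sq (r : ℝ) (m : ℕ+) (z : ℂ) :
    ‖((japanese m ^ r : ℝ) : ℂ) * z‖ ^ 2 = japanese m ^ (2 * r) * ‖z‖ ^ 2 := by
  have h := japanese_pos m
  rw [norm_mul, Complex.norm_real, Real.norm_of_nonneg (Real.rpow_nonneg h.le r), mul_pow,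
    ← Real.rpow_natCast, ← Real.rpow_mul h.le]
  congr 2
  push_cast
  ring

/-- The weighted sequence `⟨m⟩^r φ_m` is square summable iff `∑ ⟨m⟩^{2r} |φ_m|² < ∞`. -/
theorem memℓp_weight_iff (r : ℝ) (φ : SineCoeff) :
    Memℓp (fun m => ((japanese m ^ r : ℝ) : ℂ) * φ m) 2 ↔
      Summable fun m => japanese m ^ (2 * r) * ‖φ m‖ ^ 2 := by
  rw [memℓp_gen_iff (by norm_num)]
  refine summable_congr fun m => ?_
  rw [← norm_weight_sq r m (φ m)]
  norm_num

/-- The sequences with `∑_{m ≥ 1} ⟨m⟩^{2r} |φ_m|² < ∞`, as a subspace of all sequences. -/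
def sineSobolevSubmodule (r : ℝ) : Submodule ℂ SineCoeff where
  carrier := {φ | Summable fun m => japanese m ^ (2 * r) * ‖φ m‖ ^ 2}
  zero_mem' := by simp [summable_zero]
  add_mem' := by
    intro a b ha hb
    have ha' := (memℓp_weight_iff r a).2 ha
    have hb' := (memℓp_weight_iff r b).2 hb
    refine (memℓp_weight_iff r (a + b)).1 ?_
    convert ha'.add hb' using 1
    funext m
    simp [mul_add]
  smul_mem' := by
    intro c a ha
    have ha' := (memℓp_weight_iff r a).2 ha
    refine (memℓp_weight_iff r (c • a)).1 ?_
    convert ha'.const_smul c using 1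
    funext m
    simp [mul_left_comm]

/-- The space `𝓗^r` (any real `r`) of sine series `∑_{m ≥ 1} φ_m sin (m x)` with
`‖φ‖² = ∑_{m ≥ 1} ⟨m⟩^{2r} |φ_m|² < ∞`, described by its coefficients. -/
def SineSobolev (r : ℝ) : Type := sineSobolevSubmodule r

namespace SineSobolev

variable {r : ℝ}

instance : AddCommGroup (SineSobolev r) := inferInstanceAs (AddCommGroup (sineSobolevSubmodule r))

instance : Module ℂ (SineSobolev r) := inferInstanceAs (Module ℂ (sineSobolevSubmodule r))

/-- The sequence of sine coefficients of an element of `𝓗^r`. -/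
def coeff : SineSobolev r →ₗ[ℂ] SineCoeff := (sineSobolevSubmodule r).subtype

theorem summable_coeff (φ : SineSobolev r) :
    Summable fun m => japanese m ^ (2 * r) * ‖coeff φ m‖ ^ 2 := φ.2

/-- The map `φ ↦ (⟨m⟩^r φ_m)_m` from `𝓗^r` to `ℓ²`. -/
def weight (r : ℝ) : SineSobolev r →ₗ[ℂ] lp (fun _ : ℕ+ => ℂ) 2 where
  toFun φ := ⟨fun m => ((japanese m ^ r : ℝ) : ℂ) * coeff φ m,
    (memℓp_weight_iff r _).2 φ.summable_coeff⟩
  map_add' a b := by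
    ext m
    simp [mul_add]
    rfl
  map_smul' c a := by
    ext m
    simp [mul_left_comm]

theorem weight_injective (r : ℝ) : Function.Injective (weight r) := by
  intro a b h
  refine Subtype.ext (funext fun m => ?_)
  have h1 : ((japanese m ^ r : ℝ) : ℂ) * coeff a m = ((japanese m ^ r : ℝ) : ℂ) * coeff b m :=
    congrFun (congrArg Subtype.val h) m
  have h2 : ((japanese m ^ r : ℝ) : ℂ) ≠ 0 :=
    Complex.ofReal_ne_zero.2 (Real.rpow_pos_of_pos (japanese_pos m) r).ne'
  exact mul_left_cancel₀ h2 h1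

instance : NormedAddCommGroup (SineSobolev r) :=
  NormedAddCommGroup.induced (SineSobolev r) (lp (fun _ : ℕ+ => ℂ) 2) (weight r)
    (weight_injective r)

instance : NormedSpace ℂ (SineSobolev r) :=
  NormedSpace.induced ℂ (SineSobolev r) (lp (fun _ : ℕ+ => ℂ) 2) (weight r)

/-- The norm of `𝓗^r`: `‖φ‖² = ∑_{m ≥ 1} ⟨m⟩^{2r} |φ_m|²`. -/
theorem norm_sq_eq (φ : SineSobolev r) :
    ‖φ‖ ^ 2 = ∑' m, japanese m ^ (2 * r) * ‖coeff φ m‖ ^ 2 := by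
  have h := lp.norm_rpow_eq_tsum (p := 2) (by norm_num) (weight r φ)
  have h0 : ‖φ‖ = ‖weight r φ‖ := rfl
  rw [h0]
  simp only [ENNReal.toReal_ofNat, Real.rpow_ofNat] at h
  rw [h]
  exact tsum_congr fun m => norm_weight_sq r m (coeff φ m)

/-- The inclusion `𝓗^r ⊆ 𝓗^{r-1}`. -/
def incl (r : ℝ) (φ : SineSobolev r) : SineSobolev (r - 1) :=
  ⟨coeff φ, Summable.of_nonneg_of_le
    (fun m => mul_nonneg (Real.rpow_nonneg (japanese_pos m).le _) (sq_nonneg _))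
    (fun m => mul_le_mul_of_nonneg_right
      (Real.rpow_le_rpow_of_exponent_le (one_le_japanese m) (by linarith)) (sq_nonneg _))
    φ.summable_coeff⟩

end SineSobolev

open SineSobolev

/-- The phase space `𝓗^r × 𝓗^r`. -/
abbrev PhaseSpace (r : ℝ) : Type := SineSobolev r × SineSobolev r

/-- Bounded operators on `𝓗^r × 𝓗^r`, with the operator norm. -/
abbrev PhaseOp (r : ℝ) : Type := PhaseSpace r →L[ℂ] PhaseSpace r

/-- The two coefficient sequences of a point of the phase space. -/
def pairCoeff {r : ℝ} (u : PhaseSpace r) : SineCoeff × SineCoeff := (coeff u.1, coeff u.2)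

/-- The points of the phase space of the form `(φ, φ̄)`. -/
def IsRealPair {r : ℝ} (u : PhaseSpace r) : Prop :=
  ∀ n, coeff u.2 n = starRingEnd ℂ (coeff u.1 n)

/-! ### Functions on the torus and analyticity in strips -/

/-- `f` descends to the torus `𝕋^ν = (ℝ/2πℤ)^ν`. -/
def TorusPeriodic {ν : ℕ} {E : Type*} (f : EuclideanSpace ℝ (Fin ν) → E) : Prop :=
  ∀ θ i, f (θ + EuclideanSpace.single i (2 * π)) = f θ

/-- Real points as points of `ℂ^ν`. -/
def toComplexVec {ν : ℕ} (θ : EuclideanSpace ℝ (Fin ν)) : EuclideanSpace ℂ (Fin ν) :=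
  WithLp.toLp 2 fun i => (θ i : ℂ)

/-- The complex neighbourhood `{θ ∈ ℂ^ν : |Im θ| ≤ ρ}` of width `ρ`. -/
def complexStrip (ν : ℕ) (ρ : ℝ) : Set (EuclideanSpace ℂ (Fin ν)) :=
  {z | ‖(WithLp.toLp 2 fun i => (z i).im : EuclideanSpace ℝ (Fin ν))‖ ≤ ρ}

/-- `f` extends analytically to (a neighbourhood of) the strip `|Im θ| ≤ ρ`. -/
def ExtendsAnalytically {ν : ℕ} {E : Type*} [NormedAddCommGroup E] [NormedSpace ℂ E]
    (ρ : ℝ) (f : EuclideanSpace ℝ (Fin ν) → E) : Prop :=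
  ∃ F : EuclideanSpace ℂ (Fin ν) → E,
    AnalyticOnNhd ℂ F (complexStrip ν ρ) ∧ ∀ θ, F (toComplexVec θ) = f θ

/-! ### Assumptions on the potential -/

/-- The even `2π`-periodic extension in `x` of a function on `[0, π]`:
`arccos (cos x)` is the representative of `± x` modulo `2π` that lies in `[0, π]`. -/
def evenExtension (g : ℝ → ℝ) (x : ℝ) : ℝ := g (arccos (cos x))

/-- The even extension in `x` of `V` is smooth in both variables, it extends analytically in `θ`
to the strip of width `ρ`, and all the `x`-derivatives of the extension are bounded there. -/
def ConditionV1 {ν : ℕ} (V : EuclideanSpace ℝ (Fin ν) → ℝ → ℝ) (ρ : ℝ) : Prop :=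
  ContDiff ℝ (⊤ : ℕ∞) (fun p : EuclideanSpace ℝ (Fin ν) × ℝ => evenExtension (V p.1) p.2) ∧
  ∃ F : EuclideanSpace ℂ (Fin ν) → ℝ → ℂ,
    (∀ θ x, F (toComplexVec θ) x = (evenExtension (V θ) x : ℂ)) ∧
    (∀ x, AnalyticOnNhd ℂ (fun z => F z x) (complexStrip ν ρ)) ∧
    (∀ z ∈ complexStrip ν ρ, ContDiff ℝ (⊤ : ℕ∞) (F z)) ∧
    ∀ l : ℕ, ∃ C > 0, ∀ x, ∀ z ∈ complexStrip ν ρ, ‖iteratedDeriv l (F z) x‖ ≤ C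

/-- `V` has zero average over the torus, for every `x ∈ [0, π]`. -/
def ConditionV2 {ν : ℕ} (V : EuclideanSpace ℝ (Fin ν) → ℝ → ℝ) : Prop :=
  ∀ x ∈ Icc 0 π, ∫ θ in {θ : EuclideanSpace ℝ (Fin ν) | ∀ i, θ i ∈ Icc 0 (2 * π)}, V θ x = 0

/-! ### The Klein-Gordon system and its normal form -/

/-- The eigenvalues `λ_j = √(j² + m²)` of `B = √(-Δ + m²)` with Dirichlet conditions. -/
def kgEigenvalue (mass : ℝ) (j : ℕ+) : ℝ := √((j : ℝ) ^ 2 + mass ^ 2)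

/-- The power `B^s` of `B = √(-Δ + m²)`, diagonal in the basis `sin (n x)`. -/
def powB (mass s : ℝ) (φ : SineCoeff) : SineCoeff :=
  fun n => ((kgEigenvalue mass n ^ s : ℝ) : ℂ) * φ n

/-- Multiplication by the function `g` on `[0, π]`, in sine coefficients:
`(g φ)_n = ∑_m (2/π ∫_0^π g(x) sin (m x) sin (n x) dx) φ_m`. -/
def sineMul (g : ℝ → ℝ) (φ : SineCoeff) : SineCoeff :=
  fun n => ∑' m : ℕ+, ((2 / π * ∫ x in (0 : ℝ)..π, g x * sin (m * x) * sin (n * x) : ℝ) : ℂ) * φ m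

/-- The Hamiltonian `diag (B, -B) + ½ B^{-1/2} g B^{-1/2} (1, 1; -1, -1)`. -/
def kgHamiltonian (mass : ℝ) (g : ℝ → ℝ) (u : SineCoeff × SineCoeff) : SineCoeff × SineCoeff :=
  let w : SineCoeff := (1 / 2 : ℂ) •
    powB mass (-1 / 2) (sineMul g (powB mass (-1 / 2) (u.1 + u.2)))
  (powB mass 1 u.1 + w, -powB mass 1 u.2 - w)

/-- The diagonal Hamiltonian `diag (D, -D)` with `D = diag (d_j)`. -/
def diagHamiltonian (d : ℕ+ → ℝ) (u : SineCoeff × SineCoeff) : SineCoeff × SineCoeff :=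
  (fun j => (d j : ℂ) * u.1 j, fun j => -((d j : ℂ) * u.2 j))

/-- `u` is a solution on `ℝ` of `i ∂_t u = H(t) u` in the phase space `𝓗^r × 𝓗^r`, for operators
`H(t)` of order one: `u` is continuous with values in `𝓗^r × 𝓗^r`, differentiable with
values in `𝓗^{r-1} × 𝓗^{r-1}`, and satisfies the equation there. -/
def IsSolution {r : ℝ} (H : ℝ → SineCoeff × SineCoeff → SineCoeff × SineCoeff)
    (u : ℝ → PhaseSpace r) : Prop :=
  Continuous u ∧ ∀ t, ∃ v : PhaseSpace (r - 1),
    HasDerivAt (fun s => ((incl r (u s).1, incl r (u s).2) : PhaseSpace (r - 1))) v t ∧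
    Complex.I • pairCoeff v = H t (pairCoeff (u t))

/-- The annulus `R_M = {ω ∈ ℝ^ν : M ≤ |ω| ≤ 2M}`. -/
def annulus (ν : ℕ) (M : ℝ) : Set (EuclideanSpace ℝ (Fin ν)) :=
  Metric.closedBall 0 (2 * M) \ Metric.ball 0 M

end

/-! Fourier series in the angles turn a family of operators depending on θ into one infinite matrix
indexed by pairs (signed mode, Fourier index) and invariant under translations of the Fourier index.
The change of coordinates φ = T(ωt)ψ conjugates (KG) to the diagonal system exactly when (E + W) T =
T E', where E = ω·k + λ_i (with λ_i = ±λ_j according to the component), W is the matrix of the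
perturbation and E' = ω·k + λ_i^∞. So the task is to diagonalize E + W by a matrix close to the
identity. Entries are measured by weighted Schur norms, which control the width of the strip of
analyticity and the off-diagonal decay in the modes at the same time; this decay is what lets one
matrix act on both `𝓗^r` and `𝓗^{r-1}`.

Two properties of W matter. The factors B^{-1/2} on both sides make it of order -1: the weight
max(⟨i⟩,⟨j⟩) can be put on its entries. By (V2) it has no entries with equal Fourier indices. The
first step removes W by solving a homological equation with divisors ω·k + λ_i - λ_j, k ≠ 0. If |λ_i
- λ_j| is small compared with M, the divisor is of size M. If not, max(⟨i⟩,⟨j⟩) is at least of size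
M and the order -1 of W supplies the factor 1/M. Either way the generator is O(1/M), up to powers of
k paid for by analyticity (`FastNonResonant.exists_lower`), and the new perturbation is of order -1
and size ε = O(1/M) (`averaged_schemeBound`).

From there a KAM iteration (`SchemeBound.step`) diagonalizes the matrix. The divisors are bounded
below by γ 2^{-n} (1 + |k|)^{-m}, while the diagonal entries move by O(ε/⟨j⟩). Estimates are made
for pairs of frequencies, so Lipschitz dependence on ω comes along on whatever set is nonresonant.
The limit is taken in `exists_diagonalization`, and `exists_conjugation` combines it with the first
step.

The eigenvalues are real because E + W is symmetric for the indefinite form with signs ±1, and this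
form does not vanish on columns close to basis vectors (`im_eq_zero_of_intertwines`).

For the measure estimate, each condition excludes a slab of frequencies, but there are infinitely
many pairs (i, j). Eigenvalues of high modes are close to integers, so once |ω·k + n| is bounded
below for all integers n, only pairs with one small index can be resonant, and they are finitely
many for each k (`volume_resonant_le`, `volume_annulus_diff_le`).

Analyticity of V in θ and smoothness in x give the hypotheses on W (`exists_kgPert_admissible`).
Summing the Fourier series of the limiting matrix returns the operators T(θ) and the conjugation of
solutions (`fourierOp_conjugation`). -/

noncomputable section

/-! ### Infinite matrices as bounded operators on `ℓ¹` -/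

open scoped ENNReal
open Filter Topology

/-- The bounded operators on `ℓ¹(S)`, i.e. the matrices with bounded column sums. -/
abbrev MatOp (S : Type*) : Type _ := lp (fun _ : S => ℂ) 1 →L[ℂ] lp (fun _ : S => ℂ) 1

section Matrices

variable {S : Type*} [DecidableEq S]

/-- The matrix entry `A_{st}`. -/
def entry (A : MatOp S) (s t : S) : ℂ := A (lp.single 1 t (1 : ℂ)) s

@[simp] theorem entry_add (A B : MatOp S) (s t : S) :
    entry (A + B) s t = entry A s t + entry B s t := rfl

@[simp] theorem entry_sub (A B : MatOp S) (s t : S) :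
    entry (A - B) s t = entry A s t - entry B s t := rfl

@[simp] theorem entry_neg (A : MatOp S) (s t : S) : entry (-A) s t = -entry A s t := rfl

@[simp] theorem entry_zero (s t : S) : entry (0 : MatOp S) s t = 0 := rfl

theorem entry_one (s t : S) : entry (1 : MatOp S) s t = if s = t then 1 else 0 := by
  simp [entry, lp.single_apply, Pi.single_apply]

theorem hasSum_entry_apply (A : MatOp S) (x : lp (fun _ : S => ℂ) 1) (s : S) :
    HasSum (fun m => entry A s m * x m) (A x s) := by
  have h := (lp.hasSum_single (E := fun _ : S => ℂ) (p := 1) ENNReal.one_ne_top x)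
  have h2 := ((lp.evalCLM (𝕜 := ℂ) (E := fun _ : S => ℂ) (p := 1) s).comp A).hasSum h
  refine h2.congr_fun ?_ |> fun h => h
  intro m
  have : lp.single (E := fun _ : S => ℂ) 1 m (x m) = x m • lp.single 1 m (1 : ℂ) := by
    rw [← lp.single_smul]; simp
  simp only [ContinuousLinearMap.comp_apply, this, map_smul]
  exact mul_comm _ _

theorem hasSum_entry_mul (A B : MatOp S) (s t : S) :
    HasSum (fun m => entry A s m * entry B m t) (entry (A * B) s t) :=
  hasSum_entry_apply A (B (lp.single 1 t 1)) s

theorem continuous_entry (s t : S) : Continuous fun A : MatOp S => entry A s t :=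
  ((lp.evalCLM (𝕜 := ℂ) (E := fun _ : S => ℂ) (p := 1) s).continuous).comp
    (continuous_eval_const (F := MatOp S) (lp.single 1 t (1 : ℂ)))

omit [DecidableEq S] in
theorem lpOne_enorm (x : lp (fun _ : S => ℂ) 1) : ‖x‖ₑ = ∑' s, ‖x s‖ₑ := by
  have h := lp.norm_eq_tsum_rpow (p := 1) (by norm_num) x
  simp only [ENNReal.toReal_one, Real.rpow_one, div_one] at h
  have hs : Summable fun s => ‖x s‖ := by
    have := (lp.memℓp x).summable (by norm_num : 0 < (1 : ℝ≥0∞).toReal)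
    simpa using this
  rw [← ofReal_norm, h, ENNReal.ofReal_tsum_of_nonneg (fun _ => norm_nonneg _) hs]
  simp

theorem tsum_enorm_entry_le (A : MatOp S) (t : S) : ∑' s, ‖entry A s t‖ₑ ≤ ‖A‖ₑ := by
  have h := lpOne_enorm (A (lp.single 1 t (1 : ℂ)))
  unfold entry
  rw [← h, ← ofReal_norm, ← ofReal_norm]
  refine ENNReal.ofReal_le_ofReal ?_
  refine (A.le_opNorm _).trans ?_
  rw [lp.norm_single (by norm_num)]
  simp

theorem opNorm_le_of_columns {A : MatOp S} {c : ℝ≥0} (h : ∀ t, ∑' s, ‖entry A s t‖ₑ ≤ c) :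
    ‖A‖ ≤ c := by
  refine A.opNorm_le_bound c.2 fun x => ?_
  have h1 : ‖A x‖ₑ ≤ c * ‖x‖ₑ := by
    rw [lpOne_enorm, lpOne_enorm]
    calc ∑' s, ‖A x s‖ₑ ≤ ∑' s, ∑' m, ‖entry A s m‖ₑ * ‖x m‖ₑ := by
          refine ENNReal.tsum_le_tsum fun s => ?_
          rw [← (hasSum_entry_apply A x s).tsum_eq]
          refine (enorm_tsum_le_tsum_enorm).trans ?_
          simp [enorm_mul]
      _ = ∑' m, (∑' s, ‖entry A s m‖ₑ) * ‖x m‖ₑ := by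
          rw [ENNReal.tsum_comm]
          simp [ENNReal.tsum_mul_right]
      _ ≤ ∑' m, c * ‖x m‖ₑ := ENNReal.tsum_le_tsum fun m => by gcongr; exact h m
      _ = c * ∑' m, ‖x m‖ₑ := ENNReal.tsum_mul_left
  have := (ENNReal.toReal_le_toReal (by simp) (by finiteness)).2 h1
  simpa using this

/-- A matrix with bounded column sums is an operator on `ℓ¹`. -/
theorem exists_entry_eq {a : S → S → ℂ} {c : ℝ≥0} (h : ∀ t, ∑' s, ‖a s t‖ₑ ≤ c) :
    ∃ A : MatOp S, ∀ s t, entry A s t = a s t := by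
  have hcol : ∀ t, Memℓp (fun s => a s t) 1 := by
    intro t
    rw [memℓp_gen_iff (by norm_num)]
    simp only [ENNReal.toReal_one, Real.rpow_one]
    have : ∑' s, ‖a s t‖ₑ ≠ ∞ := ((h t).trans_lt ENNReal.coe_lt_top).ne
    have := ENNReal.summable_toReal this
    simpa using this
  let f : S → lp (fun _ : S => ℂ) 1 := fun t => ⟨fun s => a s t, hcol t⟩
  have hf : ∀ t, ‖f t‖ ≤ c := by
    intro t
    have h1 : ‖f t‖ₑ ≤ c := by
      rw [lpOne_enorm]; exact h t
    have := (ENNReal.toReal_le_toReal (by simp) (by finiteness)).2 h1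
    simpa using this
  have hsum : ∀ x : lp (fun _ : S => ℂ) 1, Summable fun t => ‖x t‖ := by
    intro x
    have := (lp.memℓp x).summable (by norm_num : 0 < (1 : ℝ≥0∞).toReal)
    simpa using this
  have hle : ∀ x : lp (fun _ : S => ℂ) 1, ∀ t, ‖x t • f t‖ ≤ ‖x t‖ * c := by
    intro x t
    rw [norm_smul]
    gcongr
    exact hf t
  have hsm : ∀ x : lp (fun _ : S => ℂ) 1, Summable fun t => x t • f t := fun x =>
    Summable.of_norm_bounded ((hsum x).mul_right _) (hle x)
  let L : lp (fun _ : S => ℂ) 1 →ₗ[ℂ] lp (fun _ : S => ℂ) 1 :=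
    { toFun := fun x => ∑' t, x t • f t
      map_add' := by
        intro x y
        rw [← (hsm x).tsum_add (hsm y)]
        refine tsum_congr fun t => ?_
        rw [← add_smul]; rfl
      map_smul' := by
        intro r x
        rw [RingHom.id_apply, ← (hsm x).tsum_const_smul]
        refine tsum_congr fun t => ?_
        rw [← mul_smul]; rfl }
  have hL : ∀ x, ‖L x‖ ≤ c * ‖x‖ := by
    intro x
    have h1 := tsum_of_norm_bounded ((hsum x).mul_right (c : ℝ)).hasSum (hle x)
    refine h1.trans (le_of_eq ?_)
    rw [tsum_mul_right, mul_comm]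
    have h := lp.norm_eq_tsum_rpow (p := 1) (by norm_num) x
    simp only [ENNReal.toReal_one, Real.rpow_one, div_one] at h
    rw [h]
  refine ⟨L.mkContinuous c hL, fun s t => ?_⟩
  have : L (lp.single 1 t (1 : ℂ)) = f t := by
    change ∑' m, (lp.single (E := fun _ : S => ℂ) 1 t (1 : ℂ)) m • f m = f t
    rw [tsum_eq_single t]
    · simp
    · intro m hm
      simp [lp.single_apply, hm]
  change (L (lp.single 1 t (1 : ℂ))) s = _
  rw [this]

/-! ### Schur norms -/

omit [DecidableEq S] in
/-- The weighted Schur norm: the largest weighted row or column sum. -/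
def schur (U : S → S → ℝ) (a : S → S → ℂ) : ℝ≥0∞ :=
  max (⨆ t, ∑' s, ‖a s t‖ₑ * ENNReal.ofReal (U s t))
    (⨆ s, ∑' t, ‖a s t‖ₑ * ENNReal.ofReal (U s t))

omit [DecidableEq S] in
theorem schur_le_iff {U : S → S → ℝ} {a : S → S → ℂ} {c : ℝ≥0∞} :
    schur U a ≤ c ↔ (∀ t, ∑' s, ‖a s t‖ₑ * ENNReal.ofReal (U s t) ≤ c) ∧
      ∀ s, ∑' t, ‖a s t‖ₑ * ENNReal.ofReal (U s t) ≤ c := by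
  simp [schur]

omit [DecidableEq S] in
theorem column_le_schur (U : S → S → ℝ) (a : S → S → ℂ) (t : S) :
    ∑' s, ‖a s t‖ₑ * ENNReal.ofReal (U s t) ≤ schur U a := (schur_le_iff.1 le_rfl).1 t

omit [DecidableEq S] in
theorem row_le_schur (U : S → S → ℝ) (a : S → S → ℂ) (s : S) :
    ∑' t, ‖a s t‖ₑ * ENNReal.ofReal (U s t) ≤ schur U a := (schur_le_iff.1 le_rfl).2 s

omit [DecidableEq S] in
theorem enorm_mul_weight_le_schur (U : S → S → ℝ) (a : S → S → ℂ) (s t : S) :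
    ‖a s t‖ₑ * ENNReal.ofReal (U s t) ≤ schur U a :=
  (ENNReal.le_tsum (f := fun s => ‖a s t‖ₑ * ENNReal.ofReal (U s t)) s).trans
    (column_le_schur U a t)

omit [DecidableEq S] in
/-- Comparison of Schur norms through a bound on the entries. -/
theorem schur_le_of_entry_le {U V : S → S → ℝ} {a b : S → S → ℂ} {c : ℝ≥0∞}
    (h : ∀ s t, ‖a s t‖ₑ * ENNReal.ofReal (U s t) ≤ c * (‖b s t‖ₑ * ENNReal.ofReal (V s t))) :
    schur U a ≤ c * schur V b := by
  refine schur_le_iff.2 ⟨fun t => ?_, fun s => ?_⟩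
  · refine (ENNReal.tsum_le_tsum fun s => h s t).trans ?_
    rw [ENNReal.tsum_mul_left]
    gcongr
    exact column_le_schur V b t
  · refine (ENNReal.tsum_le_tsum fun t => h s t).trans ?_
    rw [ENNReal.tsum_mul_left]
    gcongr
    exact row_le_schur V b s

omit [DecidableEq S] in
theorem schur_add_le (U : S → S → ℝ) (a b : S → S → ℂ) :
    schur U (fun s t => a s t + b s t) ≤ schur U a + schur U b := by
  have key : ∀ s t, ‖a s t + b s t‖ₑ * ENNReal.ofReal (U s t) ≤
      ‖a s t‖ₑ * ENNReal.ofReal (U s t) + ‖b s t‖ₑ * ENNReal.ofReal (U s t) := by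
    intro s t
    rw [← add_mul]
    gcongr
    exact enorm_add_le _ _
  refine schur_le_iff.2 ⟨fun t => ?_, fun s => ?_⟩
  · refine (ENNReal.tsum_le_tsum fun s => key s t).trans ?_
    rw [ENNReal.tsum_add]
    exact add_le_add (column_le_schur U a t) (column_le_schur U b t)
  · refine (ENNReal.tsum_le_tsum fun t => key s t).trans ?_
    rw [ENNReal.tsum_add]
    exact add_le_add (row_le_schur U a s) (row_le_schur U b s)

/-- The weighted Schur norm of an operator. -/
def opSchur (U : S → S → ℝ) (A : MatOp S) : ℝ≥0∞ := schur U (entry A)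

theorem opSchur_add_le (U : S → S → ℝ) (A B : MatOp S) :
    opSchur U (A + B) ≤ opSchur U A + opSchur U B := schur_add_le U (entry A) (entry B)

theorem opSchur_neg (U : S → S → ℝ) (A : MatOp S) : opSchur U (-A) = opSchur U A := by
  simp [opSchur, schur]

theorem opSchur_sub_le (U : S → S → ℝ) (A B : MatOp S) :
    opSchur U (A - B) ≤ opSchur U A + opSchur U B := by
  rw [sub_eq_add_neg, ← opSchur_neg U B]
  exact opSchur_add_le U A (-B)

theorem opSchur_mono {U V : S → S → ℝ} (h : ∀ s t, U s t ≤ V s t) (A : MatOp S) :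
    opSchur U A ≤ opSchur V A := by
  have := schur_le_of_entry_le (U := U) (V := V) (a := entry A) (b := entry A) (c := 1)
    fun s t => by rw [one_mul]; gcongr; exact h s t
  simpa [opSchur] using this

/-- Three weights are allowed so that the product of a transformation and an operator of order -1
can be estimated as an operator of order -1. -/
theorem opSchur_mul_le {U V W : S → S → ℝ} (hV : ∀ s t, 0 ≤ V s t)
    (h : ∀ s m t, U s t ≤ V s m * W m t) (A B : MatOp S) :
    opSchur U (A * B) ≤ opSchur V A * opSchur W B := by
  have key : ∀ s t, ‖entry (A * B) s t‖ₑ * ENNReal.ofReal (U s t) ≤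
      ∑' m, (‖entry A s m‖ₑ * ENNReal.ofReal (V s m)) *
        (‖entry B m t‖ₑ * ENNReal.ofReal (W m t)) := by
    intro s t
    rw [← (hasSum_entry_mul A B s t).tsum_eq]
    refine (mul_le_mul_left enorm_tsum_le_tsum_enorm _).trans ?_
    rw [← ENNReal.tsum_mul_right]
    refine ENNReal.tsum_le_tsum fun m => ?_
    rw [enorm_mul]
    calc _ ≤ ‖entry A s m‖ₑ * ‖entry B m t‖ₑ * ENNReal.ofReal (V s m * W m t) := by
          gcongr; exact h s m t
      _ = _ := by rw [ENNReal.ofReal_mul (hV s m)]; ring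
  refine schur_le_iff.2 ⟨fun t => ?_, fun s => ?_⟩
  · calc _ ≤ ∑' s, ∑' m, (‖entry A s m‖ₑ * ENNReal.ofReal (V s m)) *
          (‖entry B m t‖ₑ * ENNReal.ofReal (W m t)) := ENNReal.tsum_le_tsum fun s => key s t
      _ = ∑' m, (∑' s, ‖entry A s m‖ₑ * ENNReal.ofReal (V s m)) *
          (‖entry B m t‖ₑ * ENNReal.ofReal (W m t)) := by
          rw [ENNReal.tsum_comm]; simp only [ENNReal.tsum_mul_right]
      _ ≤ ∑' m, opSchur V A * (‖entry B m t‖ₑ * ENNReal.ofReal (W m t)) := by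
          refine ENNReal.tsum_le_tsum fun m => ?_
          gcongr
          exact column_le_schur V (entry A) m
      _ ≤ _ := by
          rw [ENNReal.tsum_mul_left]
          gcongr
          exact column_le_schur W (entry B) t
  · calc _ ≤ ∑' t, ∑' m, (‖entry A s m‖ₑ * ENNReal.ofReal (V s m)) *
          (‖entry B m t‖ₑ * ENNReal.ofReal (W m t)) := ENNReal.tsum_le_tsum fun t => key s t
      _ = ∑' m, (‖entry A s m‖ₑ * ENNReal.ofReal (V s m)) *
          ∑' t, (‖entry B m t‖ₑ * ENNReal.ofReal (W m t)) := by
          rw [ENNReal.tsum_comm]; simp only [ENNReal.tsum_mul_left]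
      _ ≤ ∑' m, (‖entry A s m‖ₑ * ENNReal.ofReal (V s m)) * opSchur W B := by
          refine ENNReal.tsum_le_tsum fun m => ?_
          gcongr
          exact row_le_schur W (entry B) m
      _ ≤ _ := by
          rw [ENNReal.tsum_mul_right]
          gcongr
          exact row_le_schur V (entry A) s

theorem opSchur_one_le {U : S → S → ℝ} (h : ∀ s, U s s ≤ 1) : opSchur U (1 : MatOp S) ≤ 1 := by
  have key : ∀ s t, ‖entry (1 : MatOp S) s t‖ₑ * ENNReal.ofReal (U s t) ≤
      if s = t then 1 else 0 := by
    intro s t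
    rw [entry_one]
    split_ifs with hst
    · subst hst
      simpa using h s
    · simp
  refine schur_le_iff.2 ⟨fun t => ?_, fun s => ?_⟩
  · refine (ENNReal.tsum_le_tsum fun s => key s t).trans ?_
    rw [tsum_ite_eq]
  · refine (ENNReal.tsum_le_tsum fun t => key s t).trans ?_
    simp_rw [eq_comm (a := s)]
    rw [tsum_ite_eq]

theorem enorm_le_opSchur {U : S → S → ℝ} (h : ∀ s t, 1 ≤ U s t) (A : MatOp S) :
    ‖A‖ₑ ≤ opSchur U A := by
  by_cases hA : opSchur U A = ∞
  · simp [hA]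
  lift opSchur U A to ℝ≥0 using hA with c hc
  have := opNorm_le_of_columns (A := A) (c := c) fun t => by
    rw [hc]
    refine le_trans (ENNReal.tsum_le_tsum fun s => ?_) (column_le_schur U (entry A) t)
    refine le_mul_of_one_le_right (by simp) ?_
    simpa using h s t
  rw [← ofReal_norm]
  simpa using ENNReal.ofReal_le_ofReal this

/-- Convergence on `ℓ¹` implies convergence of entries, and weighted row and column sums are suprema
of finite sums of entries. Limits can thus be taken in the operator norm while bounds are kept in
the stronger Schur norms. -/
theorem opSchur_le_of_tendsto {U : S → S → ℝ} {A : ℕ → MatOp S} {B : MatOp S} {c : ℝ≥0∞}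
    (hA : Tendsto A atTop (𝓝 B)) (h : ∀ n, opSchur U (A n) ≤ c) : opSchur U B ≤ c := by
  have key : ∀ s t, Tendsto (fun n => ‖entry (A n) s t‖ₑ * ENNReal.ofReal (U s t)) atTop
      (𝓝 (‖entry B s t‖ₑ * ENNReal.ofReal (U s t))) := by
    intro s t
    refine ENNReal.Tendsto.mul_const ?_ (Or.inr ENNReal.ofReal_ne_top)
    exact (((continuous_entry s t).tendsto B).comp hA).enorm
  refine schur_le_iff.2 ⟨fun t => ?_, fun s => ?_⟩
  · refine ENNReal.summable.tsum_le_of_sum_le fun F => ?_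
    refine le_of_tendsto (tendsto_finsetSum F fun s _ => key s t) (Eventually.of_forall fun n => ?_)
    exact (ENNReal.sum_le_tsum F).trans ((column_le_schur U _ t).trans (h n))
  · refine ENNReal.summable.tsum_le_of_sum_le fun F => ?_
    refine le_of_tendsto (tendsto_finsetSum F fun t _ => key s t) (Eventually.of_forall fun n => ?_)
    exact (ENNReal.sum_le_tsum F).trans ((row_le_schur U _ s).trans (h n))

/-- The operator with the given entries, if there is one. -/
def ofEntries (a : S → S → ℂ) : MatOp S :=
  open Classical in if h : ∃ A : MatOp S, ∀ s t, entry A s t = a s t then h.choose else 0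

/-- A finite Schur norm with weight at least 1 bounds the column sums, so the default value 0 of
`ofEntries` is not taken. -/
theorem entry_ofEntries {a : S → S → ℂ} {U : S → S → ℝ} (hU : ∀ s t, 1 ≤ U s t)
    (h : schur U a ≠ ∞) (s t : S) : entry (ofEntries a) s t = a s t := by
  have hex : ∃ A : MatOp S, ∀ s t, entry A s t = a s t := by
    lift schur U a to ℝ≥0 using h with c hc
    refine exists_entry_eq (c := c) fun t => ?_
    rw [hc]
    refine le_trans (ENNReal.tsum_le_tsum fun s => ?_) (column_le_schur U a t)
    refine le_mul_of_one_le_right (by simp) ?_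
    simpa using hU s t
  rw [ofEntries, dif_pos hex]
  exact hex.choose_spec s t

/-! ### Neumann series -/

theorem isUnit_one_add {U : S → S → ℝ} (hU : ∀ s t, 1 ≤ U s t) {X : MatOp S}
    (hX : opSchur U X ≤ 2⁻¹) : IsUnit (1 + X) := by
  have h1 : ‖X‖ₑ ≤ 2⁻¹ := (enorm_le_opSchur hU X).trans hX
  have h2 : ‖X‖ < 1 := by
    have := (ENNReal.toReal_le_toReal (by simp) (by simp)).2 h1
    simp at this
    linarith
  have := (Units.oneSub (-X) (by simpa using h2)).isUnit
  simpa using this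

theorem tendsto_geometric_inverse {U : S → S → ℝ} (hU : ∀ s t, 1 ≤ U s t) {X : MatOp S}
    (hX : opSchur U X ≤ 2⁻¹) :
    Tendsto (fun n => ∑ i ∈ Finset.range n, (-X) ^ i) atTop (𝓝 (Ring.inverse (1 + X))) := by
  have h1 : ‖X‖ₑ ≤ 2⁻¹ := (enorm_le_opSchur hU X).trans hX
  have h2 : ‖-X‖ < 1 := by
    have := (ENNReal.toReal_le_toReal (by simp) (by simp)).2 h1
    simp at this
    rw [norm_neg]
    linarith
  have h3 : Ring.inverse (1 + X) = ∑' n, (-X) ^ n := by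
    have := NormedRing.inverse_one_sub (-X) h2
    rw [sub_neg_eq_add] at this
    rw [this]
    rfl
  rw [h3]
  exact (summable_geometric_of_norm_lt_one h2).hasSum.tendsto_sum_nat

/-- The truncated Neumann series satisfies s_{n+1} = 1 - X s_n, so the bound 2 = 1 + 2⁻¹ · 2
propagates and survives in the limit. -/
theorem opSchur_inverse_one_add_le {U : S → S → ℝ} (hU : ∀ s t, 1 ≤ U s t)
    (hd : ∀ s, U s s ≤ 1) (hm : ∀ s m t, U s t ≤ U s m * U m t) {X : MatOp S}
    (hX : opSchur U X ≤ 2⁻¹) : opSchur U (Ring.inverse (1 + X)) ≤ 2 := by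
  refine opSchur_le_of_tendsto (tendsto_geometric_inverse hU hX) fun n => ?_
  induction n with
  | zero => simp [opSchur, schur]
  | succ n ih =>
    rw [Finset.sum_range_succ']
    simp only [pow_succ', pow_zero]
    rw [← Finset.mul_sum]
    refine (opSchur_add_le _ _ _).trans ?_
    calc _ ≤ opSchur U (-X) * opSchur U (∑ i ∈ Finset.range n, (-X) ^ i) + 1 :=
          add_le_add (opSchur_mul_le (fun s t => zero_le_one.trans (hU s t)) hm _ _)
            (opSchur_one_le hd)
      _ ≤ 2⁻¹ * 2 + 1 := by rw [opSchur_neg]; gcongr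
      _ = 2 := by rw [ENNReal.inv_mul_cancel (by simp) (by simp)]; norm_num

end Matrices

end

noncomputable section

open scoped ENNReal
open Filter Topology

section Step

variable {S : Type*} [DecidableEq S]

/-! ### Two-point bounds -/

/-- Schur bounds for two operators and for their difference; `h` is the distance of the
parameters that the operators belong to. -/
structure PairBound (U : S → S → ℝ) (h a : ℝ≥0∞) (A A' : MatOp S) : Prop where
  left : opSchur U A ≤ a
  right : opSchur U A' ≤ a
  diff : opSchur U (A - A') ≤ a * h

/-- The compatibility conditions on the weights `U` of perturbations and `Z` of transformations. -/
structure WeightPair (U Z : S → S → ℝ) : Prop where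
  one_le : ∀ s t, 1 ≤ Z s t
  diag : ∀ s, Z s s ≤ 1
  mul : ∀ s m t, Z s t ≤ Z s m * Z m t
  le : ∀ s t, Z s t ≤ U s t
  mul_left : ∀ s m t, U s t ≤ Z s m * U m t
  mul_right : ∀ s m t, U s t ≤ U s m * Z m t

theorem PairBound.mono {U V : S → S → ℝ} {h a b : ℝ≥0∞} {A A' : MatOp S}
    (hA : PairBound V h a A A') (hUV : ∀ s t, U s t ≤ V s t) (hab : a ≤ b) :
    PairBound U h b A A' :=
  ⟨(opSchur_mono hUV A).trans (hA.left.trans hab), (opSchur_mono hUV A').trans (hA.right.trans hab),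
    (opSchur_mono hUV _).trans (hA.diff.trans (by gcongr))⟩

theorem PairBound.sub {U : S → S → ℝ} {h a b : ℝ≥0∞} {A A' B B' : MatOp S}
    (hA : PairBound U h a A A') (hB : PairBound U h b B B') :
    PairBound U h (a + b) (A - B) (A' - B') := by
  refine ⟨(opSchur_sub_le _ _ _).trans (add_le_add hA.left hB.left),
    (opSchur_sub_le _ _ _).trans (add_le_add hA.right hB.right), ?_⟩
  have : A - B - (A' - B') = (A - A') - (B - B') := by abel
  rw [this, add_mul]
  exact (opSchur_sub_le _ _ _).trans (add_le_add hA.diff hB.diff)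

/-- The factor 2 is needed only for the difference: AB - A'B' = (A - A')B + A'(B - B') has two
terms, each of size a b h. -/
theorem PairBound.mul {U V W : S → S → ℝ} (hV : ∀ s t, 0 ≤ V s t)
    (hm : ∀ s m t, U s t ≤ V s m * W m t) {h a b : ℝ≥0∞} {A A' B B' : MatOp S}
    (hA : PairBound V h a A A') (hB : PairBound W h b B B') :
    PairBound U h (2 * (a * b)) (A * B) (A' * B') := by
  have h2 : a * b ≤ 2 * (a * b) := le_mul_of_one_le_left (by simp) (by norm_num)
  refine ⟨((opSchur_mul_le hV hm A B).trans ?_).trans h2,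
    ((opSchur_mul_le hV hm A' B').trans ?_).trans h2, ?_⟩
  · gcongr
    exacts [hA.left, hB.left]
  · gcongr
    exacts [hA.right, hB.right]
  · have : A * B - A' * B' = (A - A') * B + A' * (B - B') := by noncomm_ring
    rw [this]
    calc _ ≤ opSchur V (A - A') * opSchur W B + opSchur V A' * opSchur W (B - B') :=
          (opSchur_add_le _ _ _).trans
            (add_le_add (opSchur_mul_le hV hm _ _) (opSchur_mul_le hV hm _ _))
      _ ≤ (a * h) * b + a * (b * h) := by
          gcongr
          exacts [hA.diff, hB.left, hA.right, hB.diff]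
      _ = _ := by ring

/-- The difference is controlled by the resolvent identity: both inverses are at most 2 and x ≤ 2⁻¹,
giving 2 · (2⁻¹ h) · 2 = 2h. -/
theorem PairBound.inverse_one_add {U Z : S → S → ℝ} (hw : WeightPair U Z) {h x : ℝ≥0∞}
    {X X' : MatOp S} (hX : PairBound Z h x X X') (hx : x ≤ 2⁻¹) :
    PairBound Z h 2 (Ring.inverse (1 + X)) (Ring.inverse (1 + X')) := by
  have hZ : ∀ s t, 0 ≤ Z s t := fun s t => zero_le_one.trans (hw.one_le s t)
  have h1 := opSchur_inverse_one_add_le hw.one_le hw.diag hw.mul (hX.left.trans hx)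
  have h2 := opSchur_inverse_one_add_le hw.one_le hw.diag hw.mul (hX.right.trans hx)
  refine ⟨h1, h2, ?_⟩
  have u1 := isUnit_one_add hw.one_le (hX.left.trans hx)
  have u2 := isUnit_one_add hw.one_le (hX.right.trans hx)
  have key : Ring.inverse (1 + X) - Ring.inverse (1 + X') =
      -(Ring.inverse (1 + X) * (X - X') * Ring.inverse (1 + X')) := by
    have e1 := Ring.inverse_mul_cancel _ u1
    have e2 := Ring.mul_inverse_cancel _ u2
    calc _ = Ring.inverse (1 + X) * ((1 + X') * Ring.inverse (1 + X')) -
          (Ring.inverse (1 + X) * (1 + X)) * Ring.inverse (1 + X') := by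
            rw [e1, e2, mul_one, one_mul]
      _ = _ := by noncomm_ring
  rw [key, opSchur_neg]
  calc _ ≤ opSchur Z (Ring.inverse (1 + X)) * opSchur Z (X - X') *
        opSchur Z (Ring.inverse (1 + X')) :=
        (opSchur_mul_le hZ hw.mul _ _).trans (by gcongr; exact opSchur_mul_le hZ hw.mul _ _)
    _ ≤ 2 * (2⁻¹ * h) * 2 := by
        gcongr
        exact hX.diff.trans (by gcongr)
    _ = 2 * h := by
        rw [← mul_assoc 2 2⁻¹ h, ENNReal.mul_inv_cancel (by simp) (by simp), one_mul, mul_comm]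

/-- Entrywise multiplication by a matrix of divisors. -/
theorem PairBound.ofEntries {U V : S → S → ℝ} (hU : ∀ s t, 1 ≤ U s t) {h r K : ℝ≥0∞}
    {R R' : MatOp S} (hR : PairBound V h r R R') (hr : r ≠ ∞) (hK : K ≠ ∞) {g g' : S → S → ℂ}
    (hg : ∀ s t, ‖g s t‖ₑ * ENNReal.ofReal (U s t) ≤ K * ENNReal.ofReal (V s t))
    (hg' : ∀ s t, ‖g' s t‖ₑ * ENNReal.ofReal (U s t) ≤ K * ENNReal.ofReal (V s t))
    (hgg' : ∀ s t, ‖g s t - g' s t‖ₑ * ENNReal.ofReal (U s t) ≤ K * h * ENNReal.ofReal (V s t)) :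
    (∀ s t, entry (ofEntries fun s t => entry R s t * g s t) s t = entry R s t * g s t) ∧
    (∀ s t, entry (ofEntries fun s t => entry R' s t * g' s t) s t = entry R' s t * g' s t) ∧
    PairBound U h (2 * (K * r)) (ofEntries fun s t => entry R s t * g s t)
      (ofEntries fun s t => entry R' s t * g' s t) := by
  have b1 : schur U (fun s t => entry R s t * g s t) ≤ K * r := by
    refine (schur_le_of_entry_le (V := V) (b := entry R) (c := K) fun s t => ?_).trans
      (by gcongr; exact hR.left)
    rw [enorm_mul, mul_assoc]
    exact (mul_le_mul_right (hg s t) _).trans_eq (mul_left_comm _ _ _)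
  have b2 : schur U (fun s t => entry R' s t * g' s t) ≤ K * r := by
    refine (schur_le_of_entry_le (V := V) (b := entry R') (c := K) fun s t => ?_).trans
      (by gcongr; exact hR.right)
    rw [enorm_mul, mul_assoc]
    exact (mul_le_mul_right (hg' s t) _).trans_eq (mul_left_comm _ _ _)
  have e1 := entry_ofEntries hU (ne_top_of_le_ne_top (ENNReal.mul_ne_top hK hr) b1)
  have e2 := entry_ofEntries hU (ne_top_of_le_ne_top (ENNReal.mul_ne_top hK hr) b2)
  have h2 : K * r ≤ 2 * (K * r) := le_mul_of_one_le_left (by simp) (by norm_num)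
  refine ⟨e1, e2, ?_, ?_, ?_⟩
  · unfold opSchur
    rw [show entry (_root_.ofEntries fun s t => entry R s t * g s t) = _ from
      funext fun s => funext fun t => e1 s t]
    exact b1.trans h2
  · unfold opSchur
    rw [show entry (_root_.ofEntries fun s t => entry R' s t * g' s t) = _ from
      funext fun s => funext fun t => e2 s t]
    exact b2.trans h2
  · unfold opSchur
    have : entry ((_root_.ofEntries fun s t => entry R s t * g s t) -
        _root_.ofEntries fun s t => entry R' s t * g' s t) =
        fun s t => entry (R - R') s t * g s t + entry R' s t * (g s t - g' s t) := by
      funext s t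
      rw [entry_sub, e1, e2, entry_sub]
      ring
    rw [this]
    refine (schur_add_le _ _ _).trans ?_
    have c1 : schur U (fun s t => entry (R - R') s t * g s t) ≤ K * (r * h) := by
      refine (schur_le_of_entry_le (V := V) (b := entry (R - R')) (c := K) fun s t => ?_).trans
        (by gcongr; exact hR.diff)
      rw [enorm_mul, mul_assoc]
      exact (mul_le_mul_right (hg s t) _).trans_eq (mul_left_comm _ _ _)
    have c2 : schur U (fun s t => entry R' s t * (g s t - g' s t)) ≤ K * h * r := by
      refine (schur_le_of_entry_le (V := V) (b := entry R') (c := K * h) fun s t => ?_).trans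
        (by gcongr; exact hR.right)
      rw [enorm_mul, mul_assoc]
      exact (mul_le_mul_right (hgg' s t) _).trans_eq (mul_left_comm _ _ _)
    refine (add_le_add c1 c2).trans (le_of_eq ?_)
    ring

/-! ### One step of the diagonalization scheme -/

/-- The diagonal part. -/
def diagPart (R : MatOp S) : MatOp S := ofEntries fun s t => entry R s t * if s = t then 1 else 0

/-- The solution `X` of the homological equation `[E, X] + R = diag R`. -/
def homSol (E : S → ℂ) (R : MatOp S) : MatOp S :=
  ofEntries fun s t => entry R s t * if s = t then 0 else -(E s - E t)⁻¹

/-- The perturbation after conjugation with `1 + X`. -/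
def nextPert (E : S → ℂ) (R : MatOp S) : MatOp S :=
  Ring.inverse (1 + homSol E R) * (R * homSol E R - homSol E R * diagPart R)

/-- The diagonal after one step. -/
def nextDiag (E : S → ℂ) (R : MatOp S) (s : S) : ℂ := E s + entry R s s

/-- `A` conjugates `E + R` to `E' + R'`, where `E` and `E'` are (unbounded) diagonal matrices. -/
def Intertwines (E : S → ℂ) (R A : MatOp S) (E' : S → ℂ) (R' : MatOp S) : Prop :=
  ∀ s t, E s * entry A s t + entry (R * A) s t = entry A s t * E' t + entry (A * R') s t

/-- The diagonals are unbounded and are not operators on `ℓ¹`, so associativity is not available for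
A E' B. Instead the sum over the middle index of A E' B is evaluated twice, from the relation for A
and from the relation for B; each evaluation also proves its convergence. -/
theorem Intertwines.trans {E E' E'' : S → ℂ} {R R' R'' A B : MatOp S}
    (hA : Intertwines E R A E' R') (hB : Intertwines E' R' B E'' R'') :
    Intertwines E R (A * B) E'' R'' := by
  intro s t
  have h1 : HasSum (fun m => entry A s m * (E' m * entry B m t))
      (E s * entry (A * B) s t - entry ((A * R' - R * A) * B) s t) := by
    have a1 := (hasSum_entry_mul A B s t).mul_left (E s)
    have a2 := hasSum_entry_mul (A * R' - R * A) B s t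
    refine (a1.sub a2).congr_fun ?_ |> fun h => h
    intro m
    have := hA s m
    rw [entry_sub]
    linear_combination (-entry B m t) * this
  have h2 : HasSum (fun m => entry A s m * (E' m * entry B m t))
      (entry (A * B) s t * E'' t + entry (A * (B * R'' - R' * B)) s t) := by
    have a1 := (hasSum_entry_mul A B s t).mul_right (E'' t)
    have a2 := hasSum_entry_mul A (B * R'' - R' * B) s t
    refine (a1.add a2).congr_fun ?_ |> fun h => h
    intro m
    have := hB m t
    rw [entry_sub]
    linear_combination (entry A s m) * this
  have h3 := h1.unique h2
  have e1 : (A * R' - R * A) * B = A * (R' * B) - R * (A * B) := by noncomm_ring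
  have e2 : A * (B * R'' - R' * B) = A * B * R'' - A * (R' * B) := by noncomm_ring
  rw [e1, e2, entry_sub, entry_sub] at h3
  linear_combination h3

theorem intertwines_refl (E : S → ℂ) (R : MatOp S) : Intertwines E R 1 E R := by
  intro s t
  rw [mul_one, one_mul, entry_one]
  split_ifs with h
  · rw [h]; ring
  · ring

/-- With D the diagonal of R, the homological equation gives (E + R)(1 + X) = (1 + X)(E + D) + RX -
XD, and the last two terms are (1 + X) times the new perturbation. Divisors need to be nonzero only
where R has an entry, which the first step uses for equal Fourier indices. -/
theorem intertwines_step {E : S → ℂ} {R : MatOp S} (hu : IsUnit (1 + homSol E R))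
    (hE : ∀ s t, s ≠ t → entry R s t ≠ 0 → E s ≠ E t)
    (hX : ∀ s t, entry (homSol E R) s t = entry R s t * if s = t then 0 else -(E s - E t)⁻¹)
    (hD : ∀ s t, entry (diagPart R) s t = entry R s t * if s = t then 1 else 0) :
    Intertwines E R (1 + homSol E R) (nextDiag E R) (nextPert E R) := by
  intro s t
  have e1 : (1 + homSol E R) * nextPert E R = R * homSol E R - homSol E R * diagPart R := by
    rw [nextPert, ← mul_assoc, Ring.mul_inverse_cancel _ hu, one_mul]
  have e2 : entry (homSol E R * diagPart R) s t = entry (homSol E R) s t * entry R t t := by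
    refine (hasSum_entry_mul _ _ s t).unique ?_
    have : entry (homSol E R) s t * entry R t t =
        entry (homSol E R) s t * entry (diagPart R) t t := by rw [hD]; simp
    rw [this]
    refine hasSum_single t fun m hm => ?_
    rw [hD, if_neg hm]
    simp
  rw [e1, mul_add, mul_one, entry_add, entry_add, entry_sub, e2, entry_one, hX, nextDiag]
  split_ifs with h
  · subst h; ring
  · by_cases hR : entry R s t = 0
    · rw [hR]; ring
    · have := sub_ne_zero.2 (hE s t h hR)
      field_simp
      ring

theorem PairBound.diagPart {U : S → S → ℝ} (hU : ∀ s t, 1 ≤ U s t) {h r : ℝ≥0∞} {R R' : MatOp S}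
    (hR : PairBound U h r R R') (hr : r ≠ ∞) :
    (∀ s t, entry (diagPart R) s t = entry R s t * if s = t then 1 else 0) ∧
    PairBound U h (2 * r) (diagPart R) (diagPart R') := by
  have := PairBound.ofEntries hU hR hr (K := 1) (by simp)
    (g := fun s t => if s = t then 1 else 0) (g' := fun s t => if s = t then 1 else 0)
    (fun s t => by gcongr; split_ifs <;> simp) (fun s t => by gcongr; split_ifs <;> simp)
    (fun s t => by simp)
  refine ⟨this.1, ?_⟩
  have h := this.2.2
  rwa [one_mul] at h

/-- The constant is 24 = 2 · 2 · (2 + 4): 2 from RX, 4 from X times the diagonal part (itself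
bounded by 2r), and the outer factors from the product with the inverse, of size 2. -/
theorem PairBound.nextPert {U Z : S → S → ℝ} (hw : WeightPair U Z) {h r x : ℝ≥0∞}
    {E E' : S → ℂ} {R R' : MatOp S} (hR : PairBound U h r R R') (hr : r ≠ ∞) (hx : x ≤ 2⁻¹)
    (hX : PairBound Z h x (homSol E R) (homSol E' R')) :
    PairBound U h (24 * (r * x)) (nextPert E R) (nextPert E' R') := by
  have hZ : ∀ s t, 0 ≤ Z s t := fun s t => zero_le_one.trans (hw.one_le s t)
  have hU1 : ∀ s t, 1 ≤ U s t := fun s t => (hw.one_le s t).trans (hw.le s t)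
  have hU : ∀ s t, 0 ≤ U s t := fun s t => zero_le_one.trans (hU1 s t)
  have hD := (PairBound.diagPart hU1 hR hr).2
  have h1 := (PairBound.mul hU hw.mul_right hR hX).sub (PairBound.mul hZ hw.mul_left hX hD)
  have h2 := PairBound.mul hZ hw.mul_left (PairBound.inverse_one_add hw hX hx) h1
  refine h2.mono (fun _ _ => le_rfl) (le_of_eq ?_)
  ring

/-! ### Symmetries of the scheme -/

/-- Equivariance of a matrix under a permutation `σ` of the indices and an automorphism `τ` of the
scalars, up to a sign `η`. -/
def Equivariant (σ : S ≃ S) (τ : ℂ →+* ℂ) (η : ℂ) (A : MatOp S) : Prop :=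
  ∀ s t, entry A (σ s) (σ t) = η * τ (entry A s t)

variable {σ : S ≃ S} {τ : ℂ →+* ℂ} {η : ℂ}

theorem equivariant_one : Equivariant σ τ 1 (1 : MatOp S) := by
  intro s t
  rw [entry_one, entry_one]
  simp only [σ.injective.eq_iff]
  split_ifs <;> simp

theorem Equivariant.add {A B : MatOp S} (hA : Equivariant σ τ η A) (hB : Equivariant σ τ η B) :
    Equivariant σ τ η (A + B) := fun s t => by
  rw [entry_add, entry_add, hA, hB, map_add, mul_add]

theorem Equivariant.neg {A : MatOp S} (hA : Equivariant σ τ η A) :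
    Equivariant σ τ η (-A) := fun s t => by
  rw [entry_neg, entry_neg, hA, map_neg, mul_neg]

theorem Equivariant.mul (hτ : Continuous τ) {η' : ℂ} {A B : MatOp S}
    (hA : Equivariant σ τ η A) (hB : Equivariant σ τ η' B) :
    Equivariant σ τ (η * η') (A * B) := by
  intro s t
  refine (hasSum_entry_mul A B (σ s) (σ t)).unique ?_
  rw [← σ.hasSum_iff]
  have h := ((hasSum_entry_mul A B s t).map τ hτ).mul_left (η * η')
  refine h.congr_fun ?_ |> fun h => h
  intro m
  simp only [Function.comp, hA s m, hB m t, map_mul]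
  ring

theorem Equivariant.of_tendsto (hτ : Continuous τ) {A : ℕ → MatOp S} {B : MatOp S}
    (hA : Tendsto A atTop (𝓝 B)) (h : ∀ n, Equivariant σ τ η (A n)) : Equivariant σ τ η B := by
  intro s t
  have h1 := ((continuous_entry (σ s) (σ t)).tendsto B).comp hA
  have h2 := ((hτ.tendsto _).comp (((continuous_entry s t).tendsto B).comp hA)).const_mul η
  refine tendsto_nhds_unique h1 (h2.congr fun n => ?_)
  exact (h n s t).symm

theorem Equivariant.inverse_one_add (hτ : Continuous τ) {U : S → S → ℝ} (hU : ∀ s t, 1 ≤ U s t)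
    {X : MatOp S} (hX : opSchur U X ≤ 2⁻¹) (h : Equivariant σ τ 1 X) :
    Equivariant σ τ 1 (Ring.inverse (1 + X)) := by
  refine Equivariant.of_tendsto hτ (tendsto_geometric_inverse hU hX) fun n => ?_
  induction n with
  | zero => intro s t; simp
  | succ n ih =>
    rw [Finset.sum_range_succ']
    simp only [pow_succ', pow_zero]
    rw [← Finset.mul_sum]
    refine Equivariant.add ?_ equivariant_one
    simpa using h.neg.mul hτ ih

/-- The perturbation and the divisor both carry the sign η, which cancels in their quotient.
Generators and transformations are therefore equivariant with sign 1. -/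
theorem Equivariant.homSol (hη : η * η = 1) {E : S → ℂ} {R : MatOp S} (hR : Equivariant σ τ η R)
    (hE : ∀ s t, E (σ s) - E (σ t) = η * τ (E s - E t))
    (hX : ∀ s t, entry (homSol E R) s t = entry R s t * if s = t then 0 else -(E s - E t)⁻¹) :
    Equivariant σ τ 1 (homSol E R) := by
  intro s t
  rw [hX, hX, hR, hE]
  simp only [σ.injective.eq_iff]
  have hi : η⁻¹ = η := inv_eq_of_mul_eq_one_left hη
  split_ifs
  · simp
  · rw [mul_inv, hi, map_mul, map_neg, map_inv₀]
    linear_combination (-τ (entry R s t) * (τ (E s - E t))⁻¹) * hη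

theorem Equivariant.diagPart {R : MatOp S} (hR : Equivariant σ τ η R)
    (hD : ∀ s t, entry (diagPart R) s t = entry R s t * if s = t then 1 else 0) :
    Equivariant σ τ η (diagPart R) := by
  intro s t
  rw [hD, hD, hR]
  simp only [σ.injective.eq_iff]
  split_ifs <;> simp

theorem Equivariant.nextPert (hτ : Continuous τ) (hη : η * η = 1)
    {U : S → S → ℝ} (hU : ∀ s t, 1 ≤ U s t) {E : S → ℂ} {R : MatOp S}
    (hR : Equivariant σ τ η R) (hE : ∀ s t, E (σ s) - E (σ t) = η * τ (E s - E t))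
    (hX : ∀ s t, entry (_root_.homSol E R) s t =
      entry R s t * if s = t then 0 else -(E s - E t)⁻¹)
    (hD : ∀ s t, entry (_root_.diagPart R) s t = entry R s t * if s = t then 1 else 0)
    (hXU : opSchur U (_root_.homSol E R) ≤ 2⁻¹) :
    Equivariant σ τ η (_root_.nextPert E R) := by
  have hXe := hR.homSol hη hE hX
  have h1 := hR.mul hτ hXe
  have h2 := (hXe.mul hτ (hR.diagPart hD)).neg
  rw [mul_one] at h1
  rw [one_mul] at h2
  have h3 := (hXe.inverse_one_add hτ hU hXU).mul hτ (h1.add h2)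
  rw [one_mul, ← sub_eq_add_neg] at h3
  exact h3

theorem nextDiag_equivariant {E : S → ℂ} {R : MatOp S} (hR : Equivariant σ τ η R)
    (hE : ∀ s t, E (σ s) - E (σ t) = η * τ (E s - E t)) (s t : S) :
    nextDiag E R (σ s) - nextDiag E R (σ t) = η * τ (nextDiag E R s - nextDiag E R t) := by
  have := hE s t
  simp only [nextDiag, hR s s, hR t t, map_sub, map_add] at this ⊢
  linear_combination this

end Step

end

noncomputable section

open scoped ENNReal
open Filter Topology

/-! ### Modes, frequencies and weights -/

/-- Signed modes: `(true, j)` and `(false, j)` index the two components of the phase space. -/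
abbrev SignedMode : Type := Bool × ℕ+

/-- Signed modes together with Fourier indices on the torus. -/
abbrev Mode (ν : ℕ) : Type := SignedMode × (Fin ν → ℤ)

variable {ν : ℕ}

/-- A Fourier index as a vector. -/
def freq (k : Fin ν → ℤ) : EuclideanSpace ℝ (Fin ν) := WithLp.toLp 2 fun a => (k a : ℝ)

theorem freq_add (k l : Fin ν → ℤ) : freq (k + l) = freq k + freq l := by
  ext a; simp [freq]

theorem freq_sub (k l : Fin ν → ℤ) : freq (k - l) = freq k - freq l := by
  ext a; simp [freq]

theorem freq_neg (k : Fin ν → ℤ) : freq (-k) = -freq k := by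
  ext a; simp [freq]

@[simp] theorem freq_zero : freq (0 : Fin ν → ℤ) = 0 := by
  ext a; simp [freq]

theorem abs_apply_le_norm_freq (k : Fin ν → ℤ) (a : Fin ν) : |(k a : ℝ)| ≤ ‖freq k‖ := by
  have := PiLp.norm_apply_le (freq k) a
  simpa [freq] using this

theorem one_le_norm_freq {k : Fin ν → ℤ} (hk : k ≠ 0) : 1 ≤ ‖freq k‖ := by
  obtain ⟨a, ha⟩ := Function.ne_iff.1 hk
  refine le_trans ?_ (abs_apply_le_norm_freq k a)
  exact_mod_cast Int.one_le_abs ha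

theorem norm_freq_sub_le (k l m : Fin ν → ℤ) :
    ‖freq (k - m)‖ ≤ ‖freq (k - l)‖ + ‖freq (l - m)‖ := by
  rw [← sub_add_sub_cancel k l m, freq_add]
  exact norm_add_le _ _

/-! ### Submultiplicative weights. -/

/-- The ratio of the sizes of two modes, at least `1`. -/
def modeRatio (i j : ℕ+) : ℝ := max (japanese i / japanese j) (japanese j / japanese i)

theorem one_le_modeRatio (i j : ℕ+) : 1 ≤ modeRatio i j := by
  have hi := japanese_pos i
  have hj := japanese_pos j
  rcases le_total (japanese i) (japanese j) with h | h
  · exact ((one_le_div hi).2 h).trans (le_max_right _ _)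
  · exact ((one_le_div hj).2 h).trans (le_max_left _ _)

theorem modeRatio_nonneg (i j : ℕ+) : 0 ≤ modeRatio i j := zero_le_one.trans (one_le_modeRatio i j)

theorem modeRatio_self (i : ℕ+) : modeRatio i i = 1 := by
  simp [modeRatio, div_self (japanese_pos i).ne']

theorem modeRatio_comm (i j : ℕ+) : modeRatio i j = modeRatio j i := max_comm _ _

theorem japanese_div_le_modeRatio (i j : ℕ+) : japanese i / japanese j ≤ modeRatio i j :=
  le_max_left _ _

theorem japanese_le_modeRatio_mul (i j : ℕ+) : japanese i ≤ modeRatio i j * japanese j :=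
  (div_le_iff₀ (japanese_pos j)).1 (japanese_div_le_modeRatio i j)

theorem modeRatio_le_mul (i m j : ℕ+) : modeRatio i j ≤ modeRatio i m * modeRatio m j := by
  have key : ∀ i j : ℕ+, japanese i / japanese j ≤ modeRatio i m * modeRatio m j := by
    intro i j
    rw [div_le_iff₀ (japanese_pos j), mul_assoc]
    exact (japanese_le_modeRatio_mul i m).trans
      (mul_le_mul_of_nonneg_left (japanese_le_modeRatio_mul m j) (modeRatio_nonneg _ _))
  refine max_le (key i j) ?_
  rw [mul_comm, modeRatio_comm m j, modeRatio_comm i m]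
  exact key j i

theorem modeRatio_le_max (i j : ℕ+) : modeRatio i j ≤ max (japanese i) (japanese j) :=
  max_le_max (div_le_self (japanese_pos i).le (one_le_japanese j))
    (div_le_self (japanese_pos j).le (one_le_japanese i))

/-- The weight of transformations. -/
def weightZ (q : ℕ) (σ : ℝ) (s t : Mode ν) : ℝ :=
  modeRatio s.1.2 t.1.2 ^ (q + 1) * exp (σ * ‖freq (s.2 - t.2)‖)

/-- The weight of perturbations of order `-1`. -/
def weightU (q : ℕ) (σ : ℝ) (s t : Mode ν) : ℝ :=
  modeRatio s.1.2 t.1.2 ^ q * max (japanese s.1.2) (japanese t.1.2) *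
    exp (σ * ‖freq (s.2 - t.2)‖)

theorem one_le_exp_weight {σ : ℝ} (hσ : 0 ≤ σ) (k : Fin ν → ℤ) : 1 ≤ exp (σ * ‖freq k‖) :=
  Real.one_le_exp (by positivity)

theorem exp_weight_le {σ : ℝ} (hσ : 0 ≤ σ) (k l m : Fin ν → ℤ) :
    exp (σ * ‖freq (k - m)‖) ≤ exp (σ * ‖freq (k - l)‖) * exp (σ * ‖freq (l - m)‖) := by
  rw [← Real.exp_add, ← mul_add]
  exact Real.exp_le_exp.2 (mul_le_mul_of_nonneg_left (norm_freq_sub_le k l m) hσ)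

/-- Moving the factor max(⟨i⟩,⟨j⟩) through a transformation costs one mode ratio; this is why
transformations carry the power q + 1 and perturbations only q. Since the ratio is at most the
maximum, the weight of perturbations still dominates that of transformations. -/
theorem weightPair (q : ℕ) {σ : ℝ} (hσ : 0 ≤ σ) :
    WeightPair (weightU (ν := ν) q σ) (weightZ q σ) where
  one_le s t := one_le_mul_of_one_le_of_one_le (one_le_pow₀ (one_le_modeRatio _ _))
    (one_le_exp_weight hσ _)
  diag s := by simp [weightZ, modeRatio_self]
  mul s m t := by
    unfold weightZ
    calc _ ≤ (modeRatio s.1.2 m.1.2 * modeRatio m.1.2 t.1.2) ^ (q + 1) *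
          (exp (σ * ‖freq (s.2 - m.2)‖) * exp (σ * ‖freq (m.2 - t.2)‖)) := by
          have h3 := modeRatio_nonneg s.1.2 t.1.2
          have h4 := modeRatio_nonneg s.1.2 m.1.2
          have h5 := modeRatio_nonneg m.1.2 t.1.2
          have h6 := (japanese_pos s.1.2).le.trans (le_max_left _ (japanese m.1.2))
          have h7 := (japanese_pos m.1.2).le.trans (le_max_left _ (japanese t.1.2))
          gcongr
          exacts [modeRatio_le_mul _ _ _, exp_weight_le hσ _ _ _]
      _ = _ := by ring
  le s t := by
    unfold weightZ weightU
    gcongr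
    rw [pow_succ]
    have := modeRatio_nonneg s.1.2 t.1.2
    gcongr
    exact modeRatio_le_max _ _
  mul_left s m t := by
    unfold weightZ weightU
    have h0 := modeRatio_nonneg s.1.2 m.1.2
    have h1 := modeRatio_nonneg m.1.2 t.1.2
    have hJ : 0 ≤ max (japanese s.1.2) (japanese t.1.2) :=
      (japanese_pos s.1.2).le.trans (le_max_left _ _)
    have h2 : max (japanese s.1.2) (japanese t.1.2) ≤
        modeRatio s.1.2 m.1.2 * max (japanese m.1.2) (japanese t.1.2) := by
      refine max_le ?_ ?_
      · exact (japanese_le_modeRatio_mul _ _).trans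
          (mul_le_mul_of_nonneg_left (le_max_left _ _) h0)
      · exact (le_max_right _ _).trans (le_mul_of_one_le_left
          ((japanese_pos m.1.2).le.trans (le_max_left _ _)) (one_le_modeRatio _ _))
    calc _ ≤ (modeRatio s.1.2 m.1.2 * modeRatio m.1.2 t.1.2) ^ q *
          (modeRatio s.1.2 m.1.2 * max (japanese m.1.2) (japanese t.1.2)) *
          (exp (σ * ‖freq (s.2 - m.2)‖) * exp (σ * ‖freq (m.2 - t.2)‖)) := by
          have h3 := modeRatio_nonneg s.1.2 t.1.2
          have h4 := modeRatio_nonneg s.1.2 m.1.2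
          have h5 := modeRatio_nonneg m.1.2 t.1.2
          have h6 := (japanese_pos s.1.2).le.trans (le_max_left _ (japanese m.1.2))
          have h7 := (japanese_pos m.1.2).le.trans (le_max_left _ (japanese t.1.2))
          gcongr
          exacts [modeRatio_le_mul _ _ _, exp_weight_le hσ _ _ _]
      _ = _ := by ring
  mul_right s m t := by
    unfold weightZ weightU
    have h0 := modeRatio_nonneg s.1.2 m.1.2
    have h1 := modeRatio_nonneg m.1.2 t.1.2
    have hJ : 0 ≤ max (japanese s.1.2) (japanese t.1.2) :=
      (japanese_pos s.1.2).le.trans (le_max_left _ _)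
    have h2 : max (japanese s.1.2) (japanese t.1.2) ≤
        max (japanese s.1.2) (japanese m.1.2) * modeRatio m.1.2 t.1.2 := by
      refine max_le ?_ ?_
      · exact (le_max_left _ _).trans (le_mul_of_one_le_right
          ((japanese_pos m.1.2).le.trans (le_max_right _ _)) (one_le_modeRatio _ _))
      · rw [mul_comm, modeRatio_comm]
        exact (japanese_le_modeRatio_mul _ _).trans
          (mul_le_mul_of_nonneg_left (le_max_right _ _) (modeRatio_nonneg _ _))
    calc _ ≤ (modeRatio s.1.2 m.1.2 * modeRatio m.1.2 t.1.2) ^ q *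
          (max (japanese s.1.2) (japanese m.1.2) * modeRatio m.1.2 t.1.2) *
          (exp (σ * ‖freq (s.2 - m.2)‖) * exp (σ * ‖freq (m.2 - t.2)‖)) := by
          have h3 := modeRatio_nonneg s.1.2 t.1.2
          have h4 := modeRatio_nonneg s.1.2 m.1.2
          have h5 := modeRatio_nonneg m.1.2 t.1.2
          have h6 := (japanese_pos s.1.2).le.trans (le_max_left _ (japanese m.1.2))
          have h7 := (japanese_pos m.1.2).le.trans (le_max_left _ (japanese t.1.2))
          gcongr
          exacts [modeRatio_le_mul _ _ _, exp_weight_le hσ _ _ _]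
      _ = _ := by ring

theorem weightZ_mono {q q' : ℕ} {σ σ' : ℝ} (hq : q ≤ q') (hσ : σ ≤ σ') (s t : Mode ν) :
    weightZ q σ s t ≤ weightZ q' σ' s t := by
  unfold weightZ
  have := one_le_modeRatio s.1.2 t.1.2
  gcongr

theorem weightU_mono {q q' : ℕ} {σ σ' : ℝ} (hq : q ≤ q') (hσ : σ ≤ σ') (s t : Mode ν) :
    weightU q σ s t ≤ weightU q' σ' s t := by
  unfold weightU
  have := one_le_modeRatio s.1.2 t.1.2
  have hJ : 0 ≤ max (japanese s.1.2) (japanese t.1.2) :=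
      (japanese_pos s.1.2).le.trans (le_max_left _ _)
  gcongr

theorem one_le_weightU (q : ℕ) {σ : ℝ} (hσ : 0 ≤ σ) (s t : Mode ν) : 1 ≤ weightU q σ s t :=
  ((weightPair q hσ).one_le s t).trans ((weightPair q hσ).le s t)

theorem weightU_self (q : ℕ) (σ : ℝ) (s : Mode ν) : weightU q σ s s = japanese s.1.2 := by
  simp [weightU, modeRatio_self]

/-- Diagonal entries of an operator of order `-1`. -/
theorem norm_diag_le {q : ℕ} {σ r : ℝ} (hr : 0 ≤ r) {R : MatOp (Mode ν)}
    (hR : opSchur (weightU q σ) R ≤ ENNReal.ofReal r) (s : Mode ν) :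
    ‖entry R s s‖ ≤ r / japanese s.1.2 := by
  have h := (enorm_mul_weight_le_schur (weightU q σ) (entry R) s s).trans hR
  rw [weightU_self, ← ofReal_norm, ← ENNReal.ofReal_mul (norm_nonneg _)] at h
  rw [le_div_iff₀ (japanese_pos _)]
  exact (ENNReal.ofReal_le_ofReal_iff hr).1 h

/-! ### The iteration -/

section Scheme

variable {S : Type*} [DecidableEq S]

/-- The sequence of diagonals and perturbations of the iteration. -/
def scheme (E : S → ℂ) (R : MatOp S) : ℕ → (S → ℂ) × MatOp S
  | 0 => (E, R)
  | n + 1 => (nextDiag (scheme E R n).1 (scheme E R n).2,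
      nextPert (scheme E R n).1 (scheme E R n).2)

/-- The generator of the `n`-th transformation. -/
def schemeSol (E : S → ℂ) (R : MatOp S) (n : ℕ) : MatOp S :=
  homSol (scheme E R n).1 (scheme E R n).2

/-- The composition of the first `n` transformations. -/
def schemeTransf (E : S → ℂ) (R : MatOp S) : ℕ → MatOp S
  | 0 => 1
  | n + 1 => schemeTransf E R n * (1 + schemeSol E R n)

/-- The `n`-th step of the iteration is regular: the homological equation is solved by a small
bounded operator. -/
structure RegularStep (Z : S → S → ℝ) (E : S → ℂ) (R : MatOp S) (x : ℝ≥0∞) (n : ℕ) : Prop where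
  div : ∀ s t, s ≠ t → (scheme E R n).1 s ≠ (scheme E R n).1 t
  sol : ∀ s t, entry (schemeSol E R n) s t = entry (scheme E R n).2 s t *
    if s = t then 0 else -((scheme E R n).1 s - (scheme E R n).1 t)⁻¹
  diag : ∀ s t, entry (diagPart (scheme E R n).2) s t =
    entry (scheme E R n).2 s t * if s = t then 1 else 0
  small : opSchur Z (schemeSol E R n) ≤ x
  half : x ≤ 2⁻¹

theorem RegularStep.intertwines {U Z : S → S → ℝ} (hw : WeightPair U Z) {E : S → ℂ} {R : MatOp S}
    {x : ℕ → ℝ≥0∞} {N : ℕ} (h : ∀ n < N, RegularStep Z E R (x n) n) :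
    Intertwines E R (schemeTransf E R N) (scheme E R N).1 (scheme E R N).2 := by
  induction N with
  | zero => exact intertwines_refl E R
  | succ N ih =>
    have hN := h N (Nat.lt_succ_self N)
    refine (ih fun n hn => h n (hn.trans (Nat.lt_succ_self N))).trans ?_
    exact intertwines_step (isUnit_one_add hw.one_le (hN.small.trans hN.half))
      (fun s t hst _ => hN.div s t hst) hN.sol hN.diag

/-- While twice the partial sum stays below 1, the product so far is within 1 of the identity, so
the next factor adds at most 2 x_N to the distance. -/
theorem RegularStep.opSchur_transf_sub_one_le {U Z : S → S → ℝ} (hw : WeightPair U Z) {E : S → ℂ}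
    {R : MatOp S} {x : ℕ → ℝ≥0∞} {N : ℕ} (h : ∀ n < N, RegularStep Z E R (x n) n)
    (hx : ∑ n ∈ Finset.range N, x n ≤ 2⁻¹) :
    opSchur Z (schemeTransf E R N - 1) ≤ 2 * ∑ n ∈ Finset.range N, x n := by
  induction N with
  | zero => simp [schemeTransf, opSchur, schur]
  | succ N ih =>
    have hN := h N (Nat.lt_succ_self N)
    have hZ : ∀ s t, 0 ≤ Z s t := fun s t => zero_le_one.trans (hw.one_le s t)
    rw [Finset.sum_range_succ] at hx ⊢
    have ih' := ih (fun n hn => h n (hn.trans (Nat.lt_succ_self N))) ((self_le_add_right _ _).trans hx)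
    have e : schemeTransf E R (N + 1) - 1 = (schemeTransf E R N - 1) +
        ((schemeTransf E R N - 1) * schemeSol E R N + schemeSol E R N) := by
      simp only [schemeTransf]; noncomm_ring
    rw [e]
    have h1 : opSchur Z (schemeTransf E R N - 1) ≤ 1 := by
      refine ih'.trans ?_
      calc _ ≤ (2 : ℝ≥0∞) * 2⁻¹ := by gcongr; exact (self_le_add_right _ _).trans hx
        _ = 1 := ENNReal.mul_inv_cancel (by simp) (by simp)
    calc _ ≤ 2 * ∑ n ∈ Finset.range N, x n + (1 * x N + x N) := by
          refine (opSchur_add_le _ _ _).trans (add_le_add ih' ?_)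
          refine (opSchur_add_le _ _ _).trans (add_le_add ?_ hN.small)
          refine (opSchur_mul_le hZ hw.mul _ _).trans ?_
          gcongr
          exact hN.small
      _ = _ := by ring

theorem RegularStep.equivariant {Z : S → S → ℝ} {U : S → S → ℝ} (hw : WeightPair U Z)
    {E : S → ℂ} {R : MatOp S} {x : ℕ → ℝ≥0∞} {σ : S ≃ S} {τ : ℂ →+* ℂ} {η : ℂ}
    (hτ : Continuous τ) (hη : η * η = 1) (hR : Equivariant σ τ η R)
    (hE : ∀ s t, E (σ s) - E (σ t) = η * τ (E s - E t)) {N : ℕ}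
    (h : ∀ n < N, RegularStep Z E R (x n) n) :
    Equivariant σ τ η (scheme E R N).2 ∧ Equivariant σ τ 1 (schemeTransf E R N) ∧
      ∀ s t, (scheme E R N).1 (σ s) - (scheme E R N).1 (σ t) =
        η * τ ((scheme E R N).1 s - (scheme E R N).1 t) := by
  induction N with
  | zero => exact ⟨hR, equivariant_one, hE⟩
  | succ N ih =>
    have hN := h N (Nat.lt_succ_self N)
    obtain ⟨h1, h2, h3⟩ := ih fun n hn => h n (hn.trans (Nat.lt_succ_self N))
    refine ⟨?_, ?_, ?_⟩
    · exact h1.nextPert hτ hη hw.one_le h3 hN.sol hN.diag (hN.small.trans hN.half)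
    · have := h2.mul hτ (equivariant_one.add (h1.homSol hη h3 hN.sol))
      rwa [one_mul] at this
    · exact nextDiag_equivariant h1 h3

/-- Convergence of the iteration. -/
theorem exists_limit_transf {U Z : S → S → ℝ} (hw : WeightPair U Z) {E : S → ℂ} {R : MatOp S}
    {x : ℕ → ℝ≥0∞} (h : ∀ n, RegularStep Z E R (x n) n) {c : ℝ≥0∞} (hx : ∑' n, x n ≤ c)
    (hc : c ≤ 2⁻¹) (hR : Tendsto (fun n => (scheme E R n).2) atTop (𝓝 0)) {E' : S → ℂ}
    (hE' : ∀ s, Tendsto (fun n => (scheme E R n).1 s) atTop (𝓝 (E' s))) :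
    ∃ T : MatOp S, Tendsto (schemeTransf E R) atTop (𝓝 T) ∧ Intertwines E R T E' 0 ∧
      opSchur Z (T - 1) ≤ 2 * c := by
  have hsum : ∀ N, ∑ n ∈ Finset.range N, x n ≤ c := fun N => (ENNReal.sum_le_tsum _).trans hx
  have hb : ∀ N, opSchur Z (schemeTransf E R N - 1) ≤ 2 * c := fun N =>
    (RegularStep.opSchur_transf_sub_one_le hw (fun n _ => h n) ((hsum N).trans hc)).trans
      (by gcongr; exact hsum N)
  have hle : ∀ N, ‖schemeTransf E R N‖ ≤ 2 := by
    intro N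
    have h1 : ‖schemeTransf E R N - 1‖ₑ ≤ 1 :=
      ((enorm_le_opSchur hw.one_le _).trans (hb N)).trans (by
        calc (2 : ℝ≥0∞) * c ≤ 2 * 2⁻¹ := by gcongr
          _ = 1 := ENNReal.mul_inv_cancel (by simp) (by simp))
    have h2 : ‖schemeTransf E R N - 1‖ ≤ 1 := by
      have := (ENNReal.toReal_le_toReal (by simp) (by simp)).2 h1
      simpa using this
    have h3 : ‖(1 : MatOp S)‖ ≤ 1 := ContinuousLinearMap.norm_id_le
    calc _ = ‖(schemeTransf E R N - 1) + 1‖ := by rw [sub_add_cancel]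
      _ ≤ 1 + 1 := (norm_add_le _ _).trans (add_le_add h2 h3)
      _ = 2 := by norm_num
  have hsx : Summable fun n => (x n).toReal :=
    ENNReal.summable_toReal (ne_top_of_le_ne_top (by simp) (hx.trans hc))
  have hdist : ∀ n, dist (schemeTransf E R n) (schemeTransf E R (n + 1)) ≤ 2 * (x n).toReal := by
    intro n
    have e : schemeTransf E R (n + 1) - schemeTransf E R n =
        schemeTransf E R n * schemeSol E R n := by simp only [schemeTransf]; noncomm_ring
    rw [dist_comm, dist_eq_norm, e]
    refine (norm_mul_le _ _).trans (mul_le_mul (hle n) ?_ (norm_nonneg _) (by norm_num))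
    have h1 := (enorm_le_opSchur hw.one_le _).trans (h n).small
    have := (ENNReal.toReal_le_toReal (by simp)
      (ne_top_of_le_ne_top (by simp) (h n).half)).2 h1
    simpa using this
  obtain ⟨T, hT⟩ := cauchySeq_tendsto_of_complete
    (cauchySeq_of_dist_le_of_summable _ hdist (hsx.mul_left 2))
  refine ⟨T, hT, ?_, opSchur_le_of_tendsto (hT.sub_const 1) hb⟩
  -- Each entry of the relation involves one value of each diagonal and entries of bounded operators
  -- only, so it passes to the limit although the diagonals are unbounded in the index.
  intro s t
  have c1 := ((continuous_entry s t).tendsto T).comp hT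
  have c2 := ((continuous_entry s t).tendsto _).comp (hT.const_mul R)
  have c3 := ((continuous_entry s t).tendsto _).comp (hT.mul hR)
  refine tendsto_nhds_unique ((c1.const_mul (E s)).add c2)
    (((c1.mul (hE' t)).add c3).congr fun N => ?_)
  exact (RegularStep.intertwines hw (fun n (_ : n < N) => h n) s t).symm

end Scheme

end

noncomputable section

open scoped ENNReal
open Filter Topology

variable {ν : ℕ}

/-! ### Small divisors -/

/-- The constant in `(1 + x)^p ≤ C e^{c x}`, for `c ≤ b`. -/
def expLoss (p : ℕ) (b c : ℝ) : ℝ := p.factorial * exp b / c ^ p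

/-- This is t^p / p! ≤ e^t at t = c(1 + x). It is how powers of |k| from small divisors are paid for
by a loss c of analyticity. -/
theorem one_add_pow_le_expLoss (p : ℕ) {b c x : ℝ} (hc : 0 < c) (hc1 : c ≤ b) (hx : 0 ≤ x) :
    (1 + x) ^ p ≤ expLoss p b c * exp (c * x) := by
  have h := Real.pow_div_factorial_le_exp (c * (1 + x)) (by positivity) p
  rw [div_le_iff₀ (by positivity), mul_pow] at h
  have h2 : exp (c * (1 + x)) ≤ exp b * exp (c * x) := by
    rw [← Real.exp_add]
    exact Real.exp_le_exp.2 (by linarith)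
  rw [expLoss, div_mul_eq_mul_div, le_div_iff₀ (by positivity)]
  calc (1 + x) ^ p * c ^ p = c ^ p * (1 + x) ^ p := mul_comm _ _
    _ ≤ exp (c * (1 + x)) * p.factorial := h
    _ ≤ exp b * exp (c * x) * p.factorial := by gcongr
    _ = _ := by ring

/-- The divisors of the homological equation. -/
def divisor {S : Type*} [DecidableEq S] (E : S → ℂ) (s t : S) : ℂ :=
  if s = t then 0 else -(E s - E t)⁻¹

theorem enorm_mul_ofReal_le {z : ℂ} {u v K : ℝ} (hK : 0 ≤ K) (h : ‖z‖ * u ≤ K * v) :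
    ‖z‖ₑ * ENNReal.ofReal u ≤ ENNReal.ofReal K * ENNReal.ofReal v := by
  rw [← ofReal_norm, ← ENNReal.ofReal_mul (norm_nonneg _), ← ENNReal.ofReal_mul hK]
  exact ENNReal.ofReal_le_ofReal h

section

variable {S : Type*} [DecidableEq S]

theorem norm_divisor_le {E : S → ℂ} {s t : S} {a : ℝ} (ha : 0 ≤ a)
    (h : s ≠ t → 1 ≤ a * ‖E s - E t‖) : ‖divisor E s t‖ ≤ a := by
  unfold divisor
  split_ifs with hst
  · simpa using ha
  · have h1 := h hst
    have : 0 < ‖E s - E t‖ := by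
      rcases (norm_nonneg (E s - E t)).eq_or_lt with h0 | h0
      · rw [← h0] at h1; norm_num at h1
      · exact h0
    rw [norm_neg, norm_inv, inv_le_iff_one_le_mul₀ this]
    exact h1

theorem norm_divisor_sub_le {E E' : S → ℂ} {s t : S} {a b h : ℝ} (ha : 0 ≤ a) (hb : 0 ≤ b)
    (hh : 0 ≤ h) (h1 : s ≠ t → 1 ≤ a * ‖E s - E t‖) (h2 : s ≠ t → 1 ≤ a * ‖E' s - E' t‖)
    (h3 : ‖(E s - E t) - (E' s - E' t)‖ ≤ b * h) :
    ‖divisor E s t - divisor E' s t‖ ≤ a ^ 2 * b * h := by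
  by_cases hst : s = t
  · simp only [divisor, if_pos hst, sub_self, norm_zero]; positivity
  · have c1 := norm_divisor_le ha h1
    have c2 := norm_divisor_le ha h2
    have d1 : E s - E t ≠ 0 := by
      intro h0; have := h1 hst; rw [h0] at this; norm_num at this
    have d2 : E' s - E' t ≠ 0 := by
      intro h0; have := h2 hst; rw [h0] at this; norm_num at this
    have e : divisor E s t - divisor E' s t =
        divisor E s t * divisor E' s t * ((E s - E t) - (E' s - E' t)) := by
      simp only [divisor, if_neg hst]
      field_simp
      ring
    rw [e, norm_mul, norm_mul]
    calc _ ≤ a * a * (b * h) := by gcongr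
      _ = _ := by ring

end

theorem exists_one_le_exp_split {σ σ' c x : ℝ} (h : σ' + c ≤ σ) (hx : 0 ≤ x) :
    exp (c * x) * exp (σ' * x) ≤ exp (σ * x) := by
  rw [← Real.exp_add, ← add_mul]
  refine Real.exp_le_exp.2 ?_
  rw [add_comm]
  gcongr

/-- Bounds on the divisors in terms of the weights, with a loss of analyticity. -/
theorem divisor_weight_bound {q m : ℕ} {σ σ' b c δ h : ℝ} (hc : 0 < c) (hc1 : c ≤ b)
    (hσ : σ' + c ≤ σ) (hδ : 0 < δ) (hδ1 : δ ≤ 1) (hh : 0 ≤ h) {E E' : Mode ν → ℂ}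
    (h1 : ∀ s t, s ≠ t → δ / (1 + ‖freq (s.2 - t.2)‖) ^ m ≤ ‖E s - E t‖)
    (h2 : ∀ s t, s ≠ t → δ / (1 + ‖freq (s.2 - t.2)‖) ^ m ≤ ‖E' s - E' t‖)
    (h3 : ∀ s t, ‖(E s - E t) - (E' s - E' t)‖ ≤ (1 + ‖freq (s.2 - t.2)‖) * h) (s t : Mode ν) :
    ‖divisor E s t‖ₑ * ENNReal.ofReal (weightU q σ' s t) ≤
      ENNReal.ofReal (δ⁻¹ ^ 2 * expLoss (2 * m + 1) b c) * ENNReal.ofReal (weightU q σ s t) ∧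
    ‖divisor E s t - divisor E' s t‖ₑ * ENNReal.ofReal (weightU q σ' s t) ≤
      ENNReal.ofReal (δ⁻¹ ^ 2 * expLoss (2 * m + 1) b c) * ENNReal.ofReal h *
        ENNReal.ofReal (weightU q σ s t) := by
  set x := ‖freq (s.2 - t.2)‖ with hx
  have hx0 : 0 ≤ x := norm_nonneg _
  set a := δ⁻¹ * (1 + x) ^ m with ha
  have ha0 : 0 ≤ a := by positivity
  have hL : 0 ≤ expLoss (2 * m + 1) b c := by unfold expLoss; positivity
  have conv : ∀ z : ℝ, δ / (1 + x) ^ m ≤ z → 1 ≤ a * z := by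
    intro z hz
    rw [div_le_iff₀ (by positivity)] at hz
    rw [ha, mul_assoc, inv_mul_eq_div, le_div_iff₀ hδ]
    linarith
  have a1 := norm_divisor_le ha0 fun hst => conv _ (h1 s t hst)
  have a2 := norm_divisor_sub_le ha0 (by positivity) hh (fun hst => conv _ (h1 s t hst))
    (fun hst => conv _ (h2 s t hst)) (h3 s t)
  -- The power 2m + 1 comes from the difference of two inverses: two divisors contribute 2m and the
  -- Lipschitz constant 1 + |k| of the divisor contributes one more.
  have hw : (1 + x) ^ (2 * m + 1) * weightU q σ' s t ≤
      expLoss (2 * m + 1) b c * weightU q σ s t := by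
    unfold weightU
    rw [← hx]
    have hJ : 0 ≤ max (japanese s.1.2) (japanese t.1.2) :=
      (japanese_pos s.1.2).le.trans (le_max_left _ _)
    have := modeRatio_nonneg s.1.2 t.1.2
    calc _ ≤ (expLoss (2 * m + 1) b c * exp (c * x)) * (modeRatio s.1.2 t.1.2 ^ q *
          max (japanese s.1.2) (japanese t.1.2) * exp (σ' * x)) := by
          gcongr
          exact one_add_pow_le_expLoss _ hc hc1 hx0
      _ = expLoss (2 * m + 1) b c * (modeRatio s.1.2 t.1.2 ^ q *
          max (japanese s.1.2) (japanese t.1.2) * (exp (c * x) * exp (σ' * x))) := by ring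
      _ ≤ _ := by
          gcongr
          exact exists_one_le_exp_split hσ hx0
  have hU0 : 0 ≤ weightU q σ' s t := by
    unfold weightU
    have hJ : 0 ≤ max (japanese s.1.2) (japanese t.1.2) :=
      (japanese_pos s.1.2).le.trans (le_max_left _ _)
    have := modeRatio_nonneg s.1.2 t.1.2
    positivity
  -- Because δ⁻¹ ≥ 1, the bound on a single divisor is absorbed into the quadratic one and both
  -- estimates share a constant.
  have hδ' : 1 ≤ δ⁻¹ := (one_le_inv₀ hδ).2 hδ1
  constructor
  · refine enorm_mul_ofReal_le (by positivity) ?_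
    calc _ ≤ δ⁻¹ ^ 2 * (1 + x) ^ (2 * m + 1) * weightU q σ' s t := by
          gcongr
          refine a1.trans ?_
          rw [ha]
          have : (1 + x) ^ m ≤ (1 + x) ^ (2 * m + 1) :=
            pow_le_pow_right₀ (by linarith) (by omega)
          gcongr
          exact le_self_pow₀ hδ' (by norm_num)
      _ ≤ _ := by
          rw [mul_assoc, mul_assoc]
          gcongr
  · rw [← ENNReal.ofReal_mul (by positivity)]
    refine enorm_mul_ofReal_le (by positivity) ?_
    calc _ ≤ (a ^ 2 * (1 + x) * h) * weightU q σ' s t := by gcongr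
      _ = δ⁻¹ ^ 2 * h * ((1 + x) ^ (2 * m + 1) * weightU q σ' s t) := by rw [ha]; ring
      _ ≤ δ⁻¹ ^ 2 * h * (expLoss (2 * m + 1) b c * weightU q σ s t) := by gcongr
      _ = _ := by ring

/-! ### Translations of the Fourier index -/

/-- Translation of the Fourier index. -/
def shiftMode (l : Fin ν → ℤ) : Mode ν ≃ Mode ν := (Equiv.refl _).prodCongr (Equiv.addRight l)

@[simp] theorem shiftMode_apply (l : Fin ν → ℤ) (s : Mode ν) : shiftMode l s = (s.1, s.2 + l) := rfl

/-- Invariance under translations of the Fourier index. -/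
def ShiftInvariant (A : MatOp (Mode ν)) : Prop :=
  ∀ l, Equivariant (shiftMode l) (RingHom.id ℂ) 1 A

theorem ShiftInvariant.entry_eq {A : MatOp (Mode ν)} (hA : ShiftInvariant A) (i j : SignedMode)
    (k l : Fin ν → ℤ) : entry A (i, k) (j, l) = entry A (i, k - l) (j, 0) := by
  have := hA l (i, k - l) (j, 0)
  simpa using this

/-- The unperturbed diagonal `ω · k + λ_i`. -/
def freeDiag (lam : SignedMode → ℝ) (ω : EuclideanSpace ℝ (Fin ν)) (s : Mode ν) : ℂ :=
  ((inner ℝ ω (freq s.2) + lam s.1 : ℝ) : ℂ)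

/-! ### Parameters and inductive bounds of the KAM iteration. -/

/-- The widths of the strips of analyticity in the iteration. -/
def width (σ : ℝ) (n : ℕ) : ℝ := σ * (1 + (1 / 2) ^ n)

/-- The growth rate of the loss in the iteration. -/
def kamRate (m : ℕ) : ℝ := 2 ^ (2 * m + 3)

/-- The constant of the loss in the iteration. -/
def kamConst (m : ℕ) (σ γ : ℝ) : ℝ := γ⁻¹ ^ 2 * expLoss (2 * m + 1) σ (σ / 2)

/-- At step n the divisor constant γ 2^{-n} enters squared, giving 2^{2n}, and the loss of width
(σ/2) 2^{-n} enters with power 2m + 1. Together they give the growth 2^{(2m+3)n}. -/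
theorem kamConst_mul_pow (m n : ℕ) {σ γ : ℝ} :
    (γ / 2 ^ n)⁻¹ ^ 2 * expLoss (2 * m + 1) σ (σ / 2 * (1 / 2) ^ n) =
      kamConst m σ γ * kamRate m ^ n := by
  unfold kamConst kamRate expLoss
  have e : ((2 : ℝ) ^ (2 * m + 3)) ^ n = (2 ^ n) ^ 2 * (2 ^ n) ^ (2 * m + 1) := by
    rw [← pow_mul, ← pow_mul, ← pow_mul, ← pow_add]; congr 1; ring
  rw [e, inv_div, div_pow, mul_pow (σ / 2), one_div, inv_pow 2 n, inv_pow (2 ^ n),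
    inv_pow γ, div_mul_eq_div_div, div_inv_eq_mul]
  ring

/-- The size of the perturbation in the iteration. -/
def pertSize (m : ℕ) (ε : ℝ) (n : ℕ) : ℝ := ε / (2 * kamRate m) ^ n

/-- The size of the generators in the iteration. -/
def solSize (m : ℕ) (σ γ ε : ℝ) (n : ℕ) : ℝ := 2 * kamConst m σ γ * ε * (1 / 2) ^ n

theorem one_le_kamRate (m : ℕ) : 1 ≤ kamRate m := one_le_pow₀ (by norm_num)

theorem pertSize_succ_le (m : ℕ) {ε : ℝ} (hε : 0 ≤ ε) (n : ℕ) :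
    2 * pertSize m ε (n + 1) ≤ pertSize m ε n := by
  have := one_le_kamRate m
  unfold pertSize
  rw [pow_succ, ← mul_div_assoc, div_le_div_iff₀ (by positivity) (by positivity)]
  have h : 0 ≤ ε * (2 * kamRate m) ^ n := by positivity
  nlinarith

/-- The nonresonance condition at the `n`-th step: lower bounds for `ω · k + Re (d_i - d_j)`. -/
def NonResonant (m : ℕ) (γ : ℝ) (ω : EuclideanSpace ℝ (Fin ν)) (d : SignedMode → ℂ) (n : ℕ) :
    Prop :=
  ∀ i j, ∀ k : Fin ν → ℤ, k ≠ 0 →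
    γ / 2 ^ n / (1 + ‖freq k‖) ^ m ≤ |inner ℝ ω (freq k) + (d i - d j).re|

/-- The diagonal `E` is a translation invariant perturbation of `freeDiag`. -/
structure DiagBound (lam : SignedMode → ℝ) (ω : EuclideanSpace ℝ (Fin ν)) (E : Mode ν → ℂ)
    (b : ℝ) : Prop where
  shift : ∀ i k, E (i, k) = (inner ℝ ω (freq k) : ℝ) + E (i, 0)
  close : ∀ s, ‖E s - freeDiag lam ω s‖ ≤ b / japanese s.1.2

/-- At equal Fourier indices the spectral gap 2γ survives, because each diagonal entry has moved by
at most b ≤ γ/2. At different indices translation invariance reduces the claim to the nonresonance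
condition, which bounds the real part of the divisor. -/
theorem DiagBound.lower {lam : SignedMode → ℝ} {ω : EuclideanSpace ℝ (Fin ν)} {E : Mode ν → ℂ}
    {b γ : ℝ} {m n : ℕ} (hE : DiagBound lam ω E b) (hγ : 0 < γ)
    (hb0 : 0 ≤ b) (hb : 2 * b ≤ γ) (hgap : ∀ i j, i ≠ j → 2 * γ ≤ |lam i - lam j|)
    (hnr : NonResonant m γ ω (fun i => E (i, 0)) n) (s t : Mode ν) (hst : s ≠ t) :
    γ / 2 ^ n / (1 + ‖freq (s.2 - t.2)‖) ^ m ≤ ‖E s - E t‖ := by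
  obtain ⟨i, k⟩ := s
  obtain ⟨j, l⟩ := t
  by_cases hkl : k = l
  · subst hkl
    have hij : i ≠ j := fun h => hst (by rw [h])
    have hc : ∀ s : Mode ν, ‖E s - freeDiag lam ω s‖ ≤ b := fun s =>
      (hE.close s).trans (div_le_self hb0 (one_le_japanese _))
    have e : (lam i - lam j : ℝ) = (E (i, k) - E (j, k)) - (E (i, k) - freeDiag lam ω (i, k)) +
        (E (j, k) - freeDiag lam ω (j, k)) := by
      simp only [freeDiag]; push_cast; ring
    have h1 : |lam i - lam j| ≤ ‖E (i, k) - E (j, k)‖ + b + b := by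
      rw [← Real.norm_eq_abs, ← Complex.norm_real, e]
      exact (norm_add_le _ _).trans
        (add_le_add ((norm_sub_le _ _).trans (add_le_add_right (hc _) _)) (hc _))
    have h2 := hgap i j hij
    have h3 : γ / 2 ^ n ≤ γ := div_le_self hγ.le (one_le_pow₀ (by norm_num))
    simp only [sub_self, freq_zero, norm_zero, add_zero, one_pow, div_one]
    linarith
  · have h := hnr i j (k - l) (sub_ne_zero.2 hkl)
    refine h.trans ?_
    rw [hE.shift i k, hE.shift j l]
    refine le_trans (le_of_eq ?_) (Complex.abs_re_le_norm _)
    congr 1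
    simp only [freq_sub, inner_sub_right, Complex.sub_re, Complex.add_re, Complex.ofReal_re]
    ring

theorem DiagBound.sub_shift {lam : SignedMode → ℝ} {ω : EuclideanSpace ℝ (Fin ν)} {E : Mode ν → ℂ} {b : ℝ}
    (hE : DiagBound lam ω E b) (l : Fin ν → ℤ) (s t : Mode ν) :
    E (shiftMode l s) - E (shiftMode l t) = 1 * RingHom.id ℂ (E s - E t) := by
  obtain ⟨i, k⟩ := s
  obtain ⟨j, k'⟩ := t
  rw [shiftMode_apply, shiftMode_apply, hE.shift, hE.shift _ (k' + l), hE.shift i k,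
    hE.shift j k', freq_add, freq_add]
  simp only [inner_add_right, RingHom.id_apply]
  push_cast
  ring

/-- Two-point control of the iteration at a given step. -/
structure SchemeBound (lam : SignedMode → ℝ) (q m : ℕ) (σ ε : ℝ)
    (ω ω' : EuclideanSpace ℝ (Fin ν)) (n : ℕ) (E E' : Mode ν → ℂ) (R R' : MatOp (Mode ν)) :
    Prop where
  pair : PairBound (weightU q (width σ n)) (ENNReal.ofReal ‖ω - ω'‖)
    (ENNReal.ofReal (pertSize m ε n)) R R'
  inv : ShiftInvariant R
  inv' : ShiftInvariant R'
  -- The bound telescopes: with p_n the size of the n-th perturbation, the step adds at most p_n and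
  -- 2 p_{n+1} ≤ p_n, so 2ε - 2p_n + p_n ≤ 2ε - 2p_{n+1}.
  diag : DiagBound lam ω E (2 * ε - 2 * pertSize m ε n)
  diag' : DiagBound lam ω' E' (2 * ε - 2 * pertSize m ε n)
  lip : ∀ s, ‖(E s - freeDiag lam ω s) - (E' s - freeDiag lam ω' s)‖ ≤
    (2 * ε - 2 * pertSize m ε n) * ‖ω - ω'‖

theorem DiagBound.next {lam : SignedMode → ℝ} {q : ℕ} {σ r : ℝ} {ω : EuclideanSpace ℝ (Fin ν)}
    {E : Mode ν → ℂ} {R : MatOp (Mode ν)} {b b' : ℝ} (hE : DiagBound lam ω E b) (hr : 0 ≤ r)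
    (hR : opSchur (weightU q σ) R ≤ ENNReal.ofReal r) (hinv : ShiftInvariant R)
    (hb : b + r ≤ b') : DiagBound lam ω (nextDiag E R) b' := by
  refine ⟨fun i k => ?_, fun s => ?_⟩
  · have := hinv.entry_eq i i k k
    rw [sub_self] at this
    simp only [nextDiag, hE.shift i k, this]
    ring
  · have h1 := norm_diag_le hr hR s
    have h2 := hE.close s
    have := japanese_pos s.1.2
    calc _ = ‖(E s - freeDiag lam ω s) + entry R s s‖ := by simp only [nextDiag]; ring_nf
      _ ≤ b / japanese s.1.2 + r / japanese s.1.2 := (norm_add_le _ _).trans (add_le_add h2 h1)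
      _ = (b + r) / japanese s.1.2 := by ring
      _ ≤ _ := by gcongr

theorem entry_sub_diag_le {q : ℕ} {σ r : ℝ} (hr : 0 ≤ r) {R : MatOp (Mode ν)}
    (hR : opSchur (weightU q σ) R ≤ ENNReal.ofReal r) (s : Mode ν) : ‖entry R s s‖ ≤ r :=
  (norm_diag_le hr hR s).trans (div_le_self hr (one_le_japanese _))

variable {lam : SignedMode → ℝ} {q m : ℕ} {σ γ ε : ℝ}

/-- Smallness conditions of the iteration. -/
structure KamSmall (lam : SignedMode → ℝ) (m : ℕ) (σ γ ε : ℝ) : Prop where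
  width_pos : 0 < σ
  gamma_pos : 0 < γ
  gamma_le : γ ≤ 1
  gap : ∀ i j, i ≠ j → 2 * γ ≤ |lam i - lam j|
  size_nonneg : 0 ≤ ε
  size_le : 4 * ε ≤ γ
  -- 96 = 24 · 2 · 2: the constant of `PairBound.nextPert`, the factor 2 in `solSize`, and the
  -- factor 2 in the ratio `2 * kamRate m` by which the perturbation has to shrink.
  small : 96 * kamConst m σ γ * kamRate m * ε ≤ 1

theorem KamSmall.kamConst_pos (h : KamSmall lam m σ γ ε) : 0 < kamConst m σ γ := by
  have := h.gamma_pos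
  have := h.width_pos
  unfold kamConst expLoss
  positivity

theorem KamSmall.solSize_le (h : KamSmall lam m σ γ ε) (n : ℕ) : solSize m σ γ ε n ≤ 1 / 2 := by
  have h1 := h.small
  have h2 := one_le_kamRate m
  have h3 := h.kamConst_pos
  have h4 := h.size_nonneg
  unfold solSize
  have h5 : ((1 : ℝ) / 2) ^ n ≤ 1 := pow_le_one₀ (by norm_num) (by norm_num)
  have h6 : kamConst m σ γ * ε ≤ kamConst m σ γ * ε * kamRate m := le_mul_of_one_le_right
    (by positivity) h2
  have h7 : 2 * kamConst m σ γ * ε * (1 / 2) ^ n ≤ 2 * kamConst m σ γ * ε :=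
    mul_le_of_le_one_right (by positivity) h5
  nlinarith

theorem SchemeBound.step (hs : KamSmall lam m σ γ ε) {ω ω' : EuclideanSpace ℝ (Fin ν)} {n : ℕ}
    {E₀ E₀' : Mode ν → ℂ} {R₀ R₀' : MatOp (Mode ν)}
    (h : SchemeBound lam q m σ ε ω ω' n (scheme E₀ R₀ n).1 (scheme E₀' R₀' n).1
      (scheme E₀ R₀ n).2 (scheme E₀' R₀' n).2)
    (hn : NonResonant m γ ω (fun i => (scheme E₀ R₀ n).1 (i, 0)) n)
    (hn' : NonResonant m γ ω' (fun i => (scheme E₀' R₀' n).1 (i, 0)) n) :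
    SchemeBound lam q m σ ε ω ω' (n + 1) (scheme E₀ R₀ (n + 1)).1 (scheme E₀' R₀' (n + 1)).1
      (scheme E₀ R₀ (n + 1)).2 (scheme E₀' R₀' (n + 1)).2 ∧
    RegularStep (weightZ q σ) E₀ R₀ (ENNReal.ofReal (solSize m σ γ ε n)) n := by
  set E := (scheme E₀ R₀ n).1 with hE
  set E' := (scheme E₀' R₀' n).1 with hE'
  set R := (scheme E₀ R₀ n).2 with hR
  set R' := (scheme E₀' R₀' n).2 with hR'
  have hσ := hs.width_pos
  have hγ := hs.gamma_pos
  have hε := hs.size_nonneg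
  have hεγ := hs.size_le
  have hA := one_le_kamRate m
  have hC := hs.kamConst_pos
  have hp0 : 0 ≤ pertSize m ε n := by unfold pertSize; positivity
  have hp1 : pertSize m ε n ≤ ε :=
    div_le_self hε (one_le_pow₀ (by linarith))
  have l1 := h.diag.lower hγ (by linarith) (by linarith) hs.gap hn
  have l2 := h.diag'.lower hγ (by linarith) (by linarith) hs.gap hn'
  -- The term ω·k contributes |k|; the corrections to the two diagonal entries contribute at most 4ε
  -- ≤ γ ≤ 1.
  have l3 : ∀ s t : Mode ν, ‖(E s - E t) - (E' s - E' t)‖ ≤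
      (1 + ‖freq (s.2 - t.2)‖) * ‖ω - ω'‖ := by
    intro s t
    have e : (E s - E t) - (E' s - E' t) =
        ((E s - freeDiag lam ω s) - (E' s - freeDiag lam ω' s)) -
        ((E t - freeDiag lam ω t) - (E' t - freeDiag lam ω' t)) +
        ((inner ℝ (ω - ω') (freq (s.2 - t.2)) : ℝ) : ℂ) := by
      simp only [freeDiag, freq_sub, inner_sub_left, inner_sub_right]
      push_cast
      ring
    rw [e]
    refine (norm_add_le _ _).trans ?_
    have i1 := (norm_sub_le ((E s - freeDiag lam ω s) - (E' s - freeDiag lam ω' s))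
      ((E t - freeDiag lam ω t) - (E' t - freeDiag lam ω' t))).trans
      (add_le_add (h.lip s) (h.lip t))
    have i2 : ‖((inner ℝ (ω - ω') (freq (s.2 - t.2)) : ℝ) : ℂ)‖ ≤
        ‖ω - ω'‖ * ‖freq (s.2 - t.2)‖ := by
      rw [Complex.norm_real]; exact norm_inner_le_norm _ _
    have i3 : 4 * ε * ‖ω - ω'‖ ≤ 1 * ‖ω - ω'‖ := by
      have := hs.gamma_le
      gcongr
      linarith
    have i4 : 0 ≤ pertSize m ε n * ‖ω - ω'‖ := by positivity
    nlinarith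
  have hn1 : ((1 : ℝ) / 2) ^ n ≤ 1 := pow_le_one₀ (by norm_num) (by norm_num)
  have hc : 0 < σ / 2 * (1 / 2) ^ n := by positivity
  have hc1 : σ / 2 * (1 / 2) ^ n ≤ σ := by
    nlinarith
  -- The loss allotted to the step is exactly the difference of consecutive widths.
  have hw : width σ (n + 1) + σ / 2 * (1 / 2) ^ n ≤ width σ n := by
    unfold width; rw [pow_succ]; linarith
  have hδ : 0 < γ / 2 ^ n := by positivity
  have hδ1 : γ / 2 ^ n ≤ 1 := (div_le_self hγ.le (one_le_pow₀ (by norm_num))).trans hs.gamma_le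
  have b1 := fun s t => (divisor_weight_bound (q := q) hc hc1 hw hδ hδ1 (norm_nonneg (ω - ω'))
    l1 l2 l3 s t)
  have b2 := fun s t => (divisor_weight_bound (q := q) hc hc1 hw hδ hδ1 (norm_nonneg (ω - ω'))
    l2 l1 (fun s t => by rw [norm_sub_rev]; exact l3 s t) s t).1
  have hw1 : 0 ≤ width σ (n + 1) := by unfold width; positivity
  have hwσ : σ ≤ width σ (n + 1) := by
    unfold width
    exact le_mul_of_one_le_right hσ.le (by simp)
  have hwp := weightPair (ν := ν) q hw1
  obtain ⟨x1, x2, x3⟩ := PairBound.ofEntries (one_le_weightU q hw1) h.pair ENNReal.ofReal_ne_top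
    ENNReal.ofReal_ne_top (fun s t => (b1 s t).1) b2 fun s t => (b1 s t).2
  -- The growth `kamRate m ^ n` of the constants cancels against the decay of `pertSize`, leaving
  -- generators of size proportional to 2^{-n}.
  have hx : 2 * (ENNReal.ofReal ((γ / 2 ^ n)⁻¹ ^ 2 *
      expLoss (2 * m + 1) σ (σ / 2 * (1 / 2) ^ n)) * ENNReal.ofReal (pertSize m ε n)) =
      ENNReal.ofReal (solSize m σ γ ε n) := by
    rw [kamConst_mul_pow, ← ENNReal.ofReal_mul (by positivity),
      show (2 : ℝ≥0∞) = ENNReal.ofReal 2 by simp, ← ENNReal.ofReal_mul (by norm_num)]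
    congr 1
    unfold solSize pertSize
    rw [mul_pow, one_div, inv_pow]
    field_simp
  rw [hx] at x3
  have hhalf : ENNReal.ofReal (solSize m σ γ ε n) ≤ 2⁻¹ := by
    refine (ENNReal.ofReal_le_ofReal (hs.solSize_le n)).trans ?_
    rw [one_div, ENNReal.ofReal_inv_of_pos (by norm_num)]
    simp
  have xZ : PairBound (weightZ q (width σ (n + 1))) (ENNReal.ofReal ‖ω - ω'‖)
      (ENNReal.ofReal (solSize m σ γ ε n)) (homSol E R) (homSol E' R') :=
    x3.mono hwp.le le_rfl
  have hpair' := h.pair.mono (weightU_mono (q := q) le_rfl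
    (by linarith : width σ (n + 1) ≤ width σ n)) le_rfl
  have reg : RegularStep (weightZ q σ) E₀ R₀ (ENNReal.ofReal (solSize m σ γ ε n)) n := by
    refine ⟨fun s t hst heq => ?_, x1, ?_, ?_, hhalf⟩
    · have := l1 s t hst
      rw [← hE] at heq
      rw [heq, sub_self, norm_zero] at this
      exact absurd this (not_le.2 (by positivity))
    · exact (PairBound.diagPart (one_le_weightU q hw1) hpair' ENNReal.ofReal_ne_top).1
    · exact (opSchur_mono (weightZ_mono le_rfl hwσ) _).trans xZ.left
  -- The two-point lemma is applied to R' paired with itself, where the difference vanishes.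
  have reg' : (∀ s t, entry (diagPart R') s t = entry R' s t * if s = t then 1 else 0) :=
    (PairBound.diagPart (h := ENNReal.ofReal ‖ω - ω'‖) (R' := R') (one_le_weightU q hw1)
      ⟨hpair'.right, hpair'.right, by simp [opSchur, schur]⟩ ENNReal.ofReal_ne_top).1
  have hp2 := pertSize_succ_le m hε n
  refine ⟨⟨?_, ?_, ?_, ?_, ?_, ?_⟩, reg⟩
  -- The remainder is quadratically small, but only geometric decay by the factor `2 * kamRate m` is
  -- asked for; `small` is exactly what this requires.
  · refine (PairBound.nextPert hwp hpair' ENNReal.ofReal_ne_top hhalf xZ).mono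
      (fun _ _ => le_rfl) ?_
    rw [show (24 : ℝ≥0∞) = ENNReal.ofReal 24 by simp, ← ENNReal.ofReal_mul hp0,
      ← ENNReal.ofReal_mul (by norm_num)]
    refine ENNReal.ofReal_le_ofReal ?_
    have e1 : pertSize m ε (n + 1) = pertSize m ε n * (1 / (2 * kamRate m)) := by
      unfold pertSize; rw [pow_succ]; field_simp
    rw [e1, mul_left_comm]
    refine mul_le_mul_of_nonneg_left ?_ hp0
    rw [le_div_iff₀ (by positivity)]
    have := hs.small
    unfold solSize
    calc _ = (96 * kamConst m σ γ * kamRate m * ε) * (1 / 2) ^ n := by ring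
      _ ≤ 1 := mul_le_one₀ this (by positivity) hn1
  · intro l
    exact (h.inv l).nextPert (by exact continuous_id) (by norm_num) hwp.one_le
      (h.diag.sub_shift l) x1 reg.diag (xZ.left.trans hhalf)
  · intro l
    exact (h.inv' l).nextPert (by exact continuous_id) (by norm_num) hwp.one_le
      (h.diag'.sub_shift l) x2 reg' (xZ.right.trans hhalf)
  · exact h.diag.next hp0 h.pair.left h.inv (by linarith)
  · exact h.diag'.next hp0 h.pair.right h.inv' (by linarith)
  · intro s
    have hd : ‖entry (R - R') s s‖ ≤ pertSize m ε n * ‖ω - ω'‖ := by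
      refine entry_sub_diag_le (q := q) (σ := width σ n) (by positivity) ?_ s
      rw [ENNReal.ofReal_mul hp0]
      exact h.pair.diff
    have := h.lip s
    calc _ = ‖((E s - freeDiag lam ω s) - (E' s - freeDiag lam ω' s)) + entry (R - R') s s‖ := by
          simp only [scheme, nextDiag, entry_sub, ← hE, ← hE', ← hR, ← hR']; ring_nf
      _ ≤ (2 * ε - 2 * pertSize m ε n) * ‖ω - ω'‖ + pertSize m ε n * ‖ω - ω'‖ :=
          (norm_add_le _ _).trans (add_le_add this hd)
      _ = (2 * ε - pertSize m ε n) * ‖ω - ω'‖ := by ring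
      _ ≤ _ := by gcongr

theorem SchemeBound.iterate (hs : KamSmall lam m σ γ ε) {ω ω' : EuclideanSpace ℝ (Fin ν)}
    {E₀ E₀' : Mode ν → ℂ} {R₀ R₀' : MatOp (Mode ν)}
    (h : SchemeBound lam q m σ ε ω ω' 0 E₀ E₀' R₀ R₀') (N : ℕ)
    (hn : ∀ n < N, NonResonant m γ ω (fun i => (scheme E₀ R₀ n).1 (i, 0)) n)
    (hn' : ∀ n < N, NonResonant m γ ω' (fun i => (scheme E₀' R₀' n).1 (i, 0)) n) :
    SchemeBound lam q m σ ε ω ω' N (scheme E₀ R₀ N).1 (scheme E₀' R₀' N).1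
      (scheme E₀ R₀ N).2 (scheme E₀' R₀' N).2 := by
  induction N with
  | zero => exact h
  | succ N ih =>
    exact ((ih (fun n hN => hn n (hN.trans (Nat.lt_succ_self N)))
      (fun n hN => hn' n (hN.trans (Nat.lt_succ_self N)))).step hs (hn N (Nat.lt_succ_self N))
      (hn' N (Nat.lt_succ_self N))).1

end

noncomputable section

open scoped ENNReal ComplexConjugate
open Filter Topology

/-! ### The limit of the iteration -/

section

variable {S : Type*} [DecidableEq S]

theorem RegularStep.diag_equivariant {Z : S → S → ℝ} {U : S → S → ℝ} (hw : WeightPair U Z)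
    {E : S → ℂ} {R : MatOp S} {x : ℕ → ℝ≥0∞} {σ : S ≃ S} {τ : ℂ →+* ℂ} {η : ℂ}
    (hτ : Continuous τ) (hη : η * η = 1) (hR : Equivariant σ τ η R)
    (hE : ∀ s, E (σ s) = η * τ (E s)) {N : ℕ}
    (h : ∀ n < N, RegularStep Z E R (x n) n) (s : S) :
    (scheme E R N).1 (σ s) = η * τ ((scheme E R N).1 s) := by
  induction N with
  | zero => exact hE s
  | succ N ih =>
    have hN : ∀ n < N, RegularStep Z E R (x n) n := fun n hn => h n (hn.trans (Nat.lt_succ_self N))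
    have h1 := (RegularStep.equivariant hw hτ hη hR
      (fun s t => by rw [hE, hE, map_sub, mul_sub]) hN).1 s s
    simp only [scheme, nextDiag, ih hN, h1, map_add, mul_add]

-- Conjugation exchanges the two indices of the double sum, and absolute summability allows the
-- order of summation to be exchanged back, so the sum equals its conjugate.
omit [DecidableEq S] in
theorem im_tsum_eq_zero_of_hermitian {F : S → S → ℂ} (hF : Summable fun p : S × S => F p.1 p.2)
    (h : ∀ s m, conj (F s m) = F m s) : (∑' s, ∑' m, F s m).im = 0 := by
  rw [← hF.tsum_prod, ← Complex.conj_eq_iff_im, Complex.conj_tsum]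
  simp only [h]
  exact (Equiv.prodComm S S).tsum_eq fun p : S × S => F p.1 p.2

theorem summable_norm_column (A : MatOp S) (t : S) : Summable fun s => ‖entry A s t‖ := by
  have := ENNReal.summable_toReal
    (ne_top_of_le_ne_top (by simp : ‖A‖ₑ ≠ ∞) (tsum_enorm_entry_le A t))
  simpa using this

theorem tsum_norm_column_le (A : MatOp S) (t : S) : ∑' s, ‖entry A s t‖ ≤ ‖A‖ := by
  have h1 := (ENNReal.toReal_le_toReal (ne_top_of_le_ne_top (by simp) (tsum_enorm_entry_le A t))
    (by simp)).2 (tsum_enorm_entry_le A t)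
  rw [ENNReal.tsum_toReal_eq (by simp)] at h1
  simpa using h1

theorem summable_bilinear_form (W : MatOp S) {x y : S → ℂ} (hx : Summable fun s => ‖x s‖) {c : ℝ}
    (hy : ∀ s, ‖y s‖ ≤ c) : Summable fun p : S × S => y p.1 * (entry W p.1 p.2 * x p.2) := by
  rw [← (Equiv.prodComm S S).summable_iff]
  have h1 : Summable fun p : S × S => ‖entry W p.2 p.1‖ * ‖x p.1‖ := by
    rw [summable_prod_of_nonneg (fun p => mul_nonneg (norm_nonneg _) (norm_nonneg _))]
    refine ⟨fun m => (summable_norm_column W m).mul_right ‖x m‖, ?_⟩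
    simp only [tsum_mul_right]
    refine Summable.of_nonneg_of_le (fun m => mul_nonneg (tsum_nonneg fun _ => norm_nonneg _)
      (norm_nonneg _)) (fun m => ?_) (hx.mul_left ‖W‖)
    exact mul_le_mul_of_nonneg_right (tsum_norm_column_le W m) (norm_nonneg _)
  refine Summable.of_norm_bounded (h1.mul_left c) fun p => ?_
  simp only [Function.comp, Equiv.prodComm_apply, Prod.fst_swap, Prod.snd_swap, norm_mul]
  exact mul_le_mul_of_nonneg_right (hy _) (mul_nonneg (norm_nonneg _) (norm_nonneg _))

/-- Eigenvectors in `ℓ¹` of an operator that is symmetric with respect to an indefinite form have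
real eigenvalues, unless the form vanishes on them. -/
theorem im_eq_zero_of_intertwines {E : S → ℝ} {W T : MatOp S} {E' : S → ℂ}
    (h : Intertwines (fun s => (E s : ℂ)) W T E' 0) {sg : S → ℝ} (hsg : ∀ s, |sg s| = 1)
    (hW : ∀ s t, sg s * conj (entry W s t) = sg t * entry W t s)
    (hT : ∀ t, ∑' s, ‖entry (T - 1) s t‖ₑ ≤ 4⁻¹) (t : S) : (E' t).im = 0 := by
  have hxs := summable_norm_column T t
  have hxb : ∀ s, ‖entry T s t‖ ≤ ∑' s, ‖entry T s t‖ := fun s =>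
    hxs.le_tsum s fun _ _ => norm_nonneg _
  set c := ∑' s, ‖entry T s t‖ with hc
  have hx2 : Summable fun s => ‖entry T s t‖ ^ 2 := by
    refine Summable.of_nonneg_of_le (fun _ => sq_nonneg _) (fun s => ?_) (hxs.mul_left c)
    rw [sq]
    exact mul_le_mul_of_nonneg_right (hxb s) (norm_nonneg _)
  have hQ : Summable fun s => sg s * ‖entry T s t‖ ^ 2 := by
    refine Summable.of_norm_bounded hx2 fun s => ?_
    rw [norm_mul, Real.norm_eq_abs, hsg, one_mul, Real.norm_of_nonneg (sq_nonneg _)]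
  have hF := summable_bilinear_form W (x := fun s => entry T s t)
    (y := fun s => sg s * conj (entry T s t)) hxs (c := c) fun s => by
      simpa [hsg] using hxb s
  have hBim := im_tsum_eq_zero_of_hermitian (F := fun s m =>
      sg s * conj (entry T s t) * (entry W s m * entry T m t)) hF fun s m => by
    simp only [map_mul, Complex.conj_ofReal, Complex.conj_conj]
    linear_combination (entry T s t * conj (entry T m t)) * hW s m
  have hB : HasSum (fun s => sg s * conj (entry T s t) * entry (W * T) s t)
      (∑' s, ∑' m, sg s * conj (entry T s t) * (entry W s m * entry T m t)) := by
    have h1 : ∀ s, ∑' m, sg s * conj (entry T s t) * (entry W s m * entry T m t) =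
        sg s * conj (entry T s t) * entry (W * T) s t := fun s =>
      ((hasSum_entry_mul W T s t).mul_left _).tsum_eq
    have h2 := hF.prod
    simp only [h1] at h2 ⊢
    exact h2.hasSum
  -- The unbounded diagonal E is never summed on its own. By the intertwining relation, the terms of
  -- E' Q(x) minus the form of W are the real numbers E_s sg_s |x_s|², where x is the column and Q
  -- the signed quadratic form. The form of W is real by symmetry, so Im E' · Q(x) = 0.
  have key2 : ((E' t * (∑' s, sg s * ‖entry T s t‖ ^ 2 : ℝ) -
        ∑' s, ∑' m, sg s * conj (entry T s t) * (entry W s m * entry T m t)).im) = 0 := by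
    have h1 : HasSum (fun s => ((sg s * ‖entry T s t‖ ^ 2 : ℝ) : ℂ))
      ((∑' s, sg s * ‖entry T s t‖ ^ 2 : ℝ) : ℂ) := Complex.hasSum_ofReal.2 hQ.hasSum
    have h2 := Complex.hasSum_im ((h1.mul_left (E' t)).sub hB)
    refine h2.unique ?_
    have h5 : ∀ s, (E' t * ((sg s * ‖entry T s t‖ ^ 2 : ℝ) : ℂ) -
        sg s * conj (entry T s t) * entry (W * T) s t).im = 0 := by
      intro s
      have h3 := h s t
      rw [mul_zero, entry_zero, add_zero] at h3
      have h4 : E' t * ((sg s * ‖entry T s t‖ ^ 2 : ℝ) : ℂ) -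
          sg s * conj (entry T s t) * entry (W * T) s t =
          (E s * (sg s * ‖entry T s t‖ ^ 2) : ℝ) := by
        push_cast
        rw [← Complex.conj_mul']
        linear_combination (-(sg s : ℂ) * conj (entry T s t)) * h3
      rw [h4, Complex.ofReal_im]
    simp only [h5]
    exact hasSum_zero
  rw [Complex.sub_im, hBim, sub_zero, Complex.im_mul_ofReal, mul_eq_zero] at key2
  -- The form does not vanish on the column: its diagonal entry has modulus at least 3/4, hence
  -- square at least 9/16, while the other squares sum to at most (1/4)².
  refine key2.resolve_right fun h0 => ?_
  have hd := summable_norm_column (T - 1) t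
  have hdle : ∑' s, ‖entry (T - 1) s t‖ ≤ 1 / 4 := by
    have h1 := (ENNReal.toReal_le_toReal
      (ne_top_of_le_ne_top (by simp) (tsum_enorm_entry_le _ t)) (by simp)).2 (hT t)
    rw [ENNReal.tsum_toReal_eq (by simp)] at h1
    simpa using h1
  have hd1 : ∀ s, ‖entry (T - 1) s t‖ ≤ 1 / 4 := fun s =>
    (hd.le_tsum s fun _ _ => norm_nonneg _).trans hdle
  have hsum := hQ.hasSum
  rw [h0] at hsum
  have h1 := hsum.sub (hasSum_ite_eq t (sg t * ‖entry T t t‖ ^ 2))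
  have h2 := tsum_of_norm_bounded (hd.mul_left (1 / 4)).hasSum
    (f := fun s => sg s * ‖entry T s t‖ ^ 2 - if s = t then sg t * ‖entry T t t‖ ^ 2 else 0)
    fun s => by
      split_ifs with hst
      · rw [hst, sub_self, norm_zero]; positivity
      · have e : entry (T - 1) s t = entry T s t := by rw [entry_sub, entry_one, if_neg hst, sub_zero]
        have := hd1 s
        rw [e] at this ⊢
        rw [sub_zero, norm_mul, Real.norm_eq_abs, hsg, one_mul, Real.norm_of_nonneg (sq_nonneg _),
          sq]
        exact mul_le_mul_of_nonneg_right this (norm_nonneg _)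
  rw [h1.tsum_eq, tsum_mul_left, zero_sub, norm_neg, norm_mul, Real.norm_eq_abs, hsg, one_mul,
    Real.norm_of_nonneg (sq_nonneg _)] at h2
  have h3 : 1 - 1 / 4 ≤ ‖entry T t t‖ := by
    have e : entry (T - 1) t t = entry T t t - 1 := by rw [entry_sub, entry_one, if_pos rfl]
    have h4 := hd1 t
    rw [e] at h4
    have h5 := norm_sub_norm_le (1 : ℂ) (1 - entry T t t)
    rw [sub_sub_cancel, norm_one, norm_sub_rev] at h5
    linarith
  nlinarith

end

variable {ν : ℕ} {lam : SignedMode → ℝ} {q m : ℕ} {σ γ ε : ℝ}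

/-- Negation of the Fourier index and exchange of the two components. -/
def negMode : Mode ν ≃ Mode ν := (Equiv.boolNot.prodCongr (Equiv.refl _)).prodCongr (Equiv.neg _)

@[simp] theorem negMode_apply (b : Bool) (j : ℕ+) (k : Fin ν → ℤ) :
    negMode ((b, j), k) = ((!b, j), -k) := rfl

/-- Compatibility of `A` with the real structure, up to the sign `η`. -/
def RealStructure (η : ℂ) (A : MatOp (Mode ν)) : Prop := Equivariant negMode (starRingEnd ℂ) η A

theorem tendsto_pertSize (m : ℕ) (ε : ℝ) : Tendsto (pertSize m ε) atTop (𝓝 0) := by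
  have h1 := one_le_kamRate m
  have : pertSize m ε = fun n => ε * (1 / (2 * kamRate m)) ^ n := by
    funext n
    rw [pertSize, one_div, inv_pow, div_eq_mul_inv]
  rw [this]
  have h2 := (tendsto_pow_atTop_nhds_zero_of_lt_one (r := 1 / (2 * kamRate m)) (by positivity)
    (by rw [div_lt_one (by positivity)]; linarith)).const_mul ε
  simpa using h2

theorem tsum_solSize_le (hs : KamSmall lam m σ γ ε) :
    ∑' n, ENNReal.ofReal (solSize m σ γ ε n) = ENNReal.ofReal (4 * kamConst m σ γ * ε) := by
  have hC := hs.kamConst_pos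
  have hε := hs.size_nonneg
  have h1 : HasSum (solSize m σ γ ε) (4 * kamConst m σ γ * ε) := by
    have := (hasSum_geometric_two).mul_left (2 * kamConst m σ γ * ε)
    rwa [show 2 * kamConst m σ γ * ε * 2 = 4 * kamConst m σ γ * ε by ring] at this
  rw [← ENNReal.ofReal_tsum_of_nonneg (fun n => by unfold solSize; positivity) h1.summable,
    h1.tsum_eq]

/-- The limits of the diagonals. -/
def limDiag (E : Mode ν → ℂ) (R : MatOp (Mode ν)) (s : Mode ν) : ℂ :=
  limUnder atTop fun n => (scheme E R n).1 s

/-- The conjugation to diagonal form, for a nonresonant frequency. -/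
theorem exists_diagonalization (hs : KamSmall lam m σ γ ε) {ω : EuclideanSpace ℝ (Fin ν)}
    {E : Mode ν → ℂ} {R : MatOp (Mode ν)} (h : SchemeBound lam q m σ ε ω ω 0 E E R R)
    (hn : ∀ n, NonResonant m γ ω (fun i => (scheme E R n).1 (i, 0)) n)
    (hreal : RealStructure (-1) R) (hEreal : ∀ s, E (negMode s) = -conj (E s)) :
    (∀ s, Tendsto (fun n => (scheme E R n).1 s) atTop (𝓝 (limDiag E R s))) ∧
    DiagBound lam ω (limDiag E R) (2 * ε) ∧
    (∀ s, limDiag E R (negMode s) = -conj (limDiag E R s)) ∧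
    ∃ T, Intertwines E R T (limDiag E R) 0 ∧ ShiftInvariant T ∧ RealStructure 1 T ∧
      opSchur (weightZ q σ) (T - 1) ≤ ENNReal.ofReal (8 * kamConst m σ γ * ε) := by
  have hC := hs.kamConst_pos
  have hε := hs.size_nonneg
  have hA := one_le_kamRate m
  have hp0 : ∀ n, 0 ≤ pertSize m ε n := fun n => by unfold pertSize; positivity
  have hb : ∀ N, SchemeBound lam q m σ ε ω ω N (scheme E R N).1 (scheme E R N).1
      (scheme E R N).2 (scheme E R N).2 := fun N =>
    h.iterate hs N (fun n _ => hn n) (fun n _ => hn n)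
  have hreg : ∀ n, RegularStep (weightZ q σ) E R (ENNReal.ofReal (solSize m σ γ ε n)) n :=
    fun n => ((hb n).step hs (hn n) (hn n)).2
  have hw := weightPair (ν := ν) q hs.width_pos.le
  have hwidth : ∀ n, 0 ≤ width σ n := fun n => by have := hs.width_pos; unfold width; positivity
  have hlim : ∀ s, Tendsto (fun n => (scheme E R n).1 s) atTop (𝓝 (limDiag E R s)) := by
    intro s
    refine CauchySeq.tendsto_limUnder ?_
    -- A diagonal entry changes at step n by at most `pertSize m ε n` ≤ ε 2^{-n}, since `kamRate m`
    -- is at least 1.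
    refine cauchySeq_of_le_geometric (1 / 2) ε (by norm_num) fun n => ?_
    rw [dist_comm, dist_eq_norm]
    simp only [scheme, nextDiag, add_sub_cancel_left]
    refine (entry_sub_diag_le (hp0 n) (hb n).pair.left s).trans ?_
    unfold pertSize
    rw [div_eq_mul_inv, one_div, inv_pow]
    gcongr
    linarith
  have hR0 : Tendsto (fun n => (scheme E R n).2) atTop (𝓝 0) := by
    rw [tendsto_zero_iff_norm_tendsto_zero]
    refine squeeze_zero (fun _ => norm_nonneg _) (fun n => ?_) (tendsto_pertSize m ε)
    have h1 := (enorm_le_opSchur (one_le_weightU q (hwidth n)) _).trans (hb n).pair.left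
    rw [← ofReal_norm] at h1
    exact (ENNReal.ofReal_le_ofReal_iff (hp0 n)).1 h1
  have h96 : 4 * kamConst m σ γ * ε ≤ 1 / 2 := by
    have h1 := hs.small
    have h2 : kamConst m σ γ * ε ≤ kamConst m σ γ * ε * kamRate m := le_mul_of_one_le_right
      (by positivity) hA
    nlinarith
  obtain ⟨T, hT, hI, hTs⟩ := exists_limit_transf hw hreg (tsum_solSize_le hs).le
    ((ENNReal.ofReal_le_ofReal h96).trans (by
      rw [one_div, ENNReal.ofReal_inv_of_pos (by norm_num)]; simp)) hR0 hlim
  refine ⟨hlim, ⟨fun i k => ?_, fun s => ?_⟩, fun s => ?_, T, hI, fun l => ?_, ?_, ?_⟩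
  · exact tendsto_nhds_unique (hlim (i, k)) (((hlim (i, 0)).const_add _).congr fun n =>
      ((hb n).diag.shift i k).symm)
  · refine le_of_tendsto ((hlim s).sub_const _).norm (Eventually.of_forall fun n => ?_)
    refine ((hb n).diag.close s).trans ?_
    have := japanese_pos s.1.2
    have := hp0 n
    gcongr
    linarith
  · refine tendsto_nhds_unique (hlim (negMode s))
      (((Complex.continuous_conj.tendsto _).comp (hlim s)).neg.congr fun n => ?_)
    have := RegularStep.diag_equivariant hw Complex.continuous_conj (by norm_num) hreal
      (fun s => by rw [hEreal]; ring) (fun n' (_ : n' < n) => hreg n') s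
    rw [this]
    simp
  · refine Equivariant.of_tendsto continuous_id hT fun n => ?_
    exact (RegularStep.equivariant hw continuous_id (by norm_num) (h.inv l)
      (fun s t => h.diag.sub_shift l s t) (fun n' (_ : n' < n) => hreg n')).2.1
  · refine Equivariant.of_tendsto Complex.continuous_conj hT fun n => ?_
    exact (RegularStep.equivariant hw Complex.continuous_conj (by norm_num) hreal
      (fun s t => by rw [hEreal, hEreal, map_sub]; ring) (fun n' (_ : n' < n) => hreg n')).2.1
  · refine hTs.trans (le_of_eq ?_)
    rw [show (2 : ℝ≥0∞) = ENNReal.ofReal 2 by simp, ← ENNReal.ofReal_mul (by norm_num)]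
    ring_nf

end

noncomputable section

open scoped ENNReal ComplexConjugate
open Filter Topology

variable {ν : ℕ} {lam : SignedMode → ℝ} {q m : ℕ} {σ γ ε : ℝ}

/-! ### The first step: averaging of a fast oscillating perturbation -/

/-- The constant of the loss in the first step. -/
def averagingConst (m : ℕ) (Λ γ c : ℝ) : ℝ := 4 * Λ * γ⁻¹ ^ 3 * expLoss (3 * m + 1) 1 c

/-- The nonresonance conditions of the first step. -/
structure FastNonResonant (lam : SignedMode → ℝ) (m : ℕ) (γ M : ℝ)
    (ω : EuclideanSpace ℝ (Fin ν)) : Prop where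
  frequency : ∀ k : Fin ν → ℤ, k ≠ 0 → γ * M / (1 + ‖freq k‖) ^ m ≤ |inner ℝ ω (freq k)|
  modes : NonResonant m γ ω (fun i => (lam i : ℂ)) 0

/-- The parameters of the first step. -/
structure FastParams (lam : SignedMode → ℝ) (Λ σ c γ M : ℝ) : Prop where
  width_nonneg : 0 ≤ σ
  loss_pos : 0 < c
  loss_le : c ≤ 1
  gamma_pos : 0 < γ
  gamma_le : γ ≤ 1
  one_le : 1 ≤ M
  growth_one : 1 ≤ Λ
  growth : ∀ i : SignedMode, |lam i| ≤ Λ * japanese i.2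

/-- Here the largeness of M enters. The number a bounds the inverse divisor, and either a itself is
O(1/M), or the factor max(⟨i⟩,⟨j⟩) available in the weight of W is at least of order M. In both
cases, passing from the weight of order -1 to the weight of order 0 gains 1/M, for the inverse
divisor and for its Lipschitz constant. The case distinction involves only the unperturbed
eigenvalues and k, so one a serves both frequencies. -/
theorem FastNonResonant.exists_lower (hp : FastParams lam Λ σ c γ M)
    {ω ω' : EuclideanSpace ℝ (Fin ν)} (hn : FastNonResonant lam m γ M ω)
    (hn' : FastNonResonant lam m γ M ω') (s t : Mode ν) (hst : s.2 ≠ t.2) :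
    ∃ a, 0 ≤ a ∧ 1 ≤ a * ‖freeDiag lam ω s - freeDiag lam ω t‖ ∧
      1 ≤ a * ‖freeDiag lam ω' s - freeDiag lam ω' t‖ ∧
      (a * weightZ q σ s t ≤ averagingConst m Λ γ c / M * weightU (q + 1) (σ + c) s t) ∧
      (a ^ 2 * (1 + ‖freq (s.2 - t.2)‖) * weightZ q σ s t ≤
        averagingConst m Λ γ c / M * weightU (q + 1) (σ + c) s t) := by
  obtain ⟨h0, hc, hc1, hγ, hγ1, hM, hΛ, hg⟩ := hp
  obtain ⟨i, k⟩ := s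
  obtain ⟨j, l⟩ := t
  simp only at hst ⊢
  have hk : k - l ≠ 0 := sub_ne_zero.2 hst
  set x := ‖freq (k - l)‖ with hx
  have hx0 : 0 ≤ x := norm_nonneg _
  have hM0 : 0 < M := by linarith
  set J := max (japanese i.2) (japanese j.2) with hJ
  have hJ1 : 1 ≤ J := (one_le_japanese _).trans (le_max_left _ _)
  set y := 1 + x with hy
  have hy1 : 1 ≤ y := by linarith
  have hy0 : 0 < y := by linarith
  have hmr := modeRatio_nonneg i.2 j.2
  have hγi : 1 ≤ γ⁻¹ := (one_le_inv₀ hγ).2 hγ1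
  have hdiv : ∀ ω : EuclideanSpace ℝ (Fin ν), ‖freeDiag lam ω (i, k) - freeDiag lam ω (j, l)‖ =
      |inner ℝ ω (freq (k - l)) + (lam i - lam j)| := by
    intro ω
    rw [← Real.norm_eq_abs, ← Complex.norm_real]
    congr 1
    simp only [freeDiag, freq_sub, inner_sub_right]
    push_cast
    ring
  rw [hdiv, hdiv]
  have hexp : y ^ (3 * m + 1) * exp (σ * x) ≤ expLoss (3 * m + 1) 1 c * exp ((σ + c) * x) := by
    rw [add_mul, Real.exp_add]
    have := one_add_pow_le_expLoss (3 * m + 1) hc hc1 hx0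
    calc _ ≤ expLoss (3 * m + 1) 1 c * exp (c * x) * exp (σ * x) := by gcongr
      _ = _ := by ring
  have fin : ∀ z : ℝ, z ≤ 4 * Λ * γ⁻¹ ^ 3 / M * y ^ (3 * m + 1) * J →
      z * weightZ q σ (i, k) (j, l) ≤
        averagingConst m Λ γ c / M * weightU (q + 1) (σ + c) (i, k) (j, l) := by
    intro z hz
    unfold weightZ weightU averagingConst
    simp only [← hx, ← hJ]
    calc _ ≤ (4 * Λ * γ⁻¹ ^ 3 / M * y ^ (3 * m + 1) * J) *
          (modeRatio i.2 j.2 ^ (q + 1) * exp (σ * x)) := by gcongr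
      _ = (4 * Λ * γ⁻¹ ^ 3 / M) * J * modeRatio i.2 j.2 ^ (q + 1) *
          (y ^ (3 * m + 1) * exp (σ * x)) := by ring
      _ ≤ (4 * Λ * γ⁻¹ ^ 3 / M) * J * modeRatio i.2 j.2 ^ (q + 1) *
          (expLoss (3 * m + 1) 1 c * exp ((σ + c) * x)) := by gcongr
      _ = _ := by ring
  have hyp : ∀ p p' : ℕ, p ≤ p' → y ^ p ≤ y ^ p' := fun p p' h => pow_le_pow_right₀ hy1 h
  -- In the first case the difference of eigenvalues removes at most half of the lower bound for
  -- |ω·k|, and the divisor stays at least γM y^{-m}/2.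
  by_cases hcase : |lam i - lam j| ≤ γ * M / y ^ m / 2
  · have low : ∀ ω : EuclideanSpace ℝ (Fin ν), FastNonResonant lam m γ M ω →
        1 ≤ (2 * y ^ m * γ⁻¹ / M) * |inner ℝ ω (freq (k - l)) + (lam i - lam j)| := by
      intro ω hω
      have h1 := hω.frequency (k - l) hk
      rw [← hx, ← hy] at h1
      have h2 := abs_sub_abs_le_abs_sub (inner ℝ ω (freq (k - l))) (-(lam i - lam j))
      rw [abs_neg, sub_neg_eq_add] at h2
      have h3 : γ * M / y ^ m / 2 ≤ |inner ℝ ω (freq (k - l)) + (lam i - lam j)| := by linarith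
      calc 1 = (2 * y ^ m * γ⁻¹ / M) * (γ * M / y ^ m / 2) := by field_simp
        _ ≤ _ := by gcongr
    have e1 : (2 * y ^ m * γ⁻¹ / M) ≤ 4 * Λ * γ⁻¹ ^ 3 / M * y ^ (3 * m + 1) * J := by
      calc _ = 2 * 1 * γ⁻¹ / M * y ^ m * 1 := by ring
        _ ≤ 4 * Λ * γ⁻¹ ^ 3 / M * y ^ (3 * m + 1) * J := by
          gcongr
          · norm_num
          · exact le_self_pow₀ hγi (by norm_num)
          · omega
    have e2 : (2 * y ^ m * γ⁻¹ / M) ^ 2 * y ≤ 4 * Λ * γ⁻¹ ^ 3 / M * y ^ (3 * m + 1) * J := by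
      calc _ = 4 * 1 * γ⁻¹ ^ 2 / M ^ 2 * y ^ (2 * m + 1) * 1 := by
            rw [div_pow, mul_pow, mul_pow]; ring
        _ ≤ 4 * Λ * γ⁻¹ ^ 3 / M * y ^ (3 * m + 1) * J := by
          gcongr
          · norm_num
          · exact le_self_pow₀ hM (by norm_num)
          · omega
    exact ⟨_, by positivity, low ω hn, low ω' hn', fin _ e1, fin _ e2⟩
  · push Not at hcase
    -- In the second case |λ_i - λ_j| ≤ 2ΛJ forces J to be large. The resulting inequality `hone`
    -- then converts J into the factor 1/M, at the price of one more γ⁻¹ and y^m; hence the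
    -- exponents γ⁻³ and 3m + 1 of the constant.
    have hJM : M * γ * y⁻¹ ^ m ≤ 4 * Λ * J := by
      have h1 : |lam i - lam j| ≤ Λ * J + Λ * J := by
        refine (abs_sub _ _).trans (add_le_add ((hg i).trans ?_) ((hg j).trans ?_))
        · gcongr; exact le_max_left _ _
        · gcongr; exact le_max_right _ _
      have h2 : γ * M / y ^ m = M * γ * y⁻¹ ^ m := by rw [inv_pow]; field_simp
      rw [h2] at hcase
      linarith
    have hone : 1 ≤ 4 * Λ * γ⁻¹ / M * y ^ m * J := by
      have h3 : 4 * Λ * γ⁻¹ / M * y ^ m * J = (γ⁻¹ / M * y ^ m) * (4 * Λ * J) := by ring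
      rw [h3]
      calc 1 = (γ⁻¹ / M * y ^ m) * (M * γ * y⁻¹ ^ m) := by rw [inv_pow]; field_simp
        _ ≤ _ := by gcongr
    have low : ∀ ω : EuclideanSpace ℝ (Fin ν), FastNonResonant lam m γ M ω →
        1 ≤ (y ^ m * γ⁻¹) * |inner ℝ ω (freq (k - l)) + (lam i - lam j)| := by
      intro ω hω
      have h1 := hω.modes i j (k - l) hk
      rw [← hx, ← hy, pow_zero, div_one, ← Complex.ofReal_sub, Complex.ofReal_re] at h1
      calc 1 = (y ^ m * γ⁻¹) * (γ / y ^ m) := by field_simp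
        _ ≤ _ := by gcongr
    have e2 : (y ^ m * γ⁻¹) ^ 2 * y ≤ 4 * Λ * γ⁻¹ ^ 3 / M * y ^ (3 * m + 1) * J := by
      calc _ = γ⁻¹ ^ 2 * y ^ (2 * m + 1) * 1 := by rw [mul_pow]; ring
        _ ≤ γ⁻¹ ^ 2 * y ^ (2 * m + 1) * (4 * Λ * γ⁻¹ / M * y ^ m * J) := by gcongr
        _ = _ := by ring
    have e1 : y ^ m * γ⁻¹ ≤ 4 * Λ * γ⁻¹ ^ 3 / M * y ^ (3 * m + 1) * J := by
      refine le_trans ?_ e2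
      have h1 : 1 ≤ y ^ m * γ⁻¹ := one_le_mul_of_one_le_of_one_le (one_le_pow₀ hy1) hγi
      calc y ^ m * γ⁻¹ ≤ (y ^ m * γ⁻¹) ^ 2 := le_self_pow₀ h1 (by norm_num)
        _ ≤ _ := le_mul_of_one_le_right (by positivity) hy1
    exact ⟨_, by positivity, low ω hn, low ω' hn', fin _ e1, fin _ e2⟩

/-- A perturbation without terms that are constant in time. -/
def ZeroAverage (W : MatOp (Mode ν)) : Prop := ∀ s t, s.2 = t.2 → entry W s t = 0

/-- W does not depend on ω, so the Lipschitz bound concerns the divisors alone. The whole weight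
max(⟨i⟩,⟨j⟩) is spent on the gain 1/M, so the generator is only of order 0. -/
theorem averaging_pairBound (hp : FastParams lam Λ σ c γ M) {ω ω' : EuclideanSpace ℝ (Fin ν)}
    (hn : FastNonResonant lam m γ M ω) (hn' : FastNonResonant lam m γ M ω') {W : MatOp (Mode ν)}
    (hW0 : ZeroAverage W) {w : ℝ}
    (hW : opSchur (weightU (q + 1) (σ + c)) W ≤ ENNReal.ofReal w) :
    (∀ s t, entry (homSol (freeDiag lam ω) W) s t =
      entry W s t * if s = t then 0 else -(freeDiag lam ω s - freeDiag lam ω t)⁻¹) ∧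
    PairBound (weightZ q σ) (ENNReal.ofReal ‖ω - ω'‖)
      (ENNReal.ofReal (2 * (averagingConst m Λ γ c / M * w)))
      (homSol (freeDiag lam ω) W) (homSol (freeDiag lam ω') W) := by
  have hM : 0 < M := zero_lt_one.trans_le hp.one_le
  have hK : 0 ≤ averagingConst m Λ γ c / M := by
    have := hp.gamma_pos
    have := hp.loss_pos
    have : 0 < Λ := zero_lt_one.trans_le hp.growth_one
    unfold averagingConst expLoss
    positivity
  -- At equal Fourier indices a divisor gives no gain in M. There W vanishes by zero average, so the
  -- multiplier may be replaced by 0.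
  set g : EuclideanSpace ℝ (Fin ν) → Mode ν → Mode ν → ℂ := fun ω s t =>
    if s.2 = t.2 then 0 else divisor (freeDiag lam ω) s t with hg
  have heq : ∀ ω s t, entry W s t * g ω s t = entry W s t *
      if s = t then 0 else -(freeDiag lam ω s - freeDiag lam ω t)⁻¹ := by
    intro ω s t
    by_cases hst : s.2 = t.2
    · rw [hW0 s t hst, zero_mul, zero_mul]
    · simp only [hg, if_neg hst, divisor]
  have hsol : ∀ ω, homSol (freeDiag lam ω) W = ofEntries fun s t => entry W s t * g ω s t := by
    intro ω
    simp only [homSol, heq]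
  have hpair : PairBound (weightU (q + 1) (σ + c)) (ENNReal.ofReal ‖ω - ω'‖) (ENNReal.ofReal w)
      W W := ⟨hW, hW, by simp [opSchur, schur]⟩
  have hone := (weightPair (ν := ν) q hp.width_nonneg).one_le
  have hZ : ∀ s t : Mode ν, 0 ≤ weightZ q σ s t := fun s t => zero_le_one.trans (hone s t)
  have b1 : ∀ ω, FastNonResonant lam m γ M ω → ∀ s t : Mode ν,
      ‖g ω s t‖ₑ * ENNReal.ofReal (weightZ q σ s t) ≤ ENNReal.ofReal (averagingConst m Λ γ c / M) *
        ENNReal.ofReal (weightU (q + 1) (σ + c) s t) := by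
    intro ω hn s t
    by_cases hst : s.2 = t.2
    · simp [hg, if_pos hst]
    · obtain ⟨a, a0, a1, -, a3, -⟩ := hn.exists_lower (q := q) hp hn s t hst
      refine enorm_mul_ofReal_le hK (le_trans ?_ a3)
      simp only [hg, if_neg hst]
      exact mul_le_mul_of_nonneg_right (norm_divisor_le a0 fun _ => a1) (hZ s t)
  have b3 : ∀ s t : Mode ν, ‖g ω s t - g ω' s t‖ₑ * ENNReal.ofReal (weightZ q σ s t) ≤
      ENNReal.ofReal (averagingConst m Λ γ c / M) * ENNReal.ofReal ‖ω - ω'‖ *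
        ENNReal.ofReal (weightU (q + 1) (σ + c) s t) := by
    intro s t
    by_cases hst : s.2 = t.2
    · simp [hg, if_pos hst]
    · obtain ⟨a, a0, a1, a2, -, a4⟩ := hn.exists_lower (q := q) hp hn' s t hst
      rw [← ENNReal.ofReal_mul hK]
      refine enorm_mul_ofReal_le (by positivity) ?_
      simp only [hg, if_neg hst]
      have h3 : ‖(freeDiag lam ω s - freeDiag lam ω t) -
          (freeDiag lam ω' s - freeDiag lam ω' t)‖ ≤ (1 + ‖freq (s.2 - t.2)‖) * ‖ω - ω'‖ := by
        have e : (freeDiag lam ω s - freeDiag lam ω t) - (freeDiag lam ω' s - freeDiag lam ω' t) =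
            ((inner ℝ (ω - ω') (freq (s.2 - t.2)) : ℝ) : ℂ) := by
          simp only [freeDiag, freq_sub, inner_sub_left, inner_sub_right]
          push_cast
          ring
        rw [e, Complex.norm_real]
        refine (norm_inner_le_norm _ _).trans ?_
        rw [mul_comm]
        gcongr
        linarith
      have h4 := norm_divisor_sub_le a0 (by positivity) (norm_nonneg _) (fun _ => a1) (fun _ => a2)
        h3
      calc _ ≤ a ^ 2 * (1 + ‖freq (s.2 - t.2)‖) * ‖ω - ω'‖ * weightZ q σ s t :=
            mul_le_mul_of_nonneg_right h4 (hZ s t)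
        _ = (a ^ 2 * (1 + ‖freq (s.2 - t.2)‖) * weightZ q σ s t) * ‖ω - ω'‖ := by ring
        _ ≤ (averagingConst m Λ γ c / M * weightU (q + 1) (σ + c) s t) * ‖ω - ω'‖ := by gcongr
        _ = _ := by ring
  obtain ⟨x1, -, x3⟩ := PairBound.ofEntries hone hpair ENNReal.ofReal_ne_top
    ENNReal.ofReal_ne_top (b1 ω hn) (b1 ω' hn') b3
  refine ⟨fun s t => ?_, ?_⟩
  · rw [hsol, x1, heq]
  · rw [hsol, hsol]
    refine x3.mono (fun _ _ => le_rfl) (le_of_eq ?_)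
    rw [← ENNReal.ofReal_mul hK, show (2 : ℝ≥0∞) = ENNReal.ofReal 2 by simp,
      ← ENNReal.ofReal_mul (by norm_num)]

/-- The perturbation after the first step. -/
def averagedPert (lam : SignedMode → ℝ) (W : MatOp (Mode ν)) (ω : EuclideanSpace ℝ (Fin ν)) :
    MatOp (Mode ν) := nextPert (freeDiag lam ω) W

/-- Zero average includes the diagonal of W, so the first step leaves the eigenvalues where they are
and the iteration restarts from the free diagonal. -/
theorem averaged_facts (hp : FastParams lam Λ σ c γ M) (ω : EuclideanSpace ℝ (Fin ν))
    {W : MatOp (Mode ν)} (hW0 : ZeroAverage W) {w : ℝ}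
    (hW : opSchur (weightU (q + 1) (σ + c)) W ≤ ENNReal.ofReal w) :
    PairBound (weightU q σ) 0 (ENNReal.ofReal w) W W ∧
    (∀ s t, entry (diagPart W) s t = entry W s t * if s = t then 1 else 0) ∧
    nextDiag (freeDiag lam ω) W = freeDiag lam ω := by
  have hpair : PairBound (weightU q σ) 0 (ENNReal.ofReal w) W W := by
    have h1 := (opSchur_mono (weightU_mono (q := q) (q' := q + 1) (by omega)
      (by linarith [hp.loss_pos] : σ ≤ σ + c)) W).trans hW
    exact ⟨h1, h1, by simp [opSchur, schur]⟩
  refine ⟨hpair, (PairBound.diagPart (one_le_weightU q hp.width_nonneg) hpair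
    ENNReal.ofReal_ne_top).1, ?_⟩
  funext s
  rw [nextDiag, hW0 s s rfl, add_zero]

theorem averaging_half (hM : 0 < M) {K w : ℝ} (h : 4 * K * w ≤ M) :
    ENNReal.ofReal (2 * (K / M * w)) ≤ 2⁻¹ := by
  have h1 : 2 * (K / M * w) ≤ 1 / 2 := by
    rw [div_mul_eq_mul_div, ← mul_div_assoc, div_le_iff₀ hM]
    linarith
  refine (ENNReal.ofReal_le_ofReal h1).trans ?_
  rw [one_div, ENNReal.ofReal_inv_of_pos (by norm_num)]
  simp

/-- After the first step the iteration can be started. -/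
theorem averaged_schemeBound (hp : FastParams lam Λ (2 * σ) c γ M)
    {ω ω' : EuclideanSpace ℝ (Fin ν)}
    (hn : FastNonResonant lam m γ M ω) (hn' : FastNonResonant lam m γ M ω') {W : MatOp (Mode ν)}
    (hW0 : ZeroAverage W) {w : ℝ} (hw : 0 ≤ w)
    (hW : opSchur (weightU (q + 1) (2 * σ + c)) W ≤ ENNReal.ofReal w) (hinv : ShiftInvariant W)
    (hMw : 4 * averagingConst m Λ γ c * w ≤ M)
    (hε : 48 * averagingConst m Λ γ c * w ^ 2 / M ≤ ε) :
    SchemeBound lam q m σ ε ω ω' 0 (freeDiag lam ω) (freeDiag lam ω')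
      (averagedPert lam W ω) (averagedPert lam W ω') := by
  have hM : 0 < M := zero_lt_one.trans_le hp.one_le
  obtain ⟨x1, x2⟩ := averaging_pairBound hp hn hn' hW0 hW
  obtain ⟨x1', -⟩ := averaging_pairBound hp hn' hn hW0 hW
  obtain ⟨f1, f2, -⟩ := averaged_facts (q := q) hp ω hW0 hW
  have hhalf := averaging_half hM hMw
  have hwp := weightPair (ν := ν) q hp.width_nonneg
  have hpair : PairBound (weightU q (2 * σ)) (ENNReal.ofReal ‖ω - ω'‖) (ENNReal.ofReal w) W W :=
    ⟨f1.left, f1.right, by simp [opSchur, schur]⟩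
  have hwd : width σ 0 = 2 * σ := by unfold width; ring
  have hps : pertSize m ε 0 = ε := by simp [pertSize]
  have hdiag : ∀ ω : EuclideanSpace ℝ (Fin ν),
      DiagBound lam ω (freeDiag lam ω) (2 * ε - 2 * pertSize m ε 0) := by
    intro ω
    refine ⟨fun i k => ?_, fun s => ?_⟩
    · simp [freeDiag]
    · rw [hps, sub_self, sub_self, norm_zero, zero_div]
  refine ⟨?_, fun l => ?_, fun l => ?_, hdiag ω, hdiag ω', fun s => ?_⟩
  · rw [hwd, hps]
    -- With K the averaging constant, the generator has size 2Kw/M, so the new perturbation is at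
    -- most 24 · w · 2Kw/M = 48Kw²/M.
    refine (PairBound.nextPert hwp hpair ENNReal.ofReal_ne_top hhalf x2).mono
      (fun _ _ => le_rfl) ?_
    rw [show (24 : ℝ≥0∞) = ENNReal.ofReal 24 by simp, ← ENNReal.ofReal_mul hw,
      ← ENNReal.ofReal_mul (by norm_num)]
    refine ENNReal.ofReal_le_ofReal (le_trans (le_of_eq ?_) hε)
    ring
  · exact (hinv l).nextPert continuous_id (by norm_num) hwp.one_le ((hdiag ω).sub_shift l) x1 f2
      (x2.left.trans hhalf)
  · exact (hinv l).nextPert continuous_id (by norm_num) hwp.one_le ((hdiag ω').sub_shift l) x1' f2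
      (x2.right.trans hhalf)
  · rw [sub_self, sub_self, sub_self, norm_zero, hps, sub_self, zero_mul]

end

noncomputable section

open scoped ENNReal ComplexConjugate
open Filter Topology

variable {ν : ℕ} {lam : SignedMode → ℝ} {q m : ℕ} {σ γ ε : ℝ}

/-! ### Conjugation to diagonal form -/

/-- The sign of a signed mode. -/
def modeSign (i : SignedMode) : ℝ := if i.1 then 1 else -1

theorem abs_modeSign (i : SignedMode) : |modeSign i| = 1 := by
  unfold modeSign; split_ifs <;> simp

/-- The properties of the perturbation that the conjugation to diagonal form relies on. -/
structure AdmissiblePert (q : ℕ) (σ w : ℝ) (W : MatOp (Mode ν)) : Prop where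
  nonneg : 0 ≤ w
  bound : opSchur (weightU (q + 1) σ) W ≤ ENNReal.ofReal w
  inv : ShiftInvariant W
  zeroAverage : ZeroAverage W
  real : RealStructure (-1) W
  symm : ∀ s t, modeSign s.1 * conj (entry W s t) = modeSign t.1 * entry W t s

/-- The diagonals of the iteration at the frequency `ω`. -/
def iterDiag (lam : SignedMode → ℝ) (W : MatOp (Mode ν)) (n : ℕ) (ω : EuclideanSpace ℝ (Fin ν))
    (i : SignedMode) : ℂ := (scheme (freeDiag lam ω) (averagedPert lam W ω) n).1 (i, 0)

/-- The final eigenvalues. -/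
def finalDiag (lam : SignedMode → ℝ) (W : MatOp (Mode ν)) (ω : EuclideanSpace ℝ (Fin ν))
    (i : SignedMode) : ℂ := limDiag (freeDiag lam ω) (averagedPert lam W ω) (i, 0)

/-- The smallness conditions under which the scheme converges. -/
structure SchemeSmall (lam : SignedMode → ℝ) (m : ℕ) (σ c γ Λ w M ε : ℝ) : Prop where
  fast : FastParams lam Λ (2 * σ) c γ M
  kam : KamSmall lam m σ γ ε
  first : 16 * averagingConst m Λ γ c * w ≤ M
  size : 48 * averagingConst m Λ γ c * w ^ 2 / M ≤ ε
  total : 4 * averagingConst m Λ γ c * w / M + 8 * kamConst m σ γ * ε ≤ 1 / 4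

/-- Nonresonance at the steps before the `N`-th one. -/
structure NonResonantBefore (lam : SignedMode → ℝ) (W : MatOp (Mode ν)) (m : ℕ) (γ M : ℝ) (N : ℕ)
    (ω : EuclideanSpace ℝ (Fin ν)) : Prop where
  fast : FastNonResonant lam m γ M ω
  steps : ∀ n < N, NonResonant m γ ω (iterDiag lam W n ω) n

theorem averagingConst_nonneg (hp : FastParams lam Λ σ c γ M) : 0 ≤ averagingConst m Λ γ c := by
  have := hp.gamma_pos
  have := hp.loss_pos
  have : 0 < Λ := zero_lt_one.trans_le hp.growth_one
  unfold averagingConst expLoss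
  positivity

variable {W : MatOp (Mode ν)} {Λ c w M : ℝ}

theorem NonResonantBefore.schemeBound (hs : SchemeSmall lam m σ c γ Λ w M ε)
    (hW : AdmissiblePert q (2 * σ + c) w W) {N : ℕ} {ω ω' : EuclideanSpace ℝ (Fin ν)}
    (hn : NonResonantBefore lam W m γ M N ω) (hn' : NonResonantBefore lam W m γ M N ω') :
    SchemeBound lam q m σ ε ω ω' N
      (scheme (freeDiag lam ω) (averagedPert lam W ω) N).1
      (scheme (freeDiag lam ω') (averagedPert lam W ω') N).1
      (scheme (freeDiag lam ω) (averagedPert lam W ω) N).2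
      (scheme (freeDiag lam ω') (averagedPert lam W ω') N).2 := by
  have hK := averagingConst_nonneg (m := m) hs.fast
  have hw := hW.nonneg
  refine SchemeBound.iterate hs.kam ?_ N hn.steps hn'.steps
  refine averaged_schemeBound hs.fast hn.fast hn'.fast hW.zeroAverage hW.nonneg hW.bound hW.inv
    (le_trans ?_ hs.first) hs.size
  gcongr
  norm_num

theorem NonResonantBefore.iterDiag_close (hs : SchemeSmall lam m σ c γ Λ w M ε)
    (hW : AdmissiblePert q (2 * σ + c) w W) {N : ℕ} {ω : EuclideanSpace ℝ (Fin ν)}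
    (hn : NonResonantBefore lam W m γ M N ω) (i : SignedMode) :
    ‖iterDiag lam W N ω i - lam i‖ ≤ 2 * ε / japanese i.2 := by
  have h := (hn.schemeBound hs hW hn).diag.close (i, 0)
  have hJ := japanese_pos i.2
  have hp : 0 ≤ pertSize m ε N := by
    have := hs.kam.size_nonneg
    have := one_le_kamRate m
    unfold pertSize; positivity
  have e : freeDiag lam ω (i, 0) = lam i := by simp [freeDiag]
  rw [e] at h
  refine h.trans ?_
  gcongr
  linarith

theorem NonResonantBefore.iterDiag_lip (hs : SchemeSmall lam m σ c γ Λ w M ε)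
    (hW : AdmissiblePert q (2 * σ + c) w W) {N : ℕ} {ω ω' : EuclideanSpace ℝ (Fin ν)}
    (hn : NonResonantBefore lam W m γ M N ω) (hn' : NonResonantBefore lam W m γ M N ω')
    (i : SignedMode) :
    ‖iterDiag lam W N ω i - iterDiag lam W N ω' i‖ ≤ 2 * ε * ‖ω - ω'‖ := by
  have h := (hn.schemeBound hs hW hn').lip (i, 0)
  have hp : 0 ≤ pertSize m ε N := by
    have := hs.kam.size_nonneg
    have := one_le_kamRate m
    unfold pertSize; positivity
  have e : ∀ ω : EuclideanSpace ℝ (Fin ν), freeDiag lam ω (i, 0) = lam i := by simp [freeDiag]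
  rw [e, e, sub_sub_sub_cancel_right] at h
  refine h.trans ?_
  gcongr
  linarith

/-- The conjugation of the system to diagonal form by a matrix close to the identity. -/
theorem exists_conjugation (hs : SchemeSmall lam m σ c γ Λ w M ε)
    (hW : AdmissiblePert q (2 * σ + c) w W) {ω : EuclideanSpace ℝ (Fin ν)}
    (hlam : ∀ b j, lam (!b, j) = -lam (b, j))
    (hn : ∀ N, NonResonantBefore lam W m γ M N ω) :
    (∀ i, Tendsto (fun n => iterDiag lam W n ω i) atTop (𝓝 (finalDiag lam W ω i))) ∧
    (∀ i, ‖finalDiag lam W ω i - lam i‖ ≤ 2 * ε / japanese i.2) ∧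
    (∀ i, (finalDiag lam W ω i).im = 0) ∧
    (∀ b j, finalDiag lam W ω (!b, j) = -finalDiag lam W ω (b, j)) ∧
    ∃ T : MatOp (Mode ν), ShiftInvariant T ∧ RealStructure 1 T ∧
      opSchur (weightZ q σ) (T - 1) ≤
        ENNReal.ofReal (4 * averagingConst m Λ γ c * w / M + 8 * kamConst m σ γ * ε) ∧
      Intertwines (freeDiag lam ω) W T
        (fun s => (inner ℝ ω (freq s.2) : ℝ) + finalDiag lam W ω s.1) 0 := by
  have hK := averagingConst_nonneg (m := m) hs.fast
  have hw := hW.nonneg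
  have hσ := hs.kam.width_pos
  have hM : 0 < M := zero_lt_one.trans_le hs.fast.one_le
  have h0 := (hn 0).schemeBound hs hW (hn 0)
  simp only [scheme] at h0
  have hMw : 4 * averagingConst m Λ γ c * w ≤ M := by
    refine le_trans ?_ hs.first
    gcongr
    norm_num
  obtain ⟨x1, x2⟩ := averaging_pairBound hs.fast (hn 0).fast (hn 0).fast hW.zeroAverage hW.bound
  obtain ⟨f1, f2, f3⟩ := averaged_facts (q := q) hs.fast ω hW.zeroAverage hW.bound
  have hwp := weightPair (ν := ν) q hs.fast.width_nonneg
  have hwσ := weightPair (ν := ν) q hσ.le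
  have hhalf := averaging_half hM hMw
  have hE : ∀ s, freeDiag lam ω (negMode s) = (-1 : ℂ) * conj (freeDiag lam ω s) := by
    rintro ⟨⟨b, j⟩, k⟩
    simp only [negMode_apply, freeDiag, freq_neg, inner_neg_right, hlam, Complex.conj_ofReal]
    push_cast
    ring
  have hE' : ∀ s t, freeDiag lam ω (negMode s) - freeDiag lam ω (negMode t) =
      (-1 : ℂ) * conj (freeDiag lam ω s - freeDiag lam ω t) := by
    intro s t
    rw [hE, hE, map_sub, mul_sub]
  have hreal : RealStructure (-1) (averagedPert lam W ω) :=
    Equivariant.nextPert Complex.continuous_conj (by norm_num) hwp.one_le hW.real hE' x1 f2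
      (x2.left.trans hhalf)
  obtain ⟨l1, l2, l3, T, t1, t2, t3, t4⟩ := exists_diagonalization hs.kam h0
    (fun n => (hn (n + 1)).steps n (Nat.lt_succ_self n)) hreal
    (fun s => by rw [hE, neg_one_mul])
  set X := homSol (freeDiag lam ω) W with hX
  -- Only divisors between different Fourier indices have to be nonzero, since W has no other
  -- entries; `exists_lower` supplies this.
  have hstep : Intertwines (freeDiag lam ω) W (1 + X) (freeDiag lam ω) (averagedPert lam W ω) := by
    have := intertwines_step (isUnit_one_add hwp.one_le (x2.left.trans hhalf))
      (fun s t _ hst => ?_) x1 f2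
    · rwa [f3] at this
    · by_cases hk : s.2 = t.2
      · exact absurd (hW.zeroAverage s t hk) hst
      · obtain ⟨a, -, a1, -⟩ := (hn 0).fast.exists_lower (q := q) hs.fast (hn 0).fast s t hk
        intro h
        rw [h, sub_self, norm_zero, mul_zero] at a1
        norm_num at a1
  have hI := hstep.trans t1
  have hXZ : opSchur (weightZ q σ) X ≤
      ENNReal.ofReal (2 * (averagingConst m Λ γ c / M * w)) :=
    (opSchur_mono (weightZ_mono le_rfl (by linarith)) X).trans x2.left
  have hT : opSchur (weightZ q σ) ((1 + X) * T - 1) ≤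
      ENNReal.ofReal (4 * averagingConst m Λ γ c * w / M + 8 * kamConst m σ γ * ε) := by
    -- With x and y the bounds on X and T - 1, the sum x + y + xy is at most 2x + y because y ≤ 1;
    -- the 4 in the final constant is twice the 2 in x.
    have e : (1 + X) * T - 1 = X + (T - 1) + X * (T - 1) := by noncomm_ring
    have hC := hs.kam.kamConst_pos
    have hε := hs.kam.size_nonneg
    have hle : 8 * kamConst m σ γ * ε ≤ 1 := by
      have h1 := hs.total
      have : 0 ≤ 4 * averagingConst m Λ γ c * w / M := by positivity
      linarith
    have hx0 : 0 ≤ 2 * (averagingConst m Λ γ c / M * w) := by positivity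
    rw [e]
    calc _ ≤ ENNReal.ofReal (2 * (averagingConst m Λ γ c / M * w)) +
          ENNReal.ofReal (8 * kamConst m σ γ * ε) +
          ENNReal.ofReal (2 * (averagingConst m Λ γ c / M * w)) *
            ENNReal.ofReal (8 * kamConst m σ γ * ε) := by
          refine (opSchur_add_le _ _ _).trans (add_le_add ((opSchur_add_le _ _ _).trans
            (add_le_add hXZ t4)) ((opSchur_mul_le (fun s t => zero_le_one.trans (hwσ.one_le s t))
              hwσ.mul _ _).trans ?_))
          gcongr
      _ ≤ _ := by
          rw [← ENNReal.ofReal_mul hx0, ← ENNReal.ofReal_add hx0 (by positivity),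
            ← ENNReal.ofReal_add (by positivity) (by positivity)]
          refine ENNReal.ofReal_le_ofReal ?_
          have h2 : 2 * (averagingConst m Λ γ c / M * w) * (8 * kamConst m σ γ * ε) ≤
              2 * (averagingConst m Λ γ c / M * w) := mul_le_of_le_one_right hx0 hle
          have h3 : 4 * averagingConst m Λ γ c * w / M =
              2 * (2 * (averagingConst m Λ γ c / M * w)) := by ring
          linarith
  -- Reality is derived once, for the limit and from the original W. Symmetry of the intermediate
  -- perturbations is not tracked, which is why the nonresonance conditions speak of real parts.
  have him : ∀ s, (limDiag (freeDiag lam ω) (averagedPert lam W ω) s).im = 0 := by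
    refine im_eq_zero_of_intertwines hI (sg := fun s => modeSign s.1)
      (fun s => abs_modeSign s.1) hW.symm fun t => ?_
    have h1 := column_le_schur (weightZ q σ) (entry ((1 + X) * T - 1)) t
    refine (ENNReal.tsum_le_tsum fun s => ?_).trans (h1.trans (hT.trans
      ((ENNReal.ofReal_le_ofReal hs.total).trans (by
        rw [one_div, ENNReal.ofReal_inv_of_pos (by norm_num)]; simp))))
    refine le_mul_of_one_le_right (by simp) ?_
    simpa using hwσ.one_le s t
  have efree : ∀ i, freeDiag lam ω (i, 0) = lam i := by simp [freeDiag]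
  refine ⟨fun i => l1 (i, 0), fun i => ?_, fun i => him (i, 0), fun b j => ?_, (1 + X) * T, ?_, ?_,
    hT, ?_⟩
  · have := l2.close (i, 0)
    rwa [efree] at this
  · have := l3 ((b, j), 0)
    rw [negMode_apply, neg_zero, Complex.conj_eq_iff_im.2 (him _)] at this
    exact this
  · intro l
    have hd : ∀ s t, freeDiag lam ω (shiftMode l s) - freeDiag lam ω (shiftMode l t) =
      1 * RingHom.id ℂ (freeDiag lam ω s - freeDiag lam ω t) := fun s t => h0.diag.sub_shift l s t
    have := (equivariant_one.add ((hW.inv l).homSol (by norm_num) hd x1)).mul continuous_id (t2 l)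
    rwa [one_mul] at this
  · have := (equivariant_one.add (Equivariant.homSol (by norm_num) hW.real hE' x1)).mul
      Complex.continuous_conj t3
    rwa [one_mul] at this
  · have e : (fun s : Mode ν => ((inner ℝ ω (freq s.2) : ℝ) : ℂ) + finalDiag lam W ω s.1) =
        limDiag (freeDiag lam ω) (averagedPert lam W ω) := by
      funext s
      exact (l2.shift s.1 s.2).symm
    rw [e]
    exact hI

end

noncomputable section

open scoped ENNReal ComplexConjugate
open Filter Topology SineSobolev

/-! ### Matrices on `ℓ²` -/

theorem ENNReal.mul_le_sq_add_sq (a b : ℝ≥0∞) : a * b ≤ a ^ 2 + b ^ 2 := by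
  rcases le_total a b with h | h
  · calc a * b ≤ b * b := by gcongr
      _ ≤ _ := by rw [sq, sq]; exact le_add_self
  · calc a * b ≤ a * a := by gcongr
      _ ≤ _ := by rw [sq, sq]; exact le_self_add

/-- A Cauchy–Schwarz inequality with the harmless constant 2: the square is expanded as a double sum
and v_j v_l ≤ v_j² + v_l² is applied to each term. -/
theorem ENNReal.tsum_mul_sq_le {ι : Type*} (b v : ι → ℝ≥0∞) :
    (∑' j, b j * v j) ^ 2 ≤ 2 * ((∑' j, b j) * ∑' j, b j * v j ^ 2) := by
  calc (∑' j, b j * v j) ^ 2 = ∑' j, ∑' l, (b j * v j) * (b l * v l) := by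
        rw [sq, ← ENNReal.tsum_mul_right]
        simp only [ENNReal.tsum_mul_left]
    _ ≤ ∑' j, ∑' l, (b l * (b j * v j ^ 2) + b j * (b l * v l ^ 2)) := by
        refine ENNReal.tsum_le_tsum fun j => ENNReal.tsum_le_tsum fun l => ?_
        calc (b j * v j) * (b l * v l) = b j * b l * (v j * v l) := by ring
          _ ≤ b j * b l * (v j ^ 2 + v l ^ 2) := by gcongr; exact ENNReal.mul_le_sq_add_sq _ _
          _ = _ := by ring
    _ = _ := by
        simp only [ENNReal.tsum_add, ENNReal.tsum_mul_left, ENNReal.tsum_mul_right]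
        ring

theorem lpTwo_enorm_sq {ι : Type*} (x : lp (fun _ : ι => ℂ) 2) : ‖x‖ₑ ^ 2 = ∑' s, ‖x s‖ₑ ^ 2 := by
  have h := lp.norm_rpow_eq_tsum (p := 2) (by norm_num) x
  simp only [ENNReal.toReal_ofNat, Real.rpow_ofNat] at h
  have hs : Summable fun s => ‖x s‖ ^ 2 := by
    have := (lp.memℓp x).summable (by norm_num : 0 < (2 : ℝ≥0∞).toReal)
    simpa using this
  rw [← ofReal_norm, ← ENNReal.ofReal_pow (norm_nonneg _), h,
    ENNReal.ofReal_tsum_of_nonneg (fun _ => sq_nonneg _) hs]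
  refine tsum_congr fun s => ?_
  rw [ENNReal.ofReal_pow (norm_nonneg _), ofReal_norm]

theorem memℓp_two_of_tsum_ne_top {ι : Type*} {f : ι → ℂ} (h : ∑' s, ‖f s‖ₑ ^ 2 ≠ ∞) :
    Memℓp f 2 := by
  rw [memℓp_gen_iff (by norm_num)]
  have := ENNReal.summable_toReal h
  simpa using this

/-- The Schur test. -/
theorem exists_lpTwo_op {ι : Type*} {a : ι → ι → ℂ} {N : ℝ≥0}
    (hcol : ∀ j, ∑' i, ‖a i j‖ₑ ≤ N) (hrow : ∀ i, ∑' j, ‖a i j‖ₑ ≤ N) :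
    ∃ A : lp (fun _ : ι => ℂ) 2 →L[ℂ] lp (fun _ : ι => ℂ) 2, ‖A‖ ≤ 2 * N ∧
      ∀ x i, HasSum (fun j => a i j * x j) (A x i) := by
  have key : ∀ x : lp (fun _ : ι => ℂ) 2,
      ∑' i, (∑' j, ‖a i j‖ₑ * ‖x j‖ₑ) ^ 2 ≤ 2 * N ^ 2 * ‖x‖ₑ ^ 2 := by
    intro x
    calc _ ≤ ∑' i, 2 * (N * ∑' j, ‖a i j‖ₑ * ‖x j‖ₑ ^ 2) := by
          refine ENNReal.tsum_le_tsum fun i => (ENNReal.tsum_mul_sq_le _ _).trans ?_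
          gcongr
          exact hrow i
      _ = 2 * (N * ∑' j, (∑' i, ‖a i j‖ₑ) * ‖x j‖ₑ ^ 2) := by
          rw [ENNReal.tsum_mul_left, ENNReal.tsum_mul_left, ENNReal.tsum_comm]
          simp only [ENNReal.tsum_mul_right]
      _ ≤ 2 * (N * ∑' j, N * ‖x j‖ₑ ^ 2) := by
          gcongr with j
          exact hcol j
      _ = _ := by
          rw [ENNReal.tsum_mul_left, ← lpTwo_enorm_sq]
          ring
  have hfin : ∀ x : lp (fun _ : ι => ℂ) 2, ∀ i, Summable fun j => a i j * x j := by
    intro x i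
    have h1 : (∑' j, ‖a i j‖ₑ * ‖x j‖ₑ) ^ 2 ≠ ∞ :=
      ne_top_of_le_ne_top (by finiteness)
        ((ENNReal.le_tsum (f := fun i => (∑' j, ‖a i j‖ₑ * ‖x j‖ₑ) ^ 2) i).trans (key x))
    have h2 : ∑' j, ‖a i j‖ₑ * ‖x j‖ₑ ≠ ∞ := by
      intro h; rw [h] at h1; simp at h1
    have h3 := ENNReal.summable_toReal h2
    refine Summable.of_norm ?_
    simpa using h3
  have hmem : ∀ x : lp (fun _ : ι => ℂ) 2,
      ∑' i, ‖∑' j, a i j * x j‖ₑ ^ 2 ≤ 2 * N ^ 2 * ‖x‖ₑ ^ 2 := by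
    intro x
    refine le_trans (ENNReal.tsum_le_tsum fun i => ?_) (key x)
    gcongr
    refine enorm_tsum_le_tsum_enorm.trans (le_of_eq ?_)
    simp [enorm_mul]
  let L : lp (fun _ : ι => ℂ) 2 →ₗ[ℂ] lp (fun _ : ι => ℂ) 2 :=
    { toFun := fun x => ⟨fun i => ∑' j, a i j * x j,
        memℓp_two_of_tsum_ne_top (ne_top_of_le_ne_top (by finiteness) (hmem x))⟩
      map_add' := by
        intro x y
        ext i
        change ∑' j, a i j * (x j + y j) = ∑' j, a i j * x j + ∑' j, a i j * y j
        rw [← (hfin x i).tsum_add (hfin y i)]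
        simp only [mul_add]
      map_smul' := by
        intro c x
        ext i
        change ∑' j, a i j * (c * x j) = c * ∑' j, a i j * x j
        rw [← tsum_mul_left]
        simp only [mul_left_comm] }
  have hL : ∀ x, ‖L x‖ ≤ 2 * N * ‖x‖ := by
    intro x
    have h1 : ‖L x‖ₑ ^ 2 ≤ (2 * N * ‖x‖ₑ) ^ 2 := by
      rw [lpTwo_enorm_sq]
      refine (hmem x).trans ?_
      rw [mul_pow, mul_pow]
      gcongr
      norm_num
    have h2 : ‖L x‖ₑ ≤ 2 * N * ‖x‖ₑ := (ENNReal.pow_le_pow_left_iff two_ne_zero).1 h1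
    have := (ENNReal.toReal_le_toReal (by simp) (by finiteness)).2 h2
    simpa using this
  exact ⟨L.mkContinuous (2 * N) hL, L.mkContinuous_norm_le (by positivity) hL,
    fun x i => (hfin x i).hasSum⟩

/-! ### Coordinates on the phase space -/

/-- The coefficient of a point of the phase space at a signed mode. -/
def modeCoeff {r : ℝ} (u : PhaseSpace r) (i : SignedMode) : ℂ :=
  if i.1 then coeff u.1 i.2 else coeff u.2 i.2

theorem modeCoeff_ext {r : ℝ} {u v : PhaseSpace r} (h : ∀ i, modeCoeff u i = modeCoeff v i) :
    u = v := by
  refine Prod.ext (Subtype.ext (funext fun n => ?_)) (Subtype.ext (funext fun n => ?_))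
  · have := h (true, n)
    simp only [modeCoeff, if_true] at this
    exact this
  · have := h (false, n)
    simp only [modeCoeff, Bool.false_eq_true, if_false] at this
    exact this

theorem modeCoeff_add {r : ℝ} (u v : PhaseSpace r) (i : SignedMode) :
    modeCoeff (u + v) i = modeCoeff u i + modeCoeff v i := by
  unfold modeCoeff; split_ifs <;> simp

theorem modeCoeff_smul {r : ℝ} (c : ℂ) (u : PhaseSpace r) (i : SignedMode) :
    modeCoeff (c • u) i = c * modeCoeff u i := by
  unfold modeCoeff; split_ifs <;> simp

theorem sineSobolev_enorm_sq {r : ℝ} (φ : SineSobolev r) :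
    ‖φ‖ₑ ^ 2 = ∑' m, ‖((japanese m ^ r : ℝ) : ℂ) * coeff φ m‖ₑ ^ 2 :=
  lpTwo_enorm_sq (weight r φ)

theorem tsum_signedMode (f : SignedMode → ℝ≥0∞) :
    ∑' i, f i = ∑' n, f (true, n) + ∑' n, f (false, n) := by
  rw [ENNReal.tsum_prod (f := fun b n => f (b, n)), tsum_bool, add_comm]

theorem weighted_modeCoeff_tsum {r : ℝ} (u : PhaseSpace r) :
    ∑' i, ‖((japanese i.2 ^ r : ℝ) : ℂ) * modeCoeff u i‖ₑ ^ 2 = ‖u.1‖ₑ ^ 2 + ‖u.2‖ₑ ^ 2 := by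
  rw [tsum_signedMode, sineSobolev_enorm_sq, sineSobolev_enorm_sq]
  simp [modeCoeff]

theorem weight_ne_zero (r : ℝ) (m : ℕ+) : ((japanese m ^ r : ℝ) : ℂ) ≠ 0 :=
  Complex.ofReal_ne_zero.2 (Real.rpow_pos_of_pos (japanese_pos m) r).ne'

/-- The sequence with the given weighted coefficients. -/
def ofWeighted (r : ℝ) (x : ℕ+ → ℂ) (h : ∑' m, ‖x m‖ₑ ^ 2 ≠ ∞) : SineSobolev r :=
  ⟨fun m => ((japanese m ^ r : ℝ) : ℂ)⁻¹ * x m, by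
    refine (memℓp_weight_iff r _).1 ?_
    convert memℓp_two_of_tsum_ne_top h using 1
    funext m
    rw [mul_inv_cancel_left₀ (weight_ne_zero r m)]⟩

/-- The phase space as a weighted `ℓ²` space. -/
def phaseLinearEquiv (r : ℝ) : PhaseSpace r ≃ₗ[ℂ] lp (fun _ : SignedMode => ℂ) 2 where
  toFun := fun u => ⟨fun i => ((japanese i.2 ^ r : ℝ) : ℂ) * modeCoeff u i,
    memℓp_two_of_tsum_ne_top (by rw [weighted_modeCoeff_tsum]; finiteness)⟩
  invFun := fun x => (ofWeighted r (fun n => x (true, n)) (by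
      have : ‖x‖ₑ ^ 2 ≠ ∞ := by finiteness
      rw [lpTwo_enorm_sq, tsum_signedMode] at this
      exact ne_top_of_le_ne_top this le_self_add),
    ofWeighted r (fun n => x (false, n)) (by
      have : ‖x‖ₑ ^ 2 ≠ ∞ := by finiteness
      rw [lpTwo_enorm_sq, tsum_signedMode] at this
      exact ne_top_of_le_ne_top this le_add_self))
  left_inv := by
    intro u
    refine modeCoeff_ext fun i => ?_
    rcases i with ⟨b, n⟩
    have h := weight_ne_zero r n
    cases b
    · change ((japanese n ^ r : ℝ) : ℂ)⁻¹ * (((japanese n ^ r : ℝ) : ℂ) * _) = _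
      rw [inv_mul_cancel_left₀ h]
    · change ((japanese n ^ r : ℝ) : ℂ)⁻¹ * (((japanese n ^ r : ℝ) : ℂ) * _) = _
      rw [inv_mul_cancel_left₀ h]
  right_inv := by
    intro x
    ext i
    rcases i with ⟨b, n⟩
    have h := weight_ne_zero r n
    cases b
    · change ((japanese n ^ r : ℝ) : ℂ) * (((japanese n ^ r : ℝ) : ℂ)⁻¹ * _) = _
      rw [mul_inv_cancel_left₀ h]
    · change ((japanese n ^ r : ℝ) : ℂ) * (((japanese n ^ r : ℝ) : ℂ)⁻¹ * _) = _
      rw [mul_inv_cancel_left₀ h]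
  map_add' := by
    intro u v
    ext i
    change ((japanese i.2 ^ r : ℝ) : ℂ) * modeCoeff (u + v) i = _ * _ + _ * _
    rw [modeCoeff_add, mul_add]
  map_smul' := by
    intro c u
    ext i
    change ((japanese i.2 ^ r : ℝ) : ℂ) * modeCoeff (c • u) i = c * (_ * _)
    rw [modeCoeff_smul, mul_left_comm]

theorem phaseLinearEquiv_enorm_sq {r : ℝ} (u : PhaseSpace r) :
    ‖phaseLinearEquiv r u‖ₑ ^ 2 = ‖u.1‖ₑ ^ 2 + ‖u.2‖ₑ ^ 2 := by
  rw [lpTwo_enorm_sq, ← weighted_modeCoeff_tsum]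
  rfl

theorem norm_le_of_enorm_sq_le {E F : Type*} [NormedAddCommGroup E] [NormedAddCommGroup F] {x : E}
    {y : F} {C : ℝ≥0} (h : ‖x‖ₑ ^ 2 ≤ (C * ‖y‖ₑ) ^ 2) : ‖x‖ ≤ C * ‖y‖ := by
  have h2 := (ENNReal.pow_le_pow_left_iff two_ne_zero).1 h
  have := (ENNReal.toReal_le_toReal (by simp) (by finiteness)).2 h2
  simpa using this

theorem phaseLinearEquiv_norm_le {r : ℝ} (u : PhaseSpace r) : ‖phaseLinearEquiv r u‖ ≤ 2 * ‖u‖ := by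
  refine norm_le_of_enorm_sq_le (C := 2) ?_
  rw [phaseLinearEquiv_enorm_sq]
  have h1 : ‖u.1‖ₑ ≤ ‖u‖ₑ := enorm_le_iff_norm_le.2 (norm_fst_le u)
  have h2 : ‖u.2‖ₑ ≤ ‖u‖ₑ := enorm_le_iff_norm_le.2 (norm_snd_le u)
  calc _ ≤ ‖u‖ₑ ^ 2 + ‖u‖ₑ ^ 2 := by gcongr
    _ = 2 * ‖u‖ₑ ^ 2 := by ring
    _ ≤ _ := by rw [mul_pow]; gcongr; norm_num

theorem phaseLinearEquiv_symm_norm_le {r : ℝ} (x : lp (fun _ : SignedMode => ℂ) 2) :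
    ‖(phaseLinearEquiv r).symm x‖ ≤ 2 * ‖x‖ := by
  obtain ⟨u, rfl⟩ := (phaseLinearEquiv r).surjective x
  rw [LinearEquiv.symm_apply_apply]
  have h := phaseLinearEquiv_enorm_sq u
  have h1 : ‖u.1‖ ≤ 1 * ‖phaseLinearEquiv r u‖ :=
    norm_le_of_enorm_sq_le (C := 1) (by rw [ENNReal.coe_one, one_mul, h]; exact le_self_add)
  have h2 : ‖u.2‖ ≤ 1 * ‖phaseLinearEquiv r u‖ :=
    norm_le_of_enorm_sq_le (C := 1) (by rw [ENNReal.coe_one, one_mul, h]; exact le_add_self)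
  have h3 := norm_nonneg (phaseLinearEquiv r u)
  exact (max_le h1 h2).trans (by linarith)

/-- The phase space as a weighted `ℓ²` space. -/
def phaseEquiv (r : ℝ) : PhaseSpace r ≃L[ℂ] lp (fun _ : SignedMode => ℂ) 2 :=
  (phaseLinearEquiv r).toContinuousLinearEquivOfBounds 2 2 phaseLinearEquiv_norm_le
    phaseLinearEquiv_symm_norm_le

theorem phaseEquiv_apply {r : ℝ} (u : PhaseSpace r) (i : SignedMode) :
    phaseEquiv r u i = ((japanese i.2 ^ r : ℝ) : ℂ) * modeCoeff u i := rfl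

theorem norm_phaseEquiv_le (r : ℝ) :
    ‖(phaseEquiv r : PhaseSpace r →L[ℂ] lp (fun _ : SignedMode => ℂ) 2)‖ ≤ 2 :=
  ContinuousLinearMap.opNorm_le_bound _ (by norm_num) phaseLinearEquiv_norm_le

theorem norm_phaseEquiv_symm_le (r : ℝ) :
    ‖((phaseEquiv r).symm : lp (fun _ : SignedMode => ℂ) 2 →L[ℂ] PhaseSpace r)‖ ≤ 2 :=
  ContinuousLinearMap.opNorm_le_bound _ (by norm_num) phaseLinearEquiv_symm_norm_le

instance (r : ℝ) : CompleteSpace (PhaseSpace r) :=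
  (completeSpace_congr (e := (phaseEquiv r).toEquiv) (phaseEquiv r).isUniformEmbedding).2 inferInstance

/-- A coefficient as a continuous functional. -/
def modeCoeffL (r : ℝ) (i : SignedMode) : PhaseSpace r →L[ℂ] ℂ :=
  ((japanese i.2 ^ r : ℝ) : ℂ)⁻¹ •
    ((lp.evalCLM ℂ (fun _ : SignedMode => ℂ) 2 i).comp
      (phaseEquiv r : PhaseSpace r →L[ℂ] lp (fun _ : SignedMode => ℂ) 2))

theorem modeCoeffL_apply {r : ℝ} (i : SignedMode) (u : PhaseSpace r) :
    modeCoeffL r i u = modeCoeff u i := by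
  change ((japanese i.2 ^ r : ℝ) : ℂ)⁻¹ * (phaseEquiv r u i) = _
  rw [phaseEquiv_apply, inv_mul_cancel_left₀ (weight_ne_zero r i.2)]

/-- Conjugating a matrix by ⟨·⟩^r multiplies its entries by this ratio, so decay of order q makes
the matrix act on all 𝓗^r with |r| ≤ q, of either sign. -/
theorem rpow_ratio_le_modeRatio {q : ℕ} {r : ℝ} (hr : |r| ≤ q) (i j : ℕ+) :
    japanese i ^ r * (japanese j ^ r)⁻¹ ≤ modeRatio i j ^ q := by
  have hi := japanese_pos i
  have hj := japanese_pos j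
  have h1 := one_le_modeRatio i j
  rw [← div_eq_mul_inv, ← Real.div_rpow hi.le hj.le, ← Real.rpow_natCast]
  rcases le_total 0 r with h0 | h0
  · rw [abs_of_nonneg h0] at hr
    exact (Real.rpow_le_rpow (by positivity) (japanese_div_le_modeRatio i j) h0).trans
      (Real.rpow_le_rpow_of_exponent_le h1 hr)
  · rw [abs_of_nonpos h0] at hr
    rw [← neg_neg r, Real.rpow_neg (by positivity), ← Real.inv_rpow (by positivity), inv_div]
    refine (Real.rpow_le_rpow (by positivity) (japanese_div_le_modeRatio j i)
      (neg_nonneg.2 h0)).trans ?_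
    rw [modeRatio_comm]
    exact Real.rpow_le_rpow_of_exponent_le h1 hr

/-- Matrices with off-diagonal decay act on the Sobolev spaces. -/
theorem exists_phaseOp {q : ℕ} {r : ℝ} (hr : |r| ≤ q) {a : SignedMode → SignedMode → ℂ} {N : ℝ≥0}
    (hcol : ∀ j, ∑' i : SignedMode, ‖a i j‖ₑ * ENNReal.ofReal (modeRatio i.2 j.2 ^ q) ≤ N)
    (hrow : ∀ i, ∑' j : SignedMode, ‖a i j‖ₑ * ENNReal.ofReal (modeRatio i.2 j.2 ^ q) ≤ N) :
    ∃ A : PhaseOp r, ‖A‖ ≤ 8 * N ∧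
      ∀ u i, HasSum (fun j => a i j * modeCoeff u j) (modeCoeff (A u) i) := by
  have hle : ∀ i j : SignedMode,
      ‖((japanese i.2 ^ r : ℝ) : ℂ) * a i j * ((japanese j.2 ^ r : ℝ) : ℂ)⁻¹‖ₑ ≤
      ‖a i j‖ₑ * ENNReal.ofReal (modeRatio i.2 j.2 ^ q) := by
    intro i j
    have hi := Real.rpow_nonneg (japanese_pos i.2).le r
    have hj := Real.rpow_nonneg (japanese_pos j.2).le r
    rw [← ofReal_norm, ← ofReal_norm (a i j), ← ENNReal.ofReal_mul (norm_nonneg _)]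
    refine ENNReal.ofReal_le_ofReal ?_
    rw [norm_mul, norm_mul, norm_inv, Complex.norm_real, Complex.norm_real,
      Real.norm_of_nonneg hi, Real.norm_of_nonneg hj]
    have := mul_le_mul_of_nonneg_left (rpow_ratio_le_modeRatio hr i.2 j.2) (norm_nonneg (a i j))
    linarith
  obtain ⟨B, hB, hsum⟩ := exists_lpTwo_op
    (a := fun i j => ((japanese i.2 ^ r : ℝ) : ℂ) * a i j * ((japanese j.2 ^ r : ℝ) : ℂ)⁻¹)
    (fun j => (ENNReal.tsum_le_tsum fun i => hle i j).trans (hcol j))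
    (fun i => (ENNReal.tsum_le_tsum fun j => hle i j).trans (hrow i))
  refine ⟨((phaseEquiv r).symm : lp (fun _ : SignedMode => ℂ) 2 →L[ℂ] PhaseSpace r).comp
    (B.comp (phaseEquiv r : PhaseSpace r →L[ℂ] lp (fun _ : SignedMode => ℂ) 2)), ?_, ?_⟩
  · refine (ContinuousLinearMap.opNorm_comp_le _ _).trans ?_
    have h1 := (ContinuousLinearMap.opNorm_comp_le B
      (phaseEquiv r : PhaseSpace r →L[ℂ] lp (fun _ : SignedMode => ℂ) 2))
    have h2 := norm_phaseEquiv_le r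
    have h3 := norm_phaseEquiv_symm_le r
    -- Each 2 outside comes from comparing the maximum norm of the product with the `ℓ²` norm, the
    -- one in the middle from the Schur test.
    calc _ ≤ (2 : ℝ) * (2 * (N : ℝ) * 2) := by
          gcongr
          exact h1.trans (by gcongr)
      _ = 8 * (N : ℝ) := by ring
  · intro u i
    have h := (hsum (phaseEquiv r u) i).mul_left (((japanese i.2 ^ r : ℝ) : ℂ)⁻¹)
    have e : modeCoeff (((phaseEquiv r).symm : lp (fun _ : SignedMode => ℂ) 2 →L[ℂ]
        PhaseSpace r).comp (B.comp (phaseEquiv r : PhaseSpace r →L[ℂ] _)) u) i =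
        ((japanese i.2 ^ r : ℝ) : ℂ)⁻¹ * B (phaseEquiv r u) i := by
      have := phaseEquiv_apply ((phaseEquiv r).symm (B (phaseEquiv r u))) i
      rw [ContinuousLinearEquiv.apply_symm_apply] at this
      rw [this, inv_mul_cancel_left₀ (weight_ne_zero r i.2)]
      rfl
    rw [e]
    refine h.congr_fun ?_ 
    intro j
    simp only [phaseEquiv_apply]
    have h1 := weight_ne_zero r i.2
    have h2 := weight_ne_zero r j.2
    field_simp

end

noncomputable section

open scoped ENNReal ComplexConjugate
open Filter Topology SineSobolev

/-! ### Sums of exponentials -/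

/-- A summable family of exponentials of linear forms is analytic. -/
theorem analyticAt_tsum_exp {ι X E : Type*} [NormedAddCommGroup X] [NormedSpace ℂ X]
    [NormedAddCommGroup E] [NormedSpace ℂ E] [CompleteSpace E] {ℓ : ι → X →L[ℂ] ℂ} {c : ι → E}
    {z : X} {R : ℝ≥0} (hR : 0 < R)
    (hs : Summable fun k => ‖Complex.exp (ℓ k z)‖ * exp (R * ‖ℓ k‖) * ‖c k‖) :
    AnalyticAt ℂ (fun w => ∑' k, Complex.exp (ℓ k w) • c k) z := by
  -- Q k n is the multilinear form of y ↦ (ℓ_k y)^n c_k, so the sum over k of e^{ℓ_k z}/n! times Q k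
  -- n is the candidate for the n-th Taylor coefficient at z.
  let Q : ι → FormalMultilinearSeries ℂ X E := fun k n =>
    ((ContinuousMultilinearMap.mkPiAlgebraFin ℂ n ℂ).compContinuousLinearMap
      (fun _ => ℓ k)).smulRight (c k)
  have hQ : ∀ k n, ‖Q k n‖ ≤ ‖ℓ k‖ ^ n * ‖c k‖ := by
    intro k n
    refine ContinuousMultilinearMap.opNorm_le_bound (by positivity) fun m => ?_
    simp only [Q, ContinuousMultilinearMap.smulRight_apply,
      ContinuousMultilinearMap.compContinuousLinearMap_apply,
      ContinuousMultilinearMap.mkPiAlgebraFin_apply, norm_smul]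
    have h1 : ‖(List.ofFn fun i => ℓ k (m i)).prod‖ ≤ ∏ i, ‖ℓ k‖ * ‖m i‖ := by
      rw [List.prod_ofFn, norm_prod]
      exact Finset.prod_le_prod (fun _ _ => norm_nonneg _) fun i _ => (ℓ k).le_opNorm _
    rw [Finset.prod_mul_distrib, Finset.prod_const, Finset.card_univ, Fintype.card_fin] at h1
    calc _ ≤ ‖ℓ k‖ ^ n * (∏ i, ‖m i‖) * ‖c k‖ := by gcongr
      _ = _ := by ring
  have hQy : ∀ k n y, Q k n (fun _ => y) = (ℓ k y) ^ n • c k := by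
    intro k n y
    simp [Q]
  set e : ι → ℂ := fun k => Complex.exp (ℓ k z) with he
  have hterm : ∀ k n, ‖(e k * (n.factorial : ℂ)⁻¹) • Q k n‖ * (R : ℝ) ^ n ≤
      ‖e k‖ * exp (R * ‖ℓ k‖) * ‖c k‖ := by
    intro k n
    rw [norm_smul, norm_mul, norm_inv, Complex.norm_natCast]
    have h1 := Real.pow_div_factorial_le_exp (R * ‖ℓ k‖) (by positivity) n
    calc _ ≤ ‖e k‖ * (n.factorial : ℝ)⁻¹ * (‖ℓ k‖ ^ n * ‖c k‖) * (R : ℝ) ^ n := by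
          gcongr; exact hQ k n
      _ = ‖e k‖ * ((R * ‖ℓ k‖) ^ n / n.factorial) * ‖c k‖ := by rw [mul_pow]; ring
      _ ≤ _ := by gcongr
  have hsumN : ∀ n, Summable fun k => ‖(e k * (n.factorial : ℂ)⁻¹) • Q k n‖ := by
    intro n
    refine Summable.of_nonneg_of_le (fun _ => norm_nonneg _) (fun k => ?_)
      (hs.mul_left ((R : ℝ) ^ n)⁻¹)
    rw [inv_mul_eq_div, le_div_iff₀ (by positivity)]
    exact hterm k n
  have hsumQ : ∀ n, Summable fun k => (e k * (n.factorial : ℂ)⁻¹) • Q k n := fun n =>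
    (hsumN n).of_norm
  let p : FormalMultilinearSeries ℂ X E := fun n => ∑' k, (e k * (n.factorial : ℂ)⁻¹) • Q k n
  have hrad : (R : ℝ≥0∞) ≤ p.radius := by
    refine p.le_radius_of_bound (∑' k, ‖e k‖ * exp (R * ‖ℓ k‖) * ‖c k‖) fun n => ?_
    have h1 : ‖p n‖ ≤ ∑' k, ‖(e k * (n.factorial : ℂ)⁻¹) • Q k n‖ :=
      norm_tsum_le_tsum_norm (hsumN n)
    calc _ ≤ (∑' k, ‖(e k * (n.factorial : ℂ)⁻¹) • Q k n‖) * (R : ℝ) ^ n := by gcongr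
      _ = ∑' k, ‖(e k * (n.factorial : ℂ)⁻¹) • Q k n‖ * (R : ℝ) ^ n := tsum_mul_right.symm
      _ ≤ _ := ((hsumN n).mul_right _).tsum_le_tsum (fun k => hterm k n) hs
  have hball : HasFPowerSeriesOnBall (fun w => ∑' k, Complex.exp (ℓ k w) • c k) p z R := by
    refine ⟨hrad, by exact_mod_cast hR, fun {y} hy => ?_⟩
    have hyR : ‖y‖ ≤ R := by
      rw [Metric.mem_eball, edist_zero_right] at hy
      have := (ENNReal.toReal_le_toReal (by simp) (by simp)).2 hy.le
      simpa using this
    have hfib : ∀ k, HasSum (fun n : ℕ => (e k * (n.factorial : ℂ)⁻¹) • (ℓ k y) ^ n • c k)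
        (Complex.exp (ℓ k (z + y)) • c k) := by
      intro k
      have h1 : HasSum (fun n : ℕ => (ℓ k y) ^ n / n.factorial) (Complex.exp (ℓ k y)) := by
        rw [Complex.exp_eq_exp_ℂ]
        exact NormedSpace.expSeries_div_hasSum_exp (ℓ k y)
      have h2 := (h1.mul_left (e k)).smul_const (c k)
      rw [map_add, Complex.exp_add]
      refine h2.congr_fun fun n => ?_
      rw [smul_smul]; congr 1; ring
    have hfibn : ∀ k, HasSum (fun n : ℕ => ‖(e k * (n.factorial : ℂ)⁻¹) • (ℓ k y) ^ n • c k‖)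
        (‖e k‖ * exp ‖ℓ k y‖ * ‖c k‖) := by
      intro k
      have h1 : HasSum (fun n : ℕ => ‖ℓ k y‖ ^ n / n.factorial) (exp ‖ℓ k y‖) := by
        rw [Real.exp_eq_exp_ℝ]
        exact NormedSpace.expSeries_div_hasSum_exp ‖ℓ k y‖
      refine ((h1.mul_left ‖e k‖).mul_right ‖c k‖).congr_fun fun n => ?_
      rw [norm_smul, norm_smul, norm_mul, norm_inv, Complex.norm_natCast, norm_pow]
      ring
    -- For |y| ≤ R the double family is dominated by the hypothesis `hs`, so summing first over n
    -- (the exponentials) and first over k (the power series) gives the same value.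
    have hg : Summable fun x : ι × ℕ =>
        (e x.1 * (x.2.factorial : ℂ)⁻¹) • (ℓ x.1 y) ^ x.2 • c x.1 := by
      refine Summable.of_norm ?_
      rw [summable_prod_of_nonneg (fun _ => norm_nonneg _)]
      refine ⟨fun k => (hfibn k).summable, ?_⟩
      simp only [(hfibn _).tsum_eq]
      refine Summable.of_nonneg_of_le (fun k => by positivity) (fun k => ?_) hs
      have : ‖ℓ k y‖ ≤ R * ‖ℓ k‖ := ((ℓ k).le_opNorm y).trans (by
        rw [mul_comm]; gcongr)
      gcongr
    have h1 := hg.hasSum.prod_fiberwise hfib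
    have h2 := ((Equiv.prodComm ℕ ι).hasSum_iff.2 hg.hasSum).prod_fiberwise
      (g := fun n => p n fun _ => y) fun n => by
        have := (ContinuousMultilinearMap.apply ℂ (fun _ : Fin n => X) E
          (fun _ => y)).hasSum (hsumQ n).hasSum
        refine this.congr_fun fun k => ?_
        simp [hQy]
    rw [h1.tsum_eq]
    exact h2
  exact hball.analyticAt

variable {ν : ℕ}

/-! ### Characters of the torus and sums over Fourier indices. -/

/-- The linear form `z ↦ i k·z`. -/
def freqForm (k : Fin ν → ℤ) : EuclideanSpace ℂ (Fin ν) →L[ℂ] ℂ :=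
  Complex.I • innerSL ℂ (toComplexVec (freq k))

theorem freqForm_apply (k : Fin ν → ℤ) (z : EuclideanSpace ℂ (Fin ν)) :
    freqForm k z = Complex.I * ∑ a, (k a : ℂ) * z a := by
  simp [freqForm, toComplexVec, freq, PiLp.inner_apply, mul_comm]

theorem freqForm_toComplexVec (k : Fin ν → ℤ) (θ : EuclideanSpace ℝ (Fin ν)) :
    freqForm k (toComplexVec θ) = ((inner ℝ θ (freq k) : ℝ) : ℂ) * Complex.I := by
  rw [freqForm_apply, mul_comm]
  congr 1
  simp [toComplexVec, freq, PiLp.inner_apply]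

theorem freqForm_add (k l : Fin ν → ℤ) (z : EuclideanSpace ℂ (Fin ν)) :
    freqForm (k + l) z = freqForm k z + freqForm l z := by
  simp [freqForm_apply, add_mul, Finset.sum_add_distrib, mul_add]

theorem freqForm_neg (k : Fin ν → ℤ) (z : EuclideanSpace ℂ (Fin ν)) :
    freqForm (-k) z = -freqForm k z := by
  simp [freqForm_apply]

theorem freqForm_zero (z : EuclideanSpace ℂ (Fin ν)) :
    freqForm (0 : Fin ν → ℤ) z = 0 := by
  simp [freqForm_apply]

theorem norm_toComplexVec (θ : EuclideanSpace ℝ (Fin ν)) : ‖toComplexVec θ‖ = ‖θ‖ := by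
  rw [EuclideanSpace.norm_eq, EuclideanSpace.norm_eq]
  simp [toComplexVec]

theorem norm_freqForm (k : Fin ν → ℤ) : ‖freqForm k‖ = ‖freq k‖ := by
  rw [freqForm, norm_smul, Complex.norm_I, one_mul, innerSL_apply_norm, norm_toComplexVec]

theorem norm_exp_freqForm_le (k : Fin ν → ℤ) {z : EuclideanSpace ℂ (Fin ν)} {s : ℝ}
    (hz : z ∈ complexStrip ν s) : ‖Complex.exp (freqForm k z)‖ ≤ exp (s * ‖freq k‖) := by
  rw [Complex.norm_exp]
  refine Real.exp_le_exp.2 ?_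
  have e : (freqForm k z).re = -inner ℝ (WithLp.toLp 2 fun i => (z i).im) (freq k) := by
    rw [freqForm_apply]
    simp [freq, PiLp.inner_apply]
  rw [e]
  refine (neg_le_abs _).trans ((abs_real_inner_le_norm _ _).trans ?_)
  gcongr
  exact hz

theorem norm_exp_freqForm_real (k : Fin ν → ℤ) (θ : EuclideanSpace ℝ (Fin ν)) :
    ‖Complex.exp (freqForm k (toComplexVec θ))‖ = 1 := by
  rw [freqForm_toComplexVec, Complex.norm_exp_ofReal_mul_I]

theorem summable_inv_one_add_norm_freq {p : ℕ} (hp : ν < p) :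
    Summable fun k : Fin ν → ℤ => ((1 + ‖freq k‖) ^ p)⁻¹ := by
  let b := (EuclideanSpace.basisFun (Fin ν) ℝ).toBasis
  let L := Submodule.span ℤ (Set.range b)
  have hmem : ∀ k : Fin ν → ℤ, freq k ∈ L := by
    intro k
    have : freq k = ∑ a, k a • b a := by
      ext a
      simp [b, freq, Finset.sum_apply, Pi.single_apply]
    rw [this]
    exact Submodule.sum_mem _ fun a _ => Submodule.smul_mem _ _ (Submodule.subset_span ⟨a, rfl⟩)
  have hrank : Module.finrank ℤ L < p := by
    rw [ZLattice.rank ℝ L]; simpa using hp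
  have h1 := ZLattice.summable_norm_pow_inv L p hrank
  have hinj : Function.Injective fun k : Fin ν → ℤ => (⟨freq k, hmem k⟩ : L) := by
    intro k l hkl
    have h2 : freq k = freq l := congrArg Subtype.val hkl
    funext a
    have h3 : (k a : ℝ) = l a := congrArg (fun x : EuclideanSpace ℝ (Fin ν) => x a) h2
    exact_mod_cast h3
  -- The comparison with the lattice sum holds except possibly at k = 0, so finitely many terms are
  -- discarded.
  refine Summable.of_norm_bounded_eventually (h1.comp_injective hinj) ?_
  refine (Set.finite_singleton (0 : Fin ν → ℤ)).subset fun k hk => ?_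
  by_contra h0
  refine hk ?_
  have hk1 := one_le_norm_freq (k := k) h0
  change ‖((1 + ‖freq k‖) ^ p)⁻¹‖ ≤ ‖freq k‖⁻¹ ^ p
  rw [norm_inv, Real.norm_of_nonneg (by positivity)]
  rw [inv_pow]
  gcongr
  linarith

theorem summable_exp_neg_norm_freq {c : ℝ} (hc : 0 < c) :
    Summable fun k : Fin ν → ℤ => exp (-(c * ‖freq k‖)) := by
  refine Summable.of_nonneg_of_le (fun k => by positivity) (fun k => ?_)
    ((summable_inv_one_add_norm_freq (Nat.lt_succ_self ν)).mul_left (expLoss (ν + 1) c c))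
  have h := one_add_pow_le_expLoss (ν + 1) hc le_rfl (norm_nonneg (freq k))
  rw [Real.exp_neg, ← div_eq_mul_inv, le_div_iff₀ (by positivity), inv_mul_le_iff₀ (by positivity),
    mul_comm]
  exact h

end

noncomputable section

open scoped ENNReal ComplexConjugate
open Filter Topology SineSobolev

/-! ### The basis of the phase space -/

/-- The basis vector of the phase space at a signed mode. -/
def phaseSingle (r : ℝ) (j : SignedMode) : PhaseSpace r :=
  (phaseEquiv r).symm (lp.single 2 j ((japanese j.2 ^ r : ℝ) : ℂ))

theorem modeCoeff_phaseSingle (r : ℝ) (j i : SignedMode) :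
    modeCoeff (phaseSingle r j) i = if i = j then 1 else 0 := by
  have h := phaseEquiv_apply (phaseSingle r j) i
  rw [phaseSingle, ContinuousLinearEquiv.apply_symm_apply, lp.single_apply] at h
  have hw := weight_ne_zero r i.2
  split_ifs with hij
  · subst hij
    rw [Pi.single_eq_same] at h
    exact mul_left_cancel₀ hw (by rw [mul_one]; exact h.symm)
  · rw [Pi.single_eq_of_ne hij] at h
    exact (mul_eq_zero.1 h.symm).resolve_left hw

theorem hasSum_phaseSingle {r : ℝ} (u : PhaseSpace r) :
    HasSum (fun j => modeCoeff u j • phaseSingle r j) u := by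
  have h1 := lp.hasSum_single (E := fun _ : SignedMode => ℂ) (p := 2) (by norm_num) (phaseEquiv r u)
  have h2 := ((phaseEquiv r).symm : lp (fun _ : SignedMode => ℂ) 2 →L[ℂ] PhaseSpace r).hasSum h1
  have e1 : ((phaseEquiv r).symm : lp (fun _ : SignedMode => ℂ) 2 →L[ℂ] PhaseSpace r)
      (phaseEquiv r u) = u := (phaseEquiv r).symm_apply_apply u
  rw [e1] at h2
  refine h2.congr_fun fun j => ?_
  rw [phaseEquiv_apply, mul_comm, ← smul_eq_mul, lp.single_smul]
  exact (((phaseEquiv r).symm : lp (fun _ : SignedMode => ℂ) 2 →L[ℂ] PhaseSpace r).map_smul _ _).symm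

theorem ext_phaseSingle {r : ℝ} {E : Type*} [NormedAddCommGroup E] [NormedSpace ℂ E]
    {A B : PhaseSpace r →L[ℂ] E} (h : ∀ j, A (phaseSingle r j) = B (phaseSingle r j)) : A = B := by
  refine ContinuousLinearMap.ext fun u => ?_
  have ha := A.hasSum (hasSum_phaseSingle u)
  have hb := B.hasSum (hasSum_phaseSingle u)
  simp only [map_smul, h] at ha hb
  exact ha.unique hb

theorem ext_modeCoeff {r r' : ℝ} {A B : PhaseSpace r →L[ℂ] PhaseSpace r'}
    (h : ∀ i j, modeCoeff (A (phaseSingle r j)) i = modeCoeff (B (phaseSingle r j)) i) : A = B :=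
  ext_phaseSingle fun j => modeCoeff_ext fun i => h i j

/-- The matrix coefficients of an operator as continuous functionals. -/
def opCoeff {r r' : ℝ} (i j : SignedMode) : (PhaseSpace r →L[ℂ] PhaseSpace r') →L[ℂ] ℂ :=
  (modeCoeffL r' i).comp (ContinuousLinearMap.apply ℂ (PhaseSpace r') (phaseSingle r j))

theorem opCoeff_apply {r r' : ℝ} (i j : SignedMode) (A : PhaseSpace r →L[ℂ] PhaseSpace r') :
    opCoeff i j A = modeCoeff (A (phaseSingle r j)) i := modeCoeffL_apply _ _

theorem ext_opCoeff {r r' : ℝ} {A B : PhaseSpace r →L[ℂ] PhaseSpace r'}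
    (h : ∀ i j, opCoeff i j A = opCoeff i j B) : A = B :=
  ext_modeCoeff fun i j => by simpa only [opCoeff_apply] using h i j

theorem opCoeff_one {r : ℝ} (i j : SignedMode) :
    opCoeff i j (1 : PhaseOp r) = if i = j then 1 else 0 := by
  rw [opCoeff_apply, one_apply_eq_self, modeCoeff_phaseSingle]

theorem hasSum_opCoeff_apply {r r' : ℝ} (A : PhaseSpace r →L[ℂ] PhaseSpace r') (u : PhaseSpace r)
    (i : SignedMode) : HasSum (fun j => opCoeff i j A * modeCoeff u j) (modeCoeff (A u) i) := by
  have h := ((modeCoeffL r' i).comp A).hasSum (hasSum_phaseSingle u)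
  simp only [map_smul, ContinuousLinearMap.comp_apply, modeCoeffL_apply, smul_eq_mul] at h
  refine h.congr_fun fun j => ?_
  rw [opCoeff_apply, mul_comm]

/-- A product of operators, from the matrix of the first one. -/
theorem hasSum_opCoeff_mul {r r' r'' : ℝ} {a : SignedMode → SignedMode → ℂ}
    {A : PhaseSpace r' →L[ℂ] PhaseSpace r''} {B : PhaseSpace r →L[ℂ] PhaseSpace r'}
    (hA : ∀ u i, HasSum (fun j => a i j * modeCoeff u j) (modeCoeff (A u) i)) (i j : SignedMode) :
    HasSum (fun m => a i m * opCoeff m j B) (opCoeff i j (A.comp B)) := by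
  simp only [opCoeff_apply]
  exact hA _ i

/-! ### Diagonal operators -/

/-- In weighted coordinates the weights of order r and r - 1 differ by ⟨i⟩, so a diagonal of linear
growth becomes a bounded diagonal on `ℓ²`. -/
theorem exists_diagOp (r : ℝ) {d : SignedMode → ℂ} {C : ℝ} (hd : ∀ i, ‖d i‖ ≤ C * japanese i.2) :
    ∃ D : PhaseSpace r →L[ℂ] PhaseSpace (r - 1), ∀ u i, modeCoeff (D u) i = d i * modeCoeff u i := by
  have hC : ∀ i : SignedMode, ‖d i / japanese i.2‖ ≤ C := by
    intro i
    have := japanese_pos i.2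
    rw [norm_div, Complex.norm_real, Real.norm_of_nonneg this.le, div_le_iff₀ this]
    exact hd i
  have hbd : ∀ i : SignedMode, ‖d i / japanese i.2‖ₑ ≤ C.toNNReal := by
    intro i
    rw [← ofReal_norm]
    exact ENNReal.ofReal_le_ofReal (hC i)
  obtain ⟨B, -, hB⟩ := exists_lpTwo_op (N := C.toNNReal)
    (a := fun i j : SignedMode => if i = j then d i / japanese i.2 else 0)
    (fun j => by
      rw [tsum_eq_single j (by intro i hi; simp [hi])]
      simpa using hbd j)
    (fun i => by
      rw [tsum_eq_single i (by intro j hj; simp [hj.symm])]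
      simpa using hbd i)
  refine ⟨((phaseEquiv (r - 1)).symm : lp (fun _ : SignedMode => ℂ) 2 →L[ℂ]
    PhaseSpace (r - 1)).comp (B.comp (phaseEquiv r : PhaseSpace r →L[ℂ] _)), fun u i => ?_⟩
  have h1 := phaseEquiv_apply ((phaseEquiv (r - 1)).symm (B (phaseEquiv r u))) i
  rw [ContinuousLinearEquiv.apply_symm_apply] at h1
  have h2 := (hB (phaseEquiv r u) i).unique (hasSum_single i fun j hj => by simp [hj.symm])
  rw [h2, if_pos rfl, phaseEquiv_apply, Real.rpow_sub (japanese_pos i.2), Real.rpow_one] at h1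
  have h3 := weight_ne_zero r i.2
  have h4 : (japanese i.2 : ℂ) ≠ 0 := Complex.ofReal_ne_zero.2 (japanese_pos i.2).ne'
  push_cast at h1 h3
  change modeCoeff ((phaseEquiv (r - 1)).symm (B (phaseEquiv r u))) i = _
  field_simp at h1
  rw [← h1]

variable {ν : ℕ}

/-! ### Operators depending on the angles -/

/-- The block between Fourier indices k and 0 is part of a column and of a row of A. On this block
the exponential weight is the constant e^{σ|k|}, which comes out as decay of the k-th Fourier
coefficient. -/
theorem slice_bounds {q : ℕ} {σ a : ℝ} {A : MatOp (Mode ν)} (ha : 0 ≤ a)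
    (hA : opSchur (weightZ q σ) A ≤ ENNReal.ofReal a) (k : Fin ν → ℤ) :
    (∀ j, ∑' i : SignedMode, ‖entry A (i, k) (j, 0)‖ₑ *
      ENNReal.ofReal (modeRatio i.2 j.2 ^ (q + 1)) ≤ (a * exp (-(σ * ‖freq k‖))).toNNReal) ∧
    ∀ i, ∑' j : SignedMode, ‖entry A (i, k) (j, 0)‖ₑ *
      ENNReal.ofReal (modeRatio i.2 j.2 ^ (q + 1)) ≤ (a * exp (-(σ * ‖freq k‖))).toNNReal := by
  have hw : ∀ i j : SignedMode, ‖entry A (i, k) (j, 0)‖ₑ *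
      ENNReal.ofReal (modeRatio i.2 j.2 ^ (q + 1)) =
      ‖entry A (i, k) (j, 0)‖ₑ * ENNReal.ofReal (weightZ q σ (i, k) (j, 0)) *
        ENNReal.ofReal (exp (-(σ * ‖freq k‖))) := by
    intro i j
    rw [mul_assoc, ← ENNReal.ofReal_mul' (by positivity), weightZ, sub_zero, mul_assoc,
      ← Real.exp_add, add_neg_cancel, Real.exp_zero, mul_one]
  have hN : ((a * exp (-(σ * ‖freq k‖))).toNNReal : ℝ≥0∞) =
      ENNReal.ofReal a * ENNReal.ofReal (exp (-(σ * ‖freq k‖))) :=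
    ENNReal.ofReal_mul ha
  refine ⟨fun j => ?_, fun i => ?_⟩
  · simp only [hw]
    rw [ENNReal.tsum_mul_right, hN]
    gcongr
    refine le_trans ?_ ((column_le_schur _ _ (j, (0 : Fin ν → ℤ))).trans hA)
    exact ENNReal.tsum_comp_le_tsum_of_injective (f := fun i : SignedMode => ((i, k) : Mode ν))
      (fun _ _ h => (Prod.ext_iff.1 h).1)
      (fun s => ‖entry A s (j, 0)‖ₑ * ENNReal.ofReal (weightZ q σ s (j, 0)))
  · simp only [hw]
    rw [ENNReal.tsum_mul_right, hN]
    gcongr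
    refine le_trans ?_ ((row_le_schur _ _ (i, k)).trans hA)
    exact ENNReal.tsum_comp_le_tsum_of_injective
      (f := fun j : SignedMode => ((j, 0) : Mode ν))
      (fun _ _ h => (Prod.ext_iff.1 h).1)
      (fun t => ‖entry A (i, k) t‖ₑ * ENNReal.ofReal (weightZ q σ (i, k) t))

/-- The Fourier coefficient of index `k` of the operator described by a matrix. -/
def sliceOp (r : ℝ) (A : MatOp (Mode ν)) (k : Fin ν → ℤ) : PhaseOp r :=
  open Classical in if h : ∃ B : PhaseOp r, ∀ u i,
    HasSum (fun j => entry A (i, k) (j, 0) * modeCoeff u j) (modeCoeff (B u) i) then h.choose else 0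

variable {q : ℕ} {r σ a b : ℝ} {A B : MatOp (Mode ν)}

/-- The matrix `A` describes operators on the phase space of order `r`. -/
structure ActsOn (q : ℕ) (σ r a : ℝ) (A : MatOp (Mode ν)) : Prop where
  order : |r| ≤ q + 1
  nonneg : 0 ≤ a
  bound : opSchur (weightZ q σ) A ≤ ENNReal.ofReal a

theorem ActsOn.slice (h : ActsOn q σ r a A) (k : Fin ν → ℤ) :
    ‖sliceOp r A k‖ ≤ 8 * a * exp (-(σ * ‖freq k‖)) ∧
    ∀ u i, HasSum (fun j => entry A (i, k) (j, 0) * modeCoeff u j)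
      (modeCoeff (sliceOp r A k u) i) := by
  have h0 := slice_bounds h.nonneg h.bound k
  have hr : |r| ≤ (q + 1 : ℕ) := by push_cast; exact h.order
  obtain ⟨B, hB1, hB2⟩ := exists_phaseOp hr h0.1 h0.2
  have hex : ∃ B : PhaseOp r, ∀ u i,
    HasSum (fun j => entry A (i, k) (j, 0) * modeCoeff u j) (modeCoeff (B u) i) := ⟨B, hB2⟩
  have hspec := hex.choose_spec
  have heq : sliceOp r A k = hex.choose := by rw [sliceOp, dif_pos hex]
  rw [heq]
  refine ⟨?_, hspec⟩
  have : hex.choose = B := by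
    refine ContinuousLinearMap.ext fun u => ?_
    exact modeCoeff_ext fun i => (hspec u i).unique (hB2 u i)
  rw [this]
  refine hB1.trans (le_of_eq ?_)
  have := h.nonneg
  rw [Real.coe_toNNReal _ (by positivity)]
  ring

theorem ActsOn.opCoeff_slice (h : ActsOn q σ r a A) (k : Fin ν → ℤ) (i j : SignedMode) :
    opCoeff i j (sliceOp r A k) = entry A (i, k) (j, 0) := by
  rw [opCoeff_apply]
  refine ((h.slice k).2 (phaseSingle r j) i).unique ?_
  have := hasSum_single (f := fun m => entry A (i, k) (m, 0) * modeCoeff (phaseSingle r j) m) j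
    fun m hm => by rw [modeCoeff_phaseSingle, if_neg hm, mul_zero]
  simpa [modeCoeff_phaseSingle] using this

/-- The operator at a point of the complexified torus described by a matrix. -/
def fourierOp (r : ℝ) (A : MatOp (Mode ν)) (z : EuclideanSpace ℂ (Fin ν)) : PhaseOp r :=
  ∑' k, Complex.exp (freqForm k z) • sliceOp r A k

theorem ActsOn.norm_term_le (h : ActsOn q σ r a A) {s : ℝ} {z : EuclideanSpace ℂ (Fin ν)}
    (hz : z ∈ complexStrip ν s) (k : Fin ν → ℤ) :
    ‖Complex.exp (freqForm k z) • sliceOp r A k‖ ≤ 8 * a * exp (-((σ - s) * ‖freq k‖)) := by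
  rw [norm_smul]
  calc _ ≤ exp (s * ‖freq k‖) * (8 * a * exp (-(σ * ‖freq k‖))) := by
        gcongr
        · exact norm_exp_freqForm_le k hz
        · exact (h.slice k).1
    _ = 8 * a * (exp (s * ‖freq k‖) * exp (-(σ * ‖freq k‖))) := by ring
    _ = _ := by rw [← Real.exp_add]; ring_nf

theorem ActsOn.summable (h : ActsOn q σ r a A) {s : ℝ} (hs : s < σ)
    {z : EuclideanSpace ℂ (Fin ν)} (hz : z ∈ complexStrip ν s) :
    Summable fun k => ‖Complex.exp (freqForm k z) • sliceOp r A k‖ :=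
  Summable.of_nonneg_of_le (fun _ => norm_nonneg _) (h.norm_term_le hz)
    ((summable_exp_neg_norm_freq (sub_pos.2 hs)).mul_left _)

theorem toComplexVec_mem_complexStrip (θ : EuclideanSpace ℝ (Fin ν)) :
    toComplexVec θ ∈ complexStrip ν 0 := by
  change ‖(WithLp.toLp 2 fun i => (toComplexVec θ i).im : EuclideanSpace ℝ (Fin ν))‖ ≤ 0
  have : (WithLp.toLp 2 fun i => (toComplexVec θ i).im : EuclideanSpace ℝ (Fin ν)) = 0 := by
    ext i; simp [toComplexVec]
  rw [this, norm_zero]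

theorem ActsOn.norm_fourierOp_le (h : ActsOn q σ r a A) (hσ : 0 < σ)
    (θ : EuclideanSpace ℝ (Fin ν)) : ‖fourierOp r A (toComplexVec θ)‖ ≤
      8 * a * ∑' k : Fin ν → ℤ, exp (-(σ * ‖freq k‖)) := by
  have hz := toComplexVec_mem_complexStrip θ
  refine (norm_tsum_le_tsum_norm (h.summable hσ hz)).trans ?_
  rw [← tsum_mul_left]
  refine (h.summable hσ hz).tsum_le_tsum (fun k => ?_)
    ((summable_exp_neg_norm_freq hσ).mul_left _)
  simpa using h.norm_term_le hz k

theorem ActsOn.hasSum_opCoeff (h : ActsOn q σ r a A) {s : ℝ} (hs : s < σ)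
    {z : EuclideanSpace ℂ (Fin ν)} (hz : z ∈ complexStrip ν s) (i j : SignedMode) :
    HasSum (fun k => Complex.exp (freqForm k z) * entry A (i, k) (j, 0))
      (opCoeff i j (fourierOp r A z)) := by
  refine ((opCoeff i j).hasSum (h.summable hs hz).of_norm.hasSum).congr_fun fun k => ?_
  rw [map_smul, h.opCoeff_slice, smul_eq_mul]

theorem ActsOn.analyticOnNhd (h : ActsOn q σ r a A) {s : ℝ} (hs : s < σ) :
    AnalyticOnNhd ℂ (fourierOp r A) (complexStrip ν s) := by
  intro z hz
  -- Half of the remaining width serves as radius of convergence around a point of the strip; the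
  -- other half keeps the series summable.
  have hR : 0 < (σ - s) / 2 := half_pos (sub_pos.2 hs)
  refine analyticAt_tsum_exp (R := ((σ - s) / 2).toNNReal) (Real.toNNReal_pos.2 hR) ?_
  rw [Real.coe_toNNReal _ hR.le]
  refine Summable.of_nonneg_of_le (fun k => by positivity) (fun k => ?_)
    ((summable_exp_neg_norm_freq (half_pos (sub_pos.2 hs))).mul_left (8 * a))
  have h1 := h.norm_term_le hz k
  rw [norm_smul] at h1
  rw [norm_freqForm]
  calc _ = exp ((σ - s) / 2 * ‖freq k‖) * (‖Complex.exp (freqForm k z)‖ * ‖sliceOp r A k‖) := by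
        ring
    _ ≤ exp ((σ - s) / 2 * ‖freq k‖) * (8 * a * exp (-((σ - s) * ‖freq k‖))) := by gcongr
    _ = 8 * a * (exp ((σ - s) / 2 * ‖freq k‖) * exp (-((σ - s) * ‖freq k‖))) := by ring
    _ = _ := by rw [← Real.exp_add]; ring_nf

theorem torusPeriodic_fourierOp (r : ℝ) (A : MatOp (Mode ν)) :
    TorusPeriodic fun θ : EuclideanSpace ℝ (Fin ν) => fourierOp r A (toComplexVec θ) := by
  intro θ a
  unfold fourierOp
  refine tsum_congr fun k => ?_
  congr 1
  rw [freqForm_toComplexVec, freqForm_toComplexVec, inner_add_left]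
  have : inner ℝ (EuclideanSpace.single a (2 * π)) (freq k) = 2 * π * k a := by
    simp [freq, EuclideanSpace.inner_single_left]
  rw [this]
  push_cast
  rw [add_mul, Complex.exp_add, show (2 * (π : ℂ) * (k a : ℂ)) * Complex.I =
    (k a : ℂ) * (2 * π * Complex.I) by ring, Complex.exp_int_mul_two_pi_mul_I, mul_one]

theorem ActsOn.one (q : ℕ) (σ : ℝ) {r : ℝ} (hr : |r| ≤ q + 1) :
    ActsOn q σ r 1 (1 : MatOp (Mode ν)) :=
  ⟨hr, zero_le_one, by
    rw [ENNReal.ofReal_one]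
    exact opSchur_one_le fun s => by simp [weightZ, modeRatio_self]⟩

theorem ActsOn.sub (hA : ActsOn q σ r a A) (hB : ActsOn q σ r b B) :
    ActsOn q σ r (a + b) (A - B) :=
  ⟨hA.order, add_nonneg hA.nonneg hB.nonneg, (opSchur_sub_le _ _ _).trans (by
    rw [ENNReal.ofReal_add hA.nonneg hB.nonneg]; exact add_le_add hA.bound hB.bound)⟩

theorem ActsOn.add (hA : ActsOn q σ r a A) (hB : ActsOn q σ r b B) :
    ActsOn q σ r (a + b) (A + B) :=
  ⟨hA.order, add_nonneg hA.nonneg hB.nonneg, (opSchur_add_le _ _ _).trans (by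
    rw [ENNReal.ofReal_add hA.nonneg hB.nonneg]; exact add_le_add hA.bound hB.bound)⟩

theorem fourierOp_one (hr : |r| ≤ q + 1) (hσ : 0 < σ) (θ : EuclideanSpace ℝ (Fin ν)) :
    fourierOp r (1 : MatOp (Mode ν)) (toComplexVec θ) = 1 := by
  refine ext_opCoeff fun i j => ?_
  refine ((ActsOn.one (ν := ν) q σ hr).hasSum_opCoeff hσ (toComplexVec_mem_complexStrip θ)
    i j).unique ?_
  have := hasSum_single (f := fun k => Complex.exp (freqForm k (toComplexVec θ)) *
    entry (1 : MatOp (Mode ν)) (i, k) (j, 0)) 0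
    fun k hk => by rw [entry_one, if_neg (by simp [hk]), mul_zero]
  rw [opCoeff_one]
  simpa [entry_one, freqForm_zero] using this

theorem ActsOn.fourierOp_sub (hA : ActsOn q σ r a A) (hB : ActsOn q σ r b B) (hσ : 0 < σ)
    (θ : EuclideanSpace ℝ (Fin ν)) : fourierOp r (A - B) (toComplexVec θ) =
      fourierOp r A (toComplexVec θ) - fourierOp r B (toComplexVec θ) := by
  refine ext_opCoeff fun i j => ?_
  have hz := toComplexVec_mem_complexStrip θ
  refine ((hA.sub hB).hasSum_opCoeff hσ hz i j).unique ?_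
  rw [map_sub]
  refine ((hA.hasSum_opCoeff hσ hz i j).sub (hB.hasSum_opCoeff hσ hz i j)).congr_fun fun k => ?_
  rw [entry_sub, mul_sub]

/-- Translation invariance of A turns the matrix product into a convolution of Fourier coefficients
in k, so summing the Fourier series is multiplicative. -/
theorem ActsOn.fourierOp_mul {c : ℝ} (hA : ActsOn q σ r a A) (hB : ActsOn q σ r b B)
    (hAB : ActsOn q σ r c (A * B)) (hinv : ShiftInvariant A) (hσ : 0 < σ)
    (θ : EuclideanSpace ℝ (Fin ν)) : fourierOp r (A * B) (toComplexVec θ) =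
      fourierOp r A (toComplexVec θ) * fourierOp r B (toComplexVec θ) := by
  have hz := toComplexVec_mem_complexStrip θ
  refine ext_opCoeff fun i j => ?_
  refine (hAB.hasSum_opCoeff hσ hz i j).unique ?_
  have sA := hA.summable hσ hz
  have sB := hB.summable hσ hz
  have h1 := (summable_mul_of_summable_norm sA sB).hasSum
  rw [← tsum_mul_tsum_of_summable_norm sA sB] at h1
  -- The product of the two series is reindexed by (total index k, index l of the second factor).
  let e : (Fin ν → ℤ) × (Fin ν → ℤ) ≃ (Fin ν → ℤ) × (Fin ν → ℤ) :=
    { toFun := fun p => (p.1 - p.2, p.2)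
      invFun := fun p => (p.1 + p.2, p.2)
      left_inv := fun p => by simp
      right_inv := fun p => by simp }
  have h2 := (opCoeff i j).hasSum (e.hasSum_iff.2 h1)
  refine h2.prod_fiberwise fun k => ?_
  have h3 := (hasSum_entry_mul A B (i, k) (j, 0)).mul_left
    (Complex.exp (freqForm k (toComplexVec θ)))
  have h4 := (Equiv.prodComm (Fin ν → ℤ) SignedMode).hasSum_iff.2 h3
  refine h4.prod_fiberwise fun l => ?_
  have h5 := hasSum_opCoeff_mul (B := sliceOp r B l) (hA.slice (k - l)).2 i j
  have h6 := h5.mul_left (Complex.exp (freqForm (k - l) (toComplexVec θ)) *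
    Complex.exp (freqForm l (toComplexVec θ)))
  have e1 : opCoeff i j ((Complex.exp (freqForm (k - l) (toComplexVec θ)) • sliceOp r A (k - l)) *
      (Complex.exp (freqForm l (toComplexVec θ)) • sliceOp r B l)) =
      Complex.exp (freqForm (k - l) (toComplexVec θ)) * Complex.exp (freqForm l (toComplexVec θ)) *
        opCoeff i j ((sliceOp r A (k - l)).comp (sliceOp r B l)) := by
    rw [smul_mul_smul_comm, map_smul, smul_eq_mul]
    rfl
  change HasSum _ (opCoeff i j ((Complex.exp (freqForm (k - l) (toComplexVec θ)) •
    sliceOp r A (k - l)) * (Complex.exp (freqForm l (toComplexVec θ)) • sliceOp r B l)))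
  rw [e1]
  refine h6.congr_fun fun m => ?_
  change Complex.exp (freqForm k (toComplexVec θ)) * (entry A (i, k) (m, l) * entry B (m, l) (j, 0))
    = _
  rw [hB.opCoeff_slice, hinv.entry_eq i m k l, ← Complex.exp_add, ← freqForm_add, sub_add_cancel]

end

noncomputable section

open scoped ENNReal ComplexConjugate
open Filter Topology SineSobolev

/-! ### Conjugation of evolution equations -/

/-- The coefficient at a signed mode of a pair of sequences. -/
def signedCoeff (x : SineCoeff × SineCoeff) (i : SignedMode) : ℂ :=
  if i.1 then x.1 i.2 else x.2 i.2

theorem signedCoeff_pairCoeff {r : ℝ} (u : PhaseSpace r) (i : SignedMode) :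
    signedCoeff (pairCoeff u) i = modeCoeff u i := rfl

theorem signedCoeff_ext {x y : SineCoeff × SineCoeff}
    (h : ∀ i, signedCoeff x i = signedCoeff y i) : x = y := by
  refine Prod.ext (funext fun n => ?_) (funext fun n => ?_)
  · have := h (true, n)
    simp only [signedCoeff, if_true] at this
    exact this
  · have := h (false, n)
    simp only [signedCoeff, Bool.false_eq_true, if_false] at this
    exact this

theorem signedCoeff_smul (c : ℂ) (x : SineCoeff × SineCoeff) (i : SignedMode) :
    signedCoeff (c • x) i = c * signedCoeff x i := by
  unfold signedCoeff; split_ifs <;> simp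

/-- The inclusion of phase spaces. -/
def inclPair (r : ℝ) (u : PhaseSpace r) : PhaseSpace (r - 1) := (incl r u.1, incl r u.2)

theorem coeff_eq_val {r : ℝ} (φ : SineSobolev r) : coeff φ = φ.1 := rfl

theorem coeff_incl {r : ℝ} (φ : SineSobolev r) : coeff (incl r φ) = coeff φ := by
  rw [coeff_eq_val (incl r φ), incl]

theorem modeCoeff_inclPair {r : ℝ} (u : PhaseSpace r) (i : SignedMode) :
    modeCoeff (inclPair r u) i = modeCoeff u i := by
  unfold modeCoeff inclPair
  rw [coeff_incl, coeff_incl]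

theorem exists_inclOp (r : ℝ) :
    ∃ J : PhaseSpace r →L[ℂ] PhaseSpace (r - 1), ∀ u, J u = inclPair r u := by
  obtain ⟨J, hJ⟩ := exists_diagOp r (d := fun _ => 1) (C := 1) fun i => by
    simpa using one_le_japanese i.2
  exact ⟨J, fun u => modeCoeff_ext fun i => by rw [hJ, one_mul, modeCoeff_inclPair]⟩

/-- The inclusion of phase spaces as a bounded operator. -/
def inclOp (r : ℝ) : PhaseSpace r →L[ℂ] PhaseSpace (r - 1) := (exists_inclOp r).choose

theorem inclOp_apply {r : ℝ} (u : PhaseSpace r) : inclOp r u = inclPair r u :=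
  (exists_inclOp r).choose_spec u

theorem modeCoeff_inclOp {r : ℝ} (u : PhaseSpace r) (i : SignedMode) :
    modeCoeff (inclOp r u) i = modeCoeff u i := by
  rw [inclOp_apply, modeCoeff_inclPair]

/-- Once the generator is a bounded operator from order r to order r - 1, equality of coefficient
sequences is equality in the phase space of order r - 1. -/
theorem isSolution_iff {r : ℝ} {H : ℝ → SineCoeff × SineCoeff → SineCoeff × SineCoeff}
    {B : ℝ → PhaseSpace r →L[ℂ] PhaseSpace (r - 1)}
    (hB : ∀ t u, pairCoeff (B t u) = H t (pairCoeff u)) (u : ℝ → PhaseSpace r) :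
    IsSolution H u ↔ Continuous u ∧ ∀ t, ∃ v : PhaseSpace (r - 1),
      HasDerivAt (fun s => inclOp r (u s)) v t ∧ Complex.I • v = B t (u t) := by
  unfold IsSolution
  refine and_congr_right fun _ => forall_congr' fun t => exists_congr fun v => ?_
  have e : (fun s => inclOp r (u s)) = fun s => ((incl r (u s).1, incl r (u s).2) :
      PhaseSpace (r - 1)) := funext fun s => inclOp_apply (u s)
  rw [e, ← hB]
  refine and_congr_right fun _ => ⟨fun h => modeCoeff_ext fun i => ?_, fun h => ?_⟩
  · have := congrArg (fun x => signedCoeff x i) h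
    simp only [signedCoeff_smul, signedCoeff_pairCoeff] at this
    rw [modeCoeff_smul, this]
  · refine signedCoeff_ext fun i => ?_
    rw [← h, signedCoeff_smul, signedCoeff_pairCoeff, signedCoeff_pairCoeff, modeCoeff_smul]

theorem HasDerivAt.complex_clm_apply {E F : Type*} [NormedAddCommGroup E] [NormedSpace ℂ E]
    [NormedAddCommGroup F] [NormedSpace ℂ F] {S : ℝ → E →L[ℂ] F} {S' : E →L[ℂ] F} {u : ℝ → E}
    {v : E} {t : ℝ} (hS : HasDerivAt S S' t) (hu : HasDerivAt u v t) :
    HasDerivAt (fun s => S s (u s)) (S' (u t) + S t v) t :=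
  (((ContinuousLinearMap.restrictScalarsL ℂ E F ℝ ℝ).restrictScalars ℝ).hasFDerivAt.comp_hasDerivAt
    t hS).clm_apply hu

theorem HasDerivAt.exists_ringInverse {R : Type*} [NormedRing R] [CompleteSpace R]
    [NormedAlgebra ℝ R] {S : ℝ → R} {S' : R} {t : ℝ} (hS : HasDerivAt S S' t)
    (hu : IsUnit (S t)) : ∃ D, HasDerivAt (fun s => Ring.inverse (S s)) D t :=
  ⟨_, (differentiableAt_inverse (𝕜 := ℝ) hu).hasFDerivAt.comp_hasDerivAt t hS⟩

theorem Continuous.ringInverse {R : Type*} [NormedRing R] [CompleteSpace R] {T : ℝ → R}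
    (hT : Continuous T) (hu : ∀ t, IsUnit (T t)) : Continuous fun t => Ring.inverse (T t) := by
  rw [continuous_iff_continuousAt]
  intro t
  obtain ⟨u, hu⟩ := hu t
  have := NormedRing.inverse_continuousAt u
  rw [hu] at this
  exact this.comp hT.continuousAt

/-- Solutions are differentiable only in the larger space F, so the product rule is applied to S,
the version of T on F, while T itself has to be merely continuous on E. The two versions are
compatible with the inclusion J. -/
theorem solution_conjugation_iff {E F : Type*} [NormedAddCommGroup E] [NormedSpace ℂ E]
    [NormedAddCommGroup F] [NormedSpace ℂ F] [CompleteSpace E] [CompleteSpace F] {J : E →L[ℂ] F}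
    {B B' : ℝ → E →L[ℂ] F} {T : ℝ → E →L[ℂ] E} {S S' : ℝ → F →L[ℂ] F} (hT : Continuous T)
    (hTu : ∀ t, IsUnit (T t)) (hSu : ∀ t, IsUnit (S t)) (hS : ∀ t, HasDerivAt S (S' t) t)
    (hincl : ∀ t, (S t).comp J = J.comp (T t))
    (hint : ∀ t, Complex.I • (S' t).comp J + (S t).comp (B' t) = (B t).comp (T t)) (ψ : ℝ → E) :
    (Continuous ψ ∧ ∀ t, ∃ v, HasDerivAt (fun s => J (ψ s)) v t ∧ Complex.I • v = B' t (ψ t)) ↔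
    (Continuous (fun t => T t (ψ t)) ∧ ∀ t, ∃ v, HasDerivAt (fun s => J (T s (ψ s))) v t ∧
      Complex.I • v = B t (T t (ψ t))) := by
  have hincl' : ∀ t u, S t (J u) = J (T t u) := fun t u => DFunLike.congr_fun (hincl t) u
  have hint' : ∀ t u, Complex.I • S' t (J u) + S t (B' t u) = B t (T t u) := fun t u =>
    DFunLike.congr_fun (hint t) u
  have hTinv : ∀ t u, Ring.inverse (T t) (T t u) = u := fun t u =>
    DFunLike.congr_fun (Ring.inverse_mul_cancel _ (hTu t)) u
  have hSinv : ∀ t u, Ring.inverse (S t) (S t u) = u := fun t u =>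
    DFunLike.congr_fun (Ring.inverse_mul_cancel _ (hSu t)) u
  constructor
  · rintro ⟨hc, hd⟩
    refine ⟨hT.clm_apply hc, fun t => ?_⟩
    obtain ⟨v, hv, he⟩ := hd t
    refine ⟨_, ((hS t).complex_clm_apply hv).congr_of_eventuallyEq
      (Eventually.of_forall fun s => (hincl' s _).symm), ?_⟩
    rw [smul_add, ← hint', ← he, map_smul]
  · rintro ⟨hc, hd⟩
    have hψ : ψ = fun t => Ring.inverse (T t) (T t (ψ t)) := funext fun t => (hTinv t _).symm
    have hcont : Continuous ψ := by
      rw [hψ]; exact (hT.ringInverse hTu).clm_apply hc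
    refine ⟨hcont, fun t => ?_⟩
    obtain ⟨v, hv, he⟩ := hd t
    obtain ⟨D, hD⟩ := (hS t).exists_ringInverse (hSu t)
    -- In the converse direction Jψ = S⁻¹(JTψ) is differentiable. Uniqueness of derivatives and
    -- injectivity of S then give the equation.
    obtain ⟨w, hw⟩ : ∃ w, HasDerivAt (fun s => J (ψ s)) w t := by
      refine ⟨_, (hD.complex_clm_apply hv).congr_of_eventuallyEq
        (Eventually.of_forall fun s => ?_)⟩
      change _ = Ring.inverse (S s) (J (T s (ψ s)))
      rw [← hincl', hSinv]
    refine ⟨w, hw, ?_⟩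
    have h1 := ((hS t).complex_clm_apply hw).congr_of_eventuallyEq
      (Eventually.of_forall fun s => (hincl' s (ψ s)).symm)
    have h2 := h1.unique hv
    rw [← h2, smul_add, ← hint'] at he
    have h3 := add_left_cancel he
    rw [← hSinv t (Complex.I • w), map_smul, h3, hSinv]

/-- A family of invertible operators that intertwines two generators maps the solutions of one
equation to the solutions of the other one. -/
theorem isSolution_conjugation_iff {r : ℝ}
    {H H' : ℝ → SineCoeff × SineCoeff → SineCoeff × SineCoeff}
    {B B' : ℝ → PhaseSpace r →L[ℂ] PhaseSpace (r - 1)}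
    (hB : ∀ t u, pairCoeff (B t u) = H t (pairCoeff u))
    (hB' : ∀ t u, pairCoeff (B' t u) = H' t (pairCoeff u))
    {T : ℝ → PhaseOp r} {S S' : ℝ → PhaseOp (r - 1)} (hT : Continuous T)
    (hTu : ∀ t, IsUnit (T t)) (hSu : ∀ t, IsUnit (S t)) (hS : ∀ t, HasDerivAt S (S' t) t)
    (hincl : ∀ t, (S t).comp (inclOp r) = (inclOp r).comp (T t))
    (hint : ∀ t, Complex.I • (S' t).comp (inclOp r) + (S t).comp (B' t) = (B t).comp (T t))
    (ψ : ℝ → PhaseSpace r) :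
    IsSolution H' ψ ↔ IsSolution H fun t => T t (ψ t) := by
  rw [isSolution_iff hB', isSolution_iff hB]
  exact solution_conjugation_iff hT hTu hSu hS hincl hint ψ

end

noncomputable section

open scoped ENNReal ComplexConjugate
open Filter Topology SineSobolev

variable {ν : ℕ}

/-! ### The transformation along the flow on the torus -/

theorem summable_norm_freq_mul_exp {σ : ℝ} (hσ : 0 < σ) :
    Summable fun k : Fin ν → ℤ => ‖freq k‖ * exp (-(σ * ‖freq k‖)) := by
  refine Summable.of_nonneg_of_le (fun k => by positivity) (fun k => ?_)
    ((summable_exp_neg_norm_freq (half_pos hσ)).mul_left (expLoss 1 (σ / 2) (σ / 2)))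
  have h := one_add_pow_le_expLoss 1 (half_pos hσ) le_rfl (norm_nonneg (freq k))
  rw [pow_one] at h
  calc _ ≤ expLoss 1 (σ / 2) (σ / 2) * exp (σ / 2 * ‖freq k‖) * exp (-(σ * ‖freq k‖)) := by
        gcongr; linarith
    _ = _ := by rw [mul_assoc, ← Real.exp_add]; ring_nf

theorem hasDerivAt_tsum_exp {E : Type*} [NormedAddCommGroup E] [NormedSpace ℂ E] [CompleteSpace E]
    {c : (Fin ν → ℤ) → E} {b σ : ℝ} (hσ : 0 < σ) (hc : ∀ k, ‖c k‖ ≤ b * exp (-(σ * ‖freq k‖)))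
    (ω : EuclideanSpace ℝ (Fin ν)) (t : ℝ) :
    (Summable fun k => (((inner ℝ ω (freq k) : ℝ) : ℂ) * Complex.I *
      Complex.exp (freqForm k (toComplexVec (t • ω)))) • c k) ∧
    HasDerivAt (fun s : ℝ => ∑' k, Complex.exp (freqForm k (toComplexVec (s • ω))) • c k)
      (∑' k, (((inner ℝ ω (freq k) : ℝ) : ℂ) * Complex.I *
        Complex.exp (freqForm k (toComplexVec (t • ω)))) • c k) t := by
  have hu : Summable fun k : Fin ν → ℤ => ‖ω‖ * b * (‖freq k‖ * exp (-(σ * ‖freq k‖))) :=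
    (summable_norm_freq_mul_exp hσ).mul_left _
  have hb : ∀ (k : Fin ν → ℤ) (s : ℝ), ‖(((inner ℝ ω (freq k) : ℝ) : ℂ) * Complex.I *
      Complex.exp (freqForm k (toComplexVec (s • ω)))) • c k‖ ≤
      ‖ω‖ * b * (‖freq k‖ * exp (-(σ * ‖freq k‖))) := by
    intro k s
    rw [norm_smul, norm_mul, norm_mul, Complex.norm_I, norm_exp_freqForm_real, Complex.norm_real,
      mul_one, mul_one]
    calc _ ≤ ‖ω‖ * ‖freq k‖ * (b * exp (-(σ * ‖freq k‖))) := by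
          gcongr
          · exact norm_inner_le_norm _ _
          · exact hc k
      _ = _ := by ring
  have hg : ∀ (k : Fin ν → ℤ) (s : ℝ), HasDerivAt
      (fun s : ℝ => Complex.exp (freqForm k (toComplexVec (s • ω))) • c k)
      ((((inner ℝ ω (freq k) : ℝ) : ℂ) * Complex.I *
        Complex.exp (freqForm k (toComplexVec (s • ω)))) • c k) s := by
    intro k s
    have h1 : HasDerivAt (fun s : ℝ => (s : ℂ) * (((inner ℝ ω (freq k) : ℝ) : ℂ) * Complex.I))
        (((inner ℝ ω (freq k) : ℝ) : ℂ) * Complex.I) s := by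
      simpa using (Complex.ofRealCLM.hasDerivAt (x := s)).mul_const
        (((inner ℝ ω (freq k) : ℝ) : ℂ) * Complex.I)
    have h2 := (h1.cexp).smul_const (c k)
    have e : ∀ s : ℝ, freqForm k (toComplexVec (s • ω)) =
        (s : ℂ) * (((inner ℝ ω (freq k) : ℝ) : ℂ) * Complex.I) := by
      intro s
      rw [freqForm_toComplexVec, inner_smul_left]
      push_cast
      simp [mul_assoc]
    simp only [e]
    convert h2 using 2
    ring
  have h0 : Summable fun k => Complex.exp (freqForm k (toComplexVec ((0 : ℝ) • ω))) • c k := by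
    refine Summable.of_norm_bounded (g := fun k => b * exp (-(σ * ‖freq k‖)))
      ((summable_exp_neg_norm_freq hσ).mul_left _) fun k => ?_
    rw [norm_smul, norm_exp_freqForm_real, one_mul]
    exact hc k
  exact ⟨Summable.of_norm_bounded hu fun k => hb k t, hasDerivAt_tsum hu hg hb h0 t⟩

variable {q : ℕ} {r σ a w δ : ℝ} {A W T : MatOp (Mode ν)}

theorem opCoeff_comp_inclOp {r : ℝ} (S : PhaseOp (r - 1)) (i j : SignedMode) :
    opCoeff i j (S.comp (inclOp r)) = opCoeff i j S := by
  have : inclOp r (phaseSingle r j) = phaseSingle (r - 1) j := modeCoeff_ext fun i => by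
    rw [modeCoeff_inclOp, modeCoeff_phaseSingle, modeCoeff_phaseSingle]
  rw [opCoeff_apply, opCoeff_apply, ContinuousLinearMap.comp_apply, this]

theorem opCoeff_comp_diag {r : ℝ} {S : PhaseOp (r - 1)} {D : PhaseSpace r →L[ℂ] PhaseSpace (r - 1)}
    {d : SignedMode → ℂ} (hD : ∀ u i, modeCoeff (D u) i = d i * modeCoeff u i) (i j : SignedMode) :
    opCoeff i j (S.comp D) = d j * opCoeff i j S := by
  have : D (phaseSingle r j) = d j • phaseSingle (r - 1) j := modeCoeff_ext fun i => by
    rw [hD, modeCoeff_smul, modeCoeff_phaseSingle, modeCoeff_phaseSingle]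
    split_ifs with h
    · rw [h]
    · simp
  rw [opCoeff_apply, opCoeff_apply, ContinuousLinearMap.comp_apply, this, map_smul, modeCoeff_smul]

theorem ActsOn.exists_hasDerivAt (h : ActsOn q σ r a A) (hσ : 0 < σ)
    (ω : EuclideanSpace ℝ (Fin ν)) (t : ℝ) : ∃ D : PhaseOp r,
      HasDerivAt (fun s : ℝ => fourierOp r A (toComplexVec (s • ω))) D t ∧
      ∀ i j, HasSum (fun k => ((inner ℝ ω (freq k) : ℝ) : ℂ) * Complex.I *
        Complex.exp (freqForm k (toComplexVec (t • ω))) * entry A (i, k) (j, 0)) (opCoeff i j D) := by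
  obtain ⟨h1, h2⟩ := hasDerivAt_tsum_exp hσ (fun k => (h.slice k).1) ω t
  refine ⟨_, h2, fun i j => ?_⟩
  refine ((opCoeff i j).hasSum h1.hasSum).congr_fun fun k => ?_
  rw [map_smul, h.opCoeff_slice, smul_eq_mul]

/-- At both orders the operator has the same matrix coefficients, namely the Fourier sums of the
entries of A. -/
theorem ActsOn.incl_comp (h : ActsOn q σ r a A) (h' : ActsOn q σ (r - 1) a A) (hσ : 0 < σ)
    (θ : EuclideanSpace ℝ (Fin ν)) :
    (fourierOp (r - 1) A (toComplexVec θ)).comp (inclOp r) =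
      (inclOp r).comp (fourierOp r A (toComplexVec θ)) := by
  have hz := toComplexVec_mem_complexStrip θ
  refine ext_opCoeff fun i j => ?_
  rw [opCoeff_comp_inclOp, opCoeff_apply i j (ContinuousLinearMap.comp _ _),
    ContinuousLinearMap.comp_apply, modeCoeff_inclOp, ← opCoeff_apply]
  exact (h'.hasSum_opCoeff hσ hz i j).unique (h.hasSum_opCoeff hσ hz i j)

theorem norm_fourierOp_sub_one_le (hr : |r| ≤ q + 1) (hσ : 0 < σ) (hδ : 0 ≤ δ)
    (hT : opSchur (weightZ q σ) (T - 1) ≤ ENNReal.ofReal δ) (θ : EuclideanSpace ℝ (Fin ν)) :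
    ‖fourierOp r T (toComplexVec θ) - 1‖ ≤ 8 * δ * ∑' k : Fin ν → ℤ, exp (-(σ * ‖freq k‖)) := by
  have h1 : ActsOn q σ r δ (T - 1) := ⟨hr, hδ, hT⟩
  have h2 := ActsOn.one (ν := ν) q σ hr
  have h3 := h1.add h2
  rw [sub_add_cancel] at h3
  rw [← fourierOp_one hr hσ, ← h3.fourierOp_sub h2 hσ]
  exact h1.norm_fourierOp_le hσ θ

theorem isUnit_of_norm_sub_one_lt {R : Type*} [NormedRing R] [CompleteSpace R] {x : R}
    (h : ‖x - 1‖ < 1) : IsUnit x := by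
  rw [← sub_sub_cancel 1 x]
  exact isUnit_one_sub_of_norm_lt_one (by rwa [norm_sub_rev])

/-- Conjugating e^{ik·θ} at real θ replaces k by -k, which matches the sign change in `negMode`.
Hence exchanging the two components conjugates the matrix coefficients at each θ. -/
theorem ActsOn.isRealPair (h : ActsOn q σ r a A) (hσ : 0 < σ) (hreal : RealStructure 1 A)
    (θ : EuclideanSpace ℝ (Fin ν)) {u : PhaseSpace r} (hu : IsRealPair u) :
    IsRealPair (fourierOp r A (toComplexVec θ) u) := by
  have hz := toComplexVec_mem_complexStrip θ
  have hcoef : ∀ (i j : SignedMode), opCoeff (!i.1, i.2) (!j.1, j.2)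
      (fourierOp r A (toComplexVec θ)) = conj (opCoeff i j (fourierOp r A (toComplexVec θ))) := by
    intro i j
    have h1 := (Equiv.neg (Fin ν → ℤ)).hasSum_iff.2
      (h.hasSum_opCoeff hσ hz (!i.1, i.2) (!j.1, j.2))
    refine h1.unique ?_
    refine (Complex.hasSum_conj'.2 (h.hasSum_opCoeff hσ hz i j)).congr_fun fun k => ?_
    have h2 := hreal (i, k) (j, 0)
    rw [show negMode (i, k) = ((!i.1, i.2), -k) from rfl,
      show negMode (j, (0 : Fin ν → ℤ)) = ((!j.1, j.2), -0) from rfl, neg_zero, one_mul] at h2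
    simp only [Function.comp_apply, Equiv.neg_apply]
    rw [h2, map_mul, ← Complex.exp_conj, freqForm_toComplexVec, freqForm_toComplexVec, freq_neg,
      inner_neg_right]
    simp
  have hmode : ∀ j : SignedMode, modeCoeff u (!j.1, j.2) = conj (modeCoeff u j) := by
    rintro ⟨b, n⟩
    cases b
    · simp [modeCoeff, hu n]
    · simp [modeCoeff, hu n]
  intro n
  have h1 := hasSum_opCoeff_apply (fourierOp r A (toComplexVec θ)) u (true, n)
  have h2 := hasSum_opCoeff_apply (fourierOp r A (toComplexVec θ)) u (false, n)
  have h3 := (Equiv.boolNot.prodCongr (Equiv.refl ℕ+)).hasSum_iff.2 h2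
  have h4 := h3.unique ((Complex.hasSum_conj'.2 h1).congr_fun fun j => by
    have e1 := hcoef (true, n) j
    have e2 := hmode j
    simp only [Bool.not_true] at e1
    rw [map_mul, ← e1, ← e2]
    rfl)
  simpa [modeCoeff] using h4

/-- The transformation given by a matrix conjugates the corresponding evolution equations. -/
theorem fourierOp_conjugation {lam d : SignedMode → ℝ} {C : ℝ} {ω : EuclideanSpace ℝ (Fin ν)}
    (hr : |r| ≤ q + 1) (hr' : |r - 1| ≤ q + 1) (hσ : 0 < σ) (hw : 0 ≤ w)
    (hW : opSchur (weightZ q σ) W ≤ ENNReal.ofReal w) (hWinv : ShiftInvariant W) (hδ : 0 ≤ δ)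
    (hT : opSchur (weightZ q σ) (T - 1) ≤ ENNReal.ofReal δ)
    (hsmall : 8 * δ * ∑' k : Fin ν → ℤ, exp (-(σ * ‖freq k‖)) < 1)
    (hlam : ∀ i, |lam i| ≤ C * japanese i.2) (hd : ∀ i, |d i| ≤ C * japanese i.2)
    (hint : Intertwines (freeDiag lam ω) W T
      (fun s => ((inner ℝ ω (freq s.2) : ℝ) : ℂ) + (d s.1 : ℂ)) 0)
    {H H' : ℝ → SineCoeff × SineCoeff → SineCoeff × SineCoeff}
    (hH : ∀ t (u : PhaseSpace r) i, signedCoeff (H t (pairCoeff u)) i =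
      lam i * modeCoeff u i + modeCoeff (fourierOp r W (toComplexVec (t • ω)) u) i)
    (hH' : ∀ t (u : PhaseSpace r) i, signedCoeff (H' t (pairCoeff u)) i = d i * modeCoeff u i)
    (ψ : ℝ → PhaseSpace r) :
    IsSolution H' ψ ↔ IsSolution H fun t => fourierOp r T (toComplexVec (t • ω)) (ψ t) := by
  have hTa : ∀ {r' : ℝ}, |r'| ≤ q + 1 → ActsOn q σ r' (δ + 1) T := by
    intro r' h
    have h3 := (ActsOn.mk h hδ hT).add (ActsOn.one (ν := ν) q σ h)
    rwa [sub_add_cancel] at h3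
  have hWa : ActsOn q σ r w W := ⟨hr, hw, hW⟩
  have hT0 := (hTa hr).bound
  have hWT : ActsOn q σ r (w * (δ + 1)) (W * T) := by
    refine ⟨hr, mul_nonneg hw (by linarith), ?_⟩
    have hp := weightPair (ν := ν) q hσ.le
    refine (opSchur_mul_le (V := weightZ q σ) (W := weightZ q σ)
      (fun s t => zero_le_one.trans (hp.one_le s t)) hp.mul W T).trans ?_
    rw [ENNReal.ofReal_mul hw]
    exact mul_le_mul' hW hT0
  obtain ⟨Lam, hLam⟩ := exists_diagOp r (d := fun i => (lam i : ℂ)) (C := C) fun i => by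
    rw [Complex.norm_real]; exact hlam i
  obtain ⟨D, hD⟩ := exists_diagOp r (d := fun i => (d i : ℂ)) (C := C) fun i => by
    rw [Complex.norm_real]; exact hd i
  -- The derivative along the flow is taken for the operators of order r - 1, where solutions are
  -- differentiable.
  choose S' hS' hS'c using (hTa hr').exists_hasDerivAt hσ ω
  refine isSolution_conjugation_iff
    (B := fun t => Lam + (inclOp r).comp (fourierOp r W (toComplexVec (t • ω))))
    (B' := fun _ => D) (S' := S') (fun t u => signedCoeff_ext fun i => ?_)
    (fun t u => signedCoeff_ext fun i => ?_) ?_ (fun t => ?_) (fun t => ?_) hS'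
    (fun t => (hTa hr).incl_comp (hTa hr') hσ _) (fun t => ext_opCoeff fun i j => ?_) ψ
  · rw [hH, signedCoeff_pairCoeff, add_apply, modeCoeff_add, hLam,
      ContinuousLinearMap.comp_apply, modeCoeff_inclOp]
  · rw [hH', signedCoeff_pairCoeff, hD]
  · rw [continuous_iff_continuousAt]
    intro t
    obtain ⟨_, h, -⟩ := (hTa hr).exists_hasDerivAt hσ ω t
    exact h.continuousAt
  · exact isUnit_of_norm_sub_one_lt ((norm_fourierOp_sub_one_le hr hσ hδ hT _).trans_lt hsmall)
  · exact isUnit_of_norm_sub_one_lt ((norm_fourierOp_sub_one_le hr' hσ hδ hT _).trans_lt hsmall)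
  · have hz := toComplexVec_mem_complexStrip (t • ω)
    rw [map_add, map_smul, opCoeff_comp_inclOp, opCoeff_comp_diag hD, ContinuousLinearMap.add_comp,
      map_add]
    have e1 : opCoeff i j (Lam.comp (fourierOp r T (toComplexVec (t • ω)))) =
        lam i * opCoeff i j (fourierOp r T (toComplexVec (t • ω))) := by
      rw [opCoeff_apply, opCoeff_apply, ContinuousLinearMap.comp_apply, hLam]
    have e2 : opCoeff i j (((inclOp r).comp (fourierOp r W (toComplexVec (t • ω)))).comp
        (fourierOp r T (toComplexVec (t • ω)))) =
        opCoeff i j (fourierOp r (W * T) (toComplexVec (t • ω))) := by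
      rw [hWa.fourierOp_mul (hTa hr) hWT hWinv hσ, opCoeff_apply, opCoeff_apply,
        ContinuousLinearMap.comp_apply, ContinuousLinearMap.comp_apply, modeCoeff_inclOp]
      rfl
    rw [e1, e2]
    have s1 := ((hS'c t i j).const_smul Complex.I).add
      (((hTa hr').hasSum_opCoeff hσ hz i j).mul_left (d j : ℂ))
    have s2 := (((hTa hr).hasSum_opCoeff hσ hz i j).mul_left (lam i : ℂ)).add
      (hWT.hasSum_opCoeff hσ hz i j)
    -- The operator identity is compared Fourier coefficient by coefficient. Each comparison is the
    -- intertwining relation times e^{ik·ωt}; the time derivative produces i · i(ω·k) = -ω·k, which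
    -- is the term ω·k of the free diagonal on the other side.
    refine s1.unique (s2.congr_fun fun k => ?_)
    have h := hint (i, k) (j, 0)
    simp only [freeDiag, mul_zero, freq_zero, inner_zero_right, Complex.ofReal_zero, zero_add] at h
    have h0 : entry (0 : MatOp (Mode ν)) (i, k) (j, 0) = 0 := rfl
    rw [h0, add_zero] at h
    push_cast at h
    simp only [smul_eq_mul]
    have hI : Complex.I * Complex.I = -1 := Complex.I_mul_I
    linear_combination (-Complex.exp (freqForm k (toComplexVec (t • ω)))) * h +
      ((inner ℝ ω (freq k) : ℝ) : ℂ) * Complex.exp (freqForm k (toComplexVec (t • ω))) *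
        entry T (i, k) (j, 0) * hI

end

noncomputable section

open scoped ENNReal ComplexConjugate
open Filter Topology SineSobolev

variable {ν : ℕ}

/-! ### Fourier series on the torus -/

theorem TorusPeriodic.add_single {E : Type*} {f : EuclideanSpace ℝ (Fin ν) → E}
    (hf : TorusPeriodic f) (a : Fin ν) (n : ℤ) (θ : EuclideanSpace ℝ (Fin ν)) :
    f (θ + EuclideanSpace.single a (2 * π * n)) = f θ := by
  have h : Function.Periodic (fun t : ℝ => f (θ + EuclideanSpace.single a t)) (2 * π) := by
    intro t
    have := hf (θ + EuclideanSpace.single a t) a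
    rw [add_assoc, ← PiLp.single_add] at this
    exact this
  have h2 := h.int_mul n 0
  have h0 : EuclideanSpace.single a (0 : ℝ) = 0 := by ext b; simp
  simp only [zero_add, h0, add_zero] at h2
  rw [mul_comm, h2]

theorem TorusPeriodic.add_freq {E : Type*} {f : EuclideanSpace ℝ (Fin ν) → E}
    (hf : TorusPeriodic f) (k : Fin ν → ℤ) (θ : EuclideanSpace ℝ (Fin ν)) :
    f (θ + (2 * π) • freq k) = f θ := by
  have key : ∀ s : Finset (Fin ν), ∀ θ, f (θ + ∑ a ∈ s, EuclideanSpace.single a (2 * π * (k a : ℝ))) =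
      f θ := by
    intro s
    induction s using Finset.induction_on with
    | empty => simp
    | insert a s has ih =>
      intro θ
      rw [Finset.sum_insert has, ← add_assoc, ih, hf.add_single]
  have e : (2 * π) • freq k = ∑ a, EuclideanSpace.single a (2 * π * (k a : ℝ)) := by
    ext b
    simp [freq]
  rw [e, key]

/-- The point of the torus with the given normalized angles. -/
def anglePoint (x : Fin ν → ℝ) : EuclideanSpace ℝ (Fin ν) := WithLp.toLp 2 fun a => 2 * π * x a

theorem anglePoint_add (x y : Fin ν → ℝ) : anglePoint (x + y) = anglePoint x + anglePoint y := by
  ext a; simp [anglePoint, mul_add]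

theorem continuous_anglePoint : Continuous (anglePoint (ν := ν)) := by
  unfold anglePoint; fun_prop

/-- The unit cube, a fundamental domain of the torus in normalized angles. -/
def unitCube (ν : ℕ) (b : Fin ν → ℝ) : Set (Fin ν → ℝ) := {x | ∀ a, x a ∈ Ioc (b a) (b a + 1)}

theorem unitCube_eq_pi (b : Fin ν → ℝ) :
    unitCube ν b = Set.univ.pi fun a => Ioc (b a) (b a + 1) := by
  ext x; simp [unitCube]

theorem measurableSet_unitCube (b : Fin ν → ℝ) : MeasurableSet (unitCube ν b) := by
  rw [unitCube_eq_pi]; exact MeasurableSet.univ_pi fun a => measurableSet_Ioc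

theorem volume_unitCube (b : Fin ν → ℝ) : volume (unitCube ν b) = 1 := by
  rw [unitCube_eq_pi, volume_pi_pi]
  simp

/-- Periodic functions as functions on the torus. -/
def torusLift {E : Type*} (f : EuclideanSpace ℝ (Fin ν) → E) (u : UnitAddTorus (Fin ν)) : E :=
  f (anglePoint fun a => (AddCircle.equivIoc (1 : ℝ) 0 (u a)).1)

theorem TorusPeriodic.torusLift_coe {E : Type*} {f : EuclideanSpace ℝ (Fin ν) → E}
    (hf : TorusPeriodic f) (x : Fin ν → ℝ) :
    torusLift f (fun a => (x a : UnitAddCircle)) = f (anglePoint x) := by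
  rw [torusLift, ← hf.add_freq (fun a => toIocDiv (zero_lt_one' ℝ) 0 (x a))]
  congr 1
  ext a
  have h0 : (AddCircle.equivIoc (1 : ℝ) 0 ((x a : ℝ) : AddCircle (1 : ℝ))).1 =
      toIocMod (zero_lt_one' ℝ) 0 (x a) := rfl
  simp only [h0, anglePoint, freq, PiLp.add_apply, PiLp.smul_apply,
    smul_eq_mul]
  have h := toIocMod_add_toIocDiv_zsmul (zero_lt_one' ℝ) 0 (x a)
  rw [← mul_add]
  congr 1
  simpa using h

theorem isOpenQuotientMap_unitAddTorus :
    IsOpenQuotientMap fun (x : Fin ν → ℝ) (a : Fin ν) => (x a : UnitAddCircle) :=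
  IsOpenQuotientMap.piMap fun _ => QuotientAddGroup.isOpenQuotientMap_mk

theorem TorusPeriodic.continuous_torusLift {E : Type*} [TopologicalSpace E]
    {f : EuclideanSpace ℝ (Fin ν) → E} (hf : TorusPeriodic f) (hc : Continuous f) :
    Continuous (torusLift f) := by
  rw [isOpenQuotientMap_unitAddTorus.isQuotientMap.continuous_iff]
  have : torusLift f ∘ (fun (x : Fin ν → ℝ) (a : Fin ν) => (x a : UnitAddCircle)) =
      f ∘ anglePoint := funext fun x => hf.torusLift_coe x
  rw [this]
  exact hc.comp continuous_anglePoint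

/-- The cubes based at 0 and at y are two fundamental domains for the same integral over the torus.
-/
theorem TorusPeriodic.integral_translate {f : EuclideanSpace ℝ (Fin ν) → ℂ}
    (hf : TorusPeriodic f) (θ : EuclideanSpace ℝ (Fin ν)) :
    ∫ x in unitCube ν 0, f (anglePoint x + θ) = ∫ x in unitCube ν 0, f (anglePoint x) := by
  obtain ⟨y, rfl⟩ : ∃ y, anglePoint y = θ := by
    refine ⟨fun a => (2 * π)⁻¹ * θ a, ?_⟩
    ext a
    have := Real.pi_ne_zero
    simp only [anglePoint]
    field_simp
  have h1 := (UnitAddTorus.integral_preimage (torusLift f) (0 : Fin ν → ℝ)).symm.trans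
    (UnitAddTorus.integral_preimage (torusLift f) y)
  simp only [hf.torusLift_coe] at h1
  change ∫ x in unitCube ν 0, f (anglePoint x) = ∫ x in unitCube ν y, f (anglePoint x) at h1
  rw [h1, ← integral_indicator (measurableSet_unitCube _), ← integral_indicator
    (measurableSet_unitCube _),
    ← integral_add_right_eq_self ((unitCube ν y).indicator fun x => f (anglePoint x)) y]
  refine integral_congr_ae (Eventually.of_forall fun x => ?_)
  have hmem : x ∈ unitCube ν 0 ↔ x + y ∈ unitCube ν y := by
    refine forall_congr' fun a => ?_
    simp only [Pi.add_apply, Pi.zero_apply, zero_add, mem_Ioc]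
    constructor
    · rintro ⟨h, h'⟩; constructor <;> linarith
    · rintro ⟨h, h'⟩; constructor <;> linarith
  by_cases hx : x ∈ unitCube ν 0
  · simp [hx, hmem.1 hx, anglePoint_add]
  · simp [hx, mt hmem.2 hx]

/-- The Fourier coefficients of a function on the torus. -/
def torusCoeff (f : EuclideanSpace ℝ (Fin ν) → ℂ) (k : Fin ν → ℤ) : ℂ :=
  ∫ x in unitCube ν 0, Complex.exp (-freqForm k (toComplexVec (anglePoint x))) * f (anglePoint x)

theorem mFourier_coe (k : Fin ν → ℤ) (x : Fin ν → ℝ) :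
    UnitAddTorus.mFourier k (fun a => (x a : UnitAddCircle)) =
      Complex.exp (freqForm k (toComplexVec (anglePoint x))) := by
  have h : ∀ a, fourier (k a) ((x a : ℝ) : UnitAddCircle) =
      Complex.exp (2 * π * Complex.I * k a * x a) := fun a => by
    rw [fourier_coe_apply]; simp
  simp only [UnitAddTorus.mFourier, ContinuousMap.coe_mk, h]
  rw [← Complex.exp_sum, freqForm_apply, Finset.mul_sum]
  congr 1
  refine Finset.sum_congr rfl fun a _ => ?_
  simp only [toComplexVec, anglePoint]
  push_cast
  ring

theorem TorusPeriodic.hasSum_torusCoeff {f : EuclideanSpace ℝ (Fin ν) → ℂ} (hf : TorusPeriodic f)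
    (hc : Continuous f) (hs : Summable (torusCoeff f)) (θ : EuclideanSpace ℝ (Fin ν)) :
    HasSum (fun k => Complex.exp (freqForm k (toComplexVec θ)) * torusCoeff f k) (f θ) := by
  let g : C(UnitAddTorus (Fin ν), ℂ) := ⟨torusLift f, hf.continuous_torusLift hc⟩
  have hg : ∀ k, UnitAddTorus.mFourierCoeff g k = torusCoeff f k := by
    intro k
    rw [UnitAddTorus.mFourierCoeff_eq_integral g k 0]
    refine integral_congr_ae (Eventually.of_forall fun x => ?_)
    simp only [mFourier_coe, smul_eq_mul, freqForm_neg]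
    congr 1
    exact hf.torusLift_coe x
  have hs' : Summable (UnitAddTorus.mFourierCoeff g) := by
    rw [funext hg]; exact hs
  obtain ⟨y, rfl⟩ : ∃ y, anglePoint y = θ := by
    refine ⟨fun a => (2 * π)⁻¹ * θ a, ?_⟩
    ext a
    have := Real.pi_ne_zero
    simp only [anglePoint]
    field_simp
  have h := UnitAddTorus.hasSum_mFourier_series_apply_of_summable hs'
    (fun a => (y a : UnitAddCircle))
  have e : g (fun a => (y a : UnitAddCircle)) = f (anglePoint y) := hf.torusLift_coe y
  rw [e] at h
  refine h.congr_fun fun k => ?_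
  rw [hg, mFourier_coe, smul_eq_mul, mul_comm]

theorem torusCoeff_norm_le {f : EuclideanSpace ℝ (Fin ν) → ℂ} {C : ℝ} (hC : ∀ θ, ‖f θ‖ ≤ C)
    (k : Fin ν → ℤ) : ‖torusCoeff f k‖ ≤ C := by
  have h := norm_setIntegral_le_of_norm_le_const (μ := volume) (s := unitCube ν 0) (C := C)
    (f := fun x => Complex.exp (-freqForm k (toComplexVec (anglePoint x))) * f (anglePoint x))
    (by rw [volume_unitCube]; exact ENNReal.one_lt_top) fun x _ => by
      rw [norm_mul, ← freqForm_neg, norm_exp_freqForm_real, one_mul]; exact hC _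
  rw [measureReal_def, volume_unitCube, ENNReal.toReal_one, mul_one] at h
  exact h

theorem torusCoeff_neg_of_real {f : EuclideanSpace ℝ (Fin ν) → ℂ} (hf : ∀ θ, conj (f θ) = f θ)
    (k : Fin ν → ℤ) : torusCoeff f (-k) = conj (torusCoeff f k) := by
  rw [torusCoeff, torusCoeff, ← integral_conj]
  refine integral_congr_ae (Eventually.of_forall fun x => ?_)
  simp only [map_mul, hf, ← Complex.exp_conj, map_neg, freqForm_neg]
  rw [freqForm_toComplexVec]
  simp

end

noncomputable section

open scoped ENNReal ComplexConjugate
open Filter Topology SineSobolev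

variable {ν : ℕ}

/-! ### Decay of Fourier coefficients of analytic functions -/

theorem toComplexVec_add (θ η : EuclideanSpace ℝ (Fin ν)) :
    toComplexVec (θ + η) = toComplexVec θ + toComplexVec η := by
  ext a; simp [toComplexVec]

theorem toComplexVec_smul (t : ℝ) (θ : EuclideanSpace ℝ (Fin ν)) :
    toComplexVec (t • θ) = (t : ℂ) • toComplexVec θ := by
  ext a; simp [toComplexVec]

theorem continuous_toComplexVec : Continuous (toComplexVec (ν := ν)) := by
  unfold toComplexVec; fun_prop

theorem toComplexVec_mem_strip (θ : EuclideanSpace ℝ (Fin ν)) {ρ : ℝ} (hρ : 0 ≤ ρ) :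
    toComplexVec θ ∈ complexStrip ν ρ :=
  (toComplexVec_mem_complexStrip θ).trans hρ

theorem add_smul_mem_complexStrip (θ η : EuclideanSpace ℝ (Fin ν)) (s : ℂ) {ρ : ℝ}
    (h : |s.im| * ‖η‖ ≤ ρ) : toComplexVec θ + s • toComplexVec η ∈ complexStrip ν ρ := by
  have e : (WithLp.toLp 2 fun a => ((toComplexVec θ + s • toComplexVec η) a).im :
      EuclideanSpace ℝ (Fin ν)) = s.im • η := by
    ext a; simp [toComplexVec]
  change ‖(WithLp.toLp 2 fun a => ((toComplexVec θ + s • toComplexVec η) a).im :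
      EuclideanSpace ℝ (Fin ν))‖ ≤ ρ
  rw [e, norm_smul, Real.norm_eq_abs]
  exact h

/-- Instead of moving contours one variable at a time, consider Φ(s), the integral of g shifted by
sη. It is holomorphic in a strip containing 0 and i, and constant for real s by translation
invariance, so it is constant and Φ(i) = Φ(0). -/
theorem integral_unitCube_shift {g : EuclideanSpace ℂ (Fin ν) → ℂ} {ρ ρ' K : ℝ} (hρ' : 0 ≤ ρ')
    (hρ : ρ' < ρ) (hg : AnalyticOnNhd ℂ g (complexStrip ν ρ))
    (hK : ∀ z ∈ complexStrip ν ρ, ‖g z‖ ≤ K)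
    (hper : TorusPeriodic fun θ => g (toComplexVec θ)) {η : EuclideanSpace ℝ (Fin ν)}
    (hη : ‖η‖ ≤ ρ') :
    ∫ x in unitCube ν 0, g (toComplexVec (anglePoint x) + Complex.I • toComplexVec η) =
      ∫ x in unitCube ν 0, g (toComplexVec (anglePoint x)) := by
  have hρ0 : 0 < ρ := hρ'.trans_lt hρ
  -- Any b > 1 with b|η| ≤ ρ works: the strip |Im s| < b then contains i, and the shifted arguments
  -- stay in the strip of analyticity. If ρ' = 0 then η = 0.
  set b : ℝ := if ρ' = 0 then 2 else ρ / ρ' with hb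
  have hb1 : 1 < b := by
    rw [hb]
    split_ifs with h
    · norm_num
    · exact (one_lt_div (lt_of_le_of_ne hρ' (Ne.symm h))).2 hρ
  have hbη : b * ‖η‖ ≤ ρ := by
    rw [hb]
    split_ifs with h
    · rw [h] at hη
      have : ‖η‖ = 0 := le_antisymm hη (norm_nonneg _)
      rw [this, mul_zero]; exact hρ0.le
    · have h0 : 0 < ρ' := lt_of_le_of_ne hρ' (Ne.symm h)
      rw [div_mul_eq_mul_div, div_le_iff₀ h0]
      gcongr
  set D : Set ℂ := {s | s.im ∈ Ioo (-b) b} with hD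
  have hDo : IsOpen D := isOpen_Ioo.preimage Complex.continuous_im
  have hDc : Convex ℝ D := (convex_Ioo (-b) b).linear_preimage Complex.imLm
  have hmem : ∀ s ∈ D, ∀ θ : EuclideanSpace ℝ (Fin ν),
      toComplexVec θ + s • toComplexVec η ∈ complexStrip ν ρ := by
    intro s hs θ
    refine add_smul_mem_complexStrip θ η s (le_trans ?_ hbη)
    gcongr
    exact (abs_lt.2 hs).le
  set P : (Fin ν → ℝ) → ℂ → ℂ := fun x s => g (toComplexVec (anglePoint x) + s • toComplexVec η)
    with hP
  have hPd : ∀ x, ∀ s ∈ D, HasDerivAt (P x)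
      (fderiv ℂ g (toComplexVec (anglePoint x) + s • toComplexVec η) (toComplexVec η)) s := by
    intro x s hs
    have h1 := (hg _ (hmem s hs (anglePoint x))).differentiableAt.hasFDerivAt
    have h2 : HasDerivAt (fun s : ℂ => toComplexVec (anglePoint x) + s • toComplexVec η)
        (toComplexVec η) s := by
      simpa using ((hasDerivAt_id s).smul_const (toComplexVec η)).const_add
        (toComplexVec (anglePoint x))
    exact h1.comp_hasDerivAt s h2
  have hPc : ∀ s ∈ D, Continuous fun x => P x s := by
    intro s hs
    refine continuous_iff_continuousAt.2 fun x => ?_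
    have h1 := (hg _ (hmem s hs (anglePoint x))).continuousAt
    refine ContinuousAt.comp (g := g)
      (f := fun x => toComplexVec (anglePoint x) + s • toComplexVec η) h1 ?_
    exact ((continuous_toComplexVec.comp continuous_anglePoint).add continuous_const).continuousAt
  have hPc' : ∀ s ∈ D, Continuous fun x =>
      fderiv ℂ g (toComplexVec (anglePoint x) + s • toComplexVec η) (toComplexVec η) := by
    intro s hs
    refine continuous_iff_continuousAt.2 fun x => ?_
    have h1 := (hg.fderiv _ (hmem s hs (anglePoint x))).continuousAt
    have h2 : ContinuousAt (fun x => fderiv ℂ g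
        (toComplexVec (anglePoint x) + s • toComplexVec η)) x := by
      refine ContinuousAt.comp (g := fderiv ℂ g)
        (f := fun x => toComplexVec (anglePoint x) + s • toComplexVec η) h1 ?_
      exact ((continuous_toComplexVec.comp continuous_anglePoint).add continuous_const).continuousAt
    exact h2.clm_apply continuousAt_const
  have : IsFiniteMeasure (volume.restrict (unitCube ν 0)) :=
    ⟨by rw [Measure.restrict_apply_univ, volume_unitCube]; exact ENNReal.one_lt_top⟩
  set Φ : ℂ → ℂ := fun s => ∫ x in unitCube ν 0, P x s with hΦ
  have hΦd : DifferentiableOn ℂ Φ D := by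
    intro s hs
    obtain ⟨δ, hδ, hball⟩ := Metric.isOpen_iff.1 hDo s hs
    -- Since 1/2 + 1/3 < 1, discs of radius δ/3 around nearby points remain in D. The Cauchy
    -- estimate on them bounds the derivative by K/(δ/3) uniformly in x, as needed to differentiate
    -- under the integral.
    have hcl : ∀ u ∈ Metric.ball s (δ / 2), Metric.closedBall u (δ / 3) ⊆ D := by
      intro u hu w hw
      refine hball ?_
      rw [Metric.mem_ball] at hu ⊢
      rw [Metric.mem_closedBall] at hw
      linarith [dist_triangle w u s]
    have h := hasDerivAt_integral_of_dominated_loc_of_deriv_le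
      (μ := volume.restrict (unitCube ν 0)) (F := fun s x => P x s)
      (F' := fun s x =>
        fderiv ℂ g (toComplexVec (anglePoint x) + s • toComplexVec η) (toComplexVec η))
      (bound := fun _ => K / (δ / 3)) (s := Metric.ball s (δ / 2)) (x₀ := s)
      (Metric.ball_mem_nhds s (by positivity))
      (by
        filter_upwards [hDo.mem_nhds hs] with u hu
        exact (hPc u hu).aestronglyMeasurable)
      (Integrable.of_bound (hPc s hs).aestronglyMeasurable K
        (Eventually.of_forall fun x => hK _ (hmem s hs _)))
      (hPc' s hs).aestronglyMeasurable
      (Eventually.of_forall fun x u hu => by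
        have hd := hPd x u (hcl u hu (Metric.mem_closedBall_self (by positivity)))
        rw [← hd.deriv]
        refine Complex.norm_deriv_le_of_forall_mem_sphere_norm_le (by positivity) ?_ fun w hw => ?_
        · refine DifferentiableOn.diffContOnCl fun w hw => ?_
          refine (hPd x w (hcl u hu ?_)).differentiableAt.differentiableWithinAt
          exact Metric.closure_ball_subset_closedBall hw
        · exact hK _ (hmem w (hcl u hu (Metric.sphere_subset_closedBall hw)) _))
      (integrable_const _)
      (Eventually.of_forall fun x u hu =>
        hPd x u (hcl u hu (Metric.mem_closedBall_self (by positivity))))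
    exact h.2.differentiableAt.differentiableWithinAt
  have hreal : ∀ t : ℝ, Φ t = Φ 0 := by
    intro t
    have h := hper.integral_translate (t • η)
    simp only [toComplexVec_add, toComplexVec_smul] at h
    simp only [hΦ, hP, zero_smul, add_zero]
    exact h
  have h0 : (0 : ℂ) ∈ D := by simp [hD]; linarith
  have hI : Complex.I ∈ D := by simp [hD]; constructor <;> linarith
  have hana : AnalyticOnNhd ℂ Φ D := hΦd.analyticOnNhd hDo
  -- The real points 1/(n + 1) accumulate at 0 and suffice for the identity theorem.
  have hfreq : ∃ᶠ s in 𝓝[≠] (0 : ℂ), Φ s = (fun _ => Φ 0) s := by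
    have h1 : Tendsto (fun n : ℕ => ((1 / ((n : ℝ) + 1) : ℝ) : ℂ)) atTop (𝓝[≠] 0) := by
      refine tendsto_nhdsWithin_iff.2 ⟨?_, Eventually.of_forall fun n => ?_⟩
      · have := (Complex.continuous_ofReal.tendsto 0).comp
          (tendsto_one_div_add_atTop_nhds_zero_nat (𝕜 := ℝ))
        simpa [Function.comp_def] using this
      · simp only [mem_compl_iff, mem_singleton_iff, Complex.ofReal_eq_zero]
        positivity
    exact h1.frequently (Frequently.of_forall fun n => hreal _)
  have heq := hana.eqOn_of_preconnected_of_frequently_eq (g := fun _ => Φ 0) analyticOnNhd_const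
    hDc.isPreconnected h0 hfreq hI
  have h1 : Φ Complex.I = Φ 0 := heq
  simp only [hΦ, hP, zero_smul, add_zero] at h1
  exact h1

theorem torusCoeff_exp_decay {h : EuclideanSpace ℂ (Fin ν) → ℂ} {ρ ρ' C : ℝ} (hρ' : 0 ≤ ρ')
    (hρ : ρ' < ρ) (hh : AnalyticOnNhd ℂ h (complexStrip ν ρ))
    (hC : ∀ z ∈ complexStrip ν ρ, ‖h z‖ ≤ C)
    (hper : TorusPeriodic fun θ => h (toComplexVec θ)) (k : Fin ν → ℤ) :
    ‖torusCoeff (fun θ => h (toComplexVec θ)) k‖ ≤ C * exp (-(ρ' * ‖freq k‖)) := by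
  have hρ0 : 0 < ρ := hρ'.trans_lt hρ
  -- The shift points against k, so that e^{-ik·θ} acquires the factor e^{-ρ'|k|} on the shifted
  -- torus. For k = 0 division by zero gives η = 0, which is right.
  set η : EuclideanSpace ℝ (Fin ν) := -((ρ' / ‖freq k‖) • freq k) with hη
  have hηn : ‖η‖ ≤ ρ' := by
    rw [hη, norm_neg, norm_smul, norm_div, norm_norm, Real.norm_of_nonneg hρ']
    rcases eq_or_ne ‖freq k‖ 0 with h0 | h0
    · rw [h0, mul_zero]; exact hρ'
    · rw [div_mul_cancel₀ _ h0]
  have hηk : inner ℝ η (freq k) = -(ρ' * ‖freq k‖) := by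
    rw [hη, inner_neg_left, inner_smul_left, real_inner_self_eq_norm_sq]
    rcases eq_or_ne ‖freq k‖ 0 with h0 | h0
    · simp [h0]
    · simp only [conj_trivial]; field_simp
  set g : EuclideanSpace ℂ (Fin ν) → ℂ := fun z => Complex.exp (-freqForm k z) * h z with hg
  have hga : AnalyticOnNhd ℂ g (complexStrip ν ρ) := by
    intro z hz
    refine AnalyticAt.mul ?_ (hh z hz)
    exact (((freqForm k).analyticAt z).neg).cexp
  have hC0 : 0 ≤ C := (norm_nonneg _).trans (hC _ (toComplexVec_mem_strip 0 hρ0.le))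
  have hgK : ∀ z ∈ complexStrip ν ρ, ‖g z‖ ≤ exp (ρ * ‖freq k‖) * C := by
    intro z hz
    rw [hg, norm_mul, ← freqForm_neg]
    have := norm_exp_freqForm_le (-k) hz
    rw [freq_neg, norm_neg] at this
    exact mul_le_mul this (hC z hz) (norm_nonneg _) (by positivity)
  have hgp : TorusPeriodic fun θ => g (toComplexVec θ) := by
    intro θ a
    simp only [hg]
    have h1 := hper θ a
    simp only at h1
    rw [h1, freqForm_toComplexVec, freqForm_toComplexVec, inner_add_left]
    have : inner ℝ (EuclideanSpace.single a (2 * π)) (freq k) = 2 * π * k a := by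
      simp [freq, EuclideanSpace.inner_single_left]
    rw [this]
    push_cast
    rw [add_mul, neg_add, Complex.exp_add, show -((2 * (π : ℂ) * (k a : ℂ)) * Complex.I) =
      ((-k a : ℤ) : ℂ) * (2 * π * Complex.I) by push_cast; ring,
      Complex.exp_int_mul_two_pi_mul_I, mul_one]
  have key := integral_unitCube_shift hρ' hρ hga hgK hgp hηn
  have e : torusCoeff (fun θ => h (toComplexVec θ)) k =
      ∫ x in unitCube ν 0, g (toComplexVec (anglePoint x)) := rfl
  rw [e, ← key]
  have hb := norm_setIntegral_le_of_norm_le_const (μ := volume) (s := unitCube ν 0)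
    (C := C * exp (-(ρ' * ‖freq k‖)))
    (f := fun x => g (toComplexVec (anglePoint x) + Complex.I • toComplexVec η))
    (by rw [volume_unitCube]; exact ENNReal.one_lt_top) fun x _ => by
      have hz : toComplexVec (anglePoint x) + Complex.I • toComplexVec η ∈ complexStrip ν ρ := by
        refine add_smul_mem_complexStrip _ _ _ ?_
        simp only [Complex.I_im, abs_one, one_mul]
        linarith
      rw [hg, norm_mul, mul_comm]
      refine mul_le_mul (hC _ hz) (le_of_eq ?_) (norm_nonneg _) hC0
      rw [map_add, map_smul, neg_add, Complex.exp_add, norm_mul, ← freqForm_neg,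
        norm_exp_freqForm_real, one_mul, freqForm_toComplexVec, hηk, smul_eq_mul,
        show -(Complex.I * (((-(ρ' * ‖freq k‖) : ℝ) : ℂ) * Complex.I)) =
          ((-(ρ' * ‖freq k‖) : ℝ) : ℂ) by
          linear_combination (-((-(ρ' * ‖freq k‖) : ℝ) : ℂ)) * Complex.I_mul_I,
        Complex.norm_exp, Complex.ofReal_re]
  rw [measureReal_def, volume_unitCube, ENNReal.toReal_one, mul_one] at hb
  exact hb

end

noncomputable section

open scoped ENNReal ComplexConjugate
open Filter Topology SineSobolev

variable {ν : ℕ}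

/-! ### Cosine coefficients of smooth even functions -/

theorem Function.Periodic.deriv_complex {f : ℝ → ℂ} {c : ℝ} (hf : Function.Periodic f c) :
    Function.Periodic (deriv f) c := by
  intro x
  rw [← deriv_comp_add_const]
  congr 1
  exact funext hf

/-- Integration by parts over a full period; the boundary terms cancel by periodicity. -/
theorem mul_integral_mul_exp {f : ℝ → ℂ} (hf : ContDiff ℝ 1 f) (hp : Function.Periodic f (2 * π))
    (n : ℤ) : (Complex.I * n) * ∫ x in (-π)..π, f x * Complex.exp (Complex.I * n * x) =
      -∫ x in (-π)..π, deriv f x * Complex.exp (Complex.I * n * x) := by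
  have hd : ∀ x : ℝ, HasDerivAt (fun x : ℝ => Complex.exp (Complex.I * n * x))
      (Complex.exp (Complex.I * n * x) * (Complex.I * n)) x := by
    intro x
    have h1 : HasDerivAt (fun x : ℝ => Complex.I * n * (x : ℂ)) (Complex.I * n) x := by
      simpa using (Complex.ofRealCLM.hasDerivAt (x := x)).const_mul (Complex.I * n)
    exact h1.cexp
  have hc : Continuous fun x : ℝ => Complex.exp (Complex.I * n * x) := by fun_prop
  have h := intervalIntegral.integral_mul_deriv_eq_deriv_mul (a := -π) (b := π)
    (u := f) (u' := deriv f) (v := fun x : ℝ => Complex.exp (Complex.I * n * x))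
    (v' := fun x : ℝ => Complex.exp (Complex.I * n * x) * (Complex.I * n))
    (fun x _ => (hf.differentiable (by norm_num) x).hasDerivAt) (fun x _ => hd x)
    ((hf.continuous_deriv le_rfl).intervalIntegrable _ _)
    ((hc.mul continuous_const).intervalIntegrable _ _)
  have hb : f π * Complex.exp (Complex.I * n * π) -
      f (-π) * Complex.exp (Complex.I * n * (-π : ℝ)) = 0 := by
    have e1 : f π = f (-π) := by
      have := hp (-π)
      rw [← this]; congr 1; ring
    have e2 : Complex.exp (Complex.I * n * π) = Complex.exp (Complex.I * n * (-π : ℝ)) := by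
      rw [show Complex.I * n * (π : ℂ) = Complex.I * n * ((-π : ℝ) : ℂ) + n * (2 * π * Complex.I) by
        push_cast; ring, Complex.exp_add, Complex.exp_int_mul_two_pi_mul_I, mul_one]
    rw [e1, e2, sub_self]
  rw [hb, zero_sub] at h
  rw [← h, ← intervalIntegral.integral_const_mul]
  congr 1
  funext x
  ring

theorem pow_mul_norm_integral_mul_exp {f : ℝ → ℂ} (hf : ContDiff ℝ (⊤ : ℕ∞) f)
    (hp : Function.Periodic f (2 * π)) (n : ℤ) (N : ℕ) :
    |(n : ℝ)| ^ N * ‖∫ x in (-π)..π, f x * Complex.exp (Complex.I * n * x)‖ =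
      ‖∫ x in (-π)..π, iteratedDeriv N f x * Complex.exp (Complex.I * n * x)‖ := by
  induction N generalizing f with
  | zero => simp
  | succ N ih =>
    have h1 : ContDiff ℝ (⊤ : ℕ∞) (deriv f) := (contDiff_infty_iff_deriv.1 hf).2
    have h2 := ih h1 hp.deriv_complex
    rw [iteratedDeriv_succ', ← h2]
    have h3 := congrArg norm (mul_integral_mul_exp (hf.of_le (by exact_mod_cast le_top)) hp n)
    rw [norm_mul, norm_mul, Complex.norm_I, one_mul, norm_neg, Complex.norm_intCast] at h3
    rw [← h3, pow_succ]
    ring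

/-- The cosine coefficients of a function on `[0, π]`. -/
def cosCoeff (f : ℝ → ℝ) (n : ℤ) : ℝ := 1 / π * ∫ x in (0 : ℝ)..π, f x * cos (n * x)

theorem cosCoeff_neg (f : ℝ → ℝ) (n : ℤ) : cosCoeff f (-n) = cosCoeff f n := by
  simp [cosCoeff]

theorem cosCoeff_congr {f g : ℝ → ℝ} (h : ∀ x ∈ Icc 0 π, f x = g x) (n : ℤ) :
    cosCoeff f n = cosCoeff g n := by
  unfold cosCoeff
  congr 1
  refine intervalIntegral.integral_congr fun x hx => ?_
  rw [uIcc_of_le Real.pi_pos.le] at hx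
  simp only [h x hx]

/-- By evenness the cosine integral over [0, π] is half of the one over a full period, the real part
of a Fourier coefficient of a smooth periodic function, and N integrations by parts apply. This is
where smoothness of the even extension is needed. -/
theorem pow_mul_abs_cosCoeff_le {f : ℝ → ℝ} {g : ℝ → ℂ} (hfg : ∀ x, g x = f x)
    (hg : ContDiff ℝ (⊤ : ℕ∞) g) (heven : ∀ x, f (-x) = f x) (hp : Function.Periodic f (2 * π))
    {N : ℕ} {C : ℝ} (hC : ∀ x, ‖iteratedDeriv N g x‖ ≤ C) (n : ℤ) :
    |(n : ℝ)| ^ N * |cosCoeff f n| ≤ C := by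
  have hfc : Continuous f := by
    have : f = fun x => (g x).re := funext fun x => by rw [hfg]; rfl
    rw [this]
    exact Complex.continuous_re.comp hg.continuous
  have hgp : Function.Periodic g (2 * π) := fun x => by rw [hfg, hfg, hp]
  have h1 : ∫ x in (-π)..π, f x * cos (n * x) = 2 * ∫ x in (0 : ℝ)..π, f x * cos (n * x) := by
    have hi : ∀ a b : ℝ, IntervalIntegrable (fun x => f x * cos (n * x)) volume a b := fun a b =>
      Continuous.intervalIntegrable (by fun_prop) a b
    rw [← intervalIntegral.integral_add_adjacent_intervals (hi (-π) 0) (hi 0 π), two_mul]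
    congr 1
    have := intervalIntegral.integral_comp_neg (a := 0) (b := π) fun x => f x * cos (n * x)
    rw [neg_zero] at this
    rw [← this]
    congr 1
    funext x
    rw [heven, mul_neg, cos_neg]
  have h2 : ∫ x in (-π)..π, f x * cos (n * x) =
      (∫ x in (-π)..π, g x * Complex.exp (Complex.I * n * x)).re := by
    have hi : IntervalIntegrable (fun x : ℝ => g x * Complex.exp (Complex.I * n * x)) volume (-π) π :=
      Continuous.intervalIntegrable (by have := hg.continuous; fun_prop) _ _
    have h := Complex.reCLM.intervalIntegral_comp_comm hi
    simp only [Complex.reCLM_apply] at h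
    rw [← h]
    congr 1
    funext x
    rw [hfg, Complex.re_ofReal_mul, show Complex.I * n * (x : ℂ) = ((n * x : ℝ) : ℂ) * Complex.I by
      push_cast; ring, Complex.exp_ofReal_mul_I_re]
  have h3 : cosCoeff f n = (2 * π)⁻¹ *
      (∫ x in (-π)..π, g x * Complex.exp (Complex.I * n * x)).re := by
    rw [cosCoeff, ← h2, h1]
    have := Real.pi_ne_zero
    field_simp
  have h4 : ‖∫ x in (-π)..π, iteratedDeriv N g x * Complex.exp (Complex.I * n * x)‖ ≤
      C * |π - -π| := by
    refine intervalIntegral.norm_integral_le_of_norm_le_const fun x _ => ?_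
    rw [norm_mul, show Complex.I * n * (x : ℂ) = ((n * x : ℝ) : ℂ) * Complex.I by
      push_cast; ring, Complex.norm_exp_ofReal_mul_I, mul_one]
    exact hC x
  rw [← pow_mul_norm_integral_mul_exp hg hgp n N, sub_neg_eq_add,
    abs_of_nonneg (by have := Real.pi_pos; linarith : 0 ≤ π + π)] at h4
  have hpi := Real.pi_pos
  rw [h3, abs_mul, abs_of_nonneg (by positivity : 0 ≤ (2 * π)⁻¹)]
  have h5 := Complex.abs_re_le_norm (∫ x in (-π)..π, g x * Complex.exp (Complex.I * n * x))
  calc _ ≤ |(n : ℝ)| ^ N * ((2 * π)⁻¹ * ‖∫ x in (-π)..π, g x * Complex.exp (Complex.I * n * x)‖) := by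
        gcongr
    _ = (2 * π)⁻¹ *
        (|(n : ℝ)| ^ N * ‖∫ x in (-π)..π, g x * Complex.exp (Complex.I * n * x)‖) := by ring
    _ ≤ (2 * π)⁻¹ * (C * (π + π)) := by gcongr
    _ = C := by field_simp; ring

/-- The product formula 2 sin a sin b = cos(a - b) - cos(a + b) makes multiplication by a function a
Toeplitz-minus-Hankel matrix in the sine basis. -/
theorem sineMul_kernel {f : ℝ → ℝ} (hf : ContinuousOn f (Icc 0 π)) (m n : ℤ) :
    2 / π * ∫ x in (0 : ℝ)..π, f x * sin (m * x) * sin (n * x) =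
      cosCoeff f (m - n) - cosCoeff f (m + n) := by
  have hi : ∀ l : ℤ, IntervalIntegrable (fun x => f x * cos (l * x)) volume 0 π := fun l => by
    refine ContinuousOn.intervalIntegrable ?_
    rw [uIcc_of_le Real.pi_pos.le]
    exact hf.mul (by fun_prop)
  rw [cosCoeff, cosCoeff, ← mul_sub, ← intervalIntegral.integral_sub (hi _) (hi _),
    show 2 / π = 1 / π * 2 by ring, mul_assoc, ← intervalIntegral.integral_const_mul]
  congr 2
  funext x
  push_cast
  rw [sub_mul, add_mul, cos_sub, cos_add]
  ring

end

noncomputable section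

open scoped ENNReal ComplexConjugate
open Filter Topology SineSobolev
open scoped Pointwise

variable {ν : ℕ}

/-! ### Fourier coefficients of the potential -/

theorem evenExtension_eq (g : ℝ → ℝ) {x : ℝ} (hx : x ∈ Icc 0 π) : evenExtension g x = g x := by
  rw [evenExtension, arccos_cos hx.1 hx.2]

theorem evenExtension_neg (g : ℝ → ℝ) (x : ℝ) : evenExtension g (-x) = evenExtension g x := by
  rw [evenExtension, evenExtension, cos_neg]

theorem evenExtension_periodic (g : ℝ → ℝ) : Function.Periodic (evenExtension g) (2 * π) := by
  intro x
  rw [evenExtension, evenExtension, cos_add_two_pi]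

/-- The Fourier coefficient of index `k` in the angles and `n` in space of the potential. -/
def potentialCoeff (V : EuclideanSpace ℝ (Fin ν) → ℝ → ℝ) (n : ℤ) (k : Fin ν → ℤ) : ℂ :=
  torusCoeff (fun θ => (cosCoeff (evenExtension (V θ)) n : ℂ)) k

theorem potentialCoeff_neg_right (V : EuclideanSpace ℝ (Fin ν) → ℝ → ℝ) (n : ℤ) (k : Fin ν → ℤ) :
    potentialCoeff V n (-k) = conj (potentialCoeff V n k) :=
  torusCoeff_neg_of_real (fun _ => Complex.conj_ofReal _) k

theorem potentialCoeff_neg_left (V : EuclideanSpace ℝ (Fin ν) → ℝ → ℝ) (n : ℤ) (k : Fin ν → ℤ) :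
    potentialCoeff V (-n) k = potentialCoeff V n k := by
  unfold potentialCoeff
  simp only [cosCoeff_neg]

section

variable {V : EuclideanSpace ℝ (Fin ν) → ℝ → ℝ}

theorem continuous_cosCoeff
    (hV : Continuous fun p : EuclideanSpace ℝ (Fin ν) × ℝ => evenExtension (V p.1) p.2) (n : ℤ) :
    Continuous fun θ => cosCoeff (evenExtension (V θ)) n := by
  unfold cosCoeff
  refine continuous_const.mul ?_
  refine intervalIntegral.continuous_parametric_intervalIntegral_of_continuous' ?_ 0 π
  have : Continuous fun p : EuclideanSpace ℝ (Fin ν) × ℝ => cos (n * p.2) := by fun_prop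
  exact hV.mul this

/-- Fubini. Taking the angular Fourier coefficient first lets bounds that hold at fixed x, such as
decay in k or zero average, pass to `potentialCoeff`. -/
theorem potentialCoeff_eq_integral
    (hV : Continuous fun p : EuclideanSpace ℝ (Fin ν) × ℝ => evenExtension (V p.1) p.2) {C : ℝ}
    (hC : ∀ θ x, |evenExtension (V θ) x| ≤ C) (n : ℤ) (k : Fin ν → ℤ) :
    potentialCoeff V n k = 1 / π * ∫ x in (0 : ℝ)..π,
      torusCoeff (fun θ => (evenExtension (V θ) x : ℂ)) k * cos (n * x) := by
  have hpi := Real.pi_pos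
  have : IsFiniteMeasure (volume.restrict (unitCube ν 0)) :=
    ⟨by rw [Measure.restrict_apply_univ, volume_unitCube]; exact ENNReal.one_lt_top⟩
  let f : (Fin ν → ℝ) → ℝ → ℂ := fun y x =>
    Complex.exp (-freqForm k (toComplexVec (anglePoint y))) *
      (evenExtension (V (anglePoint y)) x : ℂ) * (cos (n * x) : ℂ)
  have hfc : Continuous (Function.uncurry f) := by
    have h1 : Continuous fun p : (Fin ν → ℝ) × ℝ =>
        Complex.exp (-freqForm k (toComplexVec (anglePoint p.1))) :=
      ((((freqForm k).continuous.comp continuous_toComplexVec).comp continuous_anglePoint).comp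
        continuous_fst).neg.cexp
    have h2 : Continuous fun p : (Fin ν → ℝ) × ℝ => evenExtension (V (anglePoint p.1)) p.2 :=
      hV.comp ((continuous_anglePoint.comp continuous_fst).prodMk continuous_snd)
    have h3 : Continuous fun p : (Fin ν → ℝ) × ℝ => cos (n * p.2) := by fun_prop
    exact (h1.mul (Complex.continuous_ofReal.comp h2)).mul (Complex.continuous_ofReal.comp h3)
  have hint : Integrable (Function.uncurry f)
      ((volume.restrict (unitCube ν 0)).prod (volume.restrict (Ioc 0 π))) := by
    refine Integrable.of_bound hfc.aestronglyMeasurable C (Eventually.of_forall fun p => ?_)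
    simp only [f, Function.uncurry]
    rw [norm_mul, norm_mul, ← freqForm_neg, norm_exp_freqForm_real, one_mul, Complex.norm_real,
      Complex.norm_real]
    calc _ ≤ C * 1 := by
          refine mul_le_mul (hC _ _) (abs_cos_le_one _) (norm_nonneg _) ?_
          exact (abs_nonneg _).trans (hC 0 0)
      _ = C := mul_one C
  have hswap := integral_integral_swap hint
  have hL : ∀ y, ∫ x in Ioc 0 π, f y x =
      Complex.exp (-freqForm k (toComplexVec (anglePoint y))) *
        ((∫ x in (0 : ℝ)..π, evenExtension (V (anglePoint y)) x * cos (n * x) : ℝ) : ℂ) := by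
    intro y
    rw [intervalIntegral.integral_of_le hpi.le, ← integral_complex_ofReal, ← integral_const_mul]
    refine integral_congr_ae (Eventually.of_forall fun x => ?_)
    simp only [f]
    push_cast
    ring
  have hR : ∀ x, ∫ y in unitCube ν 0, f y x =
      torusCoeff (fun θ => (evenExtension (V θ) x : ℂ)) k * cos (n * x) := by
    intro x
    rw [torusCoeff, ← integral_mul_const]
  rw [intervalIntegral.integral_of_le hpi.le]
  simp only [← hR]
  rw [← hswap]
  simp only [hL]
  rw [potentialCoeff, torusCoeff, ← integral_const_mul]
  refine integral_congr_ae (Eventually.of_forall fun y => ?_)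
  simp only [cosCoeff]
  push_cast
  ring

theorem norm_potentialCoeff_le_of_forall
    (hV : Continuous fun p : EuclideanSpace ℝ (Fin ν) × ℝ => evenExtension (V p.1) p.2) {C : ℝ}
    (hC : ∀ θ x, |evenExtension (V θ) x| ≤ C) {k : Fin ν → ℤ} {b : ℝ}
    (hb : ∀ x ∈ Icc 0 π, ‖torusCoeff (fun θ => (evenExtension (V θ) x : ℂ)) k‖ ≤ b) (n : ℤ) :
    ‖potentialCoeff V n k‖ ≤ b := by
  have hpi := Real.pi_pos
  have hb0 : 0 ≤ b := (norm_nonneg _).trans (hb 0 ⟨le_rfl, hpi.le⟩)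
  have h := intervalIntegral.norm_integral_le_of_norm_le_const (a := 0) (b := π) (C := b)
    (f := fun x => torusCoeff (fun θ => (evenExtension (V θ) x : ℂ)) k * ((cos (n * x) : ℝ) : ℂ))
    fun x hx => by
      rw [uIoc_of_le hpi.le] at hx
      rw [norm_mul, Complex.norm_real]
      calc _ ≤ b * 1 := mul_le_mul (hb x ⟨hx.1.le, hx.2⟩) (abs_cos_le_one _) (abs_nonneg _) hb0
        _ = b := mul_one b
  rw [potentialCoeff_eq_integral hV hC, norm_mul, sub_zero, abs_of_pos hpi] at *
  have e : ‖(1 / π : ℂ)‖ = 1 / π := by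
    rw [norm_div, norm_one, Complex.norm_real, Real.norm_of_nonneg hpi.le]
  rw [e]
  calc _ ≤ 1 / π * (b * π) := by gcongr
    _ = b := by field_simp

/-- Rescaling by 2π maps the half-open unit cube to a half-open cube, which agrees almost everywhere
with the closed cube of `ConditionV2`. -/
theorem volume_preimage_cube_integral (g : EuclideanSpace ℝ (Fin ν) → ℝ)
    (h : ∫ θ in {θ : EuclideanSpace ℝ (Fin ν) | ∀ i, θ i ∈ Icc 0 (2 * π)}, g θ = 0) :
    ∫ x in unitCube ν 0, g (anglePoint x) = 0 := by
  have hpi := Real.pi_pos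
  have h1 := (PiLp.volume_preserving_toLp (Fin ν)).setIntegral_preimage_emb
    (MeasurableEquiv.toLp 2 (Fin ν → ℝ)).measurableEmbedding g
    {θ : EuclideanSpace ℝ (Fin ν) | ∀ i, θ i ∈ Icc 0 (2 * π)}
  rw [h] at h1
  have h2 := Measure.setIntegral_comp_smul (volume : Measure (Fin ν → ℝ))
    (fun y => g (WithLp.toLp 2 y)) (R := 2 * π) (unitCube ν 0) (by positivity)
  have e1 : (fun x : Fin ν → ℝ => g (WithLp.toLp 2 ((2 * π) • x))) = fun x => g (anglePoint x) := rfl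
  rw [e1] at h2
  rw [h2]
  have e2 : (2 * π) • unitCube ν 0 = Set.univ.pi fun _ : Fin ν => Ioc 0 (2 * π) := by
    ext y
    rw [Set.mem_smul_set_iff_inv_smul_mem₀ (by positivity)]
    simp only [unitCube, Pi.zero_apply, zero_add, mem_Ioc,
      Set.mem_pi, mem_univ, true_imp_iff]
    refine forall_congr' fun a => ?_
    change 0 < (2 * π)⁻¹ * y a ∧ (2 * π)⁻¹ * y a ≤ 1 ↔ 0 < y a ∧ y a ≤ 2 * π
    rw [inv_mul_le_iff₀ (by positivity), mul_one]
    refine and_congr_left fun _ => ?_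
    constructor
    · intro h; exact (pos_iff_pos_of_mul_pos h).1 (by positivity)
    · intro h; positivity
  have e3 : WithLp.toLp 2 ⁻¹' {θ : EuclideanSpace ℝ (Fin ν) | ∀ i, θ i ∈ Icc 0 (2 * π)} =
      Icc (fun _ : Fin ν => (0 : ℝ)) fun _ => 2 * π := by
    ext y
    simp [Pi.le_def, forall_and]
  have hae : (Set.univ.pi fun _ : Fin ν => Ioc 0 (2 * π)) =ᵐ[volume]
      Icc (fun _ : Fin ν => (0 : ℝ)) fun _ => 2 * π :=
    Measure.univ_pi_Ioc_ae_eq_Icc (μ := fun _ : Fin ν => (volume : Measure ℝ))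
  rw [e3] at h1
  rw [e2, setIntegral_congr_set hae, h1, smul_zero]

theorem potentialCoeff_zero
    (hV : Continuous fun p : EuclideanSpace ℝ (Fin ν) × ℝ => evenExtension (V p.1) p.2) {C : ℝ}
    (hC : ∀ θ x, |evenExtension (V θ) x| ≤ C) (hV2 : ConditionV2 V) (n : ℤ) :
    potentialCoeff V n 0 = 0 := by
  have h : ∀ x ∈ Icc 0 π, ‖torusCoeff (fun θ => (evenExtension (V θ) x : ℂ)) 0‖ ≤ 0 := by
    intro x hx
    have h1 := volume_preimage_cube_integral _ (hV2 x hx)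
    rw [torusCoeff]
    simp only [freqForm_zero, neg_zero, Complex.exp_zero, one_mul, evenExtension_eq _ hx]
    rw [integral_complex_ofReal, h1]
    simp
  exact norm_le_zero_iff.1 (norm_potentialCoeff_le_of_forall hV hC h n)

/-- Two separate bounds are interpolated: exponential decay in k uniformly in n, from analyticity in
θ at fixed x, and decay in n uniformly in k, from smoothness in x at real θ. Their geometric mean
decays in both variables; half the exponential rate is lost, and mixed estimates on the complex
strip are avoided. -/
theorem exists_potentialCoeff_bound {ρ ρ' : ℝ} (hρ' : 0 ≤ ρ') (hρ : ρ' < ρ)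
    (hper : TorusPeriodic V) (hV1 : ConditionV1 V ρ) (P : ℕ) :
    ∃ K > 0, ∀ n k, ‖potentialCoeff V n k‖ ≤
      K * exp (-(ρ' / 2 * ‖freq k‖)) / (1 + |(n : ℝ)|) ^ P := by
  obtain ⟨hsm, F, hF, hFa, hFs, hFb⟩ := hV1
  have hρ0 : 0 < ρ := hρ'.trans_lt hρ
  obtain ⟨C₀, hC₀, hb₀⟩ := hFb 0
  -- Twice the desired number of derivatives, because the geometric mean halves the exponent.
  obtain ⟨C₁, hC₁, hb₁⟩ := hFb (2 * P)
  have hmem : ∀ θ : EuclideanSpace ℝ (Fin ν), toComplexVec θ ∈ complexStrip ν ρ := fun θ =>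
    toComplexVec_mem_strip θ hρ0.le
  have hC : ∀ θ x, |evenExtension (V θ) x| ≤ C₀ := by
    intro θ x
    have := hb₀ x _ (hmem θ)
    rw [iteratedDeriv_zero, hF, Complex.norm_real] at this
    exact this
  have h1 : ∀ n k, ‖potentialCoeff V n k‖ ≤ C₀ * exp (-(ρ' * ‖freq k‖)) := by
    intro n k
    refine norm_potentialCoeff_le_of_forall hsm.continuous hC (fun x _ => ?_) n
    have h := torusCoeff_exp_decay hρ' hρ (hFa x) (C := C₀)
      (fun z hz => by simpa using hb₀ x z hz)
      (fun θ a => by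
        simp only [hF]
        rw [hper θ a]) k
    simpa only [hF] using h
  have h2 : ∀ (n : ℤ) k, |(n : ℝ)| ^ (2 * P) * ‖potentialCoeff V n k‖ ≤ C₁ := by
    intro n k
    have hp : ∀ θ, |(n : ℝ)| ^ (2 * P) * |cosCoeff (evenExtension (V θ)) n| ≤ C₁ := fun θ =>
      pow_mul_abs_cosCoeff_le (hF θ) (hFs _ (hmem θ)) (evenExtension_neg _)
        (evenExtension_periodic _) (fun x => hb₁ x _ (hmem θ)) n
    rcases eq_or_ne (|(n : ℝ)| ^ (2 * P)) 0 with h0 | h0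
    · rw [h0, zero_mul]; exact hC₁.le
    · have hpos : 0 < |(n : ℝ)| ^ (2 * P) := lt_of_le_of_ne (by positivity) h0.symm
      rw [← le_div_iff₀' hpos]
      refine torusCoeff_norm_le (fun θ => ?_) k
      rw [le_div_iff₀' hpos, Complex.norm_real]
      exact hp θ
  -- The estimate is proved for squares with constant A; A + 1 replaces the square root because A ≤
  -- (A + 1)².
  refine ⟨(2 ^ (2 * P) * C₀ * (C₀ + C₁)) + 1, by positivity, fun n k => ?_⟩
  set y := ‖potentialCoeff V n k‖ with hy
  set t := |(n : ℝ)| with ht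
  set e := exp (-(ρ' / 2 * ‖freq k‖)) with he
  have he2 : exp (-(ρ' * ‖freq k‖)) = e ^ 2 := by
    rw [he, ← Real.exp_nat_mul]; congr 1; push_cast; ring
  have he0 : 0 < e := Real.exp_pos _
  have he1 : e ≤ 1 := Real.exp_le_one_iff.2 (by
    have := norm_nonneg (freq k)
    have : 0 ≤ ρ' / 2 * ‖freq k‖ := by positivity
    linarith)
  have h1' := h1 n k
  rw [he2] at h1'
  have h2' := h2 n k
  have ht0 : 0 ≤ t := abs_nonneg _
  have hy0 : 0 ≤ y := norm_nonneg _
  have hpow : (1 + t) ^ (2 * P) ≤ 2 ^ (2 * P) * (1 + t ^ (2 * P)) := by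
    rcases le_total t 1 with h | h
    · calc (1 + t) ^ (2 * P) ≤ 2 ^ (2 * P) := by gcongr; linarith
        _ ≤ _ := le_mul_of_one_le_right (by positivity) (by linarith [pow_nonneg ht0 (2 * P)])
    · calc (1 + t) ^ (2 * P) ≤ (2 * t) ^ (2 * P) := by gcongr; linarith
        _ = 2 ^ (2 * P) * t ^ (2 * P) := mul_pow _ _ _
        _ ≤ _ := by gcongr; linarith
  have h3 : (1 + t) ^ (2 * P) * y ≤ 2 ^ (2 * P) * (C₀ + C₁) := by
    have hyC : y ≤ C₀ := h1'.trans (mul_le_of_le_one_right hC₀.le (pow_le_one₀ he0.le he1))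
    calc _ ≤ 2 ^ (2 * P) * (1 + t ^ (2 * P)) * y := by gcongr
      _ = 2 ^ (2 * P) * (y + t ^ (2 * P) * y) := by ring
      _ ≤ _ := by gcongr
  rw [le_div_iff₀ (by positivity)]
  have h4 : (y * (1 + t) ^ P) ^ 2 ≤ (2 ^ (2 * P) * C₀ * (C₀ + C₁)) * e ^ 2 := by
    calc _ = y * ((1 + t) ^ (2 * P) * y) := by ring
      _ ≤ (C₀ * e ^ 2) * (2 ^ (2 * P) * (C₀ + C₁)) := by gcongr
      _ = _ := by ring
  set A := 2 ^ (2 * P) * C₀ * (C₀ + C₁) with hA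
  have hA0 : 0 ≤ A := by positivity
  refine le_of_sq_le_sq ?_ (by positivity)
  calc _ ≤ A * e ^ 2 := h4
    _ ≤ (A + 1) ^ 2 * e ^ 2 := by gcongr; nlinarith
    _ = _ := by ring

end

end

noncomputable section

open scoped ENNReal ComplexConjugate
open Filter Topology SineSobolev

variable {ν : ℕ}

/-! ### The Klein-Gordon perturbation as a matrix -/

/-- Young's inequality for matrices dominated by a convolution kernel; the factor 2 counts the two
components of the phase space. -/
theorem schur_le_of_convolution {U : Mode ν → Mode ν → ℝ} {a : Mode ν → Mode ν → ℂ}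
    {f : ℤ → ℝ≥0∞} {g : (Fin ν → ℤ) → ℝ≥0∞}
    (h : ∀ s t, ‖a s t‖ₑ * ENNReal.ofReal (U s t) ≤
      f ((s.1.2 : ℤ) - (t.1.2 : ℤ)) * g (s.2 - t.2)) :
    schur U a ≤ 2 * (∑' n, f n) * ∑' k, g k := by
  have hinj : Function.Injective fun n : ℕ+ => (n : ℤ) := fun m n hmn =>
    PNat.coe_injective (Int.ofNat_injective hmn)
  have key : ∀ (φ : ℕ+ → ℤ) (ψ : (Fin ν → ℤ) → (Fin ν → ℤ)), Function.Injective φ →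
      Function.Injective ψ → ∑' s : Mode ν, f (φ s.1.2) * g (ψ s.2) ≤
        2 * (∑' n, f n) * ∑' k, g k := by
    intro φ ψ hφ hψ
    rw [ENNReal.tsum_prod (f := fun (i : SignedMode) k => f (φ i.2) * g (ψ k))]
    simp only [ENNReal.tsum_mul_left, ENNReal.tsum_mul_right]
    rw [tsum_signedMode fun i => f (φ i.2)]
    have h1 := ENNReal.tsum_comp_le_tsum_of_injective hφ f
    have h2 := ENNReal.tsum_comp_le_tsum_of_injective hψ g
    rw [← two_mul]
    gcongr
  refine schur_le_iff.2 ⟨fun t => ?_, fun s => ?_⟩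
  · refine (ENNReal.tsum_le_tsum fun s => h s t).trans
      (key (fun n => (n : ℤ) - (t.1.2 : ℤ)) (fun k => k - t.2) ?_ (sub_left_injective))
    exact fun m n hmn => hinj (sub_left_injective hmn)
  · refine (ENNReal.tsum_le_tsum fun t => h s t).trans
      (key (fun n => (s.1.2 : ℤ) - (n : ℤ)) (fun k => s.2 - k) ?_ (sub_right_injective))
    exact fun m n hmn => hinj (sub_right_injective hmn)

theorem summable_inv_one_add_abs_sq : Summable fun n : ℤ => ((1 + |(n : ℝ)|) ^ 2)⁻¹ := by
  have h : Summable fun n : ℕ => ((1 + (n : ℝ)) ^ 2)⁻¹ := by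
    have := (summable_nat_add_iff 1).2 (Real.summable_nat_pow_inv.2 (by norm_num : 1 < 2))
    refine this.congr fun n => ?_
    push_cast
    rw [add_comm]
  refine Summable.of_nat_of_neg ?_ ?_ <;> simpa using h

theorem japanese_le_add (i j : ℕ+) : japanese i ≤ japanese j + |((i : ℤ) - (j : ℤ) : ℝ)| := by
  have hj : (j : ℝ) ≤ japanese j := Real.le_sqrt_of_sq_le (by linarith)
  have hj1 := one_le_japanese j
  have hsq : japanese j ^ 2 = 1 + (j : ℝ) ^ 2 := Real.sq_sqrt (by positivity)
  have hj0 : (0 : ℝ) < j := by exact_mod_cast j.pos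
  refine (Real.sqrt_le_left (by positivity)).2 ?_
  push_cast
  set d := (i : ℝ) - (j : ℝ) with hd
  have hi : (i : ℝ) = j + d := by rw [hd]; ring
  have h1 : d ≤ |d| := le_abs_self d
  have h2 : |d| ^ 2 = d ^ 2 := sq_abs d
  have h3 : (j : ℝ) * |d| ≤ japanese j * |d| := by gcongr
  have h4 : (j : ℝ) * d ≤ j * |d| := by gcongr
  rw [hi]
  nlinarith

theorem modeRatio_le (i j : ℕ+) : modeRatio i j ≤ 1 + |((i : ℤ) - (j : ℤ) : ℝ)| := by
  have key : ∀ i j : ℕ+, japanese i / japanese j ≤ 1 + |((i : ℤ) - (j : ℤ) : ℝ)| := by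
    intro i j
    have hj := one_le_japanese j
    rw [div_le_iff₀ (japanese_pos j)]
    have h1 := japanese_le_add i j
    have h2 := abs_nonneg ((i : ℤ) - (j : ℤ) : ℝ)
    nlinarith
  refine max_le (key i j) ?_
  rw [abs_sub_comm]
  exact key j i

/-! ### Order and off-diagonal decay of the Klein–Gordon perturbation. -/

theorem japanese_le_two_mul_kgEigenvalue (mass : ℝ) (i : ℕ+) :
    japanese i ≤ 2 * kgEigenvalue mass i := by
  have hi : (1 : ℝ) ≤ i := by exact_mod_cast i.pos
  have h0 : 0 ≤ kgEigenvalue mass i := Real.sqrt_nonneg _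
  have h1 : kgEigenvalue mass i ^ 2 = (i : ℝ) ^ 2 + mass ^ 2 := Real.sq_sqrt (by positivity)
  refine (Real.sqrt_le_left (by positivity)).2 ?_
  rw [mul_pow, h1]
  nlinarith [sq_nonneg mass]

theorem kgEigenvalue_pos (mass : ℝ) (i : ℕ+) : 0 < kgEigenvalue mass i := by
  have := japanese_le_two_mul_kgEigenvalue mass i
  have := japanese_pos i
  linarith

/-- The inverse square roots of the eigenvalues. -/
def invSqrtEigenvalue (mass : ℝ) (i : ℕ+) : ℝ := kgEigenvalue mass i ^ (-1 / 2 : ℝ)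

theorem invSqrtEigenvalue_pos (mass : ℝ) (i : ℕ+) : 0 < invSqrtEigenvalue mass i :=
  Real.rpow_pos_of_pos (kgEigenvalue_pos mass i) _

theorem invSqrtEigenvalue_sq (mass : ℝ) (i : ℕ+) :
    invSqrtEigenvalue mass i ^ 2 = (kgEigenvalue mass i)⁻¹ := by
  rw [invSqrtEigenvalue, ← Real.rpow_natCast, ← Real.rpow_mul (kgEigenvalue_pos mass i).le,
    ← Real.rpow_neg_one]
  norm_num

/-- This makes the perturbation of order -1: the two factors B^{-1/2} give the geometric mean of
1/λ_i and 1/λ_j, which compensates the maximum of the two sizes up to a mode ratio. -/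
theorem max_mul_invSqrtEigenvalue_le (mass : ℝ) (i j : ℕ+) :
    max (japanese i) (japanese j) * (invSqrtEigenvalue mass i * invSqrtEigenvalue mass j) ≤
      2 * modeRatio i j := by
  have hm := one_le_modeRatio i j
  have hi := japanese_pos i
  have hj := japanese_pos j
  have h1 : max (japanese i) (japanese j) ^ 2 ≤ modeRatio i j * (japanese i * japanese j) := by
    rcases le_total (japanese i) (japanese j) with h | h
    · rw [max_eq_right h]
      have : japanese j / japanese i ≤ modeRatio i j := le_max_right _ _
      rw [div_le_iff₀ hi] at this
      nlinarith
    · rw [max_eq_left h]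
      have : japanese i / japanese j ≤ modeRatio i j := le_max_left _ _
      rw [div_le_iff₀ hj] at this
      nlinarith
  have hli := kgEigenvalue_pos mass i
  have hlj := kgEigenvalue_pos mass j
  have h2 := japanese_le_two_mul_kgEigenvalue mass i
  have h3 := japanese_le_two_mul_kgEigenvalue mass j
  refine le_of_sq_le_sq ?_ (by positivity)
  rw [mul_pow, mul_pow, invSqrtEigenvalue_sq, invSqrtEigenvalue_sq, ← mul_inv,
    ← div_eq_mul_inv, div_le_iff₀ (by positivity)]
  calc _ ≤ modeRatio i j * (japanese i * japanese j) := h1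
    _ ≤ modeRatio i j * ((2 * kgEigenvalue mass i) * (2 * kgEigenvalue mass j)) := by gcongr
    _ = 4 * (modeRatio i j * (kgEigenvalue mass i * kgEigenvalue mass j)) := by ring
    _ ≤ 4 * (modeRatio i j ^ 2 * (kgEigenvalue mass i * kgEigenvalue mass j)) := by
        gcongr
        nlinarith
    _ = _ := by ring

/-- The entries of the perturbation. -/
def kgEntry (V : EuclideanSpace ℝ (Fin ν) → ℝ → ℝ) (mass : ℝ) (s t : Mode ν) : ℂ :=
  ((modeSign s.1 / 2 * (invSqrtEigenvalue mass s.1.2 * invSqrtEigenvalue mass t.1.2) : ℝ) : ℂ) *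
    (potentialCoeff V ((s.1.2 : ℤ) - (t.1.2 : ℤ)) (s.2 - t.2) -
      potentialCoeff V ((s.1.2 : ℤ) + (t.1.2 : ℤ)) (s.2 - t.2))

/-- The perturbation as an operator. -/
def kgPert (V : EuclideanSpace ℝ (Fin ν) → ℝ → ℝ) (mass : ℝ) : MatOp (Mode ν) :=
  ofEntries (kgEntry V mass)

variable {V : EuclideanSpace ℝ (Fin ν) → ℝ → ℝ}

/-- The exponent q + 4 is spent as follows: q + 1 on the power of the mode ratio in the weight, one
on the ratio lost in `max_mul_invSqrtEigenvalue_le`, two on summability over i - j. The coefficient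
at i + j is no larger, since |i - j| ≤ i + j. -/
theorem kgEntry_weight_le {q : ℕ} {mass σ ρ' K : ℝ} (hK : 0 ≤ K)
    (hv : ∀ n k, ‖potentialCoeff V n k‖ ≤
      K * exp (-(ρ' / 2 * ‖freq k‖)) / (1 + |(n : ℝ)|) ^ (q + 4)) (s t : Mode ν) :
    ‖kgEntry V mass s t‖ * weightU (q + 1) σ s t ≤
      (2 * K * ((1 + |(((s.1.2 : ℤ) - (t.1.2 : ℤ) : ℤ) : ℝ)|) ^ 2)⁻¹) *
        exp (-((ρ' / 2 - σ) * ‖freq (s.2 - t.2)‖)) := by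
  obtain ⟨⟨b, i⟩, k⟩ := s
  obtain ⟨⟨b', j⟩, l⟩ := t
  simp only
  set x := ‖freq (k - l)‖ with hx
  set d : ℝ := 1 + |(((i : ℤ) - (j : ℤ) : ℤ) : ℝ)| with hd
  have hd1 : 1 ≤ d := by have := abs_nonneg (((i : ℤ) - (j : ℤ) : ℤ) : ℝ); linarith
  have hi : (0 : ℝ) < i := by exact_mod_cast i.pos
  have hj : (0 : ℝ) < j := by exact_mod_cast j.pos
  have hd' : d ≤ 1 + |(((i : ℤ) + (j : ℤ) : ℤ) : ℝ)| := by
    rw [hd]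
    push_cast
    refine add_le_add le_rfl ?_
    rw [abs_of_pos (by positivity : (0 : ℝ) < i + j), abs_le]
    constructor <;> linarith
  have h1 := hv ((i : ℤ) - (j : ℤ)) (k - l)
  have h2 := hv ((i : ℤ) + (j : ℤ)) (k - l)
  have h3 : ‖potentialCoeff V ((i : ℤ) - (j : ℤ)) (k - l) -
      potentialCoeff V ((i : ℤ) + (j : ℤ)) (k - l)‖ ≤ 2 * (K * exp (-(ρ' / 2 * x)) / d ^ (q + 4)) := by
    refine (norm_sub_le _ _).trans ?_
    rw [two_mul]
    refine add_le_add h1 (h2.trans ?_)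
    gcongr
  have hmr := modeRatio_le i j
  have hmr1 := one_le_modeRatio i j
  have hmax := max_mul_invSqrtEigenvalue_le mass i j
  have hpi := invSqrtEigenvalue_pos mass i
  have hpj := invSqrtEigenvalue_pos mass j
  have e1 : ‖((modeSign (b, i) / 2 * (invSqrtEigenvalue mass i * invSqrtEigenvalue mass j) : ℝ) : ℂ)‖ =
      1 / 2 * (invSqrtEigenvalue mass i * invSqrtEigenvalue mass j) := by
    rw [Complex.norm_real, Real.norm_eq_abs, abs_mul, abs_div, abs_modeSign,
      abs_of_pos (mul_pos hpi hpj), abs_of_pos (by norm_num : (0 : ℝ) < 2)]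
  rw [kgEntry, norm_mul, e1, weightU]
  simp only
  rw [← hx]
  have hmrd : modeRatio i j ≤ d := by rw [hd]; exact_mod_cast hmr
  calc _ = 1 / 2 * ‖potentialCoeff V ((i : ℤ) - (j : ℤ)) (k - l) -
        potentialCoeff V ((i : ℤ) + (j : ℤ)) (k - l)‖ * modeRatio i j ^ (q + 1) *
        (max (japanese i) (japanese j) *
          (invSqrtEigenvalue mass i * invSqrtEigenvalue mass j)) * exp (σ * x) := by ring
    _ ≤ 1 / 2 * (2 * (K * exp (-(ρ' / 2 * x)) / d ^ (q + 4))) * d ^ (q + 1) *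
        (2 * d) * exp (σ * x) := by
        have h0 : 0 ≤ max (japanese i) (japanese j) := (japanese_pos i).le.trans (le_max_left _ _)
        have h5 := hmax.trans (mul_le_mul_of_nonneg_left hmrd two_pos.le)
        gcongr
    _ = 2 * K * (d ^ 2)⁻¹ * (exp (-(ρ' / 2 * x)) * exp (σ * x)) := by
        have : d ≠ 0 := by positivity
        have h4 : d ^ (q + 4) = d ^ (q + 1) * d * d ^ 2 := by ring
        rw [h4]
        field_simp
    _ = _ := by rw [← Real.exp_add]; ring_nf

/-- The Klein-Gordon perturbation is admissible. -/
theorem exists_kgPert_admissible {ρ ρ' σ : ℝ} (hρ' : 0 ≤ ρ') (hρ : ρ' < ρ) (hσ : 0 ≤ σ)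
    (hσ' : σ < ρ' / 2) (hper : TorusPeriodic V) (hV1 : ConditionV1 V ρ) (hV2 : ConditionV2 V)
    (mass : ℝ) (q : ℕ) :
    (∃ w, AdmissiblePert q σ w (kgPert V mass)) ∧
      ∀ s t, entry (kgPert V mass) s t = kgEntry V mass s t := by
  obtain ⟨K, hK, hv⟩ := exists_potentialCoeff_bound hρ' hρ hper hV1 (q + 4)
  have hz : ∀ n, potentialCoeff V n 0 = 0 := by
    obtain ⟨hsm, F, hF, hFa, hFs, hFb⟩ := hV1
    obtain ⟨C₀, hC₀, hb₀⟩ := hFb 0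
    refine fun n => potentialCoeff_zero (C := C₀) hsm.continuous (fun θ x => ?_) hV2 n
    have := hb₀ x _ (toComplexVec_mem_strip θ (hρ'.trans hρ.le))
    rw [iteratedDeriv_zero, hF, Complex.norm_real] at this
    exact this
  set f : ℤ → ℝ≥0∞ := fun n => ENNReal.ofReal (2 * K * ((1 + |(n : ℝ)|) ^ 2)⁻¹) with hf
  set g : (Fin ν → ℤ) → ℝ≥0∞ := fun k =>
    ENNReal.ofReal (exp (-((ρ' / 2 - σ) * ‖freq k‖))) with hg
  have hf' : ∑' n, f n ≠ ∞ := (summable_inv_one_add_abs_sq.mul_left (2 * K)).tsum_ofReal_ne_top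
  have hg' : ∑' k, g k ≠ ∞ :=
    (summable_exp_neg_norm_freq (ν := ν) (sub_pos.2 hσ')).tsum_ofReal_ne_top
  have hs : schur (weightU (q + 1) σ) (kgEntry V mass) ≤ 2 * (∑' n, f n) * ∑' k, g k := by
    refine schur_le_of_convolution fun s t => ?_
    rw [hf, hg]
    simp only
    rw [← ENNReal.ofReal_mul (by positivity), ← ofReal_norm, ← ENNReal.ofReal_mul (norm_nonneg _)]
    exact ENNReal.ofReal_le_ofReal (kgEntry_weight_le hK.le hv s t)
  have htop : 2 * (∑' n, f n) * ∑' k, g k ≠ ∞ := by finiteness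
  have hent : ∀ s t, entry (kgPert V mass) s t = kgEntry V mass s t :=
    entry_ofEntries (one_le_weightU (q + 1) hσ) (ne_top_of_le_ne_top htop hs)
  refine ⟨⟨(2 * (∑' n, f n) * ∑' k, g k).toReal, ENNReal.toReal_nonneg, ?_, ?_, ?_, ?_, ?_⟩, hent⟩
  · rw [ENNReal.ofReal_toReal htop, opSchur, funext₂ hent]
    exact hs
  · rintro l ⟨i, k⟩ ⟨j, k'⟩
    rw [shiftMode_apply, shiftMode_apply, hent, hent, kgEntry, kgEntry]
    simp
  · intro s t hst
    rw [hent, kgEntry, hst, sub_self, hz, hz, sub_self, mul_zero]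
  · rintro ⟨⟨b, i⟩, k⟩ ⟨⟨b', j⟩, l⟩
    rw [negMode_apply, negMode_apply, hent, hent, kgEntry, kgEntry]
    have e : -k - -l = -(k - l) := by abel
    have e2 : modeSign (!b, i) = -modeSign (b, i) := by cases b <;> simp [modeSign]
    simp only [e, e2, potentialCoeff_neg_right, map_mul, map_sub, Complex.conj_ofReal]
    push_cast
    ring
  · intro s t
    rw [hent, hent, kgEntry, kgEntry, ← neg_sub s.2 t.2, ← neg_sub (s.1.2 : ℤ) (t.1.2 : ℤ)]
    simp only [potentialCoeff_neg_right, potentialCoeff_neg_left, map_mul, map_sub,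
      Complex.conj_ofReal, add_comm (t.1.2 : ℤ) (s.1.2 : ℤ)]
    have e1 : (modeSign s.1 : ℂ) ^ 2 = 1 := by
      rw [← Complex.ofReal_pow, ← sq_abs, abs_modeSign]; simp
    have e2 : (modeSign t.1 : ℂ) ^ 2 = 1 := by
      rw [← Complex.ofReal_pow, ← sq_abs, abs_modeSign]; simp
    push_cast
    linear_combination (invSqrtEigenvalue mass s.1.2 * invSqrtEigenvalue mass t.1.2 / 2 *
      (conj (potentialCoeff V ((s.1.2 : ℤ) - (t.1.2 : ℤ)) (s.2 - t.2)) -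
        conj (potentialCoeff V ((s.1.2 : ℤ) + (t.1.2 : ℤ)) (s.2 - t.2))) : ℂ) * (e1 - e2)

end

noncomputable section

open scoped ENNReal ComplexConjugate
open Filter Topology SineSobolev

variable {ν : ℕ} {V : EuclideanSpace ℝ (Fin ν) → ℝ → ℝ}

/-! ### The perturbation as a multiplication operator -/

theorem hasSum_potentialCoeff {ρ : ℝ} (hρ : 0 < ρ) (hper : TorusPeriodic V) (hV1 : ConditionV1 V ρ)
    (n : ℤ) (θ : EuclideanSpace ℝ (Fin ν)) :
    HasSum (fun k => Complex.exp (freqForm k (toComplexVec θ)) * potentialCoeff V n k)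
      (cosCoeff (V θ) n : ℂ) := by
  obtain ⟨K, hK, hb⟩ := exists_potentialCoeff_bound (half_pos hρ).le (half_lt_self hρ) hper hV1 0
  have h := TorusPeriodic.hasSum_torusCoeff
    (f := fun θ => (cosCoeff (evenExtension (V θ)) n : ℂ))
    (fun θ i => by simp only [hper θ i])
    (Complex.continuous_ofReal.comp (continuous_cosCoeff hV1.1.continuous n))
    (((summable_exp_neg_norm_freq (ν := ν) (by positivity : 0 < ρ / 2 / 2)).mul_left K).of_norm_bounded
      fun k => by simpa [potentialCoeff] using hb n k) θ
  rwa [cosCoeff_congr fun x hx => evenExtension_eq (V θ) hx] at h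

theorem continuousOn_of_conditionV1 {ρ : ℝ} (hV1 : ConditionV1 V ρ)
    (θ : EuclideanSpace ℝ (Fin ν)) : ContinuousOn (V θ) (Icc 0 π) := by
  have h : Continuous fun x => evenExtension (V θ) x :=
    hV1.1.continuous.comp (Continuous.prodMk_right θ)
  exact h.continuousOn.congr fun x hx => (evenExtension_eq (V θ) hx).symm

theorem AdmissiblePert.actsOn {q : ℕ} {σ w r : ℝ} {W : MatOp (Mode ν)} (h : AdmissiblePert q σ w W)
    (hr : |r| ≤ q + 1) : ActsOn q σ r w W := by
  refine ⟨hr, h.nonneg, le_trans (opSchur_mono (fun s t => ?_) W) h.bound⟩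
  have h1 := one_le_modeRatio s.1.2 t.1.2
  have h2 : 1 ≤ max (japanese s.1.2) (japanese t.1.2) :=
    (one_le_japanese s.1.2).trans (le_max_left _ _)
  rw [weightZ, weightU]
  gcongr
  exact le_mul_of_one_le_right (by positivity) h2

theorem opCoeff_kgPert {q : ℕ} {σ w r ρ mass : ℝ} (hr : |r| ≤ q + 1) (hσ : 0 < σ) (hρ : 0 < ρ)
    (hper : TorusPeriodic V) (hV1 : ConditionV1 V ρ) (hW : AdmissiblePert q σ w (kgPert V mass))
    (hent : ∀ s t, entry (kgPert V mass) s t = kgEntry V mass s t)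
    (θ : EuclideanSpace ℝ (Fin ν)) (i j : SignedMode) :
    opCoeff i j (fourierOp r (kgPert V mass) (toComplexVec θ)) =
      (modeSign i / 2 * (invSqrtEigenvalue mass i.2 * invSqrtEigenvalue mass j.2) *
        (2 / π * ∫ x in (0 : ℝ)..π, V θ x * sin (j.2 * x) * sin (i.2 * x)) : ℝ) := by
  have h1 := (hW.actsOn hr).hasSum_opCoeff hσ (toComplexVec_mem_complexStrip θ) i j
  have h2 := ((hasSum_potentialCoeff hρ hper hV1 ((i.2 : ℤ) - (j.2 : ℤ)) θ).sub
    (hasSum_potentialCoeff hρ hper hV1 ((i.2 : ℤ) + (j.2 : ℤ)) θ)).mul_left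
    ((modeSign i / 2 * (invSqrtEigenvalue mass i.2 * invSqrtEigenvalue mass j.2) : ℝ) : ℂ)
  have h3 := sineMul_kernel (continuousOn_of_conditionV1 hV1 θ) (j.2 : ℤ) (i.2 : ℤ)
  rw [← cosCoeff_neg _ ((j.2 : ℤ) - (i.2 : ℤ)), neg_sub, add_comm (j.2 : ℤ)] at h3
  push_cast at h3
  rw [h3]
  rw [Complex.ofReal_mul _ (_ - _), Complex.ofReal_sub]
  refine h1.unique (h2.congr_fun fun k => ?_)
  rw [hent, kgEntry, sub_zero]
  ring

/-- The perturbation acts as the non-diagonal part of the Klein-Gordon Hamiltonian. -/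
theorem signedCoeff_kgHamiltonian {q : ℕ} {σ w r ρ mass : ℝ} (hr : |r| ≤ q + 1) (hσ : 0 < σ)
    (hρ : 0 < ρ) (hper : TorusPeriodic V) (hV1 : ConditionV1 V ρ)
    (hW : AdmissiblePert q σ w (kgPert V mass))
    (hent : ∀ s t, entry (kgPert V mass) s t = kgEntry V mass s t)
    (θ : EuclideanSpace ℝ (Fin ν)) (u : PhaseSpace r) (i : SignedMode) :
    signedCoeff (kgHamiltonian mass (V θ) (pairCoeff u)) i =
      ((modeSign i * kgEigenvalue mass i.2 : ℝ) : ℂ) * modeCoeff u i +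
        modeCoeff (fourierOp r (kgPert V mass) (toComplexVec θ) u) i := by
  have h1 := hasSum_opCoeff_apply (fourierOp r (kgPert V mass) (toComplexVec θ)) u i
  simp only [opCoeff_kgPert hr hσ hρ hper hV1 hW hent] at h1
  have h2 := (Equiv.prodComm ℕ+ Bool).hasSum_iff.2 h1
  have h3 := h2.prod_fiberwise fun m => hasSum_fintype _
  simp only [Function.comp_apply, Equiv.prodComm_apply, Fintype.sum_bool] at h3
  rw [← h3.tsum_eq]
  obtain ⟨b, n⟩ := i
  have h4 : ∀ φ : SineCoeff, powB mass 1 φ n = (kgEigenvalue mass n : ℂ) * φ n := fun φ => by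
    rw [powB, Real.rpow_one]
  have h5 : (modeSign (b, n) : ℂ) * ((1 / 2 : ℂ) • powB mass (-1 / 2)
      (sineMul (V θ) (powB mass (-1 / 2) (coeff u.1 + coeff u.2)))) n = ∑' m : ℕ+,
      (((modeSign (b, n) / 2 * (invSqrtEigenvalue mass n * invSqrtEigenvalue mass m) *
        (2 / π * ∫ x in (0 : ℝ)..π, V θ x * sin (m * x) * sin (n * x)) : ℝ) : ℂ) *
          modeCoeff u (true, m) +
        ((modeSign (b, n) / 2 * (invSqrtEigenvalue mass n * invSqrtEigenvalue mass m) *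
        (2 / π * ∫ x in (0 : ℝ)..π, V θ x * sin (m * x) * sin (n * x)) : ℝ) : ℂ) *
          modeCoeff u (false, m)) := by
    simp only [Pi.smul_apply, powB, sineMul, smul_eq_mul]
    rw [← tsum_mul_left, ← tsum_mul_left, ← tsum_mul_left]
    refine tsum_congr fun m => ?_
    simp only [Pi.add_apply, modeCoeff, if_true, Bool.false_eq_true, if_false, invSqrtEigenvalue]
    push_cast
    ring
  simp only [Prod.swap_prod_mk]
  rw [← h5]
  simp only [signedCoeff, kgHamiltonian, pairCoeff, modeCoeff, modeSign]
  cases b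
  · simp only [Bool.false_eq_true, if_false, Pi.sub_apply, Pi.neg_apply, h4]
    push_cast
    ring
  · simp only [if_true, Pi.add_apply, h4]
    push_cast
    ring

theorem signedCoeff_diagHamiltonian {r : ℝ} (d : ℕ+ → ℝ) (u : PhaseSpace r) (i : SignedMode) :
    signedCoeff (diagHamiltonian d (pairCoeff u)) i =
      ((modeSign i * d i.2 : ℝ) : ℂ) * modeCoeff u i := by
  obtain ⟨b, n⟩ := i
  cases b <;> simp [signedCoeff, diagHamiltonian, pairCoeff, modeCoeff, modeSign]

end

noncomputable section

open scoped ENNReal ComplexConjugate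
open Filter Topology SineSobolev

variable {ν : ℕ}

/-! ### Measure of sets on which a small divisor is small -/

theorem exists_one_le_abs {k : Fin ν → ℤ} (hk : k ≠ 0) : ∃ a, (1 : ℝ) ≤ |(k a : ℝ)| := by
  obtain ⟨a, ha⟩ := Function.ne_iff.1 hk
  exact ⟨a, by exact_mod_cast Int.one_le_abs ha⟩

theorem toLp_insertNth_sub {n : ℕ} (a : Fin (n + 1)) (x x' : ℝ) (y : Fin n → ℝ) :
    (WithLp.toLp 2 (a.insertNth x y : Fin (n + 1) → ℝ) : EuclideanSpace ℝ (Fin (n + 1))) -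
      WithLp.toLp 2 (a.insertNth x' y : Fin (n + 1) → ℝ) = EuclideanSpace.single a (x - x') := by
  ext b
  rcases Fin.eq_self_or_eq_succAbove a b with rfl | ⟨b', rfl⟩
  · simp
  · simp [Fin.succAbove_ne]

theorem inner_single_freq (k : Fin ν → ℤ) (a : Fin ν) (x : ℝ) :
    inner ℝ (EuclideanSpace.single a x) (freq k) = x * k a := by
  rw [EuclideanSpace.inner_single_left]
  simp [freq]

/-- A bounded set on which `ω ↦ ω · k` varies by at most `2 δ`, up to a small Lipschitz error, is
contained in a slab of thickness of order `δ`. -/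
theorem volume_le_of_inner_freq_close {k : Fin ν → ℤ} (hk : k ≠ 0)
    {S : Set (EuclideanSpace ℝ (Fin ν))} {R δ : ℝ} (hR : S ⊆ Metric.closedBall 0 R) (hδ : 0 ≤ δ)
    (h : ∀ ω ∈ S, ∀ ω' ∈ S, |inner ℝ (ω - ω') (freq k)| ≤ 2 * δ + 1 / 2 * ‖ω - ω'‖) :
    volume S ≤ ENNReal.ofReal (4 * δ * (2 * R) ^ (ν - 1)) := by
  rcases S.eq_empty_or_nonempty with rfl | ⟨ω₀, hω₀⟩
  · simp
  have hR0 : 0 ≤ R := (norm_nonneg ω₀).trans (by simpa using hR hω₀)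
  obtain ⟨a, ha⟩ := exists_one_le_abs hk
  obtain _ | n := ν
  · exact a.elim0
  -- S need not be measurable. The variation condition is closed, so it holds on the closure, to
  -- which Fubini applies.
  set C := closure S with hC
  have hCR : C ⊆ Metric.closedBall 0 R := closure_minimal hR Metric.isClosed_closedBall
  have hCC : ∀ ω ∈ C, ∀ ω' ∈ C, |inner ℝ (ω - ω') (freq k)| ≤ 2 * δ + 1 / 2 * ‖ω - ω'‖ := by
    have hcl : IsClosed {p : EuclideanSpace ℝ (Fin (n + 1)) × EuclideanSpace ℝ (Fin (n + 1)) |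
        |inner ℝ (p.1 - p.2) (freq k)| ≤ 2 * δ + 1 / 2 * ‖p.1 - p.2‖} :=
      isClosed_le (by fun_prop) (by fun_prop)
    have hsub := closure_minimal (s := S ×ˢ S) (fun p hp => h p.1 hp.1 p.2 hp.2) hcl
    rw [closure_prod_eq] at hsub
    exact fun ω hω ω' hω' => hsub (mk_mem_prod hω hω')
  have hCm : MeasurableSet C := isClosed_closure.measurableSet
  refine (measure_mono subset_closure).trans ?_
  have e1 := (PiLp.volume_preserving_toLp (Fin (n + 1))).measure_preimage hCm.nullMeasurableSet
  set D : Set (Fin (n + 1) → ℝ) := WithLp.toLp 2 ⁻¹' C with hD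
  have hDm : MeasurableSet D := (PiLp.volume_preserving_toLp (Fin (n + 1))).measurable hCm
  have hvp := (volume_preserving_piFinSuccAbove (fun _ : Fin (n + 1) => ℝ) a).symm
  have e2 := hvp.measure_preimage hDm.nullMeasurableSet
  rw [← hC, ← e1, ← e2, Measure.volume_eq_prod, Measure.prod_apply_symm (hvp.measurable hDm)]
  set Q : Set (Fin n → ℝ) := Set.pi univ fun _ => Icc (-R) R with hQ
  have hslice : ∀ y, volume ((fun x => (x, y)) ⁻¹'
      ((MeasurableEquiv.piFinSuccAbove (fun _ : Fin (n + 1) => ℝ) a).symm ⁻¹' D)) ≤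
      Q.indicator (fun _ => ENNReal.ofReal (4 * δ)) y := by
    intro y
    set P := (fun x => (x, y)) ⁻¹'
      ((MeasurableEquiv.piFinSuccAbove (fun _ : Fin (n + 1) => ℝ) a).symm ⁻¹' D) with hP
    have hmem : ∀ x ∈ P, (WithLp.toLp 2 (a.insertNth x y : Fin (n + 1) → ℝ) :
      EuclideanSpace ℝ (Fin (n + 1))) ∈ C := fun x hx => hx
    by_cases hy : y ∈ Q
    · rw [indicator_of_mem hy]
      -- Two points of a slice differ only in coordinate a, where |k_a| ≥ 1; hence |x - x'| ≤ 2δ +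
      -- |x - x'|/2, that is |x - x'| ≤ 4δ.
      refine (Real.volume_le_diam P).trans (Metric.ediam_le fun x hx x' hx' => ?_)
      have h1 := hCC _ (hmem x hx) _ (hmem x' hx')
      rw [toLp_insertNth_sub, inner_single_freq, PiLp.norm_single, abs_mul,
        Real.norm_eq_abs] at h1
      rw [edist_dist, Real.dist_eq]
      refine ENNReal.ofReal_le_ofReal ?_
      nlinarith [abs_nonneg (x - x')]
    · have : P = ∅ := by
        refine eq_empty_of_forall_notMem fun x hx => hy ?_
        intro b _
        have h1 := hCR (hmem x hx)
        rw [mem_closedBall_zero_iff] at h1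
        have h2 := (PiLp.norm_apply_le (p := 2) (WithLp.toLp 2
          (a.insertNth x y : Fin (n + 1) → ℝ) : EuclideanSpace ℝ (Fin (n + 1)))
            (a.succAbove b)).trans h1
        simp only [Fin.insertNth_apply_succAbove, Real.norm_eq_abs] at h2
        exact abs_le.1 h2
      rw [this]
      simp
  refine (lintegral_mono hslice).trans ?_
  rw [lintegral_indicator_const (MeasurableSet.univ_pi fun _ => measurableSet_Icc),
    volume_pi_pi]
  simp only [Real.volume_Icc, Finset.prod_const, Finset.card_univ, Fintype.card_fin]
  rw [← ENNReal.ofReal_pow (by linarith), ← ENNReal.ofReal_mul (by positivity),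
    sub_neg_eq_add, ← two_mul, Nat.add_sub_cancel]

theorem tsum_indicator_abs_sub_le (c R : ℝ) (hR : 0 ≤ R) :
    ∑' n : ℤ, (if |(n : ℝ) - c| ≤ R then 1 else 0 : ℝ≥0∞) ≤ ENNReal.ofReal (2 * R + 1) := by
  have hs : ∀ n : ℤ, n ∉ Finset.Icc ⌈c - R⌉ ⌊c + R⌋ →
      (if |(n : ℝ) - c| ≤ R then 1 else 0 : ℝ≥0∞) = 0 := by
    intro n hn
    rw [if_neg]
    intro h
    rw [abs_le] at h
    refine hn (Finset.mem_Icc.2 ⟨Int.ceil_le.2 ?_, Int.le_floor.2 ?_⟩) <;> linarith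
  rw [tsum_eq_sum hs]
  refine (Finset.sum_le_card_nsmul _ _ 1 fun n _ => by split_ifs <;> simp).trans ?_
  rw [nsmul_one, Int.card_Icc, ← ENNReal.ofReal_natCast]
  refine ENNReal.ofReal_le_ofReal ?_
  have h1 := Int.floor_le (c + R)
  have h2 := Int.le_ceil (c - R)
  have h3 : (((⌊c + R⌋ + 1 - ⌈c - R⌉).toNat : ℤ) : ℝ) = max ((⌊c + R⌋ + 1 - ⌈c - R⌉ : ℤ) : ℝ) 0 := by
    rw [Int.toNat_eq_max]; push_cast; rfl
  rw [← Int.cast_natCast, h3]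
  refine max_le ?_ (by linarith)
  push_cast
  linarith

end

noncomputable section

open scoped ENNReal ComplexConjugate
open Filter Topology SineSobolev

variable {ν : ℕ}

/-! ### Measure of the resonant frequencies -/

/-- The integer that the eigenvalue of a signed mode is asymptotic to. -/
def modeLabel (i : SignedMode) : ℤ := if i.1 then (i.2 : ℤ) else -(i.2 : ℤ)

theorem abs_modeLabel (i : SignedMode) : |(modeLabel i : ℝ)| = (i.2 : ℝ) := by
  have h : (0 : ℝ) ≤ (i.2 : ℝ) := by positivity
  unfold modeLabel
  split_ifs <;> simp

theorem modeLabel_injective : Function.Injective modeLabel := by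
  rintro ⟨b, i⟩ ⟨b', j⟩ h
  have hi := i.pos
  have hj := j.pos
  cases b <;> cases b' <;> simp [modeLabel] at h ⊢ <;> exact h

/-- The mode with small label is chosen first, in at most 2I + 1 ways, then the other one within
distance R of it; the factor 2 records which of the two is small. -/
theorem tsum_near_pairs_le {I R : ℝ} (hI : 0 ≤ I) (hR : 0 ≤ R) :
    ∑' p : SignedMode × SignedMode,
      (if (|(modeLabel p.1 : ℝ)| ≤ I ∨ |(modeLabel p.2 : ℝ)| ≤ I) ∧
        |(modeLabel p.1 : ℝ) - modeLabel p.2| ≤ R then 1 else 0 : ℝ≥0∞) ≤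
      2 * (ENNReal.ofReal (2 * I + 1) * ENNReal.ofReal (2 * R + 1)) := by
  have hlab : ∀ c r : ℝ, 0 ≤ r → ∑' i : SignedMode,
      (if |(modeLabel i : ℝ) - c| ≤ r then 1 else 0 : ℝ≥0∞) ≤ ENNReal.ofReal (2 * r + 1) :=
    fun c r hr => (ENNReal.tsum_comp_le_tsum_of_injective modeLabel_injective
      fun n : ℤ => (if |(n : ℝ) - c| ≤ r then 1 else 0 : ℝ≥0∞)).trans
      (tsum_indicator_abs_sub_le c r hr)
  have hpair : ∑' i : SignedMode, ∑' j : SignedMode,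
      (if |(modeLabel i : ℝ) - 0| ≤ I then 1 else 0 : ℝ≥0∞) *
        (if |(modeLabel j : ℝ) - modeLabel i| ≤ R then 1 else 0) ≤
      ENNReal.ofReal (2 * I + 1) * ENNReal.ofReal (2 * R + 1) := by
    simp only [ENNReal.tsum_mul_left]
    refine (ENNReal.tsum_le_tsum fun i => mul_le_mul_right (hlab _ R hR) _).trans ?_
    rw [ENNReal.tsum_mul_right]
    exact mul_le_mul_left (hlab 0 I hI) _
  set a : SignedMode → ℝ≥0∞ := fun i => if |(modeLabel i : ℝ) - 0| ≤ I then 1 else 0 with ha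
  set f : SignedMode → SignedMode → ℝ≥0∞ := fun i j =>
    if |(modeLabel j : ℝ) - modeLabel i| ≤ R then 1 else 0 with hf
  have hpair' : ∑' i : SignedMode, ∑' j : SignedMode, a j * f j i ≤
      ENNReal.ofReal (2 * I + 1) * ENNReal.ofReal (2 * R + 1) := by
    rwa [ENNReal.tsum_comm]
  have hle : ∀ i j : SignedMode, (if (|(modeLabel i : ℝ)| ≤ I ∨ |(modeLabel j : ℝ)| ≤ I) ∧
      |(modeLabel i : ℝ) - modeLabel j| ≤ R then 1 else 0 : ℝ≥0∞) ≤ a i * f i j + a j * f j i := by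
    intro i j
    split_ifs with h
    · have h2 : |(modeLabel j : ℝ) - modeLabel i| ≤ R := by rw [abs_sub_comm]; exact h.2
      rcases h.1 with h1 | h1
      · rw [ha, hf]
        simp only [sub_zero, if_pos h1, if_pos h2, mul_one]
        exact le_self_add
      · rw [ha, hf]
        simp only [sub_zero, if_pos h1, if_pos h.2, mul_one]
        exact le_add_self
    · exact zero_le
  rw [two_mul, ENNReal.tsum_prod']
  refine le_trans ?_ (add_le_add hpair hpair')
  rw [← ENNReal.tsum_add]
  refine ENNReal.tsum_le_tsum fun i => ?_
  rw [← ENNReal.tsum_add]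
  exact ENNReal.tsum_le_tsum fun j => hle i j

variable {γ τ M A : ℝ} {p : ℕ}

theorem volume_iUnion_freq_le {F : (Fin ν → ℤ) → Set (EuclideanSpace ℝ (Fin ν))} {c : ℝ}
    (hc : 0 ≤ c) (hp : ν < p) (h0 : F 0 = ∅)
    (h : ∀ k, k ≠ 0 → volume (F k) ≤ ENNReal.ofReal (c * ((1 + ‖freq k‖) ^ p)⁻¹)) :
    volume (⋃ k, F k) ≤
      ENNReal.ofReal (c * ∑' k : Fin ν → ℤ, ((1 + ‖freq k‖) ^ p)⁻¹) := by
  refine (measure_iUnion_le _).trans ?_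
  rw [← tsum_mul_left, ENNReal.ofReal_tsum_of_nonneg (fun k => by positivity)
    ((summable_inv_one_add_norm_freq hp).mul_left c)]
  refine ENNReal.tsum_le_tsum fun k => ?_
  by_cases hk : k = 0
  · rw [hk, h0]; simp
  · exact h k hk

/-- The frequencies with a small divisor `ω · k`. -/
def slowSet (ν : ℕ) (M δ : ℝ) (q : ℕ) : Set (EuclideanSpace ℝ (Fin ν)) :=
  {ω | ω ∈ Metric.closedBall 0 (2 * M) ∧
    ∃ k : Fin ν → ℤ, k ≠ 0 ∧ |inner ℝ ω (freq k)| < δ / (1 + ‖freq k‖) ^ q}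

/-- The frequencies with a small divisor `ω · k + n`. -/
def integerResonantSet (ν : ℕ) (M δ : ℝ) (q : ℕ) : Set (EuclideanSpace ℝ (Fin ν)) :=
  {ω | ω ∈ Metric.closedBall 0 (2 * M) ∧
    ∃ k : Fin ν → ℤ, k ≠ 0 ∧ ∃ n : ℤ, |inner ℝ ω (freq k) + n| < δ / (1 + ‖freq k‖) ^ q}

theorem abs_inner_sub_le (ω ω' : EuclideanSpace ℝ (Fin ν)) (k : Fin ν → ℤ) {a a' δ L : ℝ}
    (h : |inner ℝ ω (freq k) + a| < δ) (h' : |inner ℝ ω' (freq k) + a'| < δ)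
    (ha : |a - a'| ≤ L) : |inner ℝ (ω - ω') (freq k)| ≤ 2 * δ + L := by
  rw [inner_sub_left]
  rw [abs_lt] at h h'
  rw [abs_le] at ha ⊢
  constructor <;> linarith

theorem volume_slowSet_le (hγ : 0 ≤ γ) (hM : 0 ≤ M) (hp : ν < p) {q : ℕ} (hq : p ≤ q) :
    volume (slowSet ν M (γ * M) q) ≤ ENNReal.ofReal (4 * γ * (M * (4 * M) ^ (ν - 1)) *
      ∑' k : Fin ν → ℤ, ((1 + ‖freq k‖) ^ p)⁻¹) := by
  refine (measure_mono (t := ⋃ k, {ω | ω ∈ Metric.closedBall 0 (2 * M) ∧ k ≠ 0 ∧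
    |inner ℝ ω (freq k)| < γ * M / (1 + ‖freq k‖) ^ q}) fun ω hω => ?_).trans
    (volume_iUnion_freq_le (by positivity) hp (by simp) fun k hk => ?_)
  · obtain ⟨h1, k, hk⟩ := hω
    exact mem_iUnion.2 ⟨k, h1, hk⟩
  · refine (volume_le_of_inner_freq_close hk (R := 2 * M) (δ := γ * M / (1 + ‖freq k‖) ^ q)
      (fun ω hω => hω.1) (by positivity) fun ω hω ω' hω' => ?_).trans (ENNReal.ofReal_le_ofReal ?_)
    · have h1 := abs_inner_sub_le ω ω' k (a := 0) (a' := 0) (L := 0) (by simpa using hω.2.2)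
        (by simpa using hω'.2.2) (by simp)
      have := norm_nonneg (ω - ω')
      linarith
    · have h1 : ((1 + ‖freq k‖) ^ q)⁻¹ ≤ ((1 + ‖freq k‖) ^ p)⁻¹ := by
        have := norm_nonneg (freq k)
        gcongr
        linarith
      calc _ = 4 * γ * (M * (4 * M) ^ (ν - 1)) * ((1 + ‖freq k‖) ^ q)⁻¹ := by
            rw [← mul_assoc 2 2 M]; norm_num; ring
        _ ≤ _ := by gcongr

/-- Since |ω·k| ≤ 2M|k|, only O(M(1 + |k|)) integers n can be resonant for a given k. Counting them
costs one power of 1 + |k|, hence the exponent p + 1. -/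
theorem volume_integerResonantSet_le (hγ : 0 ≤ γ) (hγ1 : γ ≤ 1) (hM : 1 ≤ M) (hp : ν < p) :
    volume (integerResonantSet ν M (2 * γ) (p + 1)) ≤
      ENNReal.ofReal (40 * γ * (M * (4 * M) ^ (ν - 1)) *
        ∑' k : Fin ν → ℤ, ((1 + ‖freq k‖) ^ p)⁻¹) := by
  set F : (Fin ν → ℤ) → ℤ → Set (EuclideanSpace ℝ (Fin ν)) := fun k n =>
    {ω | ω ∈ Metric.closedBall 0 (2 * M) ∧ k ≠ 0 ∧
      |inner ℝ ω (freq k) + n| < 2 * γ / (1 + ‖freq k‖) ^ (p + 1)} with hF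
  refine (measure_mono (t := ⋃ k, ⋃ n, F k n) fun ω hω => ?_).trans
    (volume_iUnion_freq_le (by positivity) hp (by simp [hF]) fun k hk => ?_)
  · obtain ⟨h1, k, hk, n, hn⟩ := hω
    exact mem_iUnion.2 ⟨k, mem_iUnion.2 ⟨n, h1, hk, hn⟩⟩
  set x := ‖freq k‖ with hx
  have hx0 : 0 ≤ x := norm_nonneg _
  set b : ℝ := 4 * (2 * γ / (1 + x) ^ (p + 1)) * (4 * M) ^ (ν - 1) with hb
  have hterm : ∀ n : ℤ, volume (F k n) ≤ ENNReal.ofReal b *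
      (if |(n : ℝ) - 0| ≤ 2 * M * (1 + x) then 1 else 0) := by
    intro n
    split_ifs with hn
    · rw [mul_one, hb, show 4 * M = 2 * (2 * M) by ring]
      refine volume_le_of_inner_freq_close hk (fun ω hω => hω.1) (by positivity)
        fun ω hω ω' hω' => ?_
      have h1 := abs_inner_sub_le ω ω' k (L := 0) hω.2.2 hω'.2.2 (by simp)
      have := norm_nonneg (ω - ω')
      linarith
    · rw [mul_zero, nonpos_iff_eq_zero]
      refine measure_mono_null (fun ω hω => hn ?_) measure_empty
      have h1 := hω.2.2
      have h2 : |inner ℝ ω (freq k)| ≤ 2 * M * x :=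
        (abs_real_inner_le_norm _ _).trans (by
          have := mem_closedBall_zero_iff.1 hω.1
          gcongr)
      have h3 : 2 * γ / (1 + x) ^ (p + 1) ≤ 2 * M := by
        refine (div_le_self (by positivity) (one_le_pow₀ (by linarith))).trans (by linarith)
      rw [sub_zero]
      rw [abs_lt] at h1
      rw [abs_le] at h2 ⊢
      constructor <;> nlinarith
  refine (measure_iUnion_le _).trans ((ENNReal.tsum_le_tsum hterm).trans ?_)
  rw [ENNReal.tsum_mul_left]
  refine (mul_le_mul_right (tsum_indicator_abs_sub_le 0 _ (by positivity)) _).trans ?_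
  rw [← ENNReal.ofReal_mul (by positivity)]
  refine ENNReal.ofReal_le_ofReal ?_
  have h1 : 2 * (2 * M * (1 + x)) + 1 ≤ 5 * M * (1 + x) := by nlinarith
  calc b * (2 * (2 * M * (1 + x)) + 1) ≤ b * (5 * M * (1 + x)) := by gcongr
    _ = _ := by
      rw [hb, pow_succ]
      have : (1 + x) ≠ 0 := by positivity
      field_simp
      ring

/-- The measure of the frequencies for which a difference of two perturbed eigenvalues is
resonant. -/
theorem volume_resonant_le {lam : SignedMode → ℝ} (hA : 0 ≤ A)
    (hlam : ∀ i, |lam i - modeLabel i| ≤ A / (i.2 : ℝ)) (hγ : 0 < γ) (hγ1 : γ ≤ 1) (hτ : 0 ≤ τ)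
    (hτγ : τ ≤ γ) (hM : 1 ≤ M) (hp : ν < p) {G : Set (EuclideanSpace ℝ (Fin ν))}
    (hG : G ⊆ Metric.closedBall 0 (2 * M)) {d : EuclideanSpace ℝ (Fin ν) → SignedMode → ℝ}
    (hd : ∀ ω ∈ G, ∀ i, |d ω i - lam i| ≤ 1 / (i.2 : ℝ))
    (hlip : ∀ ω ∈ G, ∀ ω' ∈ G, ∀ i, |d ω i - d ω' i| ≤ 1 / 4 * ‖ω - ω'‖) :
    volume ({ω | ω ∈ G ∧ ∃ i j, ∃ k : Fin ν → ℤ, k ≠ 0 ∧ |inner ℝ ω (freq k) + (d ω i - d ω j)| <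
        τ / (1 + ‖freq k‖) ^ (2 * p + 2)} \ integerResonantSet ν M (2 * γ) (p + 1)) ≤
      ENNReal.ofReal (144 * (A + 1) * (2 * A + 5) * (τ / γ) * (M * (4 * M) ^ (ν - 1)) *
        ∑' k : Fin ν → ℤ, ((1 + ‖freq k‖) ^ p)⁻¹) := by
  set F : (Fin ν → ℤ) → SignedMode × SignedMode → Set (EuclideanSpace ℝ (Fin ν)) := fun k ij =>
    {ω | ω ∈ G ∧ k ≠ 0 ∧ ω ∉ integerResonantSet ν M (2 * γ) (p + 1) ∧
      |inner ℝ ω (freq k) + (d ω ij.1 - d ω ij.2)| < τ / (1 + ‖freq k‖) ^ (2 * p + 2)} with hF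
  refine (measure_mono (t := ⋃ k, ⋃ ij, F k ij) fun ω hω => ?_).trans
    (volume_iUnion_freq_le (by positivity) hp (by simp [hF]) fun k hk => ?_)
  · obtain ⟨⟨h1, i, j, k, hk, hn⟩, h2⟩ := hω
    exact mem_iUnion.2 ⟨k, mem_iUnion.2 ⟨(i, j), h1, hk, h2, hn⟩⟩
  set x := ‖freq k‖ with hx
  have hx0 : 0 ≤ x := norm_nonneg _
  set δ : ℝ := τ / (1 + x) ^ (2 * p + 2) with hδ
  set δ₀ : ℝ := γ / (1 + x) ^ (p + 1) with hδ₀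
  have hδ₀p : 0 < δ₀ := by positivity
  have hδδ₀ : δ ≤ δ₀ := by
    rw [hδ, hδ₀]
    gcongr
    · linarith
    · omega
    · norm_num
  have hδ₀1 : δ₀ ≤ 1 := (div_le_self hγ.le (one_le_pow₀ (by linarith))).trans hγ1
  -- Beyond I each eigenvalue is within δ₀/2 of its integer label. If both labels exceeded I, a
  -- resonance would give |ω·k + n| < δ + δ₀ ≤ 2δ₀ for an integer n, which is excluded outside the
  -- integer resonant set.
  set I : ℝ := 2 * (A + 1) / δ₀ with hI
  -- A resonance forces the labels to differ by at most |ω·k| + δ + 2(A + 1), and R dominates this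
  -- for |ω| ≤ 2M.
  set R : ℝ := (2 * A + 5) * M * (1 + x) with hR
  have hI1 : 1 ≤ I := by rw [hI, one_le_div hδ₀p]; linarith
  have hMx : 1 ≤ M * (1 + x) := one_le_mul_of_one_le_of_one_le hM (by linarith)
  have hR1 : 1 ≤ R := by rw [hR, mul_assoc]; nlinarith
  set b : ℝ := 4 * δ * (4 * M) ^ (ν - 1) with hb
  have hterm : ∀ ij, volume (F k ij) ≤ ENNReal.ofReal b *
      (if (|(modeLabel ij.1 : ℝ)| ≤ I ∨ |(modeLabel ij.2 : ℝ)| ≤ I) ∧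
        |(modeLabel ij.1 : ℝ) - modeLabel ij.2| ≤ R then 1 else 0) := by
    rintro ⟨i, j⟩
    split_ifs with hn
    · rw [mul_one, hb, show 4 * M = 2 * (2 * M) by ring]
      refine volume_le_of_inner_freq_close hk (fun ω hω => hG hω.1) (by positivity)
        fun ω hω ω' hω' => ?_
      refine abs_inner_sub_le ω ω' k hω.2.2.2 hω'.2.2.2 ?_
      have h1 := hlip ω hω.1 ω' hω'.1 i
      have h2 := hlip ω hω.1 ω' hω'.1 j
      rw [abs_le] at h1 h2 ⊢
      constructor <;> simp only <;> linarith
    · rw [mul_zero, nonpos_iff_eq_zero]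
      refine measure_mono_null (fun ω hω => hn ?_) measure_empty
      obtain ⟨hωG, -, hres, hsmall⟩ := hω
      simp only at hsmall ⊢
      have hpos : ∀ i : SignedMode, (1 : ℝ) ≤ i.2 := fun i => by exact_mod_cast i.2.pos
      have hlab : ∀ i, |d ω i - modeLabel i| ≤ (A + 1) / (i.2 : ℝ) := by
        intro i
        rw [add_div]
        have h1 := hd ω hωG i
        have h2 := hlam i
        rw [abs_le] at h1 h2 ⊢
        constructor <;> linarith
      have h1 := hlab i
      have h2 := hlab j
      constructor
      · rw [abs_modeLabel, abs_modeLabel]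
        by_contra! hij
        refine hres ⟨hG hωG, k, hk, modeLabel i - modeLabel j, ?_⟩
        have hlt : ∀ i : SignedMode, I < (i.2 : ℝ) → (A + 1) / (i.2 : ℝ) ≤ δ₀ / 2 := by
          intro i hi
          rw [div_le_iff₀ (by linarith [hpos i])]
          rw [hI, div_lt_iff₀ hδ₀p] at hi
          linarith
        have h3 := hlt i hij.1
        have h4 := hlt j hij.2
        have h5 : 2 * γ / (1 + ‖freq k‖) ^ (p + 1) = 2 * δ₀ := by rw [hδ₀, mul_div_assoc]
        rw [h5]
        push_cast
        rw [abs_lt] at hsmall ⊢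
        rw [abs_le] at h1 h2
        constructor <;> linarith
      · have h6 : ∀ i : SignedMode, (A + 1) / (i.2 : ℝ) ≤ A + 1 :=
          fun i => div_le_self (by linarith) (hpos i)
        have h3 := h6 i
        have h4 := h6 j
        have h5 : |inner ℝ ω (freq k)| ≤ 2 * M * x :=
          (abs_real_inner_le_norm _ _).trans (by
            have := mem_closedBall_zero_iff.1 (hG hωG)
            gcongr)
        have h7 : 2 * (M * x) + 1 + 2 * (A + 1) ≤ R := by
          rw [hR, mul_assoc]
          nlinarith
        rw [abs_lt] at hsmall
        rw [abs_le] at h1 h2 h5 ⊢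
        constructor <;> linarith
  refine (measure_iUnion_le _).trans ((ENNReal.tsum_le_tsum hterm).trans ?_)
  rw [ENNReal.tsum_mul_left]
  refine (mul_le_mul_right (tsum_near_pairs_le (by linarith) (by linarith)) _).trans ?_
  rw [← ENNReal.ofReal_mul (by linarith), ← ENNReal.ofReal_ofNat 2, ← ENNReal.ofReal_mul (by simp),
    ← ENNReal.ofReal_mul (by positivity)]
  refine ENNReal.ofReal_le_ofReal ?_
  -- The powers of 1 + |k| add up to -(2p + 2) from δ, p + 1 from I and 1 from R: a summable total
  -- of -p. Since I is proportional to 1/γ, the measure carries τ/γ.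
  calc b * (2 * ((2 * I + 1) * (2 * R + 1))) ≤ b * (2 * ((3 * I) * (3 * R))) := by
        gcongr <;> linarith
    _ = _ := by
      rw [hb, hI, hR, hδ, hδ₀, show 2 * p + 2 = (p + 1) + 1 + p by ring, pow_add, pow_add _ _ 1,
        pow_one]
      have : (1 + x) ≠ 0 := by positivity
      field_simp
      ring

end

noncomputable section

open scoped ENNReal ComplexConjugate
open Filter Topology SineSobolev

variable {ν : ℕ}

/-! ### The eigenvalues of the Klein-Gordon operator -/

/-- The eigenvalues of the unperturbed system. -/
def kgSigned (mass : ℝ) (i : SignedMode) : ℝ := modeSign i * kgEigenvalue mass i.2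

theorem kgSigned_not (mass : ℝ) (b : Bool) (j : ℕ+) :
    kgSigned mass (!b, j) = -kgSigned mass (b, j) := by
  cases b <;> simp [kgSigned, modeSign]

theorem kgEigenvalue_sq (mass : ℝ) (i : ℕ+) : kgEigenvalue mass i ^ 2 = (i : ℝ) ^ 2 + mass ^ 2 :=
  Real.sq_sqrt (by positivity)

theorem le_kgEigenvalue (mass : ℝ) (i : ℕ+) : (i : ℝ) ≤ kgEigenvalue mass i :=
  Real.le_sqrt_of_sq_le (by nlinarith [sq_nonneg mass])

theorem le_japanese (i : ℕ+) : (i : ℝ) ≤ japanese i :=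
  Real.le_sqrt_of_sq_le (by linarith)

theorem kgEigenvalue_le {mass : ℝ} (hmass : 0 ≤ mass) (i : ℕ+) : kgEigenvalue mass i ≤ i + mass :=
  (Real.sqrt_le_left (by positivity)).2 (by nlinarith [mul_nonneg (Nat.cast_nonneg (α := ℝ) i) hmass])

theorem abs_kgSigned_sub_modeLabel_le (mass : ℝ) (i : SignedMode) :
    |kgSigned mass i - modeLabel i| ≤ mass ^ 2 / (i.2 : ℝ) := by
  obtain ⟨b, i⟩ := i
  have hi : (0 : ℝ) < i := by exact_mod_cast i.pos
  have h1 := kgEigenvalue_sq mass i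
  have h2 := le_kgEigenvalue mass i
  have h3 : |kgSigned mass (b, i) - modeLabel (b, i)| = |kgEigenvalue mass i - i| := by
    cases b
    · rw [← abs_neg]
      congr 1
      simp [kgSigned, modeSign, modeLabel]
      ring
    · simp [kgSigned, modeSign, modeLabel]
  rw [h3, abs_of_nonneg (by linarith), le_div_iff₀ hi]
  nlinarith

theorem abs_kgSigned_le {mass : ℝ} (hmass : 0 ≤ mass) (i : SignedMode) :
    |kgSigned mass i| ≤ (1 + mass) * japanese i.2 := by
  rw [kgSigned, abs_mul, abs_modeSign, one_mul, abs_of_pos (kgEigenvalue_pos mass i.2)]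
  have h1 := kgEigenvalue_le hmass i.2
  have h2 := le_japanese i.2
  have h3 := one_le_japanese i.2
  nlinarith

/-- The product (λ_j - λ_i)(λ_j + λ_i) equals j² - i², which is at least i + j, while λ_i + λ_j ≤ (1
+ mass)(i + j). -/
theorem kgEigenvalue_gap {mass : ℝ} (hmass : 0 ≤ mass) {i j : ℕ+} (hij : i < j) :
    (1 + mass)⁻¹ ≤ kgEigenvalue mass j - kgEigenvalue mass i := by
  have h1 := kgEigenvalue_sq mass i
  have h2 := kgEigenvalue_sq mass j
  have h3 := kgEigenvalue_le hmass i
  have h4 := kgEigenvalue_le hmass j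
  have hi : (1 : ℝ) ≤ i := by exact_mod_cast i.pos
  have hj : (i : ℝ) + 1 ≤ j := by exact_mod_cast hij
  have hpi := kgEigenvalue_pos mass i
  have hpj := kgEigenvalue_pos mass j
  have h5 : (kgEigenvalue mass j - kgEigenvalue mass i) *
      (kgEigenvalue mass j + kgEigenvalue mass i) = (j : ℝ) ^ 2 - (i : ℝ) ^ 2 := by
    linear_combination h2 - h1
  have h6 : kgEigenvalue mass j + kgEigenvalue mass i ≤ (1 + mass) * (i + j) := by nlinarith
  have h7 : (i : ℝ) + j ≤ (j : ℝ) ^ 2 - (i : ℝ) ^ 2 := by nlinarith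
  rw [inv_le_iff_one_le_mul₀ (by positivity)]
  have h8 : 0 ≤ kgEigenvalue mass j - kgEigenvalue mass i := by
    by_contra! h
    nlinarith
  have h9 : (kgEigenvalue mass j - kgEigenvalue mass i) *
      (kgEigenvalue mass j + kgEigenvalue mass i) ≤
      (kgEigenvalue mass j - kgEigenvalue mass i) * ((1 + mass) * (i + j)) := by gcongr
  have h10 : (0 : ℝ) < i + j := by positivity
  nlinarith

theorem kgSigned_gap {mass : ℝ} (hmass : 0 ≤ mass) {i j : SignedMode} (hij : i ≠ j) :
    (1 + mass)⁻¹ ≤ |kgSigned mass i - kgSigned mass j| := by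
  have hne : ∀ i j : ℕ+, i ≠ j →
      (1 + mass)⁻¹ ≤ |kgEigenvalue mass i - kgEigenvalue mass j| := by
    intro i j hij
    rcases lt_or_gt_of_ne hij with h | h
    · rw [abs_sub_comm]
      exact (kgEigenvalue_gap hmass h).trans (le_abs_self _)
    · exact (kgEigenvalue_gap hmass h).trans (le_abs_self _)
  have hop : ∀ i j : ℕ+, (1 + mass)⁻¹ ≤ kgEigenvalue mass i + kgEigenvalue mass j := by
    intro i j
    have h1 := le_kgEigenvalue mass i
    have h2 := kgEigenvalue_pos mass j
    have hi : (1 : ℝ) ≤ i := by exact_mod_cast i.pos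
    have h3 : (1 + mass)⁻¹ ≤ 1 := inv_le_one_of_one_le₀ (by linarith)
    linarith
  obtain ⟨b, i⟩ := i
  obtain ⟨b', j⟩ := j
  cases b <;> cases b'
  · have := hne j i fun h => hij (by rw [h])
    simpa [kgSigned, modeSign, neg_add_eq_sub] using this
  · have := (hop i j).trans (neg_le_abs (-kgEigenvalue mass i - kgEigenvalue mass j) |>.trans' (by linarith))
    simpa [kgSigned, modeSign] using this
  · have := (hop i j).trans (le_abs_self _)
    simpa [kgSigned, modeSign] using this
  · have := hne i j fun h => hij (by rw [h])
    simpa [kgSigned, modeSign] using this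

/-! ### The set of nonresonant frequencies -/

variable {lam : SignedMode → ℝ} {W : MatOp (Mode ν)} {q m p : ℕ} {σ c γ γ' Λ w M ε A : ℝ}

/-- The frequencies in the annulus that are nonresonant up to the `N`-th step. -/
def goodSet (lam : SignedMode → ℝ) (W : MatOp (Mode ν)) (m : ℕ) (γ M : ℝ) (N : ℕ) :
    Set (EuclideanSpace ℝ (Fin ν)) := {ω | ω ∈ annulus ν M ∧ NonResonantBefore lam W m γ M N ω}

theorem annulus_subset : annulus ν M ⊆ Metric.closedBall 0 (2 * M) := sdiff_subset

theorem isClosed_annulus : IsClosed (annulus ν M) :=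
  Metric.isClosed_closedBall.sdiff Metric.isOpen_ball

theorem goodSet_zero : goodSet lam W m γ M 0 = {ω | ω ∈ annulus ν M ∧
    FastNonResonant lam m γ M ω} := by
  ext ω
  exact ⟨fun h => ⟨h.1, h.2.fast⟩, fun h => ⟨h.1, h.2, by simp⟩⟩

theorem goodSet_succ (N : ℕ) : goodSet lam W m γ M (N + 1) = {ω | ω ∈ goodSet lam W m γ M N ∧
    NonResonant m γ ω (iterDiag lam W N ω) N} := by
  ext ω
  refine ⟨fun h => ⟨⟨h.1, h.2.fast, fun n hn => h.2.steps n (hn.trans (Nat.lt_succ_self N))⟩,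
    h.2.steps N (Nat.lt_succ_self N)⟩, fun h => ⟨h.1.1, h.1.2.fast, fun n hn => ?_⟩⟩
  rcases (Nat.lt_succ_iff_lt_or_eq.1 hn) with h1 | rfl
  · exact h.1.2.steps n h1
  · exact h.2

theorem isClosed_nonResonant {G : Set (EuclideanSpace ℝ (Fin ν))} (hG : IsClosed G)
    {d : EuclideanSpace ℝ (Fin ν) → SignedMode → ℂ} (hd : ∀ i, ContinuousOn (fun ω => d ω i) G)
    (n : ℕ) : IsClosed {ω | ω ∈ G ∧ NonResonant m γ ω (d ω) n} := by
  have e : {ω | ω ∈ G ∧ NonResonant m γ ω (d ω) n} = G ∩ ⋂ (i) (j) (k : Fin ν → ℤ) (_ : k ≠ 0),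
      (G ∩ (fun ω => |inner ℝ ω (freq k) + (d ω i - d ω j).re|) ⁻¹'
        Ici (γ / 2 ^ n / (1 + ‖freq k‖) ^ m)) := by
    ext ω
    simp only [mem_ofPred_eq, mem_inter_iff, mem_iInter, mem_preimage, mem_Ici, NonResonant]
    exact ⟨fun h => ⟨h.1, fun i j k hk => ⟨h.1, h.2 i j k hk⟩⟩,
      fun h => ⟨h.1, fun i j k hk => (h.2 i j k hk).2⟩⟩
  rw [e]
  refine hG.inter (isClosed_iInter fun i => isClosed_iInter fun j => isClosed_iInter fun k =>
    isClosed_iInter fun _ => ContinuousOn.preimage_isClosed_of_isClosed ?_ hG isClosed_Ici)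
  have h1 : ContinuousOn (fun ω => (d ω i - d ω j).re) G :=
    Complex.continuous_re.comp_continuousOn ((hd i).sub (hd j))
  have h2 : Continuous fun ω : EuclideanSpace ℝ (Fin ν) => inner ℝ ω (freq k) := by fun_prop
  exact (h2.continuousOn.add h1).abs

/-- The N-th diagonal is Lipschitz on the set that is good up to step N, so the next condition cuts
out a relatively closed subset. This provides measurability without extending the eigenvalues off
the good set. -/
theorem isClosed_goodSet (hs : SchemeSmall lam m σ c γ Λ w M ε)
    (hW : AdmissiblePert q (2 * σ + c) w W) (N : ℕ) : IsClosed (goodSet lam W m γ M N) := by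
  induction N with
  | zero =>
    have e : goodSet lam W m γ M 0 = {ω | ω ∈ annulus ν M ∧
        NonResonant m γ ω (fun i => (lam i : ℂ)) 0} ∩ ⋂ (k : Fin ν → ℤ) (_ : k ≠ 0),
          {ω | γ * M / (1 + ‖freq k‖) ^ m ≤ |inner ℝ ω (freq k)|} := by
      rw [goodSet_zero]
      ext ω
      simp only [mem_ofPred_eq, mem_inter_iff, mem_iInter]
      exact ⟨fun h => ⟨⟨h.1, h.2.modes⟩, h.2.frequency⟩, fun h => ⟨h.1.1, h.2, h.1.2⟩⟩
    rw [e]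
    have h0 := isClosed_nonResonant (m := m) (γ := γ) (isClosed_annulus (ν := ν) (M := M))
      (d := fun _ i => (lam i : ℂ)) (fun i => continuousOn_const) 0
    refine h0.inter (isClosed_iInter fun k => isClosed_iInter fun _ => ?_)
    exact isClosed_le continuous_const (by fun_prop)
  | succ N ih =>
    rw [goodSet_succ]
    refine isClosed_nonResonant ih (fun i => ?_) N
    refine (LipschitzOnWith.of_dist_le_mul (K := (2 * ε).toNNReal) fun ω hω ω' hω' => ?_).continuousOn
    rw [dist_eq_norm, dist_eq_norm, Real.coe_toNNReal _ (by linarith [hs.kam.size_nonneg])]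
    exact hω.2.iterDiag_lip hs hW hω'.2 i

/-- A bad frequency is sorted by the first condition that it violates: |ω·k| too small, integer
resonance, resonance of the free eigenvalues, or resonance at step n. The constant is 44 = 4 + 40
for the first two and 432 = 3 · 144 for the last two, where the geometric series over n contributes
2. -/
theorem volume_annulus_diff_le (hs : SchemeSmall lam (2 * p + 2) σ c γ' Λ w M ε)
    (hW : AdmissiblePert q (2 * σ + c) w W) (hA : 0 ≤ A)
    (hlam : ∀ i, |lam i - modeLabel i| ≤ A / (i.2 : ℝ)) (hγ : 0 < γ) (hγ1 : γ ≤ 1)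
    (hγ' : γ' ≤ γ ^ 2) (hε : 8 * ε ≤ 1) (hp : ν < p) :
    volume (annulus ν M \ ⋂ N, goodSet lam W (2 * p + 2) γ' M N) ≤
      ENNReal.ofReal ((44 + 432 * (A + 1) * (2 * A + 5)) * γ * (M * (4 * M) ^ (ν - 1)) *
        ∑' k : Fin ν → ℤ, ((1 + ‖freq k‖) ^ p)⁻¹) := by
  have hM := hs.fast.one_le
  have hγ'0 := hs.fast.gamma_pos
  have hγ'γ : γ' ≤ γ := hγ'.trans (by nlinarith)
  set S := ∑' k : Fin ν → ℤ, ((1 + ‖freq k‖) ^ p)⁻¹ with hS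
  have hS0 : 0 ≤ S := tsum_nonneg fun k => by positivity
  set v := M * (4 * M) ^ (ν - 1) with hv
  have hv0 : 0 ≤ v := by positivity
  set Z := integerResonantSet ν M (2 * γ) (p + 1) with hZ
  set B : ℝ → Set (EuclideanSpace ℝ (Fin ν)) → (EuclideanSpace ℝ (Fin ν) → SignedMode → ℝ) →
    Set (EuclideanSpace ℝ (Fin ν)) := fun τ G d => {ω | ω ∈ G ∧ ∃ i j, ∃ k : Fin ν → ℤ, k ≠ 0 ∧
      |inner ℝ ω (freq k) + (d ω i - d ω j)| < τ / (1 + ‖freq k‖) ^ (2 * p + 2)} \ Z with hB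
  set K := 144 * (A + 1) * (2 * A + 5) with hK
  have hK0 : 0 ≤ K := by positivity
  set d : ℕ → EuclideanSpace ℝ (Fin ν) → SignedMode → ℝ := fun n ω i => (iterDiag lam W n ω i).re
    with hd
  have hB0 : volume (B (γ' / 2 ^ 0) (annulus ν M) fun _ => lam) ≤ ENNReal.ofReal (K * γ * v * S) := by
    refine (volume_resonant_le hA hlam hγ hγ1 (by positivity) (by simpa using hγ'γ) hM hp
      annulus_subset (fun ω _ i => by rw [sub_self, abs_zero]; positivity)
      (fun ω _ ω' _ i => by rw [sub_self, abs_zero]; positivity)).trans ?_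
    refine ENNReal.ofReal_le_ofReal ?_
    have : γ' / 2 ^ 0 / γ ≤ γ := by rw [div_le_iff₀ hγ]; simpa [sq] using hγ'
    gcongr
  have hBn : ∀ n, volume (B (γ' / 2 ^ n) (goodSet lam W (2 * p + 2) γ' M n) (d n)) ≤
      ENNReal.ofReal (K * γ * v * S * (1 / 2) ^ n) := by
    intro n
    refine (volume_resonant_le hA hlam hγ hγ1 (by positivity)
      ((div_le_self hγ'0.le (one_le_pow₀ one_le_two)).trans hγ'γ) hM hp
      (fun ω hω => annulus_subset hω.1) (fun ω hω i => ?_) (fun ω hω ω' hω' i => ?_)).trans ?_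
    · have h1 := (Complex.abs_re_le_norm _).trans (hω.2.iterDiag_close hs hW i)
      rw [Complex.sub_re, Complex.ofReal_re] at h1
      refine h1.trans ?_
      have := le_japanese i.2
      have : (0 : ℝ) < i.2 := by exact_mod_cast i.2.pos
      gcongr
      linarith
    · have h1 := (Complex.abs_re_le_norm _).trans (hω.2.iterDiag_lip hs hW hω'.2 i)
      rw [Complex.sub_re] at h1
      refine h1.trans ?_
      gcongr
      linarith
    · refine ENNReal.ofReal_le_ofReal ?_
      -- The quotient by γ in `volume_resonant_le` is compensated by γ' ≤ γ², and the factor 2^{-n}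
      -- in the n-th condition makes the measures summable.
      have : γ' / 2 ^ n / γ ≤ γ * (1 / 2) ^ n := by
        rw [div_le_iff₀ hγ, one_div_pow, div_eq_mul_one_div]
        have : 0 ≤ 1 / (2 : ℝ) ^ n := by positivity
        nlinarith
      calc K * (γ' / 2 ^ n / γ) * v * S ≤ K * (γ * (1 / 2) ^ n) * v * S := by gcongr
        _ = _ := by ring
  have hsub : annulus ν M \ ⋂ N, goodSet lam W (2 * p + 2) γ' M N ⊆
      (slowSet ν M (γ' * M) (2 * p + 2) ∪ Z) ∪ (B (γ' / 2 ^ 0) (annulus ν M) (fun _ => lam) ∪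
        ⋃ n, B (γ' / 2 ^ n) (goodSet lam W (2 * p + 2) γ' M n) (d n)) := by
    rintro ω ⟨hω, hbad⟩
    by_cases hωZ : ω ∈ Z
    · exact Or.inl (Or.inr hωZ)
    simp only [mem_iInter, not_forall] at hbad
    classical
    have hmin := fun n => Nat.find_min hbad (m := n)
    have hspec := Nat.find_spec hbad
    -- At the first failing index all earlier conditions hold, so the eigenvalue bounds used to
    -- estimate the excluded set are available there.
    rcases hN : Nat.find hbad with _ | N
    · rw [hN, goodSet_zero] at hspec
      by_cases hslow : ω ∈ slowSet ν M (γ' * M) (2 * p + 2)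
      · exact Or.inl (Or.inl hslow)
      refine Or.inr (Or.inl ⟨?_, hωZ⟩)
      by_contra hcon
      refine hspec ⟨hω, fun k hk => ?_, fun i j k hk => ?_⟩
      · by_contra! h
        exact hslow ⟨annulus_subset hω, k, hk, h⟩
      · by_contra! h
        refine hcon ⟨hω, i, j, k, hk, ?_⟩
        simpa using h
    · have hprev := not_not.1 (hmin N (by rw [hN]; exact Nat.lt_succ_self N))
      rw [hN, goodSet_succ] at hspec
      refine Or.inr (Or.inr (mem_iUnion.2 ⟨N, ⟨hprev, ?_⟩, hωZ⟩))
      by_contra hcon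
      refine hspec ⟨hprev, fun i j k hk => ?_⟩
      by_contra! h
      exact hcon ⟨i, j, k, hk, by simpa [hd] using h⟩
  refine (measure_mono hsub).trans ?_
  have hsum : volume (⋃ n, B (γ' / 2 ^ n) (goodSet lam W (2 * p + 2) γ' M n) (d n)) ≤
      ENNReal.ofReal (K * γ * v * S * 2) := by
    refine (measure_iUnion_le _).trans ((ENNReal.tsum_le_tsum hBn).trans ?_)
    rw [← ENNReal.ofReal_tsum_of_nonneg (fun n => by positivity)
      (summable_geometric_two.mul_left _), tsum_mul_left, tsum_geometric_two]
  have h1 := volume_slowSet_le hγ'0.le (zero_le_one.trans hM) hp (q := 2 * p + 2) (by omega)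
  have h2 := volume_integerResonantSet_le hγ.le hγ1 hM hp
  calc _ ≤ (ENNReal.ofReal (4 * γ' * v * S) + ENNReal.ofReal (40 * γ * v * S)) +
        (ENNReal.ofReal (K * γ * v * S) + ENNReal.ofReal (K * γ * v * S * 2)) :=
        (measure_union_le _ _).trans (add_le_add ((measure_union_le _ _).trans (add_le_add h1 h2))
          ((measure_union_le _ _).trans (add_le_add hB0 hsum)))
    _ = ENNReal.ofReal (4 * γ' * v * S + 40 * γ * v * S + (K * γ * v * S + K * γ * v * S * 2)) := by
        rw [← ENNReal.ofReal_add (by positivity) (by positivity),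
          ← ENNReal.ofReal_add (by positivity) (by positivity),
          ← ENNReal.ofReal_add (by positivity) (by positivity)]
    _ ≤ _ := by
        refine ENNReal.ofReal_le_ofReal ?_
        have h3 : 4 * γ' * v * S ≤ 4 * γ * v * S := by gcongr
        have h4 : (44 + 432 * (A + 1) * (2 * A + 5)) * γ * v * S =
          4 * γ * v * S + 40 * γ * v * S + (K * γ * v * S + K * γ * v * S * 2) := by rw [hK]; ring
        linarith

/-- The annulus has (2^ν - 1) M^ν times the volume of the unit ball, and 2^ν - 1 ≥ 1 because ν ≥ 1.
-/
theorem volume_annulus_ge (hν : 1 ≤ ν) (hM : 0 < M) :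
    M ^ ν * volume.real (Metric.ball (0 : EuclideanSpace ℝ (Fin ν)) 1) ≤
      volume.real (annulus ν M) := by
  have h1 : volume.real (Metric.closedBall (0 : EuclideanSpace ℝ (Fin ν)) (2 * M)) =
      (2 * M) ^ ν * volume.real (Metric.ball (0 : EuclideanSpace ℝ (Fin ν)) 1) := by
    rw [measureReal_def, Measure.addHaar_closedBall _ _ (by positivity), ENNReal.toReal_mul,
      ENNReal.toReal_ofReal (by positivity), finrank_euclideanSpace_fin, measureReal_def]
  have h2 : volume.real (Metric.ball (0 : EuclideanSpace ℝ (Fin ν)) M) =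
      M ^ ν * volume.real (Metric.ball (0 : EuclideanSpace ℝ (Fin ν)) 1) := by
    rw [measureReal_def, Measure.addHaar_ball_of_pos _ _ hM, ENNReal.toReal_mul,
      ENNReal.toReal_ofReal (by positivity), finrank_euclideanSpace_fin, measureReal_def]
  rw [annulus, measureReal_sdiff (Metric.ball_subset_closedBall.trans
    (Metric.closedBall_subset_closedBall (by linarith))) measurableSet_ball
      measure_closedBall_lt_top.ne, h1, h2, mul_pow]
  have h3 : (2 : ℝ) ≤ 2 ^ ν := le_self_pow₀ one_le_two (by omega)
  have h4 : 0 ≤ M ^ ν * volume.real (Metric.ball (0 : EuclideanSpace ℝ (Fin ν)) 1) := by positivity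
  nlinarith

end

noncomputable section

open scoped ENNReal ComplexConjugate
open Filter Topology SineSobolev

variable {ν : ℕ}

/-! ### Reduction of the Klein-Gordon system -/

/-- The smallness conditions of the scheme hold for large frequencies. -/
theorem exists_schemeSmall {lam : SignedMode → ℝ} {m : ℕ} {σ c γ Λ w S : ℝ} (hσ : 0 < σ)
    (hc : 0 < c) (hc1 : c ≤ 1) (hγ : 0 < γ) (hγ1 : γ ≤ 1) (hΛ : 1 ≤ Λ)
    (hgrowth : ∀ i : SignedMode, |lam i| ≤ Λ * japanese i.2)
    (hgap : ∀ i j, i ≠ j → 2 * γ ≤ |lam i - lam j|) (hw : 0 ≤ w) (hS : 0 ≤ S) :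
    ∃ Mstar > 1, ∃ E > 0, ∃ D ≥ 0, ∀ M, Mstar ≤ M → SchemeSmall lam m σ c γ Λ w M (E / M) ∧
      8 * (E / M) ≤ 1 ∧
      4 * averagingConst m Λ γ c * w / M + 8 * kamConst m σ γ * (E / M) = D / M ∧
      8 * (D / M) * S < 1 := by
  have ha : 0 ≤ averagingConst m Λ γ c :=
    averagingConst_nonneg (m := m) (lam := lam) (σ := σ) (M := 1)
      ⟨hσ.le, hc, hc1, hγ, hγ1, le_rfl, hΛ, hgrowth⟩
  have hk : 0 ≤ kamConst m σ γ := by unfold kamConst expLoss; positivity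
  have hkr := one_le_kamRate m
  set a := averagingConst m Λ γ c with ha'
  set k := kamConst m σ γ with hk'
  -- The size ε is taken as E/M, of the order of the perturbation left by the first step; the
  -- summand 1 keeps E positive.
  set E := 48 * a * w ^ 2 + 1 with hE
  have hE0 : 0 < E := by positivity
  set D := 4 * a * w + 8 * k * E with hD
  have hD0 : 0 ≤ D := by positivity
  have t1 : 0 ≤ 16 * a * w := by positivity
  have t2 : 0 ≤ 4 * E / γ := by positivity
  have t3 : 0 ≤ 96 * k * kamRate m * E := by positivity
  have t4 : 0 ≤ 8 * D * S := by positivity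
  -- Each summand is the threshold for M in one of the required inequalities; all of them have the
  -- form constant/M ≤ bound.
  refine ⟨2 + 16 * a * w + 4 * E / γ + 96 * k * kamRate m * E + 4 * D + 8 * E + 8 * D * S,
    by linarith, E, hE0, D, hD0, fun M hM => ?_⟩
  have hM0 : 0 < M := by linarith
  have hsum : 4 * a * w / M + 8 * k * (E / M) = D / M := by rw [hD]; ring
  refine ⟨⟨⟨by linarith, hc, hc1, hγ, hγ1, by linarith, hΛ, hgrowth⟩,
    ⟨hσ, hγ, hγ1, hgap, by positivity, ?_, ?_⟩, by linarith, ?_, ?_⟩, ?_, hsum, ?_⟩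
  · rw [← mul_div_assoc, div_le_iff₀ hM0, ← div_le_iff₀' hγ]
    linarith
  · rw [← mul_div_assoc, div_le_one hM0]
    linarith
  · rw [hE]
    gcongr
    linarith
  · rw [hsum, div_le_iff₀ hM0]
    linarith
  · rw [← mul_div_assoc, div_le_one hM0]
    linarith
  · rw [← mul_div_assoc, div_mul_eq_mul_div, div_lt_one hM0]
    linarith

variable {V : EuclideanSpace ℝ (Fin ν) → ℝ → ℝ}

/-- At a nonresonant frequency a quasi-periodic change of coordinates diagonalizes the system. -/
theorem exists_kg_conjugation {q m : ℕ} {r ρ s mass σ c γ Λ w M ε D : ℝ}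
    {ω : EuclideanSpace ℝ (Fin ν)} (hr : |r| ≤ q + 1) (hr' : |r - 1| ≤ q + 1) (hρ : 0 < ρ)
    (hper : TorusPeriodic V) (hV1 : ConditionV1 V ρ) (hsσ : s < σ)
    (hs : SchemeSmall (kgSigned mass) m σ c γ Λ w M ε) (hε : 8 * ε ≤ 1)
    (hD : 4 * averagingConst m Λ γ c * w / M + 8 * kamConst m σ γ * ε = D) (hD0 : 0 ≤ D)
    (hDS : 8 * D * ∑' k : Fin ν → ℤ, exp (-(σ * ‖freq k‖)) < 1)
    (hW : AdmissiblePert q (2 * σ + c) w (kgPert V mass))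
    (hent : ∀ s t, entry (kgPert V mass) s t = kgEntry V mass s t)
    (hn : ∀ N, NonResonantBefore (kgSigned mass) (kgPert V mass) m γ M N ω) :
    ∃ T : EuclideanSpace ℝ (Fin ν) → PhaseOp r, TorusPeriodic T ∧ ExtendsAnalytically s T ∧
      (∀ θ, IsUnit (T θ)) ∧ (∀ θ u, IsRealPair u → IsRealPair (T θ u)) ∧
      (∀ θ, ‖T θ - 1‖ ≤ 8 * D * ∑' k : Fin ν → ℤ, exp (-(σ * ‖freq k‖))) ∧
      ∀ ψ : ℝ → PhaseSpace r,
        IsSolution (fun _ => diagHamiltonian fun j =>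
          (finalDiag (kgSigned mass) (kgPert V mass) ω (true, j)).re) ψ ↔
        IsSolution (fun t => kgHamiltonian mass (V (t • ω))) fun t => T (t • ω) (ψ t) := by
  have hσ := hs.kam.width_pos
  have hc := hs.fast.loss_pos
  obtain ⟨-, hclose, him, hneg, T, -, hreal, hT, hint⟩ :=
    exists_conjugation hs hW (kgSigned_not mass) hn
  rw [hD] at hT
  have hTa : ActsOn q σ r (D + 1) T := by
    have h3 := (ActsOn.mk hr hD0 hT).add (ActsOn.one (ν := ν) q σ hr)
    rwa [sub_add_cancel] at h3
  have hnorm := norm_fourierOp_sub_one_le (r := r) hr hσ hD0 hT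
  set d : SignedMode → ℝ := fun i => (finalDiag (kgSigned mass) (kgPert V mass) ω i).re with hd
  have hdc : ∀ i, finalDiag (kgSigned mass) (kgPert V mass) ω i = (d i : ℂ) := fun i =>
    Complex.ext (by simp [hd]) (by simpa using him i)
  -- The real structure makes the eigenvalues on the second component the negatives of those on the
  -- first, so the limit has the form diag(D, -D).
  have hsign : ∀ i, d i = modeSign i * d (true, i.2) := by
    rintro ⟨b, j⟩
    cases b
    · have := congrArg Complex.re (hneg true j)
      simpa [hd, modeSign] using this
    · simp [modeSign]
  have hdbound : ∀ i, |d i| ≤ (Λ + 1) * japanese i.2 := by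
    intro i
    have h1 := (Complex.abs_re_le_norm _).trans (hclose i)
    rw [Complex.sub_re, Complex.ofReal_re] at h1
    have hJ := one_le_japanese i.2
    have h2 : 2 * ε / japanese i.2 ≤ 1 := by
      rw [div_le_one (by linarith)]
      linarith [hs.kam.size_nonneg]
    have h3 := hs.fast.growth i
    rw [abs_le] at h1 h3 ⊢
    simp only [hd]
    constructor <;> linarith
  refine ⟨fun θ => fourierOp r T (toComplexVec θ), torusPeriodic_fourierOp r T,
    ⟨fourierOp r T, hTa.analyticOnNhd hsσ, fun θ => rfl⟩,
    fun θ => isUnit_of_norm_sub_one_lt ((hnorm θ).trans_lt hDS),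
    fun θ u hu => hTa.isRealPair hσ hreal θ hu, hnorm, fun ψ => ?_⟩
  refine fourierOp_conjugation (lam := kgSigned mass) (d := d) (C := Λ + 1) hr hr' hσ hW.nonneg
    ((opSchur_mono (weightZ_mono le_rfl (by linarith)) _).trans (hW.actsOn hr).bound) hW.inv hD0 hT
    hDS (fun i => (hs.fast.growth i).trans ?_) hdbound ?_ (fun t u i => ?_) (fun t u i => ?_) ψ
  · have := japanese_pos i.2
    gcongr
    linarith
  · simpa only [hdc] using hint
  · exact signedCoeff_kgHamiltonian hr (by linarith) hρ hper hV1 hW hent (t • ω) u i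
  · rw [signedCoeff_diagHamiltonian, hsign i]

theorem lipschitzOnWith_finalDiag {lam : SignedMode → ℝ} {W : MatOp (Mode ν)} {q m : ℕ}
    {σ c γ Λ w M ε : ℝ} (hs : SchemeSmall lam m σ c γ Λ w M ε)
    (hW : AdmissiblePert q (2 * σ + c) w W) (hlam : ∀ b j, lam (!b, j) = -lam (b, j))
    (i : SignedMode) : LipschitzOnWith (2 * ε).toNNReal (fun ω => (finalDiag lam W ω i).re)
      (⋂ N, goodSet lam W m γ M N) := by
  refine LipschitzOnWith.of_dist_le_mul fun ω hω ω' hω' => ?_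
  rw [mem_iInter] at hω hω'
  have h1 := (exists_conjugation hs hW hlam fun N => (hω N).2).1 i
  have h2 := (exists_conjugation hs hW hlam fun N => (hω' N).2).1 i
  have h3 : ‖finalDiag lam W ω i - finalDiag lam W ω' i‖ ≤ 2 * ε * ‖ω - ω'‖ :=
    le_of_tendsto (h1.sub h2).norm (Eventually.of_forall fun n =>
      (hω n).2.iterDiag_lip hs hW (hω' n).2 i)
  rw [Real.dist_eq, ← Complex.sub_re, dist_eq_norm,
    Real.coe_toNNReal _ (by linarith [hs.kam.size_nonneg])]
  exact (Complex.abs_re_le_norm _).trans h3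

/-! ### The theorem: choice of the parameters. -/

theorem theorem1p1 {ν : ℕ} (hν : 1 ≤ ν) (V : EuclideanSpace ℝ (Fin ν) → ℝ → ℝ)
    (hper : TorusPeriodic V) (ρ : ℝ) (hρ : 0 < ρ) (hV1 : ConditionV1 V ρ) (hV2 : ConditionV2 V)
    (r mass α : ℝ) (hr : 0 ≤ r) (hmass : 0 ≤ mass) (hα : α ∈ Set.Ioo (0 : ℝ) 1) :
    ∃ γ₀ > 0, ∃ C > 0, ∀ γ : ℝ, 0 < γ → γ < γ₀ →
    ∃ Mstar > 1, ∃ Cr > 0, ∃ Ceig > 0, ∀ M : ℝ, Mstar ≤ M →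
    ∃ Ω ⊆ annulus ν M, MeasurableSet Ω ∧
      volume.real (annulus ν M \ Ω) / volume.real (annulus ν M) ≤ C * γ ∧
    ∃ (T : EuclideanSpace ℝ (Fin ν) → EuclideanSpace ℝ (Fin ν) → PhaseOp r)
      (lam : ℕ+ → EuclideanSpace ℝ (Fin ν) → ℝ),
      -- the eigenvalues are real-valued and Lipschitz in the frequency
      (∃ K : ℝ≥0, ∀ j, LipschitzOnWith K (lam j) Ω) ∧
      ∀ ω ∈ Ω,
        -- asymptotics of the eigenvalues
        (∀ j : ℕ+, |lam j ω - kgEigenvalue mass j| ≤ Ceig / (M * (j : ℝ) ^ α)) ∧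
        -- quasi-periodicity, analyticity, invertibility, real structure, closeness to the identity
        TorusPeriodic (T ω) ∧
        ExtendsAnalytically (ρ / 8) (T ω) ∧
        (∀ θ, IsUnit (T ω θ)) ∧
        (∀ θ u, IsRealPair u → IsRealPair (T ω θ u)) ∧
        (∀ θ, ‖T ω θ - 1‖ ≤ Cr / M ^ ((1 - α) / 2)) ∧
        -- the change of coordinates `φ = T(ω t) ψ` conjugates the two systems
        ∀ ψ : ℝ → PhaseSpace r,
          IsSolution (fun _ => diagHamiltonian fun j => lam j ω) ψ ↔
          IsSolution (fun t => kgHamiltonian mass (V (t • ω))) fun t => T ω (t • ω) (ψ t) := by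
  obtain ⟨hα0, hα1⟩ := hα
  -- The decay q + 1 of transformations must cover the orders r and r - 1.
  set q : ℕ := ⌈r⌉₊ + 1 with hq
  have hrq : r + 2 ≤ q + 1 := by
    have := Nat.le_ceil r
    rw [hq]; push_cast; linarith
  have hr1 : |r| ≤ q + 1 := by rw [abs_of_nonneg hr]; linarith
  have hr2 : |r - 1| ≤ q + 1 := by rw [abs_le]; constructor <;> linarith
  -- The final width σ exceeds ρ/8 slightly, so that the closed strip lies inside. The iteration
  -- starts from 2σ, and the first step from 2σ + c ≤ 5ρ/16.
  set σ : ℝ := 9 * ρ / 64 with hσ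
  have hσ0 : 0 < σ := by positivity
  set c : ℝ := min 1 (ρ / 32) with hc
  have hc0 : 0 < c := lt_min one_pos (by positivity)
  have hcρ : c ≤ ρ / 32 := min_le_right _ _
  -- The coefficients of V decay at rate ρ'/2 = 3ρ/8, which leaves room above 5ρ/16; and ρ' < ρ, as
  -- the contour shift needs.
  obtain ⟨⟨w, hW⟩, hent⟩ := exists_kgPert_admissible (V := V) (ρ := ρ) (ρ' := 3 * ρ / 4)
    (σ := 2 * σ + c) (by positivity) (by linarith) (by positivity) (by linarith) hper hV1 hV2 mass q
  set S₁ := ∑' k : Fin ν → ℤ, ((1 + ‖freq k‖) ^ (ν + 1))⁻¹ with hS₁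
  have hS₁0 : 0 ≤ S₁ := tsum_nonneg fun k => by positivity
  set S₂ := ∑' k : Fin ν → ℤ, exp (-(σ * ‖freq k‖)) with hS₂
  have hS₂0 : 0 ≤ S₂ := tsum_nonneg fun k => by positivity
  set β := volume.real (Metric.ball (0 : EuclideanSpace ℝ (Fin ν)) 1) with hβ
  have hβ0 : 0 < β :=
    ENNReal.toReal_pos (Metric.measure_ball_pos _ _ one_pos).ne' measure_ball_lt_top.ne
  set K := 44 + 432 * (mass ^ 2 + 1) * (2 * mass ^ 2 + 5) with hK
  -- The constant is the ratio of the bounds in `volume_annulus_diff_le` and `volume_annulus_ge`,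
  -- with p = ν + 1 for summability over k; the summand 1 makes it positive.
  refine ⟨1, one_pos, K * 4 ^ (ν - 1) * S₁ / β + 1, by positivity, fun γ hγ hγ1 => ?_⟩
  -- The scheme runs with γ' rather than γ: the square yields a measure of order γ, and the second
  -- factor keeps 2γ' below the spectral gap (1 + mass)⁻¹.
  set γ' := γ ^ 2 * ((1 + mass)⁻¹ / 2) with hγ'
  have hinv : (1 + mass)⁻¹ ≤ 1 := inv_le_one_of_one_le₀ (by linarith)
  have hinv0 : 0 < (1 + mass)⁻¹ := by positivity
  have hγsq : γ ^ 2 ≤ 1 := pow_le_one₀ hγ.le hγ1.le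
  have hγ'0 : 0 < γ' := by positivity
  have hγ'γ : γ' ≤ γ ^ 2 := mul_le_of_le_one_right (by positivity) (by linarith)
  obtain ⟨Mstar, hMstar, E, hE, D, hD, hlarge⟩ := exists_schemeSmall (lam := kgSigned mass)
    (m := 2 * (ν + 1) + 2) (Λ := 1 + mass) hσ0 hc0 (min_le_left _ _) hγ'0 (hγ'γ.trans hγsq)
    (by linarith) (abs_kgSigned_le hmass)
    (fun i j hij => le_trans (by rw [hγ']; nlinarith) (kgSigned_gap hmass hij)) hW.nonneg hS₂0
  refine ⟨Mstar, hMstar, 8 * D * S₂ + 1, by positivity, 2 * E, by positivity, fun M hM => ?_⟩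
  obtain ⟨hs, hε, hDM, hsmall⟩ := hlarge M hM
  have hM1 : 1 < M := hMstar.trans_le hM
  have hM0 : 0 < M := by linarith
  set W := kgPert V mass with hWdef
  set Ω := ⋂ N, goodSet (kgSigned mass) W (2 * (ν + 1) + 2) γ' M N with hΩ
  have hΩmem : ∀ ω ∈ Ω, ∀ N, NonResonantBefore (kgSigned mass) W (2 * (ν + 1) + 2) γ' M N ω :=
    fun ω hω N => (mem_iInter.1 hω N).2
  have hconj := fun ω (hω : ω ∈ Ω) => exists_kg_conjugation (s := ρ / 8) hr1 hr2 hρ hper hV1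
    (by linarith) hs hε hDM (by positivity) hsmall hW hent (hΩmem ω hω)
  choose! T hT1 hT2 hT3 hT4 hT5 hT6 using hconj
  refine ⟨Ω, fun ω hω => (mem_iInter.1 hω 0).1,
    (isClosed_iInter fun N => isClosed_goodSet hs hW N).measurableSet, ?_, T,
    fun j ω => (finalDiag (kgSigned mass) W ω (true, j)).re,
    ⟨_, fun j => lipschitzOnWith_finalDiag hs hW (kgSigned_not mass) (true, j)⟩,
    fun ω hω => ⟨fun j => ?_, hT1 ω hω, hT2 ω hω, hT3 ω hω, hT4 ω hω,
      fun θ => (hT5 ω hω θ).trans ?_, hT6 ω hω⟩⟩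
  · have hann := volume_annulus_ge hν hM0
    have hpos : 0 < M ^ ν * β := by positivity
    have hvol := ENNReal.toReal_le_of_le_ofReal (by positivity) (volume_annulus_diff_le hs hW
      (sq_nonneg mass) (abs_kgSigned_sub_modeLabel_le mass) hγ hγ1.le hγ'γ hε (Nat.lt_succ_self ν))
    rw [← hK, ← hS₁] at hvol
    rw [div_le_iff₀ (hpos.trans_le hann)]
    refine hvol.trans ?_
    have hMν : M * (4 * M) ^ (ν - 1) = 4 ^ (ν - 1) * M ^ ν := by
      rw [mul_pow, mul_left_comm, mul_pow_sub_one (by omega)]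
    calc _ = K * 4 ^ (ν - 1) * S₁ / β * γ * (M ^ ν * β) := by
          rw [hMν]
          field_simp
      _ ≤ (K * 4 ^ (ν - 1) * S₁ / β + 1) * γ * volume.real (annulus ν M) := by
          gcongr
          linarith
  · have h1 := (exists_conjugation hs hW (kgSigned_not mass) (hΩmem ω hω)).2.1 (true, j)
    have h2 := (Complex.abs_re_le_norm _).trans h1
    rw [Complex.sub_re, Complex.ofReal_re, kgSigned, modeSign, if_pos rfl, one_mul] at h2
    refine h2.trans ?_
    have hj : (1 : ℝ) ≤ j := by exact_mod_cast j.pos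
    -- The scheme gives the decay 1/⟨j⟩, stronger than the required j^{-α}.
    have h3 : (j : ℝ) ^ α ≤ japanese j := by
      refine le_trans ?_ (le_japanese j)
      simpa using Real.rpow_le_rpow_of_exponent_le hj hα1.le
    have h4 : 0 < (j : ℝ) ^ α := Real.rpow_pos_of_pos (by linarith) _
    rw [← mul_div_assoc, div_div]
    gcongr
  -- The transformation is within O(1/M) of the identity, which for M > 1 is stronger than the
  -- required power.
  · have h1 : M ^ ((1 - α) / 2) ≤ M := by
      simpa using Real.rpow_le_rpow_of_exponent_le hM1.le (by linarith : (1 - α) / 2 ≤ 1)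
    have h2 : 0 < M ^ ((1 - α) / 2) := Real.rpow_pos_of_pos hM0 _
    calc 8 * (D / M) * S₂ = 8 * D * S₂ / M := by ring
      _ ≤ (8 * D * S₂ + 1) / M ^ ((1 - α) / 2) := by
        gcongr
        linarith

end
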